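/- Let $\omega$ be the exponent of matrix multiplication, i.e. the infimum of all $\tau$ such that two $n\times n$ matrices over $\mathbb{Q}$ can be multiplied with $O(n^{\tau})$ arithmetic operations. For a graph $G=(V,E)$ with $m$ edges, let $N[v]$ be the closed neighborhood of $v$. Partial 2-Dominating Set asks for vertices $x_1,x_2\in V$ that maximize $|N[x_1]\cup N[x_2]|$, together with this maximum; such a pair is called a solution. Graphs are given by the number of vertices, the number of edges and a list of the edges, and running times are numbers of operations of a word RAM whose words have $\Theta(\log N)$ bits, where $N$ is the sum of the number of vertices, the number of edges and the parameter $d$ (if there is one). (1) There is an algorithm that solves Partial 2-Dominating Set in time $m^{\frac{2\omega}{\omega+1}+o(1)}$ (as $m\to\infty$). (2) There is an algorithm that, given a graph with $m\ge 1$ edges and an integer $d\ge 1$, finds in time $O(m\cdot d)+\left(\frac md\right)^{\omega+o(1)}$ a pair $x_1,x_2$ that maximizes $|N[x_1]\cup N[x_2]|$ among all pairs of vertices of degree at least $d$, or reports that there is no vertex of degree at least $d$. In particular, if some solution consists of two vertices of degree at least $d$, then the pair found is a solution. (For $d=\lceil m^{(\omega-1)/(\omega+1)}\rceil$ the time is $m^{\frac{2\omega}{\omega+1}+o(1)}$.)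 (3) There is an algorithm that, given a graph with $m\ge 1$ edges and an integer $d\ge 1$ (for example a power of two), in time $O(m\cdot d)$ either returns a pair that maximizes $|N[x_1]\cup N[x_2]|$ over all $x_1\in V$ and $x_2\in V_d:=\{v\in V\mid d\le\deg(v)<2d\}$, or correctly reports that no solution contains a vertex of $V_d$. -/

import Mathlib

open Filter Topology

/-! ## The exponent of matrix multiplication -/

/-- `l` is a straight-line computation over `R`, latest result first: every entry is the sum,
difference or product of two elements, each of which is freely available (an element of `free`)
or was computed before. The number of arithmetic operations is `l.length`. -/
def IsComputation {R : Type*} [Ring R] (free : Set R) : List R → Prop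
  | [] => True
  | f :: l => IsComputation free l ∧
      ∃ g h : R, (g ∈ free ∨ g ∈ l) ∧ (h ∈ free ∨ h ∈ l) ∧ (f = g + h ∨ f = g - h ∨ f = g * h)

/-- Polynomials over `ℚ` in the `2 * n ^ 2` entries of two generic `n × n` matrices. -/
abbrev EntryPoly (n : ℕ) : Type := MvPolynomial ((Fin n × Fin n) ⊕ (Fin n × Fin n)) ℚ

/-- The first generic `n × n` matrix. -/
noncomputable def genericLeft (n : ℕ) : Matrix (Fin n) (Fin n) (EntryPoly n) :=
  fun i j => MvPolynomial.X (Sum.inl (i, j))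

/-- The second generic `n × n` matrix. -/
noncomputable def genericRight (n : ℕ) : Matrix (Fin n) (Fin n) (EntryPoly n) :=
  fun i j => MvPolynomial.X (Sum.inr (i, j))

/-- Two `n × n` matrices over `ℚ` can be multiplied with at most `t` arithmetic operations
(additions, subtractions, multiplications), by a straight-line program that may use the matrix
entries and rational constants for free. -/
def MatMulWithin (n : ℕ) (t : ℝ) : Prop :=
  ∃ l : List (EntryPoly n),
    IsComputation (Set.range MvPolynomial.X ∪ Set.range MvPolynomial.C) l ∧
    (∀ i k : Fin n, (genericLeft n * genericRight n) i k ∈ l) ∧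
    (l.length : ℝ) ≤ t

/-- The exponent `ω` of matrix multiplication: the infimum of all `τ` such that `n × n` matrices
can be multiplied with `O(n ^ τ)` arithmetic operations. -/
noncomputable def matMulExponent : ℝ :=
  sInf {τ : ℝ | ∃ C : ℝ, ∀ n : ℕ, MatMulWithin n (C * (n : ℝ) ^ τ)}

/-! ## The word RAM -/

namespace WordRAM

/-- A machine state: registers and a random access memory, all holding natural numbers. -/
structure State where
  reg : ℕ → ℕ
  mem : ℕ → ℕ

/-- Expressions over constants, registers and memory cells (`load a` reads the cell with address
`a`). Subtraction is truncated, division is rounded down, `lt a b` is `1` if `a < b`, else `0`. -/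
inductive Expr where
  | const (k : ℕ)
  | reg (r : ℕ)
  | load (a : Expr)
  | add (a b : Expr)
  | sub (a b : Expr)
  | mul (a b : Expr)
  | div (a b : Expr)
  | mod (a b : Expr)
  | lt (a b : Expr)

/-- The value of an expression in a state. -/
def Expr.val (s : State) : Expr → ℕ
  | .const k => k
  | .reg r => s.reg r
  | .load a => s.mem (a.val s)
  | .add a b => a.val s + b.val s
  | .sub a b => a.val s - b.val s
  | .mul a b => a.val s * b.val s
  | .div a b => a.val s / b.val s
  | .mod a b => a.val s % b.val s
  | .lt a b => if a.val s < b.val s then 1 else 0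

/-- All values (addresses included) that occur in the evaluation of an expression fit into
machine words of `w` bits. -/
def Expr.Fits (w : ℕ) (s : State) : Expr → Prop
  | .const k => k < 2 ^ w
  | .reg r => s.reg r < 2 ^ w
  | .load a => a.Fits w s ∧ s.mem (a.val s) < 2 ^ w
  | .add a b => a.Fits w s ∧ b.Fits w s ∧ a.val s + b.val s < 2 ^ w
  | .sub a b => a.Fits w s ∧ b.Fits w s
  | .mul a b => a.Fits w s ∧ b.Fits w s ∧ a.val s * b.val s < 2 ^ w
  | .div a b => a.Fits w s ∧ b.Fits w s
  | .mod a b => a.Fits w s ∧ b.Fits w s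
  | .lt a b => a.Fits w s ∧ b.Fits w s ∧ 1 < 2 ^ w

/-- The number of elementary operations in the evaluation of an expression. -/
def Expr.cost : Expr → ℕ
  | .const _ => 1
  | .reg _ => 1
  | .load a => a.cost + 1
  | .add a b => a.cost + b.cost + 1
  | .sub a b => a.cost + b.cost + 1
  | .mul a b => a.cost + b.cost + 1
  | .div a b => a.cost + b.cost + 1
  | .mod a b => a.cost + b.cost + 1
  | .lt a b => a.cost + b.cost + 1

/-- Programs. `assign r e` writes `e` to register `r`, `store a e` writes `e` to the memory cell
with address `a`; a condition counts as true if its value is not `0`. -/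
inductive Prog where
  | skip
  | assign (r : ℕ) (e : Expr)
  | store (a e : Expr)
  | seq (p q : Prog)
  | cond (b : Expr) (p q : Prog)
  | loop (b : Expr) (p : Prog)

/-- `Exec w p s s' t`: on a machine with words of `w` bits, the program `p`, started in the state
`s`, halts in the state `s'` after exactly `t` elementary operations, and no value that occurs
exceeds the word size. The semantics is deterministic, and a run with an overflow or without end
has no derivation. -/
inductive Exec (w : ℕ) : Prog → State → State → ℕ → Prop where
  | skip (s : State) : Exec w .skip s s 1
  | assign (r : ℕ) (e : Expr) (s : State) (he : e.Fits w s) :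
      Exec w (.assign r e) s ⟨Function.update s.reg r (e.val s), s.mem⟩ (e.cost + 1)
  | store (a e : Expr) (s : State) (ha : a.Fits w s) (he : e.Fits w s) :
      Exec w (.store a e) s ⟨s.reg, Function.update s.mem (a.val s) (e.val s)⟩
        (a.cost + e.cost + 1)
  | seq {p q : Prog} {s s₁ s₂ : State} {t₁ t₂ : ℕ} (hp : Exec w p s s₁ t₁)
      (hq : Exec w q s₁ s₂ t₂) : Exec w (.seq p q) s s₂ (t₁ + t₂)
  | condTrue {b : Expr} {p q : Prog} {s s₁ : State} {t : ℕ} (hb : b.Fits w s)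
      (hv : b.val s ≠ 0) (hp : Exec w p s s₁ t) : Exec w (.cond b p q) s s₁ (b.cost + 1 + t)
  | condFalse {b : Expr} {p q : Prog} {s s₁ : State} {t : ℕ} (hb : b.Fits w s)
      (hv : b.val s = 0) (hq : Exec w q s s₁ t) : Exec w (.cond b p q) s s₁ (b.cost + 1 + t)
  | loopTrue {b : Expr} {p : Prog} {s s₁ s₂ : State} {t₁ t₂ : ℕ} (hb : b.Fits w s)
      (hv : b.val s ≠ 0) (hp : Exec w p s s₁ t₁) (hl : Exec w (.loop b p) s₁ s₂ t₂) :
      Exec w (.loop b p) s s₂ (b.cost + 1 + t₁ + t₂)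
  | loopFalse {b : Expr} {p : Prog} {s : State} (hb : b.Fits w s) (hv : b.val s = 0) :
      Exec w (.loop b p) s s (b.cost + 1)

end WordRAM

/-! ## Partial 2-Dominating Set -/

/-- The number `|N[x] ∪ N[y]|` of vertices dominated by `x` and `y`. -/
def domCount {n : ℕ} (G : SimpleGraph (Fin n)) [DecidableRel G.Adj] (x y : Fin n) : ℕ :=
  (insert x (G.neighborFinset x) ∪ insert y (G.neighborFinset y)).card

/-- Among all pairs of vertices that satisfy `S`, the pair `x, y` dominates the most vertices. -/
def IsBestPair {n : ℕ} (G : SimpleGraph (Fin n)) [DecidableRel G.Adj]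
    (S : Fin n → Fin n → Prop) (x y : Fin n) : Prop :=
  S x y ∧ ∀ x' y' : Fin n, S x' y' → domCount G x' y' ≤ domCount G x y

/-- `x, y` is a solution to Partial 2-Dominating Set on `G`. -/
def IsSolution {n : ℕ} (G : SimpleGraph (Fin n)) [DecidableRel G.Adj] (x y : Fin n) : Prop :=
  IsBestPair G (fun _ _ => True) x y

/-- `L` lists every edge of `G` exactly once, in any order and orientation. -/
def IsEdgeList {n : ℕ} (G : SimpleGraph (Fin n)) (L : List (Fin n × Fin n)) : Prop :=
  (L.map fun e => s(e.1, e.2)).Nodup ∧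
    ∀ e : Sym2 (Fin n), e ∈ (L.map fun e => s(e.1, e.2)) ↔ e ∈ G.edgeSet

/-- The initial state for a graph given by the edge list `L`: the memory holds the number of
vertices, the number of edges and then the two ends of each edge; a further parameter `d` of the
input is in register `0`. Everything else is `0`. -/
def inputState (n : ℕ) (L : List (Fin n × Fin n)) (d : ℕ) : WordRAM.State where
  reg := fun r => if r = 0 then d else 0
  mem := fun a =>
    (n :: L.length :: L.flatMap fun e => [(e.1 : ℕ), (e.2 : ℕ)]).getD a 0

/-- In the final state `s`, registers `1` and `2` hold the vertices `x` and `y`, and register `0`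
holds the number of vertices dominated by them. -/
def Outputs {n : ℕ} (G : SimpleGraph (Fin n)) [DecidableRel G.Adj] (s : WordRAM.State)
    (x y : Fin n) : Prop :=
  s.reg 0 = domCount G x y ∧ s.reg 1 = x ∧ s.reg 2 = y

/-- In the final state `s`, the program reports (by a `0` in register `0`) that it has found no
pair. -/
def OutputsNone (s : WordRAM.State) : Prop := s.reg 0 = 0

/-- `RunsWithin P c G d B Q`: on every edge list of `G` and the parameter `d`, and with machine
words of any length `w ≥ c * log₂ (n + m + d + 2)`, the program `P` halts without overflow after
at most `B` elementary operations, in a state that satisfies `Q`. -/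
def RunsWithin (P : WordRAM.Prog) (c : ℕ) {n : ℕ} (G : SimpleGraph (Fin n)) [DecidableRel G.Adj]
    (d : ℕ) (B : ℝ) (Q : WordRAM.State → Prop) : Prop :=
  ∀ L : List (Fin n × Fin n), IsEdgeList G L →
    ∀ w : ℕ, (n + G.edgeFinset.card + d + 2) ^ c ≤ 2 ^ w →
      ∃ (s : WordRAM.State) (t : ℕ), WordRAM.Exec w P (inputState n L d) s t ∧ (t : ℝ) ≤ B ∧ Q s

/-! Write A(v) for the closed neighborhood of v. Since A(v) has deg(v) + 1 elements, degree at least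
d means |A(v)| > d. Isolated vertices are interchangeable, and 2m + 2 vertices always include two
isolated ones, so it suffices to keep the first 2m + 2 vertices and all ends of edges
(`IsEdgeList.exists_core`). Then the sum of all |A(v)| is O(m + 1), independently of n.

One vertex in a degree range (part 3). Let d < |A(y)| ≤ 2d and let u maximize |A(u)| = top. Suppose
top > 4d. A vertex x with |A(x)| < top - 2d is useless, because (u, y) is at least as good as (x,
y). If some other x has more than 2d elements outside A(u), then (u, x) beats every pair (·, y), and
no solution meets the range. Otherwise each remaining A(x) differs from the reference set Z = A(u)
in at most 6d places. (If top ≤ 4d, take Z empty and keep all x.) For fixed y, |A(x) ∪ A(y)| equals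
|A(x)| + |A(y) \ Z| plus corrections at those v in A(y) where A(x) and Z differ. Candidates without
a correction are ranked by |A(x)| alone. So if T corrections are met, it is enough to evaluate the
corrected candidates and the first T + 1 in the order of decreasing |A(x)|
(`Nbr.dom_le_of_touched`). Double counting bounds the sum of T over all y by O(dm) (`sum_work_le`).

Two vertices of high degree (part 2). At most N = 2m/d vertices have degree at least d. Common
neighbors of small degree are counted by listing all pairs inside each small A(v), in O(dm) steps.
Common neighbors of high degree are entries of the square of an N × N matrix (`Nbr.dom_add_common`,
`heavyCore_spec`).

Multiplying matrices with exponent ω + o(1). The second mixed derivatives at 0 turn a straight-line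
program with t operations into a bilinear algorithm with 2t products (`hasRank_of_computation`).
Hence for every ε there are n₀ and r ≤ n₀ ^ (ω + ε) such that n₀ × n₀ matrices need only r products,
and Kronecker powers of the three coefficient tables multiply matrices of size n₀ ^ L with r ^ L
products (`kronecker_mul`). The infimum ω need not be attained, so no single table is good enough.
The program therefore tries all codes of tables below K = ⌈log₂ N⌉ + K₀, checks the Brent equations
for each, and uses the cheapest valid one (`search_spec`). Every fixed code is eventually tried, so
the cost is O(N ^ (ω + ε)) for every ε (`exists_params`). Rational coefficients are avoided by
computing modulo M = D(N + 1) + 1, where D is a common denominator: M exceeds every entry of the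
product, and -(N + 1) is the inverse of D.

All pairs (part 1). For a threshold d, run the algorithm for ranges over closed neighborhoods of
size 1, 2, (2, 4], (4, 8], … up to d, and the matrix algorithm above d. The exponent ω is unknown to
the program, so it minimizes md plus the cost it would itself pay for size 2m/d over powers of two
d. The minimum is no worse than d ≈ m ^ ((ω - 1)/(ω + 1)), which balances md with (m/d) ^ ω.

The machine. The algorithms are written in a loop language with a functional semantics, verified by
a calculus of specifications (`spec_loop`, `spec_forEach`), and compiled once and for all to the
word RAM (`compile_run`, `exists_prog`). -/

set_option linter.constructorNameAsVariable false
set_option linter.unusedSimpArgs false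

/-! ## A loop language with zero-initialised two-dimensional arrays -/

namespace LoopRAM

/-- Variables. -/
inductive Var
  | o0 | o1 | o2
  | n | m | ge | gi | ga | gb | gt | gl | cnt
  | lo | hi | dd | top | u | uu | low | bad | ks | cc | tu | tc | bs | g | best | b1 | b2
  | i | j | k | l | v | x | y | t | q | p | c
  | d | hc | N | K | pw | cap | bq | fb | fk | cb | ck | kk | n0 | r | D | off | M | e2 | sc
  | al | be | ga' | tt | acc | want | ok | qq | L
  | as | s | s1 | ka | kt | kq | kc | kb | ix | kn
  | bd | bj | bc | g0 | g1 | g2 | jj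
  deriving DecidableEq

/-- Arrays. -/
inductive Arr
  | mat | len | adj | ver | cand | dl | dlen | pos | neg
  | hgh | c2 | tU | tV | tW | xA | xB | xC
  deriving DecidableEq

/-- The number of arrays. -/
abbrev numArr : ℕ := 17

/-- Terms. -/
inductive Term
  | const (k : ℕ)
  | reg (v : Var)
  | get (a : Arr) (x y : Var)
  | add (a b : Term)
  | sub (a b : Term)
  | mul (a b : Term)
  | div (a b : Term)
  | mod (a b : Term)
  | lt (a b : Term)

instance (k : ℕ) : OfNat Term k := ⟨.const k⟩
instance : Add Term := ⟨.add⟩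
instance : Sub Term := ⟨.sub⟩
instance : Mul Term := ⟨.mul⟩
instance : Div Term := ⟨.div⟩
instance : Mod Term := ⟨.mod⟩

/-- The input: its cells, their number, and the bound for values that are not obviously small. -/
structure Env where
  inp : ℕ → ℕ
  size : ℕ
  wd : ℕ

/-- A state, with the time elapsed. -/
structure St where
  reg : Var → ℕ
  arr : Arr → ℕ → ℕ → ℕ
  time : ℕ

namespace St
def tick (s : St) : St := ⟨s.reg, s.arr, s.time + 1⟩
def set (s : St) (v : Var) (x : ℕ) : St := ⟨Function.update s.reg v x, s.arr, s.time + 1⟩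
def put (s : St) (a : Arr) (x y z : ℕ) : St :=
  ⟨s.reg, Function.update s.arr a fun x' y' => if x' = x ∧ y' = y then z else s.arr a x' y',
    s.time + 1⟩
def clear (s : St) : St := ⟨s.reg, fun _ _ _ => 0, s.time + 1⟩

@[simp] theorem tick_reg (s : St) : s.tick.reg = s.reg := rfl
@[simp] theorem tick_arr (s : St) : s.tick.arr = s.arr := rfl
@[simp] theorem tick_time (s : St) : s.tick.time = s.time + 1 := rfl
@[simp] theorem clear_reg (s : St) : s.clear.reg = s.reg := rfl
@[simp] theorem clear_arr (s : St) (a : Arr) (x y : ℕ) : s.clear.arr a x y = 0 := rfl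
@[simp] theorem clear_time (s : St) : s.clear.time = s.time + 1 := rfl
@[simp] theorem set_reg (s : St) (v u : Var) (x : ℕ) :
    (s.set v x).reg u = if u = v then x else s.reg u := by
  simp [set, Function.update_apply]
@[simp] theorem set_arr (s : St) (v : Var) (x : ℕ) : (s.set v x).arr = s.arr := rfl
@[simp] theorem set_time (s : St) (v : Var) (x : ℕ) : (s.set v x).time = s.time + 1 := rfl
@[simp] theorem put_reg (s : St) (a : Arr) (x y z : ℕ) : (s.put a x y z).reg = s.reg := rfl
@[simp] theorem put_arr (s : St) (a b : Arr) (x y z : ℕ) : (s.put a x y z).arr b =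
    if b = a then (fun x' y' => if x' = x ∧ y' = y then z else s.arr a x' y') else s.arr b := by
  simp [put, Function.update_apply]
@[simp] theorem put_time (s : St) (a : Arr) (x y z : ℕ) :
    (s.put a x y z).time = s.time + 1 := rfl
end St

namespace Term
/-- The value of a term. -/
def val (s : St) : Term → ℕ
  | const k => k
  | reg v => s.reg v
  | get a x y => s.arr a (s.reg x) (s.reg y)
  | add a b => a.val s + b.val s
  | sub a b => a.val s - b.val s
  | mul a b => a.val s * b.val s
  | div a b => a.val s / b.val s
  | mod a b => a.val s % b.val s
  | lt a b => if a.val s < b.val s then 1 else 0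

/-- Terms whose value does not exceed all values in the state. -/
def low : Term → Bool
  | const _ | reg _ | get _ _ _ | lt _ _ => true
  | sub a _ | div a _ | mod a _ => a.low
  | add _ _ | mul _ _ => false

def isOne : Term → Bool
  | const k => k == 1
  | _ => false

/-- Terms whose value exceeds all values in the state by at most one. -/
def safe : Term → Bool
  | add a b => a.low && b.isOne
  | t => t.low

section simps
variable (s : St) (a b : Term) (v x y : Var) (r : Arr) (k : ℕ)
@[simp] theorem val_const : (const k).val s = k := rfl
@[simp] theorem val_ofNat : (no_index (OfNat.ofNat k) : Term).val s = k := rfl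
@[simp] theorem val_reg : (reg v).val s = s.reg v := rfl
@[simp] theorem val_get : (get r x y).val s = s.arr r (s.reg x) (s.reg y) := rfl
@[simp] theorem val_add : (a + b).val s = a.val s + b.val s := rfl
@[simp] theorem val_sub : (a - b).val s = a.val s - b.val s := rfl
@[simp] theorem val_mul : (a * b).val s = a.val s * b.val s := rfl
@[simp] theorem val_div : (a / b).val s = a.val s / b.val s := rfl
@[simp] theorem val_mod : (a % b).val s = a.val s % b.val s := rfl
@[simp] theorem val_lt : (lt a b).val s = if a.val s < b.val s then 1 else 0 := rfl
@[simp] theorem low_const : (const k).low = true := rfl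
@[simp] theorem low_ofNat : (no_index (OfNat.ofNat k) : Term).low = true := rfl
@[simp] theorem low_reg : (reg v).low = true := rfl
@[simp] theorem low_get : (get r x y).low = true := rfl
@[simp] theorem low_lt : (lt a b).low = true := rfl
@[simp] theorem low_sub : (a - b).low = a.low := rfl
@[simp] theorem low_div : (a / b).low = a.low := rfl
@[simp] theorem low_mod : (a % b).low = a.low := rfl
@[simp] theorem low_add : (a + b).low = false := rfl
@[simp] theorem low_mul : (a * b).low = false := rfl
@[simp] theorem safe_const : (const k).safe = true := rfl
@[simp] theorem safe_ofNat : (no_index (OfNat.ofNat k) : Term).safe = true := rfl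
@[simp] theorem safe_reg : (reg v).safe = true := rfl
@[simp] theorem safe_get : (get r x y).safe = true := rfl
@[simp] theorem safe_lt : (lt a b).safe = true := rfl
@[simp] theorem safe_sub : (a - b).safe = a.low := rfl
@[simp] theorem safe_div : (a / b).safe = a.low := rfl
@[simp] theorem safe_mod : (a % b).safe = a.low := rfl
@[simp] theorem safe_mul : (a * b).safe = false := rfl
@[simp] theorem safe_add_one : (a + 1).safe = a.low := by
  change (a.low && isOne (const 1)) = a.low
  simp [isOne]
end simps
end Term

/-- Commands. `loop i lim p` runs `p` with `i = 0, …, lim - 1`. -/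
inductive Cmd
  | skip
  | assign (v : Var) (t : Term)
  | read (v u : Var)
  | put (a : Arr) (x y : Var) (t : Term)
  | seq (p q : Cmd)
  | ite (t : Term) (p q : Cmd)
  | loop (i lim : Var) (p : Cmd)
  | clear

infixr:60 " ;; " => Cmd.seq
infix:61 " ::= " => Cmd.assign
infix:62 " ≺ " => Term.lt
prefix:max "♯" => Term.reg

/-- Run `f` for `i = 0, …, k - 1`. -/
def iter (f : St → St) (i : Var) (s : St) : ℕ → St
  | 0 => s
  | k + 1 => (f (iter f i s k)).set i (k + 1)

namespace Cmd

def run (E : Env) : Cmd → St → St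
  | skip, s => s.tick
  | assign v t, s => s.set v (t.val s)
  | read v u, s => s.set v (E.inp (s.reg u))
  | put a x y t, s => s.put a (s.reg x) (s.reg y) (t.val s)
  | seq p q, s => q.run E (p.run E s)
  | ite t p q, s => if t.val s ≠ 0 then p.run E s.tick else q.run E s.tick
  | loop i lim p, s => iter (p.run E) i (s.set i 0) (s.reg lim)
  | clear, s => s.clear

/-- No value is too large. -/
def Ok (E : Env) : Cmd → St → Prop
  | skip, _ => True
  | assign _ t, s => t.safe = false → t.val s < E.wd
  | read _ u, s => s.reg u < E.size
  | put _ _ _ t, s => t.safe = false → t.val s < E.wd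
  | seq p q, s => p.Ok E s ∧ q.Ok E (p.run E s)
  | ite t p q, s => if t.val s ≠ 0 then p.Ok E s.tick else q.Ok E s.tick
  | loop i lim p, s => ∀ k < s.reg lim, p.Ok E (iter (p.run E) i (s.set i 0) k)
  | clear, _ => True

/-- The variables written. -/
def wr : Cmd → List Var
  | assign v _ | read v _ => [v]
  | seq p q | ite _ p q => p.wr ++ q.wr
  | loop i _ p => i :: p.wr
  | _ => []

/-- The arrays written. -/
def wa : Cmd → List Arr
  | put a _ _ _ => [a]
  | seq p q | ite _ p q => p.wa ++ q.wa
  | loop _ _ p => p.wa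
  | clear => [.mat, .len, .adj, .ver, .cand, .dl, .dlen, .pos, .neg, .hgh, .c2, .tU, .tV,
      .tW, .xA, .xB, .xC]
  | _ => []

/-- Loops do not write their counter and their limit. -/
def wf : Cmd → Bool
  | seq p q | ite _ p q => p.wf && q.wf
  | loop i lim p => p.wf && !(p.wr.contains i) && !(p.wr.contains lim) && !(i == lim)
  | _ => true

end Cmd

/-- `s'` agrees with `s` off the variables and arrays that `p` writes. -/
def Frame (p : Cmd) (s s' : St) : Prop :=
  (∀ v ∉ p.wr, s'.reg v = s.reg v) ∧ ∀ a ∉ p.wa, s'.arr a = s.arr a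

theorem iter_reg {f : St → St} {i : Var} {s : St} (h : s.reg i = 0) (k : ℕ) :
    (iter f i s k).reg i = k := by
  cases k <;> simp [iter, h]

/-- This lets specifications mention only what a command changes. Everything else is recovered by
deciding membership in the lists of written variables and arrays. -/
theorem frame_run (E : Env) (p : Cmd) (s : St) : Frame p s (p.run E s) := by
  induction p generalizing s with
  | skip => simp [Frame, Cmd.run]
  | assign v t => simp +contextual [Frame, Cmd.run, Cmd.wr]
  | read v u => simp +contextual [Frame, Cmd.run, Cmd.wr]
  | put a x y t => simp +contextual [Frame, Cmd.run, Cmd.wa]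
  | clear =>
    refine ⟨fun v _ => rfl, fun a h => ?_⟩
    cases a <;> simp [Cmd.wa] at h
  | seq p q hp hq =>
    refine ⟨fun v h => ?_, fun a h => ?_⟩
    · simp only [Cmd.wr, List.mem_append, not_or] at h
      simp [Cmd.run, (hq _).1 v h.2, (hp _).1 v h.1]
    · simp only [Cmd.wa, List.mem_append, not_or] at h
      simp [Cmd.run, (hq _).2 a h.2, (hp _).2 a h.1]
  | ite t p q hp hq =>
    refine ⟨fun v h => ?_, fun a h => ?_⟩
    · simp only [Cmd.wr, List.mem_append, not_or] at h
      simp only [Cmd.run]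
      split_ifs
      · simp [(hp _).1 v h.1]
      · simp [(hq _).1 v h.2]
    · simp only [Cmd.wa, List.mem_append, not_or] at h
      simp only [Cmd.run]
      split_ifs
      · simp [(hp _).2 a h.1]
      · simp [(hq _).2 a h.2]
  | loop i lim p hp =>
    have key : ∀ k, Frame (.loop i lim p) s (iter (p.run E) i (s.set i 0) k) := by
      intro k
      induction k with
      | zero => simp +contextual [Frame, iter, Cmd.wr]
      | succ k ih =>
        refine ⟨fun v h => ?_, fun a h => ?_⟩
        · have h1 := ih.1 v h
          simp only [Cmd.wr, List.mem_cons, not_or] at h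
          simp [iter, h.1, (hp _).1 v h.2, h1]
        · have h1 := ih.2 a h
          simp only [Cmd.wa] at h
          simp [iter, (hp _).2 a h, h1]
    exact key _

theorem time_le_run (E : Env) (p : Cmd) (s : St) : s.time ≤ (p.run E s).time := by
  induction p generalizing s with
  | seq p q hp hq => exact (hp s).trans (hq _)
  | ite t p q hp hq =>
    simp only [Cmd.run]
    split_ifs
    · exact (Nat.le_succ _).trans (hp s.tick)
    · exact (Nat.le_succ _).trans (hq s.tick)
  | loop i lim p hp =>
    simp only [Cmd.run]
    generalize s.reg lim = k
    induction k with
    | zero => simp [iter]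
    | succ k ih => exact ih.trans ((hp _).trans (by simp [iter]))
  | _ => simp [Cmd.run]

/-! ### Specifications -/

/-- Started in `s`, the command `p` works without overflow and ends in a state satisfying `Q`. -/
def Spec (E : Env) (p : Cmd) (s : St) (Q : St → Prop) : Prop := p.Ok E s ∧ Q (p.run E s)

section Spec
variable {E : Env} {p q : Cmd} {s : St} {Q Q' : St → Prop}

@[simp] theorem spec_skip : Spec E .skip s Q ↔ Q s.tick := by simp [Spec, Cmd.Ok, Cmd.run]
@[simp] theorem spec_clear : Spec E .clear s Q ↔ Q s.clear := by simp [Spec, Cmd.Ok, Cmd.run]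
@[simp] theorem spec_assign {v : Var} {t : Term} :
    Spec E (v ::= t) s Q ↔ (t.safe = false → t.val s < E.wd) ∧ Q (s.set v (t.val s)) := by
  simp [Spec, Cmd.Ok, Cmd.run]
@[simp] theorem spec_read {v u : Var} :
    Spec E (.read v u) s Q ↔ s.reg u < E.size ∧ Q (s.set v (E.inp (s.reg u))) := by
  simp [Spec, Cmd.Ok, Cmd.run]
@[simp] theorem spec_put {a : Arr} {x y : Var} {t : Term} : Spec E (.put a x y t) s Q ↔
    (t.safe = false → t.val s < E.wd) ∧ Q (s.put a (s.reg x) (s.reg y) (t.val s)) := by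
  simp [Spec, Cmd.Ok, Cmd.run]
@[simp] theorem spec_seq : Spec E (p ;; q) s Q ↔ Spec E p s fun s' => Spec E q s' Q := by
  simp [Spec, Cmd.Ok, Cmd.run, and_assoc]
@[simp] theorem spec_ite {t : Term} : Spec E (.ite t p q) s Q ↔
    if t.val s ≠ 0 then Spec E p s.tick Q else Spec E q s.tick Q := by
  by_cases h : t.val s = 0 <;> simp [Spec, Cmd.Ok, Cmd.run, h]

theorem Spec.mono (h : Spec E p s Q) (hQ : ∀ s', Frame p s s' → s.time ≤ s'.time → Q s' → Q' s') :
    Spec E p s Q' :=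
  ⟨h.1, hQ _ (frame_run E p s) (time_le_run E p s) h.2⟩

/-- The number of rounds is fixed on entry. In each round the frame property relative to the entry
state is available besides the invariant, so `I` need not repeat what the body leaves alone. -/
theorem spec_loop {i lim : Var} (I : ℕ → St → Prop) (h0 : I 0 (s.set i 0))
    (hs : ∀ k < s.reg lim, ∀ s', Frame (.loop i lim p) s s' → s'.reg i = k → I k s' →
      Spec E p s' fun s'' => I (k + 1) (s''.set i (k + 1)))
    (hQ : ∀ s', Frame (.loop i lim p) s s' → I (s.reg lim) s' → Q s') :
    Spec E (.loop i lim p) s Q := by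
  have key : ∀ k ≤ s.reg lim, I k (iter (p.run E) i (s.set i 0) k) ∧
      (∀ k' < k, p.Ok E (iter (p.run E) i (s.set i 0) k')) ∧
      Frame (.loop i lim p) s (iter (p.run E) i (s.set i 0) k) := by
    intro k
    induction k with
    | zero => exact fun _ => ⟨h0, by simp, by simp +contextual [Frame, iter, Cmd.wr]⟩
    | succ k ih =>
      intro hk
      obtain ⟨h1, h2, h3⟩ := ih (by omega)
      obtain ⟨h4, h5⟩ := hs k hk _ h3 (iter_reg (by simp) k) h1
      refine ⟨h5, fun k' hk' => ?_, ?_⟩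
      · rcases Nat.lt_succ_iff_lt_or_eq.mp hk' with h | rfl
        · exact h2 _ h
        · exact h4
      · have hf := frame_run E p (iter (p.run E) i (s.set i 0) k)
        refine ⟨fun v h => ?_, fun a h => ?_⟩
        · have := h3.1 v h
          simp only [Cmd.wr, List.mem_cons, not_or] at h
          simp [iter, h.1, hf.1 v h.2, this]
        · have := h3.2 a h
          simp only [Cmd.wa] at h
          simp [iter, hf.2 a h, this]
  obtain ⟨h1, h2, h3⟩ := key _ le_rfl
  exact ⟨h2, hQ _ h3 h1⟩

/-- The first `k` entries of a function as a list. -/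
def row (f : ℕ → ℕ) (k : ℕ) : List ℕ := (List.range k).map f

@[simp] theorem row_zero (f : ℕ → ℕ) : row f 0 = [] := rfl
@[simp] theorem length_row (f : ℕ → ℕ) (k : ℕ) : (row f k).length = k := by simp [row]
theorem row_succ (f : ℕ → ℕ) (k : ℕ) : row f (k + 1) = row f k ++ [f k] := by
  simp [row, List.range_succ]
theorem row_congr {f g : ℕ → ℕ} {k : ℕ} (h : ∀ i < k, f i = g i) : row f k = row g k := by
  simpa [row] using h
theorem row_take (f : ℕ → ℕ) {k l : ℕ} (h : k ≤ l) : (row f l).take k = row f k := by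
  simp [row, List.take_range, ← List.map_take, h]
theorem row_push (f g : ℕ → ℕ) (k z : ℕ) (hk : g k = z) (h : ∀ i < k, g i = f i) :
    row g (k + 1) = row f k ++ [z] := by
  rw [row_succ, hk, row_congr h]
theorem row_split {f : ℕ → ℕ} {k : ℕ} {l₁ l₂ : List ℕ} {v : ℕ} (h : row f k = l₁ ++ v :: l₂) :
    f l₁.length = v ∧ l₁.length < k := by
  have h1 : (row f k).length = (l₁ ++ v :: l₂).length := by rw [h]
  simp only [length_row, List.length_append, List.length_cons] at h1
  have h2 : (row f k)[l₁.length]? = some v := by simp [h]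
  rw [row, List.getElem?_map, List.getElem?_range (by omega)] at h2
  exact ⟨by simpa using h2, by omega⟩

/-- Run `p` for all entries `w` of a row of an array. -/
def Cmd.forEach (i lim w : Var) (a : Arr) (x : Var) (p : Cmd) : Cmd :=
  .loop i lim (w ::= .get a x i ;; p)

/-- The invariant is indexed by the prefix of the row that has been processed. The row must not be
overwritten by the body, and neither may the variable `x` that selects it; hence `ha` and `hx`. -/
theorem spec_forEach {i lim w x : Var} {a : Arr} (l : List ℕ) (I : List ℕ → St → Prop)
    (ha : a ∉ p.wa) (hx : x ∉ i :: w :: p.wr)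
    (hl : row (s.arr a (s.reg x)) (s.reg lim) = l) (h0 : I [] (s.set i 0))
    (hs : ∀ l₁ v l₂, l = l₁ ++ v :: l₂ → ∀ s', Frame (.forEach i lim w a x p) s s' →
      s'.reg i = l₁.length → I l₁ s' →
      Spec E p (s'.set w v) fun s'' => I (l₁ ++ [v]) (s''.set i (l₁.length + 1)))
    (hQ : ∀ s', Frame (.forEach i lim w a x p) s s' → I l s' → Q s') :
    Spec E (.forEach i lim w a x p) s Q := by
  have hlen : s.reg lim = l.length := by rw [← hl]; simp
  refine spec_loop (fun k => I (l.take k)) (by simpa using h0) (fun k hk s' hF hi hI => ?_)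
    (fun s' hF hI => hQ s' hF (by simpa [hlen] using hI))
  rw [hlen] at hk
  have h1 := row_split (f := s.arr a (s.reg x)) (k := s.reg lim) (l₁ := l.take k) (v := l[k])
    (l₂ := l.drop (k + 1)) (by rw [hl]; simp)
  have hk' : (l.take k).length = k := by simp; omega
  rw [hk'] at h1
  have h2 := hs (l.take k) l[k] (l.drop (k + 1)) (by simp) s' hF (by rw [hk', hi]) hI
  have h3 : s'.arr a (s'.reg x) (s'.reg i) = l[k] := by
    rw [hF.1 x (by simpa [Cmd.forEach, Cmd.wr] using hx),
      hF.2 a (by simpa [Cmd.forEach, Cmd.wa] using ha), hi, h1.1]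
  rw [hk'] at h2
  rw [← List.take_succ_eq_append_getElem hk] at h2
  rw [spec_seq, spec_assign]
  refine ⟨by simp, ?_⟩
  rw [Term.val_get, h3]
  exact h2

end Spec

end LoopRAM

/-! ## Compilation to the word RAM -/

namespace LoopRAM
open WordRAM

/-- The register of a variable; registers `3` and `4` hold the row length and the address of the
arrays. -/
def Var.code (v : Var) : ℕ := if v.ctorIdx < 3 then v.ctorIdx else v.ctorIdx + 2

theorem Var.code_injective : Function.Injective Var.code := by
  have h : Function.Injective Var.ctorIdx := Function.LeftInverse.injective Var.ofNat_ctorIdx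
  intro a b hab
  apply h
  simp only [Var.code] at hab
  split_ifs at hab <;> omega

@[simp] theorem Var.code_inj {v u : Var} : v.code = u.code ↔ v = u := Var.code_injective.eq_iff

theorem Var.code_ne (v : Var) : v.code ≠ 3 ∧ v.code ≠ 4 := by
  simp only [Var.code]
  split_ifs <;> omega

theorem Arr.ctorIdx_lt (a : Arr) : a.ctorIdx < numArr := by cases a <;> decide

theorem Arr.ctorIdx_injective : Function.Injective Arr.ctorIdx :=
  Function.LeftInverse.injective Arr.ofNat_ctorIdx

/-- The address of an array entry. -/
def addr (B W : ℕ) (a : Arr) (x y : ℕ) : ℕ := B + ((x * W + y) * numArr + a.ctorIdx)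

theorem addr_inj {B W : ℕ} {a b : Arr} {x y x' y' : ℕ} (hy : y < W) (hy' : y' < W) :
    addr B W a x y = addr B W b x' y' ↔ a = b ∧ x = x' ∧ y = y' := by
  refine ⟨fun h => ?_, fun ⟨h1, h2, h3⟩ => by rw [h1, h2, h3]⟩
  have ha := a.ctorIdx_lt
  have hb := b.ctorIdx_lt
  simp only [addr, numArr] at h ha hb
  have h1 : x * W + y = x' * W + y' := by omega
  have h2 : a.ctorIdx = b.ctorIdx := by omega
  have h3 : y = y' := by
    have := congrArg (· % W) h1
    simpa [Nat.add_mod, Nat.mod_eq_of_lt hy, Nat.mod_eq_of_lt hy'] using this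
  subst h3
  refine ⟨Arr.ctorIdx_injective h2, ?_, rfl⟩
  exact Nat.eq_of_mul_eq_mul_right (by omega) (Nat.add_right_cancel h1)

theorem addr_lt {B W : ℕ} {a : Arr} {x y : ℕ} (hx : x < W) (hy : y < W) :
    addr B W a x y < B + W * W * numArr := by
  have ha := a.ctorIdx_lt
  have : x * W + y + 1 ≤ W * W := by nlinarith
  simp only [addr, numArr] at *
  omega

def addrE (a : Arr) (x y : Var) : Expr :=
  .add (.reg 4) (.add (.mul (.add (.mul (.reg x.code) (.reg 3)) (.reg y.code)) (.const numArr))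
    (.const a.ctorIdx))

def Term.compile : Term → Expr
  | const k => .const k
  | reg v => .reg v.code
  | get a x y => .load (addrE a x y)
  | add a b => .add a.compile b.compile
  | sub a b => .sub a.compile b.compile
  | mul a b => .mul a.compile b.compile
  | div a b => .div a.compile b.compile
  | mod a b => .mod a.compile b.compile
  | lt a b => .lt a.compile b.compile

/-- A bound for the cost, the constants and the number of leaves of a term. -/
def Term.bd : Term → ℕ
  | const k => k + 1
  | reg _ => 1
  | get _ _ _ => 12
  | add a b | sub a b | mul a b | div a b | mod a b | lt a b => a.bd + b.bd + 1

def Cmd.compile : Cmd → Prog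
  | skip => .skip
  | assign v t => .assign v.code t.compile
  | read v u => .assign v.code (.load (.reg u.code))
  | put a x y t => .store (addrE a x y) t.compile
  | seq p q => .seq p.compile q.compile
  | ite t p q => .cond t.compile p.compile q.compile
  | loop i lim p => .seq (.assign i.code (.const 0))
      (.loop (.lt (.reg i.code) (.reg lim.code))
        (.seq p.compile (.assign i.code (.add (.reg i.code) (.const 1)))))
  | clear => .assign 4 (.add (.reg 4) (.mul (.mul (.reg 3) (.reg 3)) (.const numArr)))

def Cmd.bd : Cmd → ℕ
  | assign _ t => t.bd + 1
  | put _ _ _ t => t.bd + 12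
  | seq p q => max p.bd q.bd
  | ite t p q => max (t.bd + 1) (max p.bd q.bd)
  | loop _ _ p => max 8 p.bd
  | _ => 8

theorem Term.bd_pos (t : Term) : 1 ≤ t.bd := by cases t <;> simp [Term.bd]

/-- The state `σ` of the word RAM represents `s`. -/
structure Rel (E : Env) (W B : ℕ) (s : St) (σ : State) : Prop where
  reg : ∀ v, σ.reg v.code = s.reg v
  r3 : σ.reg 3 = W
  r4 : σ.reg 4 = B
  inp : ∀ i < E.size, σ.mem i = E.inp i
  size_le : E.size ≤ B
  -- Each `clear` moves the base by one block of all arrays, and there are at most as many of them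
  -- as ticks.
  le_size : B ≤ E.size + s.time * (W * W * numArr)
  arr : ∀ a x y, x < W → y < W → σ.mem (addr B W a x y) = s.arr a x y
  zero : ∀ i, B + W * W * numArr ≤ i → σ.mem i = 0
  -- This bound is inductive without overflow checks: a safe term exceeds the present maximum by at
  -- most one, and each assignment takes one tick.
  regb : ∀ v, s.reg v < E.wd + s.time
  arrb : ∀ a x y, s.arr a x y < E.wd + s.time

section
variable {E : Env} {W B w Z : ℕ} {s : St} {σ : State}

theorem Term.low_bound (h : Rel E W B s σ) (h2 : 2 ≤ E.wd) {t : Term} (hb : t.bd ≤ E.wd)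
    (ht : t.low = true) : t.val s < E.wd + s.time := by
  induction t with
  | const k => simp only [Term.bd, Term.val_const] at *; omega
  | reg v => exact h.regb v
  | get a x y => exact h.arrb a _ _
  | sub a b iha ihb =>
    exact (Nat.sub_le _ _).trans_lt (iha (by simp only [Term.bd] at hb; omega) ht)
  | div a b iha ihb =>
    exact (Nat.div_le_self _ _).trans_lt (iha (by simp only [Term.bd] at hb; omega) ht)
  | mod a b iha ihb =>
    exact (Nat.mod_le _ _).trans_lt (iha (by simp only [Term.bd] at hb; omega) ht)
  | lt a b => simp only [Term.val_lt]; split_ifs <;> omega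
  | _ => simp [Term.low] at ht

/-- The growth by one of a safe term is paid for by the tick of the assignment; only unsafe terms
need an explicit comparison with `E.wd`. -/
theorem Term.safe_bound (h : Rel E W B s σ) (h2 : 2 ≤ E.wd) {t : Term} (hb : t.bd ≤ E.wd)
    (ht : t.safe = false → t.val s < E.wd) : t.val s < E.wd + (s.time + 1) := by
  by_cases hs : t.safe = true
  · by_cases hl : t.low = true
    · have := Term.low_bound h h2 hb hl
      omega
    · cases t with
      | add a b =>
        simp only [Term.safe, Bool.and_eq_true] at hs
        have h1 := Term.low_bound h h2 (by simp only [Term.bd] at hb; omega) hs.1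
        have h3 : b.val s = 1 := by
          cases b <;> simp [Term.isOne] at hs ⊢
          exact hs.2
        simp only [Term.val]
        omega
      | _ => simp_all [Term.safe]
  · have := ht (by simpa using hs)
    omega

/-- Registers stay below `W`. After at most `W` clears of blocks of 17 · `W` ^ 2 cells, every
address is below `W` ^ 6, which fits since `Z` is at least 6. -/
theorem addrE_spec (h : Rel E W B s σ) (hW : 64 ≤ W) (hT : s.time + E.wd ≤ W)
    (hE : E.size ≤ W) (hZ : 6 ≤ Z) (hw : W ^ Z ≤ 2 ^ w) (a : Arr) (x y : Var) :
    (addrE a x y).Fits w σ ∧ (addrE a x y).val σ = addr B W a (s.reg x) (s.reg y) := by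
  have hx : s.reg x < W := (h.regb x).trans_le (by omega)
  have hy : s.reg y < W := (h.regb y).trans_le (by omega)
  have h6 : W ^ 6 ≤ 2 ^ w := (Nat.pow_le_pow_right (by omega) hZ).trans hw
  have hB : B ≤ W + W * (W * W * numArr) := h.le_size.trans (by gcongr; omega)
  have h3 : W * W * numArr ≤ W ^ 3 := by
    calc W * W * numArr ≤ W * W * W := by gcongr; simp [numArr]; omega
      _ = W ^ 3 := by ring
  have h5 : B + W * W * numArr ≤ W ^ 6 := by
    calc B + W * W * numArr ≤ W + W * W ^ 3 + W ^ 3 := by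
          have : W * (W * W * numArr) ≤ W * W ^ 3 := by gcongr
          omega
      _ ≤ W ^ 6 := by
        have e1 : W ≤ W ^ 5 := Nat.le_self_pow (by omega) W
        have e2 : W ^ 3 ≤ W ^ 5 := Nat.pow_le_pow_right (by omega) (by omega)
        have e3 : W ^ 4 ≤ W ^ 5 := Nat.pow_le_pow_right (by omega) (by omega)
        have e4 : W ^ 6 = W * W ^ 5 := by ring
        have e5 : W * W ^ 3 = W ^ 4 := by ring
        nlinarith
  have h7 := addr_lt (B := B) (a := a) hx hy
  have ha := a.ctorIdx_lt
  have hval : (addrE a x y).val σ = addr B W a (s.reg x) (s.reg y) := by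
    simp [addrE, Expr.val, addr, h.reg, h.r3, h.r4]
  refine ⟨?_, hval⟩
  have h8 : B + ((s.reg x * W + s.reg y) * numArr + a.ctorIdx) < 2 ^ w := by
    simp only [addr] at h7; omega
  have h9 : s.reg x * W + s.reg y < 2 ^ w := by simp only [numArr] at h8; omega
  have hW' : W < 2 ^ w := by
    have : W ^ 1 < W ^ 6 := Nat.pow_lt_pow_right (by omega) (by omega)
    rw [pow_one] at this
    omega
  simp only [addrE, Expr.Fits, Expr.val, h.reg, h.r3, h.r4]
  simp only [numArr] at *
  refine ⟨?_, ⟨⟨⟨⟨?_, ?_, ?_⟩, ?_, ?_⟩, ?_, ?_⟩, ?_, ?_⟩, ?_⟩ <;> omega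

/-- Variables and array entries are below `W`. Sums and products of numbers below powers of `W` are
below the power with the added exponents (plus one), so every intermediate value is below `W` to the
bound `bd`, hence fits. -/
theorem Term.compile_spec (h : Rel E W B s σ) (hW : 64 ≤ W) (hT : s.time + E.wd ≤ W)
    (hE : E.size ≤ W) (hZ : 6 ≤ Z) (hw : W ^ Z ≤ 2 ^ w) (t : Term) (ht : t.bd ≤ Z) :
    t.compile.Fits w σ ∧ t.compile.val σ = t.val s ∧ t.val s < W ^ t.bd ∧
      t.compile.cost ≤ t.bd := by
  have hp : ∀ {k l : ℕ}, k ≤ l → W ^ k ≤ W ^ l := fun h => Nat.pow_le_pow_right (by omega) h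
  have hreg : ∀ v, s.reg v < W := fun v => (h.regb v).trans_le (by omega)
  have two : ∀ t : Term, 2 ≤ W ^ t.bd := fun t =>
    le_trans (by omega : 2 ≤ W) (Nat.le_self_pow (by have := t.bd_pos; omega) W)
  have h1w : 1 < 2 ^ w := by
    have := hp hZ
    have : W ≤ W ^ 6 := Nat.le_self_pow (by omega) W
    omega
  induction t with
  | const k =>
    have : k < W ^ (k + 1) :=
      (Nat.lt_pow_self (by omega : 1 < W)).trans_le (hp (by omega))
    exact ⟨this.trans_le ((hp ht).trans hw), rfl, this, by simp [Term.compile, Expr.cost, bd]⟩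
  | reg v =>
    refine ⟨?_, h.reg v, by simpa [bd] using hreg v, by simp [Term.compile, Expr.cost, bd]⟩
    change σ.reg v.code < _
    rw [h.reg]
    have h3 : W ^ 1 ≤ W ^ Z := hp (by omega)
    exact (hreg v).trans_le ((by simpa using h3 : W ≤ W ^ Z).trans hw)
  | get a x y =>
    have h1 := addrE_spec h hW hT hE hZ hw a x y
    have h2 : σ.mem ((addrE a x y).val σ) = s.arr a (s.reg x) (s.reg y) := by
      rw [h1.2]; exact h.arr _ _ _ (hreg x) (hreg y)
    have h3 : s.arr a (s.reg x) (s.reg y) < W := (h.arrb a _ _).trans_le (by omega)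
    have h4 : W ^ 1 ≤ W ^ 12 := hp (by omega)
    have h5 : W ^ 1 ≤ W ^ Z := hp (by omega)
    rw [pow_one] at h4 h5
    refine ⟨⟨h1.1, ?_⟩, h2, h3.trans_le h4, by simp [Term.compile, addrE, Expr.cost, bd]⟩
    rw [h2]; omega
  | add a b iha ihb =>
    simp only [bd] at ht
    obtain ⟨a1, a2, a3, a4⟩ := iha (by omega)
    obtain ⟨b1, b2, b3, b4⟩ := ihb (by omega)
    have h1 : a.val s + b.val s < W ^ (a.bd + b.bd + 1) := by
      have := two a
      have := two b
      have h2 : W ^ a.bd * W ^ b.bd ≤ W ^ (a.bd + b.bd + 1) := by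
        rw [← pow_add]; exact hp (by omega)
      nlinarith
    refine ⟨⟨a1, b1, ?_⟩, by simp [compile, Expr.val, val, a2, b2], h1, ?_⟩
    · rw [a2, b2]; exact h1.trans_le ((hp (by omega)).trans hw)
    · simp only [compile, Expr.cost, bd]; omega
  | mul a b iha ihb =>
    simp only [bd] at ht
    obtain ⟨a1, a2, a3, a4⟩ := iha (by omega)
    obtain ⟨b1, b2, b3, b4⟩ := ihb (by omega)
    have h1 : a.val s * b.val s < W ^ (a.bd + b.bd + 1) := by
      have h2 : W ^ a.bd * W ^ b.bd ≤ W ^ (a.bd + b.bd + 1) := by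
        rw [← pow_add]; exact hp (by omega)
      exact (Nat.mul_lt_mul'' a3 b3).trans_le h2
    refine ⟨⟨a1, b1, ?_⟩, by simp [compile, Expr.val, val, a2, b2], h1, ?_⟩
    · rw [a2, b2]; exact h1.trans_le ((hp (by omega)).trans hw)
    · simp only [compile, Expr.cost, bd]; omega
  | sub a b iha ihb =>
    simp only [bd] at ht
    obtain ⟨a1, a2, a3, a4⟩ := iha (by omega)
    obtain ⟨b1, b2, b3, b4⟩ := ihb (by omega)
    refine ⟨⟨a1, b1⟩, by simp [compile, Expr.val, val, a2, b2],
      (Nat.sub_le _ _).trans_lt (a3.trans_le (hp ?_)), ?_⟩ <;>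
      simp only [compile, Expr.cost, bd] <;> omega
  | div a b iha ihb =>
    simp only [bd] at ht
    obtain ⟨a1, a2, a3, a4⟩ := iha (by omega)
    obtain ⟨b1, b2, b3, b4⟩ := ihb (by omega)
    refine ⟨⟨a1, b1⟩, by simp [compile, Expr.val, val, a2, b2],
      (Nat.div_le_self _ _).trans_lt (a3.trans_le (hp ?_)), ?_⟩ <;>
      simp only [compile, Expr.cost, bd] <;> omega
  | mod a b iha ihb =>
    simp only [bd] at ht
    obtain ⟨a1, a2, a3, a4⟩ := iha (by omega)
    obtain ⟨b1, b2, b3, b4⟩ := ihb (by omega)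
    refine ⟨⟨a1, b1⟩, by simp [compile, Expr.val, val, a2, b2],
      (Nat.mod_le _ _).trans_lt (a3.trans_le (hp ?_)), ?_⟩ <;>
      simp only [compile, Expr.cost, bd] <;> omega
  | lt a b iha ihb =>
    simp only [bd] at ht
    obtain ⟨a1, a2, a3, a4⟩ := iha (by omega)
    obtain ⟨b1, b2, b3, b4⟩ := ihb (by omega)
    refine ⟨⟨a1, b1, h1w⟩, by simp [compile, Expr.val, val, a2, b2], ?_, ?_⟩
    · have := two (.lt a b)
      simp only [val, bd] at *
      split_ifs <;> omega
    · simp only [compile, Expr.cost, bd]; omega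

theorem Rel.set (h : Rel E W B s σ) (v : Var) {x : ℕ} (hx : x < E.wd + (s.time + 1)) :
    Rel E W B (s.set v x) ⟨Function.update σ.reg v.code x, σ.mem⟩ where
  reg u := by simp [Function.update_apply, h.reg]
  r3 := by simp [v.code_ne.1.symm, h.r3]
  r4 := by simp [v.code_ne.2.symm, h.r4]
  inp := h.inp
  size_le := h.size_le
  le_size := h.le_size.trans (by simp only [St.set_time]; gcongr; omega)
  arr := h.arr
  zero := h.zero
  regb u := by
    have := h.regb u
    simp only [St.set_reg, St.set_time]
    split_ifs <;> omega
  arrb a x y := by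
    have := h.arrb a x y
    simp only [St.set_arr, St.set_time]
    omega

theorem Rel.tick (h : Rel E W B s σ) : Rel E W B s.tick σ where
  reg := h.reg
  r3 := h.r3
  r4 := h.r4
  inp := h.inp
  size_le := h.size_le
  le_size := h.le_size.trans (by simp only [St.tick_time]; gcongr; omega)
  arr := h.arr
  zero := h.zero
  regb u := (h.regb u).trans (by simp)
  arrb a x y := (h.arrb a x y).trans (by simp)

theorem Rel.put (h : Rel E W B s σ) (a : Arr) {x y z : ℕ} (hx : x < W) (hy : y < W)
    (hz : z < E.wd + (s.time + 1)) :
    Rel E W B (s.put a x y z) ⟨σ.reg, Function.update σ.mem (addr B W a x y) z⟩ where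
  reg := h.reg
  r3 := h.r3
  r4 := h.r4
  inp i hi := by
    have : i ≠ addr B W a x y := by
      have := h.size_le
      simp only [addr]; omega
    simp [this, h.inp i hi]
  size_le := h.size_le
  le_size := h.le_size.trans (by simp only [St.put_time]; gcongr; omega)
  arr b x' y' hx' hy' := by
    simp only [Function.update_apply, addr_inj hy' hy, St.put_arr]
    by_cases hb : b = a
    · simp only [hb, true_and, if_true]
      split_ifs
      · rfl
      · exact h.arr _ _ _ hx' hy'
    · simp [hb, h.arr b _ _ hx' hy']
  zero i hi := by
    have : i ≠ addr B W a x y := by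
      have := addr_lt (B := B) (a := a) hx hy
      omega
    simp [this, h.zero i hi]
  regb u := (h.regb u).trans (by simp)
  arrb b x' y' := by
    have h1 := h.arrb b x' y'
    have h2 := h.arrb a x' y'
    simp only [St.put_arr, St.put_time]
    split_ifs with h3
    · dsimp only
      split_ifs <;> omega
    · omega

/-- Clearing all arrays takes constant time: the base moves past everything ever written, where the
memory is still zero. -/
theorem Rel.clear (h : Rel E W B s σ) (hwd : 0 < E.wd) :
    Rel E W (B + W * W * numArr) s.clear
      ⟨Function.update σ.reg 4 (B + W * W * numArr), σ.mem⟩ where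
  reg u := by simp [u.code_ne.2, h.reg]
  r3 := by simp [h.r3]
  r4 := by simp
  inp := h.inp
  size_le := h.size_le.trans (by omega)
  le_size := by
    have := h.le_size
    simp only [St.clear_time, add_mul, one_mul]
    omega
  arr a x y _ _ := h.zero _ (by simp only [addr]; omega)
  zero i hi := h.zero i (by omega)
  regb u := (h.regb u).trans (by simp)
  arrb a x y := by simp [hwd]

/-- One tick is simulated by at most `Z` operations. The bound `hT` concerns the final time only;
time is monotone, so it covers all intermediate states. Well-formedness makes the compiled loop,
which tests its condition in every round, agree with the fixed number of rounds of the source loop.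
-/
theorem compile_run (hW : 64 ≤ W) (hE : E.size ≤ W) (hZ : 12 ≤ Z) (hw : W ^ Z ≤ 2 ^ w)
    (h2 : 2 ≤ E.wd) (hinp : ∀ i < E.size, E.inp i < E.wd) (p : Cmd) (hwf : p.wf = true)
    (hbZ : p.bd ≤ Z) (hbE : p.bd ≤ E.wd) (s : St) (σ : State) (B : ℕ) (h : Rel E W B s σ)
    (hok : p.Ok E s) (hT : (p.run E s).time + E.wd ≤ W) :
    ∃ (σ' : State) (B' t : ℕ), Exec w p.compile σ σ' t ∧ Rel E W B' (p.run E s) σ' ∧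
      t + Z * s.time ≤ Z * (p.run E s).time := by
  induction p generalizing s σ B with
  | skip => exact ⟨σ, B, 1, .skip σ, h.tick, by simp only [Cmd.run, St.tick_time]; nlinarith⟩
  | assign v t =>
    simp only [Cmd.bd, Cmd.run, St.set_time] at *
    obtain ⟨h3, h4, -, h5⟩ := t.compile_spec h hW (by omega) hE (by omega) hw (by omega)
    refine ⟨_, B, _, .assign _ _ _ h3, ?_, by nlinarith⟩
    rw [h4]
    exact h.set v (t.safe_bound h h2 (by omega) hok)
  | read v u =>
    simp only [Cmd.bd, Cmd.run, St.set_time, Cmd.Ok] at *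
    have h3 := hinp _ hok
    have h5 : σ.mem (σ.reg u.code) = E.inp (s.reg u) := by rw [h.reg, h.inp _ hok]
    have h4 : W ^ 1 ≤ W ^ Z := Nat.pow_le_pow_right (by omega) (by omega)
    rw [pow_one] at h4
    have h6 := h.regb u
    have h7 : Expr.Fits w σ (.load (.reg u.code)) := by
      simp only [Expr.Fits, Expr.val, h5]
      rw [h.reg]
      omega
    refine ⟨_, B, _, .assign _ _ _ h7, ?_, by simp only [Expr.cost]; nlinarith⟩
    simp only [Expr.val, h5]
    exact h.set v (by omega)
  | put a x y t =>
    simp only [Cmd.bd, Cmd.run, St.put_time] at *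
    obtain ⟨h3, h4, -, h5⟩ := t.compile_spec h hW (by omega) hE (by omega) hw (by omega)
    obtain ⟨h6, h7⟩ := addrE_spec h hW (by omega) hE (by omega) hw a x y
    refine ⟨_, B, _, .store _ _ _ h6 h3, ?_, ?_⟩
    · rw [h4, h7]
      exact h.put a ((h.regb x).trans_le (by omega)) ((h.regb y).trans_le (by omega))
        (t.safe_bound h h2 (by omega) hok)
    · simp only [addrE, Expr.cost]; nlinarith
  | seq p q hp hq =>
    simp only [Cmd.bd, Cmd.wf, Bool.and_eq_true] at *
    have h3 := time_le_run E q (p.run E s)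
    simp only [Cmd.run] at *
    obtain ⟨σ1, B1, t1, e1, r1, c1⟩ := hp hwf.1 (by omega) (by omega) s σ B h hok.1 (by omega)
    obtain ⟨σ2, B2, t2, e2, r2, c2⟩ := hq hwf.2 (by omega) (by omega) _ σ1 B1 r1 hok.2 hT
    exact ⟨σ2, B2, _, .seq e1 e2, r2, by omega⟩
  | ite t p q hp hq =>
    simp only [Cmd.bd, Cmd.wf, Bool.and_eq_true, Cmd.run, Cmd.Ok] at *
    have hle : s.time + 1 ≤ (if t.val s ≠ 0 then p.run E s.tick else q.run E s.tick).time := by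
      split_ifs
      · exact time_le_run E p s.tick
      · exact time_le_run E q s.tick
    obtain ⟨h3, h4, -, h5⟩ := t.compile_spec h hW (by omega) hE (by omega) hw (by omega)
    by_cases ht : t.val s ≠ 0
    · rw [if_pos ht] at hok hT hle ⊢
      obtain ⟨σ1, B1, t1, e1, r1, c1⟩ := hp hwf.1 (by omega) (by omega) _ σ B h.tick hok hT
      refine ⟨σ1, B1, _, .condTrue h3 (by rw [h4]; exact ht) e1, r1, ?_⟩
      rw [St.tick_time, Nat.mul_add] at c1
      omega
    · rw [if_neg ht] at hok hT hle ⊢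
      obtain ⟨σ1, B1, t1, e1, r1, c1⟩ := hq hwf.2 (by omega) (by omega) _ σ B h.tick hok hT
      refine ⟨σ1, B1, _, .condFalse h3 (by rw [h4]; simpa using ht) e1, r1, ?_⟩
      rw [St.tick_time, Nat.mul_add] at c1
      omega
  | clear =>
    simp only [Cmd.run, St.clear_time] at *
    have h5 := addrE_spec h hW (by omega) hE (by omega) hw .mat .n .n
    have h6 : W ^ 6 ≤ W ^ Z := Nat.pow_le_pow_right (by omega) (by omega)
    have hB : B ≤ W + W * (W * W * numArr) := h.le_size.trans (by gcongr; omega)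
    have h7 : B + W * W * numArr < 2 ^ w := by
      refine lt_of_lt_of_le ?_ (h6.trans hw)
      calc B + W * W * numArr ≤ W + W * (W * W * 17) + W * W * 17 := by simp only [numArr] at *; omega
        _ < W ^ 6 := by
          have e0 : W ≤ W * W := by nlinarith
          have e1 : W ^ 6 = W * W * W * (W * W * W) := by ring
          have e2 : 64 * 64 * 64 ≤ W * W * W := Nat.mul_le_mul (Nat.mul_le_mul hW hW) hW
          have e3 : W * W ≤ W * W * W := Nat.le_mul_of_pos_right _ (by omega)
          nlinarith
    have h8 : W * W < 2 ^ w := by simp only [numArr] at h7; omega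
    have h9 : W < 2 ^ w := by nlinarith
    have h10 : Expr.Fits w σ
        (.add (.reg 4) (.mul (.mul (.reg 3) (.reg 3)) (.const numArr))) := by
      simp only [Expr.Fits, Expr.val, h.r3, h.r4]
      simp only [numArr] at *
      refine ⟨?_, ⟨⟨?_, ?_, ?_⟩, ?_, ?_⟩, ?_⟩ <;> omega
    refine ⟨_, B + W * W * numArr, _, .assign _ _ _ h10, ?_, ?_⟩
    · simp only [Expr.val, h.r3, h.r4]
      exact h.clear (by omega)
    · simp only [Expr.cost]; nlinarith
  | loop i lim p hp =>
    simp only [Cmd.bd, Cmd.wf, Bool.and_eq_true, Cmd.run, Cmd.Ok] at *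
    obtain ⟨⟨⟨hwf1, hwf2⟩, hwf3⟩, hwf4⟩ := hwf
    simp only [Bool.not_eq_true', List.contains_eq_mem, decide_eq_false_iff_not, beq_eq_false_iff_ne]
      at hwf2 hwf3 hwf4
    set f := iter (p.run E) i (s.set i 0) with hf
    set N := s.reg lim with hN
    have h1w : W < 2 ^ w := by
      have : W ^ 1 < W ^ Z := Nat.pow_lt_pow_right (by omega) (by omega)
      rw [pow_one] at this
      omega
    have hstep : ∀ k, (f k).time + 1 ≤ (f (k + 1)).time := fun k => by
      have := time_le_run E p (f k)
      simp only [hf, iter, St.set_time] at *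
      omega
    have hmono : ∀ k l, (f k).time ≤ (f (k + l)).time := fun k l => by
      induction l with
      | zero => simp
      | succ l ih => have := hstep (k + l); rw [← add_assoc]; omega
    have hlim : ∀ k, (f k).reg lim = N := fun k => by
      induction k with
      | zero => simp [hf, iter, Ne.symm hwf4, hN]
      | succ k ih =>
        have := (frame_run E p (f k)).1 lim hwf3
        simp only [hf, iter, St.set_reg, Ne.symm hwf4, if_false] at *
        omega
    have hi : ∀ k, (f k).reg i = k := iter_reg (by simp)
    -- Induction on the number of remaining rounds. The surplus 4 is the last, failing test;
    -- together with the initial assignment of the counter it is paid for by the tick that starts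
    -- the loop.
    have key : ∀ l k, k + l = N → ∀ σ B, Rel E W B (f k) σ → ∃ (σ' : State) (B' t : ℕ),
        Exec w (.loop (.lt (.reg i.code) (.reg lim.code))
          (.seq p.compile (.assign i.code (.add (.reg i.code) (.const 1))))) σ σ' t ∧
        Rel E W B' (f N) σ' ∧ t + Z * (f k).time ≤ Z * (f N).time + 4 := by
      intro l
      induction l with
      | zero =>
        intro k hk σ B hr
        obtain rfl : k = N := by omega
        have h3 := hr.regb i
        have h4 := hr.regb lim
        rw [hlim] at h4
        refine ⟨σ, B, _, .loopFalse ?_ ?_, hr, ?_⟩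
        · simp only [Expr.Fits, hr.reg, hi, hlim]
          omega
        · simp [Expr.val, hr.reg, hi, hlim]
        · simp [Expr.cost]; omega
      | succ l ih =>
        intro k hk σ B hr
        have h3 := hmono (k + 1) l
        rw [show k + 1 + l = N by omega] at h3
        have h4 := hstep k
        have h5 : (f (k + 1)).time = (p.run E (f k)).time + 1 := by simp [hf, iter]
        obtain ⟨σ1, B1, t1, e1, r1, c1⟩ :=
          hp hwf1 (by omega) (by omega) (f k) σ B hr (hok k (by omega)) (by omega)
        have h6 : (p.run E (f k)).reg i = k := by
          rw [(frame_run E p (f k)).1 i hwf2, hi]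
        have r2 := r1.set i (x := k + 1) (by have := r1.regb i; omega)
        obtain ⟨σ2, B2, t2, e2, r3, c2⟩ := ih (k + 1) (by omega) _ B1 r2
        have h7 := hr.regb i
        have h8 := hr.regb lim
        have h9 := r1.regb i
        rw [hi] at h7
        rw [hlim] at h8
        have h10 : Expr.Fits w σ1 (.add (.reg i.code) (.const 1)) := by
          simp only [Expr.Fits, Expr.val, r1.reg, h6]
          omega
        have e3 := Exec.assign (w := w) i.code _ σ1 h10
        have h11 : Expr.val σ1 (.add (.reg i.code) (.const 1)) = k + 1 := by
          simp [Expr.val, r1.reg, h6]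
        rw [h11] at e3
        refine ⟨σ2, B2, _, .loopTrue ?_ ?_ (.seq e1 e3) e2, r3, ?_⟩
        · simp only [Expr.Fits, hr.reg, hi, hlim]
          omega
        · simp [Expr.val, hr.reg, hi, hlim]
          omega
        · simp only [Expr.cost]
          nlinarith
    have h3 := hmono 0 N
    have h4 : (f 0).time = s.time + 1 := by simp [hf, iter]
    rw [zero_add] at h3
    have r0 : Rel E W B (f 0) _ := h.set i (x := 0) (by omega)
    obtain ⟨σ1, B1, t1, e1, r1, c1⟩ := key N 0 (by omega) _ B r0
    refine ⟨σ1, B1, _, .seq (.assign _ _ _ ?_) e1, r1, ?_⟩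
    · simp only [Expr.Fits]; omega
    · simp only [Expr.cost]
      nlinarith

end


/-- The sum of the parameters of the input, plus two. -/
def sizeE : Expr := .add (.add (.load (.const 0)) (.load (.const 1))) (.add (.reg 0) (.const 2))

def powE : ℕ → Expr
  | 0 => .const 1
  | k + 1 => .mul (powE k) sizeE

/-- The input for the loop language, where values up to `(n + m + d + 2) ^ a` are allowed. -/
def inputEnv (n : ℕ) (L : List (Fin n × Fin n)) (d a : ℕ) : Env :=
  ⟨(inputState n L d).mem, 2 * L.length + 2, (n + L.length + d + 2) ^ a⟩

def initSt (d : ℕ) : St := ⟨fun v => if v = .o0 then d else 0, fun _ _ _ => 0, 0⟩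

theorem length_flatMap_pair {n : ℕ} (L : List (Fin n × Fin n)) :
    (L.flatMap fun e => [(e.1 : ℕ), (e.2 : ℕ)]).length = 2 * L.length := by
  induction L with
  | nil => rfl
  | cons e L ih => simp only [List.flatMap_cons, List.length_append, ih, List.length_cons,
      List.length_nil]; omega

theorem inputState_mem_zero {n : ℕ} (L : List (Fin n × Fin n)) (d : ℕ) {i : ℕ}
    (hi : 2 * L.length + 2 ≤ i) : (inputState n L d).mem i = 0 := by
  simp only [inputState]
  rw [List.getD_eq_default]
  simp only [List.length_cons, length_flatMap_pair]
  omega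

theorem inputState_mem_lt {n : ℕ} (L : List (Fin n × Fin n)) (d i : ℕ) :
    (inputState n L d).mem i < n + L.length + d + 2 := by
  simp only [inputState]
  by_cases h : i < (n :: L.length :: L.flatMap fun e => [(e.1 : ℕ), (e.2 : ℕ)]).length
  · rw [List.getD_eq_getElem _ _ h]
    have := List.getElem_mem h
    generalize (n :: L.length :: L.flatMap fun e => [(e.1 : ℕ), (e.2 : ℕ)])[i] = x at this ⊢
    simp only [List.mem_cons, List.mem_flatMap, List.not_mem_nil, or_false] at this
    rcases this with h | h | ⟨e, -, h | h⟩ <;> omega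
  · rw [List.getD_eq_default _ _ (by omega)]
    omega

@[simp] theorem inputState_zero {n : ℕ} (L : List (Fin n × Fin n)) (d : ℕ) :
    (inputState n L d).mem 0 = n := rfl
@[simp] theorem inputState_one {n : ℕ} (L : List (Fin n × Fin n)) (d : ℕ) :
    (inputState n L d).mem 1 = L.length := rfl
@[simp] theorem inputState_reg {n : ℕ} (L : List (Fin n × Fin n)) (d : ℕ) :
    (inputState n L d).reg 0 = d := rfl

theorem sizeE_val {n : ℕ} (L : List (Fin n × Fin n)) (d : ℕ) :
    sizeE.val (inputState n L d) = n + L.length + d + 2 := by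
  simp only [sizeE, Expr.val, inputState_zero, inputState_one, inputState_reg]
  omega

theorem powE_val {n : ℕ} (L : List (Fin n × Fin n)) (d k : ℕ) :
    (powE k).val (inputState n L d) = (n + L.length + d + 2) ^ k := by
  induction k with
  | zero => rfl
  | succ k ih => simp only [powE, Expr.val, ih, sizeE_val, pow_succ]

theorem sizeE_fits {n : ℕ} (L : List (Fin n × Fin n)) (d w : ℕ)
    (hw : n + L.length + d + 2 < 2 ^ w) : sizeE.Fits w (inputState n L d) := by
  simp only [sizeE, Expr.Fits, Expr.val, inputState_zero, inputState_one, inputState_reg]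
  omega

theorem powE_fits {n : ℕ} (L : List (Fin n × Fin n)) (d k w : ℕ)
    (hw : (n + L.length + d + 2) ^ (k + 1) < 2 ^ w) : (powE k).Fits w (inputState n L d) := by
  induction k with
  | zero => rw [zero_add, pow_one] at hw; simp only [powE, Expr.Fits]; omega
  | succ k ih =>
    have h1 : (n + L.length + d + 2) ^ (k + 1) < 2 ^ w :=
      (Nat.pow_le_pow_right (by omega) (by omega)).trans_lt hw
    refine ⟨ih h1, sizeE_fits L d w ?_, ?_⟩
    · exact (Nat.le_self_pow (by omega) _).trans_lt h1
    · rw [powE_val, sizeE_val, ← pow_succ]; exact h1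

/-- The row length is `W = S ^ (a + 1)`, where `S = n + m + d + 2`. Time and admissible values are
bounded by `S ^ a`, and since `S` is at least 2 their sum is at most `W`. The prologue computes `W`
and puts the arrays behind the input. -/
theorem exists_prog (p : Cmd) (hwf : p.wf = true) (a : ℕ) (ha : 6 ≤ a) (hbd : p.bd ≤ 2 ^ a) :
    ∃ (P : Prog) (c K : ℕ), ∀ (n : ℕ) (L : List (Fin n × Fin n)) (d w : ℕ),
      p.Ok (inputEnv n L d a) (initSt d) →
      (p.run (inputEnv n L d a) (initSt d)).time ≤ (n + L.length + d + 2) ^ a →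
      (n + L.length + d + 2) ^ c ≤ 2 ^ w →
      ∃ (σ : State) (t : ℕ), Exec w P (inputState n L d) σ t ∧
        t ≤ K * ((p.run (inputEnv n L d a) (initSt d)).time + 1) ∧
        σ.reg 0 = (p.run (inputEnv n L d a) (initSt d)).reg .o0 ∧
        σ.reg 1 = (p.run (inputEnv n L d a) (initSt d)).reg .o1 ∧
        σ.reg 2 = (p.run (inputEnv n L d a) (initSt d)).reg .o2 := by
  set Z := max 12 p.bd with hZ
  refine ⟨.seq (.seq (.assign 4 (.add (.add (.load (.const 1)) (.load (.const 1))) (.const 2)))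
    (.assign 3 (powE (a + 1)))) p.compile, (a + 1) * Z, 8 + (powE (a + 1)).cost + Z,
    fun n L d w hok hT hw => ?_⟩
  set S := n + L.length + d + 2 with hS
  have hW : S ^ (a + 1) = S ^ a * S := pow_succ _ _
  have hSa : S ≤ S ^ a := Nat.le_self_pow (by omega) S
  have h2a : 2 ^ a ≤ S ^ a := Nat.pow_le_pow_left (by omega) a
  have h64 : 2 ^ 6 ≤ 2 ^ a := Nat.pow_le_pow_right (by omega) ha
  have hWw : (S ^ (a + 1)) ^ Z ≤ 2 ^ w := by rwa [← pow_mul]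
  have hle : S ^ (a + 1 + 2) ≤ (S ^ (a + 1)) ^ Z := by
    rw [← pow_mul]
    exact Nat.pow_le_pow_right (by omega) (by nlinarith [le_max_left 12 p.bd])
  have hlt : S ^ (a + 1 + 1) < 2 ^ w :=
    (Nat.pow_lt_pow_right (by omega) (by omega)).trans_le (hle.trans hWw)
  have hlt' : S * S < 2 ^ w :=
    lt_of_le_of_lt (by rw [← pow_two]; exact Nat.pow_le_pow_right (by omega) (by omega)) hlt
  set s0 := inputState n L d with hs0
  have hfit : Expr.Fits w s0 (.add (.add (.load (.const 1)) (.load (.const 1))) (.const 2)) := by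
    have h1 : L.length + L.length + 2 < 2 ^ w := by nlinarith
    simp only [Expr.Fits, Expr.val, hs0, inputState_one]
    omega
  set s1 : State := ⟨Function.update s0.reg 4 (2 * L.length + 2), s0.mem⟩ with hs1
  have e1 : Exec w (.assign 4 (.add (.add (.load (.const 1)) (.load (.const 1))) (.const 2))) s0 s1
      8 := by
    have := Exec.assign (w := w) 4 _ s0 hfit
    have h1 : Expr.val s0 (.add (.add (.load (.const 1)) (.load (.const 1))) (.const 2)) =
        2 * L.length + 2 := by
      simp only [Expr.val, hs0, inputState_one]
      omega
    rw [h1] at this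
    exact this
  have hval : ∀ e : Expr, sizeE.val s1 = sizeE.val s0 := fun e => by
    simp [sizeE, Expr.val, hs1]
  have hval' : ∀ k, (powE k).val s1 = (powE k).val s0 ∧
      ((powE k).Fits w s0 → (powE k).Fits w s1) := fun k => by
    induction k with
    | zero => exact ⟨rfl, id⟩
    | succ k ih =>
      refine ⟨by simp [powE, Expr.val, ih.1, hval (.const 0)], fun h => ⟨ih.2 h.1, ?_, ?_⟩⟩
      · have := h.2.1
        simpa [sizeE, Expr.Fits, Expr.val, hs1] using this
      · rw [ih.1, hval (.const 0)]; exact h.2.2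
  have e2 := Exec.assign (w := w) 3 (powE (a + 1)) s1 ((hval' _).2 (powE_fits L d _ _ hlt))
  rw [(hval' _).1, powE_val] at e2
  have hrel : Rel (inputEnv n L d a) (S ^ (a + 1)) (2 * L.length + 2) (initSt d)
      ⟨Function.update s1.reg 3 (S ^ (a + 1)), s1.mem⟩ := by
    refine ⟨fun v => ?_, by simp, by simp [hs1], fun i _ => rfl, le_rfl,
      by simp [inputEnv, initSt], fun b x y _ _ => ?_, fun i hi => ?_, fun v => ?_, fun b x y => ?_⟩
    · have h0 : v.code = 0 ↔ v = .o0 := Var.code_inj (u := .o0)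
      simp [hs1, hs0, v.code_ne.1, v.code_ne.2, inputState, initSt, h0]
    · exact inputState_mem_zero L d (by simp only [addr]; omega)
    · exact inputState_mem_zero L d (by omega)
    · change (if v = .o0 then d else 0) < S ^ a + 0
      split_ifs <;> omega
    · change 0 < S ^ a + 0
      omega
  have hwd : (inputEnv n L d a).wd = S ^ a := rfl
  have hsz : (inputEnv n L d a).size = 2 * L.length + 2 := rfl
  obtain ⟨σ, B, t, e3, hr, ht⟩ := compile_run (W := S ^ (a + 1)) (Z := Z) (w := w)
    (by nlinarith) (by rw [hsz]; nlinarith) (le_max_left _ _) hWw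
    (by rw [hwd]; omega)
    (fun i _ => (inputState_mem_lt L d i).trans_le hSa) p hwf (le_max_right _ _)
    (hbd.trans h2a) (initSt d) _ _ hrel hok (by rw [hwd, hW]; nlinarith)
  refine ⟨σ, _, .seq (.seq e1 e2) e3, ?_, hr.reg .o0, hr.reg .o1, hr.reg .o2⟩
  have : (initSt d).time = 0 := rfl
  rw [this] at ht
  have hz : 12 ≤ Z := le_max_left _ _
  generalize (p.run (inputEnv n L d a) (initSt d)).time = T at *
  have := Nat.zero_le ((8 + (powE (a + 1)).cost) * T)
  nlinarith

end LoopRAM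

/-! ## Adjacency lists -/

namespace LoopRAM

/-- Make `x` a vertex of the adjacency structure. -/
def touch (x : Var) : Cmd :=
  .gt ::= .get .len x x ;;
  .ite (♯.gt ≺ 1)
    (.put .adj x .gt (♯x) ;; .put .mat x x 1 ;; .put .len x x 1 ;; .put .ver .n .cnt (♯x) ;;
      .cnt ::= ♯.cnt + 1)
    .skip

/-- Append `y` to the neighbors of `x`. -/
def push (x y : Var) : Cmd :=
  .put .mat x y 1 ;; .gt ::= .get .len x x ;; .put .adj x .gt (♯y) ;; .put .len x x (♯.gt + 1)

/-- Read the graph. -/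
def pre : Cmd :=
  .gt ::= 0 ;; .read .n .gt ;; .gt ::= 1 ;; .read .m .gt ;; .cnt ::= 0 ;;
  -- Only the first min(n, 2m + 2) vertices are entered unconditionally, so that the time does not
  -- depend on n; ends of edges are added when they are read.
  .gl ::= ♯.m + ♯.m + 2 ;; .ite (♯.n ≺ ♯.gl) (.gl ::= ♯.n) .skip ;;
  .loop .gi .gl (touch .gi) ;;
  .ge ::= 2 ;;
  .loop .gi .m
    (.read .ga .ge ;; .ge ::= ♯.ge + 1 ;; .read .gb .ge ;; .ge ::= ♯.ge + 1 ;;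
      touch .ga ;; touch .gb ;; push .ga .gb ;; push .gb .ga)

/-- The state holds the list `R` of vertices and the closed neighborhoods `A`. -/
structure GRep (s : St) (R : List ℕ) (A : ℕ → List ℕ) : Prop where
  cnt : s.reg .cnt = R.length
  ver : row (s.arr .ver (s.reg .n)) R.length = R
  len : ∀ v, s.arr .len v v = (A v).length
  adj : ∀ v, row (s.arr .adj v) (A v).length = A v
  mat : ∀ v u, s.arr .mat v u = if u ∈ A v then 1 else 0

theorem GRep.congr {s s' : St} {R : List ℕ} {A : ℕ → List ℕ} (h : GRep s R A)
    (h1 : s'.reg .cnt = s.reg .cnt) (h2 : s'.reg .n = s.reg .n) (h3 : s'.arr .ver = s.arr .ver)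
    (h4 : s'.arr .len = s.arr .len) (h5 : s'.arr .adj = s.arr .adj)
    (h6 : s'.arr .mat = s.arr .mat) : GRep s' R A :=
  ⟨by rw [h1, h.cnt], by rw [h2, h3, h.ver], by rw [h4]; exact h.len, by rw [h5]; exact h.adj,
    by rw [h6]; exact h.mat⟩

/-- `R` and `A` are the vertices and closed neighborhoods of a graph with vertex set `V` and
adjacency relation `r`. -/
structure GInv (V : ℕ → Prop) (r : ℕ → ℕ → Prop) (k l : ℕ) (R : List ℕ) (A : ℕ → List ℕ) :
    Prop where
  nodup : R.Nodup
  mem : ∀ v, v ∈ R ↔ V v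
  nodupA : ∀ v, (A v).Nodup
  memA : ∀ v u, u ∈ A v ↔ V v ∧ (u = v ∨ r v u)
  dom : ∀ v u, r v u → V v
  -- Each list contains its own vertex; `k` is the number of further entries, two per edge once both
  -- directions are pushed.
  sum : (R.map fun v => (A v).length).sum = R.length + k
  length : R.length ≤ l

theorem GInv.mem_iff {V : ℕ → Prop} {r : ℕ → ℕ → Prop} {k l : ℕ} {R : List ℕ} {A : ℕ → List ℕ}
    (h : GInv V r k l R A) (v : ℕ) : v ∈ R ↔ A v ≠ [] := by
  refine (h.mem v).trans ⟨fun hv => List.ne_nil_of_mem ((h.memA v v).2 ⟨hv, .inl rfl⟩), fun hv => ?_⟩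
  obtain ⟨u, hu⟩ := List.exists_mem_of_ne_nil _ hv
  exact ((h.memA v u).1 hu).1

theorem GInv.touch {V : ℕ → Prop} {r : ℕ → ℕ → Prop} {k l : ℕ} {R : List ℕ} {A : ℕ → List ℕ}
    (h : GInv V r k l R A) (x : ℕ) :
    GInv (fun v => V v ∨ v = x) r k (l + 1) (if x ∈ R then R else R ++ [x])
      (if x ∈ R then A else Function.update A x [x]) := by
  by_cases hx : x ∈ R
  · have hV := (h.mem x).1 hx
    have e : ∀ v, (V v ∨ v = x) ↔ V v := fun v =>
      ⟨fun h => h.elim id fun h => h ▸ hV, Or.inl⟩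
    simp only [if_pos hx, e]
    exact { h with length := h.length.trans (Nat.le_succ _) }
  · simp only [if_neg hx]
    have hV := mt (h.mem x).2 hx
    refine ⟨?_, fun v => by simp [h.mem], fun v => ?_, fun v u => ?_, fun v u hr => .inl (h.dom v u hr),
      ?_, by simpa using h.length⟩
    · rw [List.nodup_append]
      exact ⟨h.nodup, by simp, by simp; rintro a ha rfl; exact hx ha⟩
    · by_cases hv : v = x
      · simp [hv]
      · simp [hv, h.nodupA]
    · by_cases hv : v = x
      · subst hv
        simpa using fun hr => absurd (h.dom _ _ hr) hV
      · simp [hv, h.memA]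
    · have : (R.map fun v => (Function.update A x [x] v).length) = R.map fun v => (A v).length := by
        refine List.map_congr_left fun v hv => ?_
        rw [Function.update_of_ne]
        rintro rfl; exact hx hv
      simp [this, h.sum]; omega

theorem sum_map_update {R : List ℕ} (hR : R.Nodup) {x : ℕ} (hx : x ∈ R) (f : ℕ → ℕ) (z : ℕ) :
    (R.map (Function.update f x z)).sum + f x = (R.map f).sum + z := by
  induction R with
  | nil => simp at hx
  | cons a R ih =>
    rw [List.nodup_cons] at hR
    by_cases ha : a = x
    · subst ha
      have : R.map (Function.update f a z) = R.map f := List.map_congr_left fun v hv => by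
        rw [Function.update_of_ne]; rintro rfl; exact hR.1 hv
      simp [this]; omega
    · have := ih hR.2 ((List.mem_cons.1 hx).resolve_left (Ne.symm ha))
      simp [ha]; omega

theorem GInv.push {V : ℕ → Prop} {r : ℕ → ℕ → Prop} {k l : ℕ} {R : List ℕ} {A : ℕ → List ℕ}
    (h : GInv V r k l R A) {x y : ℕ} (hx : V x) (hxy : x ≠ y) (hr : ¬ r x y) :
    GInv V (fun v u => r v u ∨ (v = x ∧ u = y)) (k + 1) l R
      (Function.update A x (A x ++ [y])) := by
  refine ⟨h.nodup, h.mem, fun v => ?_, fun v u => ?_, ?_, ?_, h.length⟩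
  · by_cases hv : v = x
    · subst hv
      rw [Function.update_self, List.nodup_append]
      refine ⟨h.nodupA v, by simp, ?_⟩
      simp only [List.mem_singleton]
      rintro a ha _ rfl rfl
      rcases ((h.memA _ _).1 ha).2 with h | h
      · exact hxy h.symm
      · exact hr h
    · simp [hv, h.nodupA]
  · by_cases hv : v = x
    · subst hv
      simp [h.memA, hx, or_assoc]
    · simp [hv, h.memA]
  · rintro v u (h1 | ⟨rfl, -⟩)
    · exact h.dom v u h1
    · exact hx
  · have h1 := sum_map_update h.nodup ((h.mem x).2 hx) (fun v => (A v).length) ((A x).length + 1)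
    have h2 : (fun v => (Function.update A x (A x ++ [y]) v).length) =
        Function.update (fun v => (A v).length) x ((A x).length + 1) := by
      funext v
      by_cases hv : v = x
      · subst hv; simp
      · simp [hv]
    rw [h2]
    have := h.sum
    omega

section
variable {E : Env} {s : St} {R : List ℕ} {A : ℕ → List ℕ}

/-- A vertex has been entered exactly if its list is nonempty, since it belongs to its own closed
neighborhood. So the stored length serves as the membership test. -/
theorem touch_spec (x : Var) (hx : x ≠ .gt) (h : GRep s R A) (hRA : ∀ v, v ∈ R ↔ A v ≠ []) :
    Spec E (touch x) s fun s' => GRep s' (if s.reg x ∈ R then R else R ++ [s.reg x])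
      (if s.reg x ∈ R then A else Function.update A (s.reg x) [s.reg x]) ∧
      s'.time ≤ s.time + 7 := by
  by_cases hR : s.reg x ∈ R
  · have h1 : 1 ≤ (A (s.reg x)).length := List.length_pos_iff.2 ((hRA _).1 hR)
    have h2 : ¬ (A (s.reg x)).length < 1 := by omega
    simp only [touch, spec_seq, spec_assign, spec_ite]
    simp [h.len, h2, hR]
    exact h.congr (by simp) (by simp) rfl rfl rfl rfl
  · have h1 : A (s.reg x) = [] := by simpa using mt (hRA _).2 hR
    simp only [touch, spec_seq, spec_assign, spec_ite, spec_put]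
    simp [h.len, h1, hR, hx]
    refine ⟨by simp [h.cnt], ?_, fun v => ?_, fun v => ?_, fun v u => ?_⟩
    · simp only [List.length_append, List.length_singleton]
      rw [row_push (s.arr .ver (s.reg .n)) _ _ (s.reg x), h.ver]
      · simp [h.cnt]
      · intro i hi
        simp [h.cnt]
        omega
    · by_cases hv : v = s.reg x
      · simp [hv]
      · simp [hv, h.len]
    · by_cases hv : v = s.reg x
      · subst hv
        rw [Function.update_self, List.length_singleton, row_push (fun _ => 0) _ _ (s.reg x)] <;> simp
      · simpa [hv] using h.adj v
    · by_cases hv : v = s.reg x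
      · subst hv
        simp [h.mat, h1]
      · simp [hv, h.mat]

theorem push_spec (x y : Var) (hx : x ≠ .gt) (hy : y ≠ .gt) (h : GRep s R A) :
    Spec E (push x y) s fun s' =>
      GRep s' R (Function.update A (s.reg x) (A (s.reg x) ++ [s.reg y])) ∧
      s'.time ≤ s.time + 4 := by
  simp only [push, spec_seq, spec_assign, spec_put]
  simp [h.len, hx, hy]
  refine ⟨h.cnt, h.ver, fun v => ?_, fun v => ?_, fun v u => ?_⟩
  · by_cases hv : v = s.reg x
    · simp [hv]
    · simp [hv, h.len]
  · by_cases hv : v = s.reg x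
    · subst hv
      simp only [Function.update_self, List.length_append, List.length_singleton]
      rw [row_push (s.arr .adj (s.reg x)) _ _ (s.reg y), h.adj]
      · simp
      · intro i hi
        simp
        omega
    · simpa [hv] using h.adj v
  · by_cases hv : v = s.reg x
    · subst hv
      by_cases hu : u = s.reg y <;> simp [hu, h.mat]
    · simp [hv, h.mat]

/-- The vertices in `R` after a list `F` of edges has been read. -/
def edgeV (b : ℕ) (F : List (ℕ × ℕ)) (v : ℕ) : Prop := v < b ∨ ∃ e ∈ F, v = e.1 ∨ v = e.2

def edgeR (F : List (ℕ × ℕ)) (v u : ℕ) : Prop := (v, u) ∈ F ∨ (u, v) ∈ F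

/-- The hypothesis `hne` excludes loops and repeated edges (in either orientation); this keeps the
lists free of duplicates, so that their lengths are cardinalities. -/
theorem pre_spec {n : ℕ} (F : List (ℕ × ℕ)) (h0 : E.inp 0 = n) (h1 : E.inp 1 = F.length)
    (hF : ∀ k (h : k < F.length), E.inp (2 + 2 * k) = F[k].1 ∧ E.inp (3 + 2 * k) = F[k].2)
    (hsz : E.size = 2 * F.length + 2) (hwd : 2 * F.length + 2 < E.wd)
    (hne : ∀ k (h : k < F.length), F[k].1 ≠ F[k].2 ∧ ¬ edgeR (F.take k) F[k].1 F[k].2)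
    (hs : ∀ a x y, s.arr a x y = 0) :
    Spec E pre s fun s' => (∃ R A, GRep s' R A ∧ GInv (edgeV (min n (2 * F.length + 2)) F) (edgeR F)
      (2 * F.length) (4 * F.length + 2) R A) ∧ s'.reg .n = n ∧ s'.reg .m = F.length ∧
      s'.time ≤ s.time + 60 * (F.length + 1) ∧ ∀ a x y, a ∉ pre.wa → s'.arr a x y = 0 := by
  set b := min n (2 * F.length + 2) with hb
  obtain ⟨wa, hwa⟩ : ∃ l, l = pre.wa := ⟨_, rfl⟩
  rw [← hwa]
  simp only [pre, spec_seq, spec_assign, spec_read, spec_ite]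
  simp only [Term.val_const, Term.val_ofNat, Term.val_reg, Term.val_add, Term.val_lt, St.set_reg,
    reduceCtorEq, if_true, if_false, h0, h1, hsz]
  refine ⟨by simp, by omega, by simp, by omega, by simp, by omega, ?_⟩
  suffices key : ∀ s' : St, s'.reg .n = n → s'.reg .m = F.length → s'.reg .gl = b →
      s'.reg .cnt = 0 → s'.arr = s.arr → s'.time ≤ s.time + 10 →
      Spec E (.loop .gi .gl (touch .gi)) s' (fun s' => (Term.safe 2 = false → 2 < E.wd) ∧
        Spec E (.loop .gi .m
    (.read .ga .ge ;; .ge ::= ♯.ge + 1 ;; .read .gb .ge ;; .ge ::= ♯.ge + 1 ;;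
      touch .ga ;; touch .gb ;; push .ga .gb ;; push .gb .ga)) (s'.set .ge 2)
        fun s' => (∃ R A, GRep s' R A ∧ GInv (edgeV b F) (edgeR F)
      (2 * F.length) (4 * F.length + 2) R A) ∧ s'.reg .n = n ∧ s'.reg .m = F.length ∧
      s'.time ≤ s.time + 60 * (F.length + 1) ∧ ∀ a x y, a ∉ wa → s'.arr a x y = 0) by
    by_cases hlt : n < F.length + F.length + 2
    · simp only [hlt, if_true]
      rw [if_pos (by simp)]
      refine ⟨by simp, key _ ?_ ?_ ?_ ?_ rfl ?_⟩ <;> simp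
      omega
    · simp only [hlt, if_false]
      rw [if_neg (by simp), spec_skip]
      refine key _ ?_ ?_ ?_ ?_ rfl ?_ <;> simp
      omega
  intro s1 hn hm hgl hc ha ht
  refine spec_loop (fun k s' => (∃ R A, GRep s' R A ∧
    GInv (edgeV k []) (edgeR []) 0 k R A) ∧ s'.time ≤ s.time + 11 + 8 * k) ?_ ?_ ?_
  · refine ⟨⟨[], fun _ => [], ⟨by simp [hc], by simp, by simp [ha, hs], by simp, by simp [ha, hs]⟩, ?_⟩,
      by simp; omega⟩
    constructor <;> simp [edgeV, edgeR]
  · rintro k hk s2 hF2 hi ⟨⟨R, A, hG, hI⟩, ht2⟩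
    refine (touch_spec .gi (by decide) hG hI.mem_iff).mono ?_
    · rintro s3 - - ⟨hG3, ht3⟩
      refine ⟨⟨_, _, hG3.congr (by simp) (by simp) rfl rfl rfl rfl, ?_⟩, by simp; omega⟩
      have := hI.touch (s2.reg .gi)
      convert this using 2 with v
      rw [hi]
      simp [edgeV]
      omega
  · rintro s2 hF2 ⟨⟨R, A, hG, hI⟩, ht2⟩
    refine ⟨by simp, ?_⟩
    have hm2 : s2.reg .m = F.length := by rw [hF2.1 .m (by decide), hm]
    have hn2 : s2.reg .n = n := by rw [hF2.1 .n (by decide), hn]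
    refine spec_loop (fun k s' => (∃ R A, GRep s' R A ∧
      GInv (edgeV b (F.take k)) (edgeR (F.take k)) (2 * k) (b + 2 * k) R A) ∧
      s'.reg .ge = 2 + 2 * k ∧ s'.time ≤ s.time + 13 + 8 * b + 30 * k) ?_ ?_ ?_
    · refine ⟨⟨R, A, hG.congr (by simp) (by simp) rfl rfl rfl rfl, by simpa [hgl] using hI⟩,
        by simp, by simp; omega⟩
    · rintro k hk s3 hF3 hi ⟨⟨R, A, hG, hI⟩, hge, ht3⟩
      simp only [St.set_reg, reduceCtorEq, if_false, hm2] at hk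
      obtain ⟨hp1, hp2⟩ := hF k hk
      obtain ⟨hne1, hne2⟩ := hne k hk
      have e3 : 2 + 2 * k + 1 = 3 + 2 * k := by omega
      simp only [spec_seq, spec_assign, spec_read, Term.val_const, Term.val_ofNat, Term.val_reg,
        Term.val_add, St.set_reg, reduceCtorEq, if_true, if_false, hge, e3, hp1, hp2, hsz]
      refine ⟨by omega, by simp, by omega, by simp, ?_⟩
      set s4 := ((((s3.set .ga F[k].1).set .ge (3 + 2 * k)).set .gb F[k].2).set .ge
        (3 + 2 * k + 1)) with hs4
      have hG4 : GRep s4 R A := hG.congr (by simp [hs4]) (by simp [hs4]) rfl rfl rfl rfl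
      have ht4 : s4.time = s3.time + 4 := by simp [hs4]
      have ha4 : s4.reg .ga = F[k].1 := by simp [hs4]
      have hb4 : s4.reg .gb = F[k].2 := by simp [hs4]
      have hge4 : s4.reg .ge = 4 + 2 * k := by simp [hs4]; omega
      clear_value s4
      refine (touch_spec .ga (by decide) hG4 hI.mem_iff).mono ?_
      rintro s5 hF5 - ⟨hG5, ht5⟩
      have hI5 := hI.touch (s4.reg .ga)
      refine (touch_spec .gb (by decide) hG5 hI5.mem_iff).mono ?_
      rintro s6 hF6 - ⟨hG6, ht6⟩
      have hI6 := hI5.touch (s5.reg .gb)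
      refine (push_spec .ga .gb (by decide) (by decide) hG6).mono ?_
      rintro s7 hF7 - ⟨hG7, ht7⟩
      have ha5 : s5.reg .ga = F[k].1 := by rw [hF5.1 _ (by decide), ha4]
      have ha6 : s6.reg .ga = F[k].1 := by rw [hF6.1 _ (by decide), ha5]
      have ha7 : s7.reg .ga = F[k].1 := by rw [hF7.1 _ (by decide), ha6]
      have hb5 : s5.reg .gb = F[k].2 := by rw [hF5.1 _ (by decide), hb4]
      have hb6 : s6.reg .gb = F[k].2 := by rw [hF6.1 _ (by decide), hb5]
      have hb7 : s7.reg .gb = F[k].2 := by rw [hF7.1 _ (by decide), hb6]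
      have hI7 := hI6.push (x := s6.reg .ga) (y := s6.reg .gb) (by simp [ha6, ha4])
        (by rw [ha6, hb6]; exact hne1) (by rw [ha6, hb6]; exact hne2)
      refine (push_spec .gb .ga (by decide) (by decide) hG7).mono ?_
      rintro s8 hF8 - ⟨hG8, ht8⟩
      have hI8 := hI7.push (x := s7.reg .gb) (y := s7.reg .ga) (by simp [hb7, hb5])
        (by rw [ha7, hb7]; exact hne1.symm) (by
          rw [ha7, hb7, ha6, hb6]
          rintro (h | h)
          · exact hne2 (Or.symm h)
          · exact hne1 h.1.symm)
      refine ⟨⟨_, _, hG8.congr (by simp) (by simp) rfl rfl rfl rfl, ?_⟩, ?_, ?_⟩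
      · rw [ha7, hb7, ha6, hb6, ha4, hb5] at *
        have eV : edgeV b (F.take (k + 1)) = fun v =>
            (edgeV b (F.take k) v ∨ v = F[k].1) ∨ v = F[k].2 := by
          funext v
          simp only [edgeV, List.take_succ_eq_append_getElem hk, List.mem_append, List.mem_singleton,
            or_and_right, exists_or, exists_eq_left, or_assoc]
        have eR : edgeR (F.take (k + 1)) = fun v u =>
            (edgeR (F.take k) v u ∨ (v = F[k].1 ∧ u = F[k].2)) ∨ (v = F[k].2 ∧ u = F[k].1) := by
          funext v u
          simp only [edgeR, List.take_succ_eq_append_getElem hk, List.mem_append, List.mem_singleton,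
            Prod.ext_iff, eq_iff_iff]
          tauto
        rw [eV, eR]
        exact hI8
      · simp [hF8.1 .ge (by decide), hF7.1 .ge (by decide), hF6.1 .ge (by decide),
          hF5.1 .ge (by decide), hge4]
        omega
      · simp
        omega
    · rintro s3 hF3 ⟨⟨R, A, hG, hI⟩, -, ht3⟩
      simp only [St.set_reg, reduceCtorEq, if_false, hm2] at hI ht3
      refine ⟨⟨R, A, hG, ?_⟩, ?_, ?_, by omega, ?_⟩
      · rw [List.take_length] at hI
        exact { hI with length := hI.length.trans (by omega) }
      · rw [hF3.1 .n (by decide)]; simp [hn2]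
      · rw [hF3.1 .m (by decide)]; simp [hm2]
      · intro a x y hpre
        have : a ∉ (Cmd.loop .gi .gl (touch .gi)).wa := fun h => hpre (by
          rw [hwa]
          simp only [pre, Cmd.wa, List.mem_append] at h ⊢; tauto)
        rw [hF3.2 a (fun h => hpre (by rw [hwa]; simp only [pre, Cmd.wa, List.mem_append] at h ⊢; tauto)),
          St.set_arr, hF2.2 a this, ha, hs]

end


/-! ## Closed neighborhoods, domination and candidates -/

/-- `R` lists vertices of a graph with `m` edges, and `A` their closed neighborhoods. -/
structure Nbr (m : ℕ) (R : List ℕ) (A : ℕ → List ℕ) : Prop where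
  nodup : R.Nodup
  nodupA : ∀ v, (A v).Nodup
  self : ∀ v ∈ R, v ∈ A v
  symm : ∀ v u, u ∈ A v → v ∈ A u
  mem : ∀ v u, u ∈ A v → v ∈ R
  sum : (R.map fun v => (A v).length).sum ≤ R.length + 2 * m
  length : R.length ≤ 4 * m + 2

theorem GInv.nbr {b m : ℕ} {F : List (ℕ × ℕ)} {R : List ℕ} {A : ℕ → List ℕ}
    (h : GInv (edgeV b F) (edgeR F) (2 * m) (4 * m + 2) R A) : Nbr m R A := by
  refine ⟨h.nodup, h.nodupA, fun v hv => ?_, fun v u hu => ?_, fun v u hu => ?_, h.sum.le, h.length⟩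
  · exact (h.memA v v).2 ⟨(h.mem v).1 hv, .inl rfl⟩
  · obtain ⟨h1, rfl | h2⟩ := (h.memA v u).1 hu
    · exact hu
    · exact (h.memA _ _).2 ⟨h.dom _ _ h2.symm, .inr h2.symm⟩
  · exact (h.mem v).2 ((h.memA v u).1 hu).1

/-- The number of vertices dominated by `x` and `y`. -/
def dom (A : ℕ → List ℕ) (x y : ℕ) : ℕ := ((A x).toFinset ∪ (A y).toFinset).card

section
variable {m : ℕ} {R : List ℕ} {A : ℕ → List ℕ}

theorem dom_comm (A : ℕ → List ℕ) (x y : ℕ) : dom A x y = dom A y x := by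
  rw [dom, dom, Finset.union_comm]

theorem Nbr.dom_eq (h : Nbr m R A) (x y : ℕ) :
    dom A x y = (A x).length + (A y).countP (· ∉ A x) := by
  rw [dom, ← Finset.union_sdiff_self_eq_union, Finset.card_union_of_disjoint Finset.disjoint_sdiff,
    List.toFinset_card_of_nodup (h.nodupA x), List.countP_eq_length_filter,
    ← List.toFinset_card_of_nodup ((h.nodupA y).filter _)]
  congr 2
  ext v
  simp

theorem Nbr.dom_le_length (h : Nbr m R A) (x y : ℕ) : dom A x y ≤ R.length := by
  rw [← List.toFinset_card_of_nodup h.nodup]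
  refine Finset.card_le_card fun v hv => ?_
  simp only [Finset.mem_union, List.mem_toFinset] at hv ⊢
  rcases hv with hv | hv <;> exact h.mem _ _ (h.symm _ _ hv)

theorem Nbr.length_le_dom (h : Nbr m R A) (x y : ℕ) : (A x).length ≤ dom A x y := by
  rw [h.dom_eq]; omega

theorem Nbr.dom_le_add (h : Nbr m R A) (x y : ℕ) : dom A x y ≤ (A x).length + (A y).length := by
  rw [h.dom_eq]
  have := List.countP_le_length (p := (· ∉ A x)) (l := A y)
  omega

theorem Nbr.length_pos (h : Nbr m R A) {x : ℕ} (hx : x ∈ R) : 1 ≤ (A x).length :=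
  List.length_pos_of_mem (h.self x hx)

/-- The elements of `R` sorted by the lengths `top, top - 1, …, top - K + 1` of their lists. -/
def sortC (A : ℕ → List ℕ) (R : List ℕ) (top K : ℕ) : List ℕ :=
  (List.range K).flatMap fun k => R.filter fun v => (A v).length + k = top

theorem sortC_succ (A : ℕ → List ℕ) (R : List ℕ) (top K : ℕ) :
    sortC A R top (K + 1) = sortC A R top K ++ R.filter fun v => (A v).length + K = top := by
  simp [sortC, List.range_succ]

theorem mem_sortC {top low x : ℕ} (htop : ∀ v ∈ R, (A v).length ≤ top) (hlow : low ≤ top) :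
    x ∈ sortC A R top (top - low + 1) ↔ x ∈ R ∧ low ≤ (A x).length := by
  simp only [sortC, List.mem_flatMap, List.mem_range, List.mem_filter, decide_eq_true_eq]
  constructor
  · rintro ⟨k, hk, hx, h⟩
    exact ⟨hx, by omega⟩
  · rintro ⟨hx, h⟩
    have := htop x hx
    exact ⟨top - (A x).length, by omega, hx, by omega⟩

theorem sortC_sorted (A : ℕ → List ℕ) (R : List ℕ) (top K : ℕ) :
    (sortC A R top K).Pairwise fun a b => (A b).length ≤ (A a).length := by
  rw [sortC, List.pairwise_flatMap]
  refine ⟨fun k _ => ?_, ?_⟩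
  · refine List.Pairwise.imp_of_mem (R := fun _ _ => True) ?_ (List.pairwise_of_forall fun _ _ => trivial)
    intro a b ha hb _
    simp only [List.mem_filter, decide_eq_true_eq] at ha hb
    omega
  · refine List.pairwise_lt_range.imp ?_
    intro k l hkl a ha b hb
    simp only [List.mem_filter, decide_eq_true_eq] at ha hb
    omega

theorem sortC_nodup (hR : R.Nodup) (top K : ℕ) : (sortC A R top K).Nodup := by
  rw [sortC, List.nodup_flatMap]
  refine ⟨fun k _ => hR.filter _, List.pairwise_lt_range.imp ?_⟩
  intro k l hkl
  rw [Function.onFun, List.disjoint_left]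
  intro a ha hb
  simp only [List.mem_filter, decide_eq_true_eq] at ha hb
  omega

/-- The elements of `C` whose neighborhoods differ from `Z` in `v`. -/
def diffs (A : ℕ → List ℕ) (C Z : List ℕ) (v : ℕ) : List ℕ :=
  C.filter fun x => decide (v ∈ A x) != decide (v ∈ Z)

theorem mem_diffs {C Z : List ℕ} {v x : ℕ} :
    x ∈ diffs A C Z v ↔ x ∈ C ∧ ¬(v ∈ A x ↔ v ∈ Z) := by
  simp [diffs]

/-- The number of pairs met when the lists `D v`, `v ∈ l`, are traversed. -/
def touches (D : ℕ → List ℕ) (l : List ℕ) : ℕ := (l.map fun v => (D v).length).sum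

theorem countP_split (l Z X : List ℕ) :
    l.countP (· ∉ X) + l.countP (fun v => v ∉ Z ∧ v ∈ X) =
      l.countP (· ∉ Z) + l.countP (fun v => v ∈ Z ∧ v ∉ X) := by
  induction l with
  | nil => rfl
  | cons a l ih =>
    simp only [List.countP_cons]
    by_cases h1 : a ∈ X <;> by_cases h2 : a ∈ Z <;> simp [h1, h2] at ih ⊢ <;> omega

/-- The number of elements of `A y` outside `A x` is the number outside `Z`, corrected at the places
where `A x` and `Z` differ. Only these places have to be visited. -/
theorem Nbr.dom_eq_base (h : Nbr m R A) (Z : List ℕ) (x y : ℕ) :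
    dom A x y = (A x).length + (A y).countP (· ∉ Z) +
      (A y).countP (fun v => v ∈ Z ∧ v ∉ A x) - (A y).countP (fun v => v ∉ Z ∧ v ∈ A x) := by
  have := countP_split (A y) Z (A x)
  rw [h.dom_eq]
  omega

/-- Without differences inside `A y`, the value depends on `x` through the length of `A x` alone. -/
theorem Nbr.dom_untouched (h : Nbr m R A) {C Z : List ℕ} {x y : ℕ} (hx : x ∈ C)
    (ht : ∀ v ∈ A y, x ∉ diffs A C Z v) :
    dom A x y = (A x).length + (A y).countP (· ∉ Z) := by
  rw [h.dom_eq]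
  congr 1
  refine List.countP_congr fun v hv => ?_
  have := ht v hv
  simp only [mem_diffs, hx, true_and, not_not] at this
  simp [this]

/-- Evaluating the touched candidates and sufficiently many of the first ones is enough. -/
theorem Nbr.dom_le_of_touched (h : Nbr m R A) {Z : List ℕ} {top low dd b u y T : ℕ}
    (htop : ∀ v ∈ R, (A v).length ≤ top) (hlow : low ≤ top) (hld : low = 0 ∨ low + 2 * dd = top)
    (hu : u ∈ R) (hut : (A u).length = top) (hy : (A y).length ≤ 2 * dd)
    (hT : T = touches (diffs A (sortC A R top (top - low + 1)) Z) (A y))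
    (h1 : ∀ v ∈ A y, ∀ x ∈ diffs A (sortC A R top (top - low + 1)) Z v, dom A x y ≤ b)
    (h2 : ∀ x ∈ (sortC A R top (top - low + 1)).take (T + 1), dom A x y ≤ b)
    {x : ℕ} (hx : x ∈ R) : dom A x y ≤ b := by
  set C := sortC A R top (top - low + 1) with hC
  have key : ∀ x ∈ C, dom A x y ≤ b := by
    intro x hx
    by_cases ht : ∃ v ∈ A y, x ∈ diffs A C Z v
    · obtain ⟨v, hv, hxv⟩ := ht
      exact h1 v hv x hxv
    by_cases hx' : x ∈ C.take (T + 1)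
    · exact h2 x hx'
    have ht : ∀ v ∈ A y, x ∉ diffs A C Z v := fun v hv hxv => ht ⟨v, hv, hxv⟩
    have hxd : x ∈ C.drop (T + 1) := by
      rw [← List.take_append_drop (T + 1) C, List.mem_append] at hx
      exact hx.resolve_left hx'
    have hlen : T + 1 < C.length := by
      by_contra hc
      rw [List.drop_eq_nil_of_le (by omega)] at hxd
      simp at hxd
    -- Pigeonhole: at most `T` candidates are touched, so one of the first `T + 1` is not.
    obtain ⟨x', hx'C, hx't⟩ : ∃ x' ∈ C.take (T + 1), ∀ v ∈ A y, x' ∉ diffs A C Z v := by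
      by_contra hc
      push Not at hc
      have hsub : C.take (T + 1) ⊆ (A y).flatMap (diffs A C Z) := fun x' hx' => by
        obtain ⟨v, hv, hxv⟩ := hc x' hx'
        exact List.mem_flatMap.2 ⟨v, hv, hxv⟩
      have hnd : (C.take (T + 1)).Nodup := (sortC_nodup h.nodup _ _).sublist (List.take_sublist _ _)
      have := (List.subperm_of_subset hnd hsub).length_le
      rw [List.length_take, List.length_flatMap] at this
      rw [touches] at hT
      omega
    have hs := sortC_sorted A R top (top - low + 1)
    rw [← hC, ← List.take_append_drop (T + 1) C, List.pairwise_append] at hs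
    -- The untouched `x'` precedes `x` in the order of decreasing length, hence dominates at least
    -- as much together with `y`.
    have h3 := hs.2.2 x' hx'C x hxd
    have h4 := h2 x' hx'C
    rw [h.dom_untouched (List.mem_of_mem_take hx'C) hx't] at h4
    rw [h.dom_untouched hx ht]
    omega
  by_cases hxC : x ∈ C
  · exact key x hxC
  · rw [hC, mem_sortC htop hlow] at hxC
    -- A vertex that was cut off has fewer than `top - 2 * dd` elements, so with `y` it dominates
    -- fewer than `top`, which `u` reaches alone.
    have h3 := key u ((mem_sortC htop hlow).2 ⟨hu, by omega⟩)
    have h4 := h.length_le_dom u y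
    have h5 := h.dom_le_add x y
    have h6 : ¬ low ≤ (A x).length := fun h => hxC ⟨hx, h⟩
    omega

/-- Double counting: by symmetry, `v` lies in the lists of exactly as many `y` as `A v` has
elements. -/
theorem sum_flip (h : Nbr m R A) (f : ℕ → ℕ) :
    (R.map fun y => ((A y).map f).sum).sum = (R.map fun v => (A v).length * f v).sum := by
  have e1 : ∀ l : List ℕ, l.Nodup → ∀ g : ℕ → ℕ, (l.map g).sum = ∑ v ∈ l.toFinset, g v :=
    fun l hl g => (List.sum_toFinset g hl).symm
  rw [e1 R h.nodup, e1 R h.nodup]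
  simp_rw [e1 _ (h.nodupA _)]
  rw [Finset.sum_comm' (s' := fun v => (A v).toFinset) (t' := R.toFinset)]
  · refine Finset.sum_congr rfl fun v _ => ?_
    rw [Finset.sum_const, List.toFinset_card_of_nodup (h.nodupA v), smul_eq_mul]
  · intro x y
    simp only [List.mem_toFinset]
    exact ⟨fun ⟨_, h2⟩ => ⟨h.symm _ _ h2, h.mem _ _ (h.symm _ _ h2)⟩,
      fun ⟨h1, _⟩ => ⟨h.mem _ _ (h.symm _ _ h1), h.symm _ _ h1⟩⟩

theorem sum_map_le_sum {l : List ℕ} {f g : ℕ → ℕ} (h : ∀ v ∈ l, f v ≤ g v) :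
    (l.map f).sum ≤ (l.map g).sum := List.sum_le_sum h

/-- Each candidate occurs in as many lists as its neighborhood differs from `Z`. -/
theorem sum_diffs_le (h : Nbr m R A) {C Z : List ℕ} {b : ℕ}
    (hb : ∀ x ∈ C, (A x).countP (· ∉ Z) + Z.countP (· ∉ A x) ≤ b) :
    (R.map fun v => (diffs A C Z v).length).sum ≤ C.length * b := by
  induction C with
  | nil => simp [diffs]
  | cons x C ih =>
    have h1 := ih fun y hy => hb y (List.mem_cons_of_mem _ hy)
    have h2 := hb x List.mem_cons_self
    have e : ∀ v, (diffs A (x :: C) Z v).length =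
        (diffs A C Z v).length + if (v ∈ A x ↔ v ∈ Z) then 0 else 1 := fun v => by
      by_cases h : v ∈ A x <;> by_cases h' : v ∈ Z <;> simp [diffs, h, h']
    have h3 : (R.map fun v => if (v ∈ A x ↔ v ∈ Z) then 0 else 1).sum ≤
        (A x).countP (· ∉ Z) + Z.countP (· ∉ A x) := by
      have e1 : (R.map fun v => if (v ∈ A x ↔ v ∈ Z) then 0 else 1).sum =
          (R.filter fun v => ¬(v ∈ A x ↔ v ∈ Z)).length := by
        rw [← List.countP_eq_length_filter]
        clear ih h1 hb h
        induction R with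
        | nil => rfl
        | cons a R ih =>
          rw [List.map_cons, List.sum_cons, List.countP_cons, ih]
          by_cases hh : (a ∈ A x ↔ a ∈ Z) <;> simp [hh, add_comm]
      rw [e1, List.countP_eq_length_filter, List.countP_eq_length_filter, ← List.length_append]
      refine (List.subperm_of_subset (h.nodup.filter _) fun v hv => ?_).length_le
      simp only [List.mem_filter, List.mem_append, decide_eq_true_eq] at hv ⊢
      tauto
    simp only [e, List.sum_map_add, List.length_cons]
    nlinarith

theorem sortC_subperm (h : Nbr m R A) (top K : ℕ) : (sortC A R top K).Subperm R :=
  List.subperm_of_subset (sortC_nodup h.nodup _ _) fun v hv => by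
    obtain ⟨k, -, hk⟩ := List.mem_flatMap.1 hv
    exact (List.mem_filter.1 hk).1

theorem sum_sortC_le (h : Nbr m R A) (top K : ℕ) (f : ℕ → ℕ) :
    ((sortC A R top K).map f).sum ≤ (R.map f).sum := by
  obtain ⟨l, hl1, hl2⟩ := sortC_subperm h top K
  rw [← (hl1.map _).sum_eq]
  exact (hl2.map _).sum_le_sum (by simp)

/-- Markov's inequality for the lengths. It makes the candidates rare when `top`, and with it `low`,
is large. -/
theorem length_sortC_mul_le (h : Nbr m R A) {top low : ℕ} (htop : ∀ v ∈ R, (A v).length ≤ top)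
    (hlow : low ≤ top) :
    (sortC A R top (top - low + 1)).length * low ≤ R.length + 2 * m := by
  refine le_trans ?_ h.sum
  have h8 : ((sortC A R top (top - low + 1)).map fun _ => low).sum ≤
      ((sortC A R top (top - low + 1)).map fun v => (A v).length).sum :=
    sum_map_le_sum fun v hv => ((mem_sortC htop hlow).1 hv).2
  rw [List.map_const', List.sum_replicate, smul_eq_mul] at h8
  exact h8.trans (sum_sortC_le h _ _ _)

/-- The total work for traversing the lists of differences. -/
theorem sum_work_le (h : Nbr m R A) {Z : List ℕ} {top low dd u : ℕ}
    (htop : ∀ v ∈ R, (A v).length ≤ top) (hlow : low ≤ top)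
    (hmode : (low = 0 ∧ top ≤ 4 * dd ∧ Z = []) ∨
      (low + 2 * dd = top ∧ 4 * dd < top ∧ Z = A u ∧ (A u).length = top ∧
        ∀ x ∈ R, low ≤ (A x).length → (A x).countP (· ∉ A u) ≤ 2 * dd)) :
    (R.map fun y => touches (diffs A (sortC A R top (top - low + 1)) Z) (A y)).sum ≤
      12 * dd * (R.length + 2 * m) := by
  set C := sortC A R top (top - low + 1) with hC
  have e1 := sum_flip h fun v => (diffs A C Z v).length
  simp only [touches]
  rw [e1]
  have hs := h.sum
  rcases hmode with ⟨h1, h2, rfl⟩ | ⟨h1, h2, rfl, h4, h5⟩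
  -- For empty `Z` the differences at `v` are candidates in `A v`, at most `4 * dd` of them.
  · have : ∀ v ∈ R, (A v).length * (diffs A C [] v).length ≤ (A v).length * (4 * dd) := by
      intro v hv
      refine Nat.mul_le_mul_left _ (le_trans ?_ ((htop v hv).trans h2))
      refine (List.subperm_of_subset ((sortC_nodup h.nodup _ _).filter _) fun x hx => ?_).length_le
      have := mem_diffs.1 hx
      simp only [List.not_mem_nil, iff_false, not_not] at this
      exact h.symm _ _ this.2
    refine (sum_map_le_sum this).trans ?_
    rw [List.sum_map_mul_right]
    nlinarith
  -- At most `2 * dd` elements of `A x` lie outside `A u`. Since `A u` is longer by at most `2 *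
  -- dd`, it has at most `4 * dd` elements outside `A x`.
  · have hb : ∀ x ∈ C, (A x).countP (· ∉ A u) + (A u).countP (· ∉ A x) ≤ 6 * dd := by
      intro x hx
      rw [hC, mem_sortC htop hlow] at hx
      have h6 := h5 x hx.1 hx.2
      have h7 := h.dom_eq x u
      have h8 := h.dom_eq u x
      rw [dom_comm] at h7
      omega
    have h6 := sum_diffs_le h hb
    have h7 := length_sortC_mul_le h htop hlow
    rw [← hC] at h7
    have h8 : ∀ v ∈ R, (A v).length * (diffs A C (A u) v).length ≤
        top * (diffs A C (A u) v).length := fun v hv => Nat.mul_le_mul_right _ (htop v hv)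
    refine (sum_map_le_sum h8).trans ?_
    rw [List.sum_map_mul_left]
    -- Here `top ≤ 2 * low` because `4 * dd < top`. The factor `low` times the number of candidates
    -- is then O(m + 1), which is what makes the bound independent of `top`.
    calc top * (R.map fun v => (diffs A C (A u) v).length).sum
        ≤ (2 * low) * (C.length * (6 * dd)) := Nat.mul_le_mul (by omega) h6
      _ = 12 * dd * (C.length * low) := by ring
      _ ≤ _ := Nat.mul_le_mul_left _ h7

end


/-! ## Pairs with a vertex whose degree is in a given range -/

/-- `a = b`. -/
def Term.eq (a b : Term) : Term := 1 - ((a ≺ b) + (b ≺ a))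

@[simp] theorem Term.val_eq (s : St) (a b : Term) :
    (Term.eq a b).val s = if a.val s = b.val s then 1 else 0 := by
  simp only [Term.eq, Term.val_sub, Term.val_ofNat, Term.val_add, Term.val_lt]
  split_ifs <;> omega

/-- The commands leave the graph alone. -/
def Cmd.graphFree (p : Cmd) : Bool :=
  !(p.wr.contains .cnt) && !(p.wr.contains .n) && !(p.wa.contains .ver) && !(p.wa.contains .len) &&
    !(p.wa.contains .adj) && !(p.wa.contains .mat)

theorem GRep.frame {p : Cmd} {s s' : St} {R : List ℕ} {A : ℕ → List ℕ} (h : GRep s R A)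
    (hF : Frame p s s') (hp : p.graphFree = true) : GRep s' R A := by
  simp only [Cmd.graphFree, Bool.and_eq_true, Bool.not_eq_true', List.contains_eq_mem,
    decide_eq_false_iff_not] at hp
  obtain ⟨⟨⟨⟨⟨h1, h2⟩, h3⟩, h4⟩, h5⟩, h6⟩ := hp
  exact h.congr (hF.1 _ h1) (hF.1 _ h2) (hF.2 _ h3) (hF.2 _ h4) (hF.2 _ h5) (hF.2 _ h6)

theorem GRep.frame_of_eq {p : Cmd} {s s₁ s' : St} {R : List ℕ} {A : ℕ → List ℕ} (h : GRep s R A)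
    (hF : Frame p s₁ s') (hp : p.graphFree = true) (h1 : s₁.reg .cnt = s.reg .cnt)
    (h2 : s₁.reg .n = s.reg .n) (h3 : s₁.arr = s.arr) : GRep s' R A :=
  (h.congr h1 h2 (by rw [h3]) (by rw [h3]) (by rw [h3]) (by rw [h3]) : GRep s₁ R A).frame hF hp

/-- The number of elements of `l` outside `X`. -/
def outs (X l : List ℕ) : ℕ := l.countP (· ∉ X)

@[simp] theorem outs_nil (X : List ℕ) : outs X [] = 0 := rfl
@[simp] theorem outs_append (X l l' : List ℕ) : outs X (l ++ l') = outs X l + outs X l' := by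
  simp [outs]
theorem outs_singleton (X : List ℕ) (a : ℕ) : outs X [a] = if a ∈ X then 0 else 1 := by
  by_cases h : a ∈ X <;> simp [outs, h]

/-- The sum of the values of `f` on `l`. -/
def wsum (f : ℕ → ℕ) (l : List ℕ) : ℕ := (l.map f).sum

@[simp] theorem wsum_nil (f : ℕ → ℕ) : wsum f [] = 0 := rfl
@[simp] theorem wsum_append (f : ℕ → ℕ) (l l' : List ℕ) :
    wsum f (l ++ l') = wsum f l + wsum f l' := by simp [wsum]
@[simp] theorem wsum_singleton (f : ℕ → ℕ) (a : ℕ) : wsum f [a] = f a := by simp [wsum]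

def scanMax : Cmd :=
  .top ::= 0 ;; .u ::= ♯.n ;;
  .forEach .i .cnt .v .ver .n
    (.t ::= .get .len .v .v ;; .ite (♯.top ≺ ♯.t) (.top ::= ♯.t ;; .u ::= ♯.v) .skip)

/-- Sets `bad` if some sufficiently long list has more than `2 * dd` elements outside that of `uu`.
Then this vertex and `uu` beat every pair with a vertex of the given range. -/
def checkSpread : Cmd :=
  .forEach .i .cnt .v .ver .n
    (.t ::= .get .len .v .v ;;
      .ite (♯.t ≺ ♯.low) .skip
        (.c ::= 0 ;;
          .forEach .j .t .x .adj .v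
            (.q ::= .get .mat .uu .x ;; .ite (♯.q ≺ 1) (.c ::= ♯.c + 1) .skip) ;;
          .ite (♯.dd + ♯.dd ≺ ♯.c) (.bad ::= 1) .skip))

/-- Sorting by one scan per length is affordable, as only O(dd) different lengths occur among the
candidates. -/
def sortCand : Cmd :=
  .ks ::= ♯.top - ♯.low + 1 ;; .cc ::= 0 ;;
  .loop .k .ks
    (.forEach .i .cnt .v .ver .n
      (.t ::= .get .len .v .v ;;
        .ite (.eq (♯.t + ♯.k) (♯.top)) (.put .cand .n .cc (♯.v) ;; .cc ::= ♯.cc + 1) .skip))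

def pushDiff : Cmd :=
  .ite (♯.q ≺ 1)
    (.p ::= .get .dlen .v .v ;; .put .dl .v .p (♯.x) ;; .put .dlen .v .v (♯.p + 1)) .skip

/-- The symmetric difference of `A x` and `Z` in two passes: the elements of `A x` outside `Z`, then
those of `Z` outside `A x`. Both passes append `x` to the list of the vertex in question. -/
def listDiffs : Cmd :=
  .tu ::= .get .len .uu .uu ;;
  .forEach .i .cc .x .cand .n
    (.t ::= .get .len .x .x ;;
      .forEach .j .t .v .adj .x (.q ::= .get .mat .uu .v ;; pushDiff) ;;
      .forEach .j .tu .v .adj .uu (.q ::= .get .mat .x .v ;; pushDiff))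

section
variable {E : Env} {s : St} {R : List ℕ} {A : ℕ → List ℕ}

theorem scanMax_spec (hG : GRep s R A) : Spec E scanMax s fun s' =>
    (∀ v ∈ R, (A v).length ≤ s'.reg .top) ∧
    ((R = [] ∧ s'.reg .top = 0) ∨ s'.reg .u ∈ R ∧ (A (s'.reg .u)).length = s'.reg .top ∨
      s'.reg .top = 0) ∧
    s'.time ≤ s.time + 10 * (R.length + 1) := by
  simp only [scanMax, spec_seq, spec_assign]
  refine ⟨by simp, by simp, ?_⟩
  refine spec_forEach R (fun l s' => (∀ v ∈ l, (A v).length ≤ s'.reg .top) ∧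
    (s'.reg .u ∈ R ∧ (A (s'.reg .u)).length = s'.reg .top ∨ s'.reg .top = 0) ∧
    s'.time ≤ s.time + 3 + 7 * l.length) (by decide) (by decide) (by simp [hG.cnt, hG.ver]) (by simp) ?_ ?_
  · rintro l₁ v l₂ hl s' hF hi ⟨h1, h2, h3⟩
    have hv : v ∈ R := by rw [hl]; simp
    have hG' : GRep s' R A := hG.frame_of_eq hF (by decide) (by simp) (by simp) rfl
    by_cases h : s'.reg .top < (A v).length
    · simp [hG'.len, h, hv]
      refine ⟨fun w hw => ?_, by omega⟩
      rcases hw with hw | rfl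
      · exact (h1 w hw).trans h.le
      · exact le_rfl
    · simp [hG'.len, h]
      refine ⟨fun w hw => ?_, h2, by omega⟩
      rcases hw with hw | rfl
      · exact h1 w hw
      · omega
  · rintro s' hF ⟨h1, h2, h3⟩
    exact ⟨h1, .inr h2, by omega⟩

theorem checkSpread_spec (hG : GRep s R A) (hb : s.reg .bad = 0) :
    Spec E checkSpread s fun s' =>
    (s'.reg .bad = 0 → ∀ x ∈ R, s.reg .low ≤ (A x).length →
      outs (A (s.reg .uu)) (A x) ≤ 2 * s.reg .dd) ∧
    (s'.reg .bad ≠ 0 → ∃ x ∈ R, s.reg .low ≤ (A x).length ∧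
      2 * s.reg .dd < outs (A (s.reg .uu)) (A x)) ∧
    s'.time ≤ s.time + 1 + 10 * (R.length + (R.map fun v => (A v).length).sum) := by
  refine spec_forEach R (fun l s' => (s'.reg .bad = 0 → ∀ x ∈ l, s.reg .low ≤ (A x).length →
      outs (A (s.reg .uu)) (A x) ≤ 2 * s.reg .dd) ∧
    (s'.reg .bad ≠ 0 → ∃ x ∈ R, s.reg .low ≤ (A x).length ∧
      2 * s.reg .dd < outs (A (s.reg .uu)) (A x)) ∧
    s'.time ≤ s.time + 1 + 10 * (l.length + (l.map fun v => (A v).length).sum))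
    (by decide) (by decide) (by simp [hG.cnt, hG.ver]) (by simp [hb]) ?_ (fun s' _ h => h)
  rintro l₁ v l₂ hl s1 hF1 hi ⟨h1, h2, h3⟩
  have hv : v ∈ R := by rw [hl]; simp
  have hG1 : GRep s1 R A := hG.frame hF1 (by decide)
  have hlow := hF1.1 .low (by decide)
  have huu := hF1.1 .uu (by decide)
  have hdd := hF1.1 .dd (by decide)
  by_cases h : (A v).length < s.reg .low
  · simp [hG1.len, hlow, h]
    refine ⟨fun hbad x hx hxl => ?_, h2, by omega⟩
    rcases hx with hx | rfl
    · exact h1 hbad x hx hxl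
    · omega
  · simp [hG1.len, hlow, h]
    refine spec_forEach (A v) (fun l s' => s'.reg .c = outs (A (s.reg .uu)) l ∧
      s'.time ≤ s1.time + 5 + 5 * l.length) (by decide) (by decide) (by simp [hG1.adj]) (by simp) ?_ ?_
    · rintro m₁ x m₂ hm s2 hF2 hj ⟨h4, h5⟩
      have hG2 : GRep s2 R A :=
        hG1.frame_of_eq hF2 (by decide) (by simp) (by simp) rfl
      have huu2 := hF2.1 .uu (by decide)
      simp at huu2
      simp [hG2.mat, huu2, huu]
      by_cases hx : x ∈ A (s.reg .uu)
      · simp [hx, h4, outs_singleton]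
        omega
      · simp [hx, h4, outs_singleton]
        omega
    · rintro s2 hF2 ⟨h4, h5⟩
      have hb2 := hF2.1 .bad (by decide)
      have hdd2 := hF2.1 .dd (by decide)
      simp at hb2 hdd2
      by_cases hc : s.reg .dd + s.reg .dd < outs (A (s.reg .uu)) (A v)
      · simp [hdd2, hdd, h4, hc]
        exact ⟨⟨v, hv, by omega, by omega⟩, by omega⟩
      · simp [hdd2, hdd, h4, hc, hb2]
        refine ⟨fun hbad x hx hxl => ?_, h2, by omega⟩
        rcases hx with hx | rfl
        · exact h1 hbad x hx hxl
        · omega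

theorem sortCand_spec (hG : GRep s R A) : Spec E sortCand s fun s' =>
    row (s'.arr .cand (s'.reg .n)) (s'.reg .cc) =
      sortC A R (s.reg .top) (s.reg .top - s.reg .low + 1) ∧
    s'.time ≤ s.time + 3 + 7 * (s.reg .top - s.reg .low + 1) * (R.length + 1) := by
  simp only [sortCand, spec_seq, spec_assign]
  refine ⟨by simp, by simp, ?_⟩
  refine spec_loop (fun k s' => row (s'.arr .cand (s'.reg .n)) (s'.reg .cc) =
      sortC A R (s.reg .top) k ∧ s'.time ≤ s.time + 3 + k * (7 * (R.length + 1))) (by simp [sortC]) ?_ ?_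
  · rintro k hk s1 hF1 hi ⟨h1, h2⟩
    have hG1 : GRep s1 R A :=
      hG.frame_of_eq hF1 (by decide) (by simp) (by simp) rfl
    have htop := hF1.1 .top (by decide)
    simp at htop
    refine spec_forEach R (fun l s' => row (s'.arr .cand (s'.reg .n)) (s'.reg .cc) =
      sortC A R (s.reg .top) k ++ l.filter (fun v => (A v).length + k = s.reg .top) ∧
      s'.time ≤ s1.time + 1 + 6 * l.length) (by decide) (by decide) (by simp [hG1.cnt, hG1.ver])
      (by simpa using h1) ?_ ?_
    · rintro l₁ v l₂ hl s2 hF2 hj ⟨h3, h4⟩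
      have hG2 : GRep s2 R A := hG1.frame hF2 (by decide)
      have htop2 := hF2.1 .top (by decide)
      have hk2 := hF2.1 .k (by decide)
      simp [hG2.len, htop2, htop, hk2, hi]
      by_cases hc : (A v).length + k = s.reg .top
      · simp [hc, ← List.append_assoc]
        refine ⟨?_, by omega⟩
        rw [row_push (s2.arr .cand (s2.reg .n)) _ _ v, h3]
        · simp
        · intro i hi
          simp
          omega
      · simp [hc, h3]
        omega
    · rintro s2 hF2 ⟨h3, h4⟩
      have : (k + 1) * (7 * (R.length + 1)) = k * (7 * (R.length + 1)) + 7 * R.length + 7 := by ring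
      simp [h3, sortC_succ]
      omega
  · rintro s' hF ⟨h1, h2⟩
    simp at h1 h2
    refine ⟨h1, h2.trans (le_of_eq (by ring))⟩

/-- The state holds the lists `D`. -/
def DRep (s : St) (D : ℕ → List ℕ) : Prop :=
  ∀ v, s.arr .dlen v v = (D v).length ∧ row (s.arr .dl v) (D v).length = D v

theorem DRep.congr {s s' : St} {D D' : ℕ → List ℕ} (h : DRep s D)
    (h1 : s'.arr .dlen = s.arr .dlen) (h2 : s'.arr .dl = s.arr .dl) (h3 : ∀ v, D' v = D v) :
    DRep s' D' := fun v => by rw [h1, h2, h3]; exact h v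

theorem pushDiff_spec {D : ℕ → List ℕ} (hD : DRep s D) : Spec E pushDiff s fun s' =>
    DRep s' (fun v => D v ++ if v = s.reg .v ∧ s.reg .q = 0 then [s.reg .x] else []) ∧
    s'.time ≤ s.time + 4 := by
  simp only [pushDiff, spec_ite]
  by_cases hq : s.reg .q = 0
  · simp [hq]
    intro v
    by_cases hv : v = s.reg .v
    · subst hv
      simp [(hD _).1]
      rw [row_push (s.arr .dl (s.reg .v)) _ _ (s.reg .x), (hD _).2]
      · simp
      · intro i hi
        simp
        omega
    · simpa [hv] using hD v
  · simp [hq]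
    exact hD

theorem listDiffs_spec (hG : GRep s R A) {C : List ℕ}
    (hC : row (s.arr .cand (s.reg .n)) (s.reg .cc) = C) (hD : ∀ v, s.arr .dlen v v = 0)
    (hnd : ∀ v, (A v).Nodup) :
    Spec E listDiffs s fun s' => DRep s' (diffs A C (A (s.reg .uu))) ∧
      s'.time ≤ s.time + 2 + wsum (fun x => 5 + 7 * ((A x).length + (A (s.reg .uu)).length)) C := by
  set Z := A (s.reg .uu) with hZ
  simp only [listDiffs, spec_seq, spec_assign]
  refine ⟨by simp, ?_⟩
  refine spec_forEach C (fun l s' => DRep s' (diffs A l Z) ∧ s'.time ≤ s.time + 2 +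
    wsum (fun x => 5 + 7 * ((A x).length + Z.length)) l) (by decide) (by decide) (by simp [hC])
    ⟨fun v => by simp [diffs, hD], by simp⟩ ?_ (fun s' _ h => h)
  rintro l₁ x l₂ hl s1 hF1 hi ⟨h1, h2⟩
  have hG1 : GRep s1 R A :=
    hG.frame_of_eq hF1 (by decide) (by simp) (by simp) rfl
  have huu1 := hF1.1 .uu (by decide)
  have htu1 := hF1.1 .tu (by decide)
  simp at huu1 htu1
  simp [hG1.len]
  refine spec_forEach (A x) (fun m s' => DRep s' (fun v => diffs A l₁ Z v ++
    if v ∈ m ∧ v ∉ Z then [x] else []) ∧ s'.time ≤ s1.time + 3 + 7 * m.length)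
    (by decide) (by decide) (by simp [hG1.adj]) ⟨h1.congr rfl rfl fun _ => by simp, by simp⟩ ?_ ?_
  · rintro m₁ v m₂ hm s2 hF2 hj ⟨h3, h4⟩
    have hG2 : GRep s2 R A :=
      hG1.frame_of_eq hF2 (by decide) (by simp) (by simp) rfl
    have huu2 := hF2.1 .uu (by decide)
    have hx2 := hF2.1 .x (by decide)
    simp at huu2 hx2
    simp [hG2.mat, huu2, huu1, ← hZ]
    refine Spec.mono (pushDiff_spec (D := fun v => diffs A l₁ Z v ++
      if v ∈ m₁ ∧ v ∉ Z then [x] else []) (h3.congr rfl rfl fun _ => rfl)) ?_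
    rintro s3 - - ⟨h5, h6⟩
    refine ⟨h5.congr rfl rfl ?_, by simp at h6 ⊢; omega⟩
    have hvm : v ∉ m₁ := fun h => by
      have := hnd x
      rw [hm, List.nodup_append] at this
      exact this.2.2 v h v (by simp) rfl
    intro w
    by_cases hw : w = v
    · subst hw
      by_cases hz : w ∈ Z <;> simp [hz, hvm, hx2]
    · simp [hw]
  · rintro s2 hF2 ⟨h3, h4⟩
    have hG2 : GRep s2 R A :=
      hG1.frame_of_eq hF2 (by decide) (by simp) (by simp) rfl
    have huu2 := hF2.1 .uu (by decide)
    have htu2 := hF2.1 .tu (by decide)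
    have hx2 := hF2.1 .x (by decide)
    simp at huu2 htu2 hx2
    refine spec_forEach Z (fun m s' => DRep s' (fun v => (diffs A l₁ Z v ++
      if v ∈ A x ∧ v ∉ Z then [x] else []) ++ if v ∈ m ∧ v ∉ A x then [x] else []) ∧
      s'.time ≤ s1.time + 4 + 7 * (A x).length + 7 * m.length)
      (by decide) (by decide) (by simp [huu2, huu1, htu2, htu1, hG.len, ← hZ]; exact hG2.adj _)
      ⟨h3.congr rfl rfl fun _ => by simp, by simp; omega⟩ ?_ ?_
    · rintro m₁ v m₂ hm s3 hF3 hj ⟨h5, h6⟩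
      have hG3 : GRep s3 R A := hG2.frame hF3 (by decide)
      have hx3 := hF3.1 .x (by decide)
      simp [hG3.mat, hx3, hx2]
      refine Spec.mono (pushDiff_spec (D := fun v => (diffs A l₁ Z v ++
        if v ∈ A x ∧ v ∉ Z then [x] else []) ++ if v ∈ m₁ ∧ v ∉ A x then [x] else [])
        (h5.congr rfl rfl fun _ => rfl)) ?_
      rintro s4 - - ⟨h7, h8⟩
      refine ⟨h7.congr rfl rfl ?_, by simp at h8 ⊢; omega⟩
      have hvm : v ∉ m₁ := fun h => by
        have := hnd (s.reg .uu)
        rw [← hZ, hm, List.nodup_append] at this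
        exact this.2.2 v h v (by simp) rfl
      intro w
      by_cases hw : w = v
      · subst hw
        by_cases hz : w ∈ A x <;> simp [hz, hvm, hx3, hx2]
      · simp [hw]
    · rintro s3 hF3 ⟨h5, h6⟩
      refine ⟨h5.congr rfl rfl fun w => ?_, by omega⟩
      by_cases h7 : w ∈ A x <;> by_cases h8 : w ∈ Z <;> simp [diffs, h7, h8]

end


/-! ### Evaluating pairs by corrections to the reference set -/

def evalPair : Cmd :=
  .l ::= .get .len .x .x ;;
  .c ::= ♯.l + ♯.bs + .get .pos .y .x - .get .neg .y .x ;;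
  .ite (♯.best ≺ ♯.c) (.best ::= ♯.c ;; .b1 ::= ♯.x ;; .b2 ::= ♯.y) .skip

/-- For the current `y`, `pos` counts the elements of `A y` in `Z` that `x` misses, `neg` those
outside `Z` that `x` contains, and `tc` all visits. Row `y` is used for this `y` only, so the
counters need no resetting. -/
def countDiffs : Cmd :=
  .forEach .j .t .v .adj .y
    (.q ::= .get .mat .uu .v ;; .p ::= .get .dlen .v .v ;;
      .ite (♯.q ≺ 1) (.bs ::= ♯.bs + 1) .skip ;;
      .forEach .k .p .x .dl .v
        (.tc ::= ♯.tc + 1 ;;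
          .ite (♯.q ≺ 1) (.c ::= .get .neg .y .x ;; .put .neg .y .x (♯.c + 1))
            (.c ::= .get .pos .y .x ;; .put .pos .y .x (♯.c + 1))))

def evalTouched : Cmd :=
  .forEach .j .t .v .adj .y (.p ::= .get .dlen .v .v ;; .forEach .k .p .x .dl .v evalPair)

/-- One candidate more than there were visits, or all of them: this guarantees that an untouched one
is included if there is any. -/
def evalFirst : Cmd :=
  .g ::= ♯.tc + 1 ;; .ite (♯.cc ≺ ♯.g) (.g ::= ♯.cc) .skip ;;
  .forEach .k .g .x .cand .n evalPair

/-- The best pair of `P` so far is at least as good as the pairs in `S`. -/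
structure Best (A : ℕ → List ℕ) (s : St) (P S : ℕ → ℕ → Prop) : Prop where
  le : ∀ x y, S x y → dom A x y ≤ s.reg .best
  att : s.reg .best = 0 ∨ P (s.reg .b1) (s.reg .b2) ∧ s.reg .best = dom A (s.reg .b1) (s.reg .b2)

section
variable {E : Env} {s : St} {R : List ℕ} {A : ℕ → List ℕ} {P S S' : ℕ → ℕ → Prop}

theorem Best.congr {s' : St} (h : Best A s P S) (h1 : s'.reg .best = s.reg .best)
    (h2 : s'.reg .b1 = s.reg .b1) (h3 : s'.reg .b2 = s.reg .b2)
    (h4 : ∀ x y, S' x y → S x y) : Best A s' P S' :=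
  ⟨fun x y hxy => by rw [h1]; exact h.le x y (h4 x y hxy), by rw [h1, h2, h3]; exact h.att⟩

theorem evalPair_spec (hG : GRep s R A) (hB : Best A s P S) (hP : P (s.reg .x) (s.reg .y))
    (hv : (A (s.reg .x)).length + s.reg .bs + s.arr .pos (s.reg .y) (s.reg .x) -
      s.arr .neg (s.reg .y) (s.reg .x) = dom A (s.reg .x) (s.reg .y))
    (hwd : dom A (s.reg .x) (s.reg .y) < E.wd) :
    Spec E evalPair s fun s' =>
      Best A s' P (fun x y => S x y ∨ (x = s.reg .x ∧ y = s.reg .y)) ∧ s'.time ≤ s.time + 6 := by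
  simp only [evalPair, spec_seq, spec_assign, spec_ite]
  by_cases h : s.reg .best < dom A (s.reg .x) (s.reg .y)
  · simp [hG.len, hv, hwd, h]
    refine ⟨?_, by simp [hP]⟩
    rintro x y (hxy | ⟨rfl, rfl⟩)
    · simpa using (hB.le x y hxy).trans h.le
    · simp
  · simp [hG.len, hv, hwd, h]
    refine ⟨?_, by simpa using hB.att⟩
    rintro x y (hxy | ⟨rfl, rfl⟩)
    · simpa using hB.le x y hxy
    · simpa using h

theorem countDiffs_spec (hG : GRep s R A) {D : ℕ → List ℕ} (hD : DRep s D)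
    (ht : s.reg .t = (A (s.reg .y)).length) (hbs : s.reg .bs = 0) (htc : s.reg .tc = 0)
    (h0 : ∀ x, s.arr .pos (s.reg .y) x = 0 ∧ s.arr .neg (s.reg .y) x = 0) :
    Spec E countDiffs s fun s' => s'.reg .bs = outs (A (s.reg .uu)) (A (s.reg .y)) ∧
      s'.reg .tc = wsum (fun v => (D v).length) (A (s.reg .y)) ∧
      (∀ x, s'.arr .pos (s.reg .y) x =
        wsum (fun v => if v ∈ A (s.reg .uu) then (D v).count x else 0) (A (s.reg .y))) ∧
      (∀ x, s'.arr .neg (s.reg .y) x =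
        wsum (fun v => if v ∈ A (s.reg .uu) then 0 else (D v).count x) (A (s.reg .y))) ∧
      (∀ y ≠ s.reg .y, s'.arr .pos y = s.arr .pos y ∧ s'.arr .neg y = s.arr .neg y) ∧
      s'.time ≤ s.time + 1 + 8 * (A (s.reg .y)).length +
        6 * wsum (fun v => (D v).length) (A (s.reg .y)) := by
  set Z := A (s.reg .uu) with hZ
  set y := s.reg .y with hy
  refine spec_forEach (A y) (fun l s' => s'.reg .bs = outs Z l ∧
      s'.reg .tc = wsum (fun v => (D v).length) l ∧
      (∀ x, s'.arr .pos y x = wsum (fun v => if v ∈ Z then (D v).count x else 0) l) ∧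
      (∀ x, s'.arr .neg y x = wsum (fun v => if v ∈ Z then 0 else (D v).count x) l) ∧
      (∀ y' ≠ y, s'.arr .pos y' = s.arr .pos y' ∧ s'.arr .neg y' = s.arr .neg y') ∧
      s'.time ≤ s.time + 1 + 8 * l.length + 6 * wsum (fun v => (D v).length) l)
    (by decide) (by decide) (by rw [ht, ← hy, hG.adj]) (by simp [hbs, htc, h0]) ?_ (fun _ _ h => h)
  rintro l₁ v l₂ hl s1 hF1 hi ⟨h1, h2, h3, h4, h5, h6⟩
  have hG1 : GRep s1 R A := hG.frame hF1 (by decide)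
  have huu := hF1.1 .uu (by decide)
  have hy1 := hF1.1 .y (by decide)
  have hD1 : DRep s1 D :=
    hD.congr (hF1.2 .dlen (by decide)) (hF1.2 .dl (by decide)) fun _ => rfl
  have key : ∀ s2 : St, s2.reg .q = (if v ∈ Z then 1 else 0) → s2.reg .p = (D v).length →
      s2.reg .v = v → s2.reg .y = y → s2.arr = s1.arr → s2.reg .tc = s1.reg .tc →
      s2.reg .bs = outs Z (l₁ ++ [v]) → s2.time ≤ s1.time + 5 →
      Spec E (.forEach .k .p .x .dl .v
        (.tc ::= ♯.tc + 1 ;;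
          .ite (♯.q ≺ 1) (.c ::= .get .neg .y .x ;; .put .neg .y .x (♯.c + 1))
            (.c ::= .get .pos .y .x ;; .put .pos .y .x (♯.c + 1)))) s2 fun s' =>
      s'.reg .bs = outs Z (l₁ ++ [v]) ∧
      s'.reg .tc = wsum (fun v => (D v).length) (l₁ ++ [v]) ∧
      (∀ x, s'.arr .pos y x = wsum (fun v => if v ∈ Z then (D v).count x else 0) (l₁ ++ [v])) ∧
      (∀ x, s'.arr .neg y x = wsum (fun v => if v ∈ Z then 0 else (D v).count x) (l₁ ++ [v])) ∧
      (∀ y' ≠ y, s'.arr .pos y' = s.arr .pos y' ∧ s'.arr .neg y' = s.arr .neg y') ∧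
      s'.time + 1 ≤ s.time + 1 + 8 * (l₁ ++ [v]).length +
        6 * wsum (fun v => (D v).length) (l₁ ++ [v]) := by
    intro s2 hq hp hv hy2 ha htc2 hbs2 ht2
    refine spec_forEach (D v) (fun d s' => s'.reg .tc = s1.reg .tc + d.length ∧
      (∀ x, s'.arr .pos y x = s1.arr .pos y x + if v ∈ Z then d.count x else 0) ∧
      (∀ x, s'.arr .neg y x = s1.arr .neg y x + if v ∈ Z then 0 else d.count x) ∧
      (∀ y' ≠ y, s'.arr .pos y' = s.arr .pos y' ∧ s'.arr .neg y' = s.arr .neg y') ∧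
      s'.time ≤ s2.time + 1 + 6 * d.length) (by decide) (by decide)
      (by rw [hp, hv, ha]; exact (hD1 v).2) (by simpa [htc2, ha] using h5) ?_ ?_
    · rintro d₁ x d₂ hd s3 hF3 hk ⟨g1, g2, g3, g4, g5⟩
      have hq3 := hF3.1 .q (by decide)
      have hy3 := hF3.1 .y (by decide)
      rw [hq] at hq3
      rw [hy2] at hy3
      by_cases hz : v ∈ Z
      · simp only [hz, if_true] at hq3 g2 g3
        simp [hq3, hy3, hz, g1, g2, g3]
        refine ⟨by omega, fun x' => ?_, fun y' hy' => ?_, by omega⟩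
        · by_cases hx : x' = x
          · subst hx
            simp [add_assoc]
          · simp [hx, g2, List.count_singleton, Ne.symm hx]
        · simp [hy', g4 y' hy']
      · simp only [hz, if_false] at hq3 g2 g3
        simp [hq3, hy3, hz, g1, g2, g3]
        refine ⟨by omega, fun x' => ?_, fun y' hy' => ?_, by omega⟩
        · by_cases hx : x' = x
          · subst hx
            simp [add_assoc]
          · simp [hx, g3, List.count_singleton, Ne.symm hx]
        · simp [hy', g4 y' hy']
    · rintro s3 hF3 ⟨g1, g2, g3, g4, g5⟩
      refine ⟨by rw [hF3.1 .bs (by decide), hbs2], by simp [g1, h2], fun x => by simp [g2, h3],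
        fun x => by simp [g3, h4], g4, by simp; omega⟩
  by_cases hz : v ∈ Z
  · simp [hG1.mat, huu, hy1, ← hZ, hz, (hD1 v).1]
    refine (key _ ?_ ?_ ?_ ?_ ?_ ?_ ?_ ?_).mono ?_ <;> try simp [hz, hy1, h1, outs_singleton, ← hy]
  · simp [hG1.mat, huu, hy1, ← hZ, hz, (hD1 v).1]
    refine (key _ ?_ ?_ ?_ ?_ ?_ ?_ ?_ ?_).mono ?_ <;> try simp [hz, hy1, h1, outs_singleton, ← hy]

theorem evalTouched_spec (hG : GRep s R A) {D : ℕ → List ℕ} (hD : DRep s D)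
    (ht : s.reg .t = (A (s.reg .y)).length) (hB : Best A s P S)
    (hx : ∀ v ∈ A (s.reg .y), ∀ x ∈ D v, P x (s.reg .y) ∧ dom A x (s.reg .y) < E.wd ∧
      (A x).length + s.reg .bs + s.arr .pos (s.reg .y) x - s.arr .neg (s.reg .y) x =
        dom A x (s.reg .y)) :
    Spec E evalTouched s fun s' =>
      Best A s' P (fun x y => S x y ∨ (y = s.reg .y ∧ ∃ v ∈ A y, x ∈ D v)) ∧
      s'.time ≤ s.time + 1 + 4 * (A (s.reg .y)).length +
        8 * wsum (fun v => (D v).length) (A (s.reg .y)) := by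
  set y := s.reg .y with hy
  refine spec_forEach (A y) (fun l s' =>
      Best A s' P (fun x y' => S x y' ∨ (y' = y ∧ ∃ v ∈ l, x ∈ D v)) ∧
      s'.time ≤ s.time + 1 + 4 * l.length + 8 * wsum (fun v => (D v).length) l)
    (by decide) (by decide) (by rw [ht, ← hy, hG.adj])
    ⟨hB.congr (by simp) (by simp) (by simp) (by simp), by simp⟩ ?_
    (fun s' _ h => ⟨h.1.congr rfl rfl rfl (by rintro x y' (h | ⟨rfl, h⟩); exacts [.inl h, .inr ⟨rfl, h⟩]),
      h.2⟩)
  rintro l₁ v l₂ hl s1 hF1 hi ⟨h1, h2⟩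
  have hv : v ∈ A y := by rw [hl]; simp
  have hG1 : GRep s1 R A := hG.frame hF1 (by decide)
  have hy1 := hF1.1 .y (by decide)
  have hbs1 := hF1.1 .bs (by decide)
  have hpos1 := hF1.2 .pos (by decide)
  have hneg1 := hF1.2 .neg (by decide)
  have hD1 : DRep s1 D :=
    hD.congr (hF1.2 .dlen (by decide)) (hF1.2 .dl (by decide)) fun _ => rfl
  simp only [spec_seq, spec_assign]
  refine ⟨by simp, ?_⟩
  refine spec_forEach (D v) (fun d s' =>
      Best A s' P (fun x y' => S x y' ∨ (y' = y ∧ ((∃ v ∈ l₁, x ∈ D v) ∨ x ∈ d))) ∧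
      s'.time ≤ s1.time + 3 + 8 * d.length)
    (by decide) (by decide) (by simp [(hD1 v).1]; exact (hD1 v).2)
    ⟨h1.congr (by simp) (by simp) (by simp) (by simp), by simp⟩ ?_ ?_
  · rintro d₁ x d₂ hd s2 hF2 hk ⟨g1, g2⟩
    have hG2 : GRep s2 R A := hG1.frame_of_eq hF2 (by decide) (by simp) (by simp) rfl
    have hy2 := hF2.1 .y (by decide)
    have hbs2 := hF2.1 .bs (by decide)
    have hpos2 := hF2.2 .pos (by decide)
    have hneg2 := hF2.2 .neg (by decide)
    simp at hy2 hbs2 hpos2 hneg2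
    obtain ⟨k1, k2, k3⟩ := hx v hv x (by rw [hd]; simp)
    have e1 : (s2.set .x x).reg .x = x := by simp
    have e2 : (s2.set .x x).reg .y = y := by simp [hy2, hy1, ← hy]
    have e3 : (s2.set .x x).reg .bs = s.reg .bs := by simp [hbs2, hbs1]
    refine Spec.mono (evalPair_spec (s := s2.set .x x) (P := P)
      (hG2.congr (by simp) (by simp) rfl rfl rfl rfl)
      (g1.congr (by simp) (by simp) (by simp) fun _ _ h => h) ?_ ?_ ?_) ?_
    · rw [e1, e2]; exact k1
    · rw [e1, e2, e3, St.set_arr, hpos2, hneg2, hpos1, hneg1]; exact k3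
    · rw [e1, e2]; exact k2
    · rintro s3 - - ⟨g3, g4⟩
      rw [e1, e2] at g3
      refine ⟨g3.congr (by simp) (by simp) (by simp) ?_, by simp at g4 ⊢; omega⟩
      intro x' y' h
      simp only [List.mem_append, List.mem_singleton] at h
      rcases h with h | ⟨h, h' | h' | h'⟩
      exacts [.inl (.inl h), .inl (.inr ⟨h, .inl h'⟩), .inl (.inr ⟨h, .inr h'⟩), .inr ⟨h', h⟩]
  · rintro s2 hF2 ⟨g1, g2⟩
    refine ⟨g1.congr (by simp) (by simp) (by simp) ?_, by simp; omega⟩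
    intro x' y' h
    simp only [List.mem_append, List.mem_singleton, or_and_right, exists_or, exists_eq_left] at h
    tauto

theorem evalFirst_spec (hG : GRep s R A) {C : List ℕ}
    (hC : row (s.arr .cand (s.reg .n)) (s.reg .cc) = C) (hB : Best A s P S)
    (hx : ∀ x ∈ C, P x (s.reg .y) ∧ dom A x (s.reg .y) < E.wd ∧
      (A x).length + s.reg .bs + s.arr .pos (s.reg .y) x - s.arr .neg (s.reg .y) x =
        dom A x (s.reg .y)) :
    Spec E evalFirst s fun s' =>
      Best A s' P (fun x y => S x y ∨ (y = s.reg .y ∧ x ∈ C.take (s.reg .tc + 1))) ∧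
      s'.time ≤ s.time + 4 + 8 * (s.reg .tc + 1) := by
  set y := s.reg .y with hy
  have key : ∀ s1 : St, GRep s1 R A → row (s1.arr .cand (s1.reg .n)) (s1.reg .g) =
      C.take (s.reg .tc + 1) → Best A s1 P S → s1.reg .y = y → s1.arr = s.arr →
      s1.reg .bs = s.reg .bs → s1.time ≤ s.time + 3 →
      Spec E (.forEach .k .g .x .cand .n evalPair) s1 fun s' =>
      Best A s' P (fun x y' => S x y' ∨ (y' = y ∧ x ∈ C.take (s.reg .tc + 1))) ∧
      s'.time ≤ s.time + 4 + 8 * (s.reg .tc + 1) := by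
    intro s1 hG1 hC1 hB1 hy1 ha1 hbs1 ht1
    refine spec_forEach (C.take (s.reg .tc + 1)) (fun d s' =>
      Best A s' P (fun x y' => S x y' ∨ (y' = y ∧ x ∈ d)) ∧
      s'.time ≤ s1.time + 1 + 8 * d.length)
      (by decide) (by decide) hC1 ⟨hB1.congr (by simp) (by simp) (by simp) (by simp), by simp⟩ ?_ ?_
    · rintro d₁ x d₂ hd s2 hF2 hk ⟨g1, g2⟩
      have hG2 : GRep s2 R A := hG1.frame hF2 (by decide)
      have hy2 := hF2.1 .y (by decide)
      have hbs2 := hF2.1 .bs (by decide)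
      have hpos2 := hF2.2 .pos (by decide)
      have hneg2 := hF2.2 .neg (by decide)
      obtain ⟨k1, k2, k3⟩ := hx x (List.mem_of_mem_take (by rw [hd]; simp : x ∈ C.take (s.reg .tc + 1)))
      have e1 : (s2.set .x x).reg .x = x := by simp
      have e2 : (s2.set .x x).reg .y = y := by simp [hy2, hy1, ← hy]
      have e3 : (s2.set .x x).reg .bs = s.reg .bs := by simp [hbs2, hbs1]
      refine Spec.mono (evalPair_spec (s := s2.set .x x) (P := P)
        (hG2.congr (by simp) (by simp) rfl rfl rfl rfl)
        (g1.congr (by simp) (by simp) (by simp) fun _ _ h => h) ?_ ?_ ?_) ?_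
      · rw [e1, e2]; exact k1
      · rw [e1, e2, e3, St.set_arr, hpos2, hneg2, ha1]; exact k3
      · rw [e1, e2]; exact k2
      · rintro s3 - - ⟨g3, g4⟩
        rw [e1, e2] at g3
        refine ⟨g3.congr (by simp) (by simp) (by simp) ?_, by simp at g4 ⊢; omega⟩
        intro x' y' h
        simp only [List.mem_append, List.mem_singleton] at h
        tauto
    · rintro s2 hF2 ⟨g1, g2⟩
      refine ⟨g1, ?_⟩
      have := List.length_take_le (s.reg .tc + 1) C
      omega
  have hlen : s.reg .cc = C.length := by rw [← hC]; simp
  simp only [evalFirst, spec_seq, spec_assign, spec_ite]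
  by_cases h : s.reg .cc < s.reg .tc + 1
  · simp [h]
    refine key _ (hG.congr (by simp) (by simp) rfl rfl rfl rfl) ?_
      (hB.congr (by simp) (by simp) (by simp) fun _ _ h => h) (by simp [hy]) rfl (by simp) (by simp)
    rw [List.take_of_length_le (by omega)]
    simpa using hC
  · simp [h]
    refine key _ (hG.congr (by simp) (by simp) rfl rfl rfl rfl) ?_
      (hB.congr (by simp) (by simp) (by simp) fun _ _ h => h) (by simp [hy]) rfl (by simp) (by simp)
    rw [← hC, row_take _ (by omega)]
    simp

end


/-! ### All pairs with a vertex in one range of degrees -/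

def evalAll : Cmd :=
  .forEach .i .cnt .y .ver .n
    (.t ::= .get .len .y .y ;;
      .ite (♯.lo ≺ ♯.t)
        (.ite (♯.hi ≺ ♯.t) .skip (.tc ::= 0 ;; .bs ::= 0 ;; countDiffs ;; evalTouched ;; evalFirst))
        .skip)

/-- Find a best pair with a vertex whose closed neighborhood has more than `lo` and at most `hi`
elements. -/
def nearCore : Cmd :=
  .dd ::= ♯.lo ;; .ite (♯.lo ≺ 1) (.dd ::= 1) .skip ;;
  scanMax ;;
  .low ::= 0 ;; .uu ::= ♯.n ;; .bad ::= 0 ;;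
  .ite (♯.dd + ♯.dd + (♯.dd + ♯.dd) ≺ ♯.top)
    (.low ::= ♯.top - (♯.dd + ♯.dd) ;; .uu ::= ♯.u ;; checkSpread) .skip ;;
  .best ::= 0 ;; .b1 ::= 0 ;; .b2 ::= 0 ;;
  .ite (♯.bad) .skip (sortCand ;; listDiffs ;; evalAll)

theorem wsum_ite (p : ℕ → Prop) [DecidablePred p] (l : List ℕ) :
    wsum (fun v => if p v then 1 else 0) l = l.countP (fun v => p v) := by
  induction l with
  | nil => rfl
  | cons a l ih =>
    rw [List.countP_cons, ← ih]
    by_cases h : p a <;> simp [wsum, h, add_comm]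

theorem count_diffs {A : ℕ → List ℕ} {C Z : List ℕ} (hC : C.Nodup) {x : ℕ} (hx : x ∈ C) (v : ℕ) :
    (diffs A C Z v).count x = if (v ∈ A x ↔ v ∈ Z) then 0 else 1 := by
  have h := mem_diffs (A := A) (C := C) (Z := Z) (v := v) (x := x)
  by_cases h' : (v ∈ A x ↔ v ∈ Z)
  · rw [if_pos h']
    exact List.count_eq_zero_of_not_mem fun hm => (h.1 hm).2 h'
  · rw [if_neg h']
    exact List.count_eq_one_of_mem (hC.filter _) (h.2 ⟨hx, h'⟩)

section
variable {E : Env} {s : St} {R : List ℕ} {A : ℕ → List ℕ} {m : ℕ}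

theorem spec_ite_of_ne {t : Term} {p q : Cmd} {Q : St → Prop} (h : t.val s ≠ 0) :
    Spec E (.ite t p q) s Q ↔ Spec E p s.tick Q := by rw [spec_ite, if_pos h]

theorem spec_ite_of_eq {t : Term} {p q : Cmd} {Q : St → Prop} (h : t.val s = 0) :
    Spec E (.ite t p q) s Q ↔ Spec E q s.tick Q := by rw [spec_ite, if_neg (by simpa using h)]

/-- For each `y` in the range the counters turn `Nbr.dom_eq_base` into an O(1) evaluation of any
candidate, and `Nbr.dom_le_of_touched` shows that the evaluated candidates are enough. The rows of
`pos` and `neg` of later vertices are still zero; this is part of the invariant. -/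
theorem evalAll_spec (hN : Nbr m R A) (hG : GRep s R A) {C : List ℕ}
    (hCs : C = sortC A R (s.reg .top) (s.reg .top - s.reg .low + 1))
    (hC : row (s.arr .cand (s.reg .n)) (s.reg .cc) = C)
    (hD : DRep s (diffs A C (A (s.reg .uu)))) (hwd : R.length < E.wd)
    (h0 : ∀ y x, s.arr .pos y x = 0 ∧ s.arr .neg y x = 0)
    (htop : ∀ v ∈ R, (A v).length ≤ s.reg .top) (hlow : s.reg .low ≤ s.reg .top) {dd : ℕ}
    (hld : s.reg .low = 0 ∨ s.reg .low + 2 * dd = s.reg .top)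
    (hu : s.reg .top ≠ 0 → s.reg .u ∈ R ∧ (A (s.reg .u)).length = s.reg .top)
    (hhi : s.reg .hi ≤ 2 * dd) (hb : s.reg .best = 0) :
    Spec E evalAll s fun s' =>
      Best A s' (fun x y => x ∈ R ∧ y ∈ R ∧ s.reg .lo < (A y).length ∧ (A y).length ≤ s.reg .hi)
        (fun x y => x ∈ R ∧ y ∈ R ∧ s.reg .lo < (A y).length ∧ (A y).length ≤ s.reg .hi) ∧
      s'.time ≤ s.time + 1 + wsum (fun y => 40 + 12 * (A y).length +
        22 * touches (diffs A C (A (s.reg .uu))) (A y)) R := by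
  set Z := A (s.reg .uu) with hZ
  set D := diffs A C Z with hDd
  set V : ℕ → Prop := fun y => s.reg .lo < (A y).length ∧ (A y).length ≤ s.reg .hi with hV
  have hCn : C.Nodup := by rw [hCs]; exact sortC_nodup hN.nodup _ _
  have hCR : ∀ x ∈ C, x ∈ R := fun x hx => by
    rw [hCs, mem_sortC htop hlow] at hx
    exact hx.1
  refine spec_forEach R (fun l s' => Best A s' (fun x y => x ∈ R ∧ y ∈ R ∧ V y)
      (fun x y => x ∈ R ∧ y ∈ l ∧ V y) ∧
      (∀ y ∉ l, ∀ x, s'.arr .pos y x = 0 ∧ s'.arr .neg y x = 0) ∧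
      s'.time ≤ s.time + 1 + wsum (fun y => 40 + 12 * (A y).length + 22 * touches D (A y)) l)
    (by decide) (by decide) (by simp [hG.cnt, hG.ver])
    ⟨⟨by simp, by simp [hb]⟩, by simp [h0], by simp⟩ ?_ (fun s' _ h => ⟨h.1, h.2.2⟩)
  rintro l₁ y l₂ hl s1 hF1 hi ⟨h1, h2, h3⟩
  have hy : y ∈ R := by rw [hl]; simp
  have hyl : y ∉ l₁ := fun h => by
    have := hN.nodup
    rw [hl, List.nodup_append] at this
    exact this.2.2 y h y (by simp) rfl
  have hG1 : GRep s1 R A := hG.frame hF1 (by decide)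
  have hD1 : DRep s1 D := hD.congr (hF1.2 .dlen (by decide)) (hF1.2 .dl (by decide)) fun _ => rfl
  have elo := hF1.1 .lo (by decide)
  have ehi := hF1.1 .hi (by decide)
  have euu := hF1.1 .uu (by decide)
  have ecc := hF1.1 .cc (by decide)
  have en := hF1.1 .n (by decide)
  have ec := hF1.2 .cand (by decide)
  have skip : ∀ s2 : St, ¬ V y → s2.reg .best = s1.reg .best → s2.reg .b1 = s1.reg .b1 →
      s2.reg .b2 = s1.reg .b2 → s2.arr = s1.arr → s2.time ≤ s1.time + 10 →
      Best A s2 (fun x y => x ∈ R ∧ y ∈ R ∧ V y) (fun x y' => x ∈ R ∧ y' ∈ l₁ ++ [y] ∧ V y') ∧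
      (∀ y' ∉ l₁ ++ [y], ∀ x, s2.arr .pos y' x = 0 ∧ s2.arr .neg y' x = 0) ∧
      s2.time ≤ s.time + 1 + wsum (fun y => 40 + 12 * (A y).length + 22 * touches D (A y))
        (l₁ ++ [y]) := by
    intro s2 hv e1 e2 e3 e4 e5
    refine ⟨h1.congr e1 e2 e3 ?_, fun y' hy' => ?_, ?_⟩
    · rintro x y' ⟨k1, k2, k3⟩
      simp only [List.mem_append, List.mem_singleton] at k2
      rcases k2 with k2 | rfl
      · exact ⟨k1, k2, k3⟩
      · exact absurd k3 hv
    · rw [e4]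
      exact h2 y' fun h => hy' (by simp [h])
    · simp; omega
  rw [spec_seq, spec_assign]
  refine ⟨by simp, ?_⟩
  by_cases hv1 : s.reg .lo < (A y).length
  swap
  · rw [spec_ite_of_eq (by simp [hG1.len, elo, hv1]), spec_skip]
    exact skip _ (fun h => hv1 h.1) (by simp) (by simp) (by simp) rfl (by simp)
  rw [spec_ite_of_ne (by simp [hG1.len, elo, hv1])]
  by_cases hv2 : s.reg .hi < (A y).length
  · rw [spec_ite_of_ne (by simp [hG1.len, ehi, hv2]), spec_skip]
    exact skip _ (fun h => by have := h.2; omega) (by simp) (by simp) (by simp) rfl (by simp)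
  have hVy : V y := ⟨hv1, by omega⟩
  rw [spec_ite_of_eq (by simp [hG1.len, ehi, hv2])]
  simp only [spec_seq, spec_assign]
  refine ⟨by simp, by simp, ?_⟩
  refine Spec.mono (countDiffs_spec (R := R) (A := A) (D := D)
    (s := (((((s1.set .y y).set .t _).tick.tick).set .tc 0).set .bs 0))
    (hG1.congr (by simp) (by simp) rfl rfl rfl rfl)
    (hD1.congr rfl rfl fun _ => rfl) (by simp [hG1.len]) (by simp) (by simp)
    (by simpa using h2 y hyl)) ?_
  rintro s2 hF2 - ⟨g1, g2, g3, g4, g5, g6⟩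
  simp at g1 g2 g3 g4 g5 g6
  simp only [euu, ← hZ] at g1 g2 g3 g4
  have hG2 : GRep s2 R A := hG1.frame_of_eq hF2 (by decide) (by simp) (by simp) rfl
  have hD2 : DRep s2 D := hD1.congr (hF2.2 .dlen (by decide)) (hF2.2 .dl (by decide)) fun _ => rfl
  have hy2 := hF2.1 .y (by decide)
  have ht2 := hF2.1 .t (by decide)
  have hn2 := hF2.1 .n (by decide)
  have hcc2 := hF2.1 .cc (by decide)
  have hcand2 := hF2.2 .cand (by decide)
  have hB2 := h1.congr (S' := fun x y => x ∈ R ∧ y ∈ l₁ ∧ V y)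
    (s' := s2) (by rw [hF2.1 .best (by decide)]; simp)
    (by rw [hF2.1 .b1 (by decide)]; simp) (by rw [hF2.1 .b2 (by decide)]; simp) (fun _ _ h => h)
  simp [hG1.len] at hy2 ht2 hn2 hcc2 hcand2
  have hval : ∀ x ∈ C, (A x).length + s2.reg .bs + s2.arr .pos y x - s2.arr .neg y x =
      dom A x y := by
    intro x hx
    rw [g1, g3, g4, hN.dom_eq_base Z x y, outs]
    have e1 : ∀ v, (if v ∈ Z then (D v).count x else 0) = if v ∈ Z ∧ v ∉ A x then 1 else 0 := by
      intro v
      rw [hDd, count_diffs hCn hx]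
      by_cases k1 : v ∈ Z <;> by_cases k2 : v ∈ A x <;> simp [k1, k2]
    have e2 : ∀ v, (if v ∈ Z then 0 else (D v).count x) = if v ∉ Z ∧ v ∈ A x then 1 else 0 := by
      intro v
      rw [hDd, count_diffs hCn hx]
      by_cases k1 : v ∈ Z <;> by_cases k2 : v ∈ A x <;> simp [k1, k2]
    simp only [e1, e2]
    rw [wsum_ite, wsum_ite]
  refine Spec.mono (evalTouched_spec (D := D) hG2 hD2 (by rw [ht2, hy2]) hB2 ?_) ?_
  · rw [hy2]
    intro v hv x hx
    have hxC := (mem_diffs.1 hx).1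
    exact ⟨⟨hCR x hxC, hy, hVy⟩, (hN.dom_le_length x y).trans_lt hwd, hval x hxC⟩
  rintro s3 hF3 - ⟨k1, k2⟩
  rw [hy2] at k1 k2
  have hG3 : GRep s3 R A := hG2.frame hF3 (by decide)
  have hy3 := hF3.1 .y (by decide)
  have hn3 := hF3.1 .n (by decide)
  have hcc3 := hF3.1 .cc (by decide)
  have htc3 := hF3.1 .tc (by decide)
  have hbs3 := hF3.1 .bs (by decide)
  have hcand3 := hF3.2 .cand (by decide)
  have hpos3 := hF3.2 .pos (by decide)
  have hneg3 := hF3.2 .neg (by decide)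
  refine Spec.mono (evalFirst_spec (C := C) hG3 (by rw [hcand3, hcand2, hn3, hn2, hcc3, hcc2, ec, en, ecc, hC])
    k1 ?_) ?_
  · rw [hy3, hy2, hbs3, hpos3, hneg3]
    exact fun x hx => ⟨⟨hCR x hx, hy, hVy⟩, (hN.dom_le_length x y).trans_lt hwd, hval x hx⟩
  rintro s4 hF4 - ⟨q1, q2⟩
  rw [hy3, hy2] at q1
  rw [htc3, g2] at q1 q2
  have hpos4 := hF4.2 .pos (by decide)
  have hneg4 := hF4.2 .neg (by decide)
  refine ⟨⟨?_, by simpa using q1.att⟩, fun y' hy' x => ?_, ?_⟩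
  · rintro x y' ⟨w1, w2, w3⟩
    simp only [List.mem_append, List.mem_singleton] at w2
    rcases w2 with w2 | rfl
    · simpa using q1.le x y' (.inl (.inl ⟨w1, w2, w3⟩))
    · have htn : s.reg .top ≠ 0 := by
        have := hN.length_pos w1
        have := htop x w1
        omega
      simp only [St.set_reg, reduceCtorEq, if_false]
      refine hN.dom_le_of_touched (Z := Z) (T := wsum (fun v => (D v).length) (A y')) htop hlow hld
        (hu htn).1 (hu htn).2 (w3.2.trans hhi) (by rw [← hCs]; rfl) ?_ ?_ w1
      · rw [← hCs]
        exact fun v hv x hx => q1.le x y' (.inl (.inr ⟨rfl, v, hv, hx⟩))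
      · rw [← hCs]
        exact fun x hx => q1.le x y' (.inr ⟨rfl, hx⟩)
  · simp only [List.mem_append, List.mem_singleton, not_or] at hy'
    have := g5 y' hy'.2
    simp only [St.set_arr, hpos4, hpos3, hneg4, hneg3, this]
    exact h2 y' hy'.1 x
  · have : wsum (fun v => (D v).length) (A y) = touches D (A y) := rfl
    rw [this] at g6 k2 q2
    simp
    omega

theorem sortC_length_le (hN : Nbr m R A) (top K : ℕ) : (sortC A R top K).length ≤ R.length :=
  (sortC_subperm hN top K).length_le

-- With `dd = max lo 1` the range satisfies `hi ≤ 2 * dd`; the maximum also covers the range (0, 1]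
-- of isolated vertices. The first alternative is the negative report: each pair in question is
-- beaten strictly by some other pair. It also covers an empty range.
set_option maxHeartbeats 400000 in
theorem nearCore_spec (hN : Nbr m R A) (hG : GRep s R A) (hn : A (s.reg .n) = [])
    (hwd : R.length < E.wd) (hhi : s.reg .hi ≤ 2 * max (s.reg .lo) 1)
    (h0 : ∀ v, s.arr .dlen v v = 0)
    (h1 : ∀ y x, s.arr .pos y x = 0 ∧ s.arr .neg y x = 0) :
    Spec E nearCore s fun s' =>
      ((s'.reg .best = 0 ∧ ∀ x ∈ R, ∀ y ∈ R, s.reg .lo < (A y).length →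
        (A y).length ≤ s.reg .hi → ∃ a ∈ R, ∃ b ∈ R, dom A x y < dom A a b) ∨
      (s'.reg .best ≠ 0 ∧ Best A s'
        (fun x y => x ∈ R ∧ y ∈ R ∧ s.reg .lo < (A y).length ∧ (A y).length ≤ s.reg .hi)
        (fun x y => x ∈ R ∧ y ∈ R ∧ s.reg .lo < (A y).length ∧ (A y).length ≤ s.reg .hi))) ∧
      s'.time ≤ s.time + 5000 * (max (s.reg .lo) 1 * (m + 1)) := by
  have key : ∀ s1 : St, s1.reg .dd = max (s.reg .lo) 1 → s1.reg .lo = s.reg .lo →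
      s1.reg .hi = s.reg .hi → s1.reg .n = s.reg .n → s1.reg .cnt = s.reg .cnt →
      s1.arr = s.arr → s1.time ≤ s.time + 4 → Spec E
      (scanMax ;;
        .low ::= 0 ;; .uu ::= ♯.n ;; .bad ::= 0 ;;
        .ite (♯.dd + ♯.dd + (♯.dd + ♯.dd) ≺ ♯.top)
          (.low ::= ♯.top - (♯.dd + ♯.dd) ;; .uu ::= ♯.u ;; checkSpread) .skip ;;
        .best ::= 0 ;; .b1 ::= 0 ;; .b2 ::= 0 ;;
        .ite (♯.bad) .skip (sortCand ;; listDiffs ;; evalAll)) s1 fun s' =>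
      ((s'.reg .best = 0 ∧ ∀ x ∈ R, ∀ y ∈ R, s.reg .lo < (A y).length →
        (A y).length ≤ s.reg .hi → ∃ a ∈ R, ∃ b ∈ R, dom A x y < dom A a b) ∨
      (s'.reg .best ≠ 0 ∧ Best A s'
        (fun x y => x ∈ R ∧ y ∈ R ∧ s.reg .lo < (A y).length ∧ (A y).length ≤ s.reg .hi)
        (fun x y => x ∈ R ∧ y ∈ R ∧ s.reg .lo < (A y).length ∧ (A y).length ≤ s.reg .hi))) ∧
      s'.time ≤ s.time + 5000 * (max (s.reg .lo) 1 * (m + 1)) := by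
    intro s1 e1 e2 e3 e4 e5 e6 e7
    set dd := max (s.reg .lo) 1 with hdd
    have hdd1 : 1 ≤ dd := le_max_right _ _
    have hG1 : GRep s1 R A := hG.congr e5 e4 (by rw [e6]) (by rw [e6]) (by rw [e6]) (by rw [e6])
    rw [spec_seq]
    refine Spec.mono (scanMax_spec hG1) ?_
    rintro s2 hF2 - ⟨g1, g2, g3⟩
    have hG2 : GRep s2 R A := hG1.frame hF2 (by decide)
    have d2 := hF2.1 .dd (by decide)
    have lo2 := hF2.1 .lo (by decide)
    have hi2 := hF2.1 .hi (by decide)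
    have n2 := hF2.1 .n (by decide)
    have a2 : s2.arr = s.arr := by
      funext a
      rw [hF2.2 a (by simp [scanMax, Cmd.wa, Cmd.forEach]), e6]
    rw [e1] at d2
    rw [e2] at lo2
    rw [e3] at hi2
    rw [e4] at n2
    have hu : s2.reg .top ≠ 0 → s2.reg .u ∈ R ∧ (A (s2.reg .u)).length = s2.reg .top := by
      intro h
      rcases g2 with g2 | g2 | g2
      · exact absurd g2.2 h
      · exact g2
      · exact absurd g2 h
    have hs := hN.sum
    have hRl := hN.length
    -- the common end
    have fin : ∀ s3 : St, GRep s3 R A → s3.reg .lo = s.reg .lo → s3.reg .hi = s.reg .hi →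
        s3.reg .top = s2.reg .top → s3.reg .u = s2.reg .u → s3.reg .low ≤ s2.reg .top →
        ((s3.reg .low = 0 ∧ s2.reg .top ≤ 4 * dd ∧ A (s3.reg .uu) = []) ∨
          (s3.reg .low + 2 * dd = s2.reg .top ∧ 4 * dd < s2.reg .top ∧
            A (s3.reg .uu) = A (s2.reg .u) ∧ (A (s2.reg .u)).length = s2.reg .top ∧
          ∀ x ∈ R, s3.reg .low ≤ (A x).length → (A x).countP (· ∉ A (s2.reg .u)) ≤ 2 * dd)) →
        s3.reg .best = 0 → s3.arr = s.arr → s3.time ≤ s.time + 200 * (m + 1) →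
        Spec E (sortCand ;; listDiffs ;; evalAll) s3 fun s' =>
      ((s'.reg .best = 0 ∧ ∀ x ∈ R, ∀ y ∈ R, s.reg .lo < (A y).length →
        (A y).length ≤ s.reg .hi → ∃ a ∈ R, ∃ b ∈ R, dom A x y < dom A a b) ∨
      (s'.reg .best ≠ 0 ∧ Best A s'
        (fun x y => x ∈ R ∧ y ∈ R ∧ s.reg .lo < (A y).length ∧ (A y).length ≤ s.reg .hi)
        (fun x y => x ∈ R ∧ y ∈ R ∧ s.reg .lo < (A y).length ∧ (A y).length ≤ s.reg .hi))) ∧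
      s'.time ≤ s.time + 5000 * (dd * (m + 1)) := by
      intro s3 hG3 lo3 hi3 top3 u3 hlow hmode hb3 a3 t3
      rw [spec_seq]
      refine Spec.mono (sortCand_spec hG3) ?_
      rintro s4 hF4 - ⟨c1, c2⟩
      set C := sortC A R (s3.reg .top) (s3.reg .top - s3.reg .low + 1) with hC
      have hG4 : GRep s4 R A := hG3.frame hF4 (by decide)
      have uu4 := hF4.1 .uu (by decide)
      rw [spec_seq]
      refine Spec.mono (listDiffs_spec hG4 c1
        (fun v => by rw [hF4.2 .dlen (by decide), a3, h0]) hN.nodupA) ?_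
      rintro s5 hF5 - ⟨c3, c4⟩
      have hG5 : GRep s5 R A := hG4.frame hF5 (by decide)
      have top5 : s5.reg .top = s2.reg .top := by
        rw [hF5.1 .top (by decide), hF4.1 .top (by decide), top3]
      have low5 : s5.reg .low = s3.reg .low := by
        rw [hF5.1 .low (by decide), hF4.1 .low (by decide)]
      have u5 : s5.reg .u = s2.reg .u := by
        rw [hF5.1 .u (by decide), hF4.1 .u (by decide), u3]
      have uu5 : s5.reg .uu = s3.reg .uu := by
        rw [hF5.1 .uu (by decide), hF4.1 .uu (by decide)]
      have hi5 : s5.reg .hi = s.reg .hi := by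
        rw [hF5.1 .hi (by decide), hF4.1 .hi (by decide), hi3]
      have lo5 : s5.reg .lo = s.reg .lo := by
        rw [hF5.1 .lo (by decide), hF4.1 .lo (by decide), lo3]
      rw [uu4] at c3 c4
      refine Spec.mono (evalAll_spec hN hG5 (C := C) (dd := dd) (by rw [hC, top5, low5, top3])
        (by rw [hF5.2 .cand (by decide), hF5.1 .n (by decide), hF5.1 .cc (by decide), c1])
        (by rw [uu5]; exact c3) hwd
        (fun y x => by
          rw [hF5.2 .pos (by decide), hF5.2 .neg (by decide), hF4.2 .pos (by decide),
            hF4.2 .neg (by decide), a3]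
          exact h1 y x)
        (by rw [top5]; exact g1) (by rw [low5, top5]; exact hlow)
        (by rw [low5, top5]; exact hmode.imp (·.1) (·.1)) (by rw [top5, u5]; exact hu)
        (by rw [hi5]; exact hhi)
        (by rw [hF5.1 .best (by decide), hF4.1 .best (by decide), hb3])) ?_
      rintro s6 - - ⟨c5, c6⟩
      rw [lo5, hi5] at c5
      rw [uu5] at c6
      refine ⟨?_, ?_⟩
      · by_cases hb : s6.reg .best = 0
        -- Every pair dominates at least one vertex, so the value 0 means that the range is empty.
        · refine .inl ⟨hb, fun x hx y hy k1 k2 => ?_⟩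
          have k3 := c5.le x y ⟨hx, hy, k1, k2⟩
          have k4 := hN.length_le_dom x y
          have k5 := hN.length_pos hx
          omega
        · exact .inr ⟨hb, c5⟩
      · have w1 := sum_work_le hN (Z := A (s3.reg .uu)) g1 hlow (by
          rcases hmode with h | h
          · exact .inl h
          · exact .inr h)
        rw [← top3, ← hC] at w1
        have w2 : wsum (fun y => 40 + 12 * (A y).length +
            22 * touches (diffs A C (A (s3.reg .uu))) (A y)) R =
            40 * R.length + 12 * (R.map fun v => (A v).length).sum +
            22 * (R.map fun y => touches (diffs A C (A (s3.reg .uu))) (A y)).sum := by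
          simp only [wsum, List.sum_map_add, List.sum_map_mul_left, List.map_const',
            List.sum_replicate, smul_eq_mul]
          ring
        have w3 : wsum (fun x => 5 + 7 * ((A x).length + (A (s3.reg .uu)).length)) C =
            5 * C.length + 7 * (C.map fun v => (A v).length).sum +
              7 * (C.length * (A (s3.reg .uu)).length) := by
          simp only [wsum, List.sum_map_add, List.sum_map_mul_left, List.map_const',
            List.sum_replicate, smul_eq_mul]
          ring
        have w4 : (C.map fun v => (A v).length).sum ≤ R.length + 2 * m :=
          (sum_sortC_le hN _ _ _).trans hs
        have w5 : C.length ≤ R.length := sortC_length_le hN _ _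
        have w6 : C.length * (A (s3.reg .uu)).length ≤ 2 * (R.length + 2 * m) := by
          rcases hmode with ⟨-, -, h⟩ | ⟨k1, k2, k3, k4, -⟩
          · simp [h]
          · have := length_sortC_mul_le hN g1 hlow
            rw [← top3, ← hC] at this
            rw [k3, k4]
            calc C.length * s2.reg .top ≤ C.length * (2 * s3.reg .low) :=
                  Nat.mul_le_mul_left _ (by omega)
              _ = 2 * (C.length * s3.reg .low) := by ring
              _ ≤ _ := Nat.mul_le_mul_left _ this
        -- The number of sorting passes is at most `4 * dd + 1` without a cut and `2 * dd + 1` with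
        -- one.
        have w7 : s3.reg .top - s3.reg .low + 1 ≤ 5 * dd := by
          rw [top3]
          rcases hmode with h | h <;> omega
        have w8 : 7 * (s3.reg .top - s3.reg .low + 1) * (R.length + 1) ≤
            7 * (5 * dd) * (4 * m + 3) :=
          Nat.mul_le_mul (Nat.mul_le_mul_left _ w7) (by omega)
        have w9 : 12 * dd * (R.length + 2 * m) ≤ 12 * dd * (6 * m + 2) :=
          Nat.mul_le_mul_left _ (by omega)
        have w10 : m + 1 ≤ dd * (m + 1) := Nat.le_mul_of_pos_left _ hdd1
        have w11 : 7 * (5 * dd) * (4 * m + 3) ≤ 140 * (dd * (m + 1)) := by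
          rw [show 7 * (5 * dd) * (4 * m + 3) = 140 * (dd * m) + 105 * dd by ring,
            show dd * (m + 1) = dd * m + dd by ring]
          omega
        have w12 : 12 * dd * (6 * m + 2) ≤ 72 * (dd * (m + 1)) := by
          rw [show 12 * dd * (6 * m + 2) = 72 * (dd * m) + 24 * dd by ring,
            show dd * (m + 1) = dd * m + dd by ring]
          omega
        omega
    rw [spec_seq, spec_assign, spec_seq, spec_assign, spec_seq, spec_assign, spec_seq]
    refine ⟨by simp, by simp, by simp, ?_⟩
    have w10 : m + 1 ≤ dd * (m + 1) := Nat.le_mul_of_pos_left _ hdd1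
    by_cases hm : dd + dd + (dd + dd) < s2.reg .top
    · have hu' := hu (by omega)
      rw [spec_ite_of_ne (by simp [d2, hm]), spec_seq, spec_assign, spec_seq, spec_assign]
      refine ⟨by simp, by simp, ?_⟩
      refine Spec.mono (checkSpread_spec (R := R) (A := A)
        (hG2.congr (by simp) (by simp) rfl rfl rfl rfl) (by simp)) ?_
      rintro s3 hF3 - ⟨k1, k2, k3⟩
      have hG3 : GRep s3 R A := hG2.frame_of_eq hF3 (by decide) (by simp) (by simp) rfl
      simp [d2] at k1 k2 k3
      rw [spec_seq, spec_assign, spec_seq, spec_assign, spec_seq, spec_assign]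
      refine ⟨by simp, by simp, by simp, ?_⟩
      by_cases hbad : s3.reg .bad = 0
      · rw [spec_ite_of_eq (by simp [hbad])]
        have lo3 := hF3.1 .lo (by decide)
        have hi3 := hF3.1 .hi (by decide)
        have top3 := hF3.1 .top (by decide)
        have u3 := hF3.1 .u (by decide)
        have low3 := hF3.1 .low (by decide)
        have uu3 := hF3.1 .uu (by decide)
        simp [d2] at lo3 hi3 top3 u3 low3 uu3
        refine fin _ (hG3.congr (by simp) (by simp) rfl rfl rfl rfl) (by simp [lo3, lo2])
          (by simp [hi3, hi2])
          (by simp [top3]) (by simp [u3]) (by simp [low3])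
          (.inr ⟨by simp [low3]; omega, by omega, by simp [uu3], hu'.2, ?_⟩) (by simp) ?_ ?_
        · intro x hx hxl
          simp [low3] at hxl
          exact k1 hbad x hx (by omega)
        · simp only [St.tick_arr, St.set_arr]
          funext a
          rw [hF3.2 a (by simp [checkSpread, Cmd.wa, Cmd.forEach])]
          simp [a2]
        · simp; omega
      · rw [spec_ite_of_ne (by simp [hbad]), spec_skip]
        refine ⟨.inl ⟨by simp, fun x hx y hy v1 v2 => ?_⟩, ?_⟩
        -- The pair of `u` and `z` dominates more than `top + 2 * dd` vertices, while a pair with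
        -- `y` dominates at most `top + 2 * dd`.
        · obtain ⟨z, hz, hz1, hz2⟩ := k2 hbad
          refine ⟨_, hu'.1, z, hz, ?_⟩
          rw [hN.dom_eq (s2.reg .u) z]
          have k4 := hN.dom_le_add x y
          have k5 := g1 x hx
          rw [outs] at hz2
          omega
        · simp; omega
    · rw [spec_ite_of_eq (by simp [d2, hm]), spec_skip, spec_seq, spec_assign, spec_seq,
        spec_assign, spec_seq, spec_assign]
      refine ⟨by simp, by simp, by simp, ?_⟩
      rw [spec_ite_of_eq (by simp)]
      -- The number `n` is not a vertex, so its list is empty: with `uu = n` the same code runs with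
      -- the reference set empty.
      exact fin _ (hG2.congr (by simp) (by simp) rfl rfl rfl rfl) (by simp [lo2]) (by simp [hi2])
          (by simp) (by simp) (by simp)
          (.inl ⟨by simp, by omega, by simp [n2, hn]⟩) (by simp)
          (by simp [a2]) (by simp; omega)
  rw [nearCore, spec_seq, spec_assign, spec_seq, spec_ite]
  refine ⟨by simp, ?_⟩
  by_cases h : s.reg .lo < 1
  · simp only [Term.val_lt, Term.val_reg, Term.val_ofNat, St.set_reg, reduceCtorEq, if_false, h,
      if_true, ne_eq, one_ne_zero, not_false_eq_true, spec_assign]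
    refine ⟨by simp, key _ (by simp; omega) (by simp) (by simp) (by simp) (by simp) rfl (by simp)⟩
  · simp only [Term.val_lt, Term.val_reg, Term.val_ofNat, St.set_reg, reduceCtorEq, if_false, h,
      if_true, ne_eq, not_true, spec_skip]
    exact key _ (by simp; omega) (by simp) (by simp) (by simp) (by simp) rfl (by simp)

end


/-! ## Recursive matrix multiplication -/

theorem sum_range_mul {F : Type*} [AddCommMonoid F] (a b : ℕ) (f : ℕ → F) :
    ∑ i ∈ Finset.range (a * b), f i =
      ∑ i ∈ Finset.range a, ∑ j ∈ Finset.range b, f (i * b + j) := by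
  induction a with
  | zero => simp
  | succ a ih => rw [Nat.succ_mul, Finset.sum_range_add, ih, Finset.sum_range_succ]

section
variable {F : Type*} [CommRing F]

/-- The entries of the `s`-th Kronecker power of a matrix `T` with `ρ` rows and `κ` columns. -/
def kr (ρ κ : ℕ) (T : ℕ → ℕ → F) : ℕ → ℕ → ℕ → F
  | 0, _, _ => 1
  | s + 1, a, b => kr ρ κ T s (a / ρ) (b / κ) * T (a % ρ) (b % κ)

/-- The Kronecker power applied to the first `s` digits. -/
def mix (ρ κ L : ℕ) (T : ℕ → ℕ → F) (x : ℕ → F) (s a c : ℕ) : F :=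
  ∑ b ∈ Finset.range (κ ^ s), kr ρ κ T s a b * x (b * κ ^ (L - s) + c)

theorem mix_zero (ρ κ L : ℕ) (T : ℕ → ℕ → F) (x : ℕ → F) (a c : ℕ) :
    mix ρ κ L T x 0 a c = x c := by simp [mix, kr]

theorem mix_self (ρ κ L : ℕ) (T : ℕ → ℕ → F) (x : ℕ → F) (a : ℕ) :
    mix ρ κ L T x L a 0 = ∑ b ∈ Finset.range (κ ^ L), kr ρ κ T L a b * x b := by simp [mix]

/-- Transforming one more digit costs only `κ` operations per entry. Going digit by digit is what
makes the Kronecker power cheap: all stages have length at most r ^ L. -/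
theorem mix_succ {ρ κ L s : ℕ} (hs : s < L) (T : ℕ → ℕ → F) (x : ℕ → F) {a t c : ℕ} (ht : t < ρ) :
    mix ρ κ L T x (s + 1) (a * ρ + t) c =
      ∑ β ∈ Finset.range κ, T t β * mix ρ κ L T x s a (β * κ ^ (L - (s + 1)) + c) := by
  have e1 : (a * ρ + t) / ρ = a := by
    rw [mul_comm, Nat.mul_add_div (by omega), Nat.div_eq_of_lt ht, add_zero]
  have e2 : (a * ρ + t) % ρ = t := by rw [mul_comm, Nat.mul_add_mod, Nat.mod_eq_of_lt ht]
  simp only [mix, kr, e1, e2, pow_succ, sum_range_mul, Finset.mul_sum]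
  rw [Finset.sum_comm]
  refine Finset.sum_congr rfl fun β hβ => Finset.sum_congr rfl fun b _ => ?_
  have hβ := Finset.mem_range.1 hβ
  have e3 : (b * κ + β) / κ = b := by
    rw [mul_comm, Nat.mul_add_div (by omega), Nat.div_eq_of_lt hβ, add_zero]
  have e4 : (b * κ + β) % κ = β := by rw [mul_comm, Nat.mul_add_mod, Nat.mod_eq_of_lt hβ]
  have e5 : κ ^ (L - s) = κ * κ ^ (L - (s + 1)) := by
    rw [← pow_succ']
    congr 1
    omega
  rw [e3, e4, e5, show b * (κ * κ ^ (L - (s + 1))) + (β * κ ^ (L - (s + 1)) + c) =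
    (b * κ + β) * κ ^ (L - (s + 1)) + c by ring]
  ring

/-- Products of entries of the matrix multiplication tensor. -/
def brent (n0 : ℕ) (α β γ : ℕ) : Prop :=
  α % n0 = β / n0 ∧ γ / n0 = α / n0 ∧ γ % n0 = β % n0

instance (n0 α β γ : ℕ) : Decidable (brent n0 α β γ) := by unfold brent; infer_instance

/-- The trilinear form of a Kronecker power factors over the digits; this splits off the last one.
-/
theorem sum_kr {r e : ℕ} {U V W : ℕ → ℕ → F} {B : ℕ → ℕ → ℕ → F} (he : 0 < e)
    (h : ∀ α < e, ∀ β < e, ∀ γ < e, ∑ t ∈ Finset.range r, U t α * V t β * W γ t = B α β γ)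
    (L c c' g : ℕ) :
    ∑ a ∈ Finset.range (r ^ (L + 1)), kr r e U (L + 1) a c * kr r e V (L + 1) a c' *
      kr e r W (L + 1) g a = (∑ a ∈ Finset.range (r ^ L), kr r e U L a (c / e) *
        kr r e V L a (c' / e) * kr e r W L (g / e) a) * B (c % e) (c' % e) (g % e) := by
  rw [pow_succ, sum_range_mul, Finset.sum_mul]
  refine Finset.sum_congr rfl fun a _ => ?_
  rw [← h _ (Nat.mod_lt _ he) _ (Nat.mod_lt _ he) _ (Nat.mod_lt _ he), Finset.mul_sum]
  refine Finset.sum_congr rfl fun t ht => ?_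
  have ht := Finset.mem_range.1 ht
  have e1 : (a * r + t) / r = a := by
    rw [mul_comm, Nat.mul_add_div (by omega), Nat.div_eq_of_lt ht, add_zero]
  have e2 : (a * r + t) % r = t := by rw [mul_comm, Nat.mul_add_mod, Nat.mod_eq_of_lt ht]
  simp only [kr, e1, e2]
  ring

/-- The position of the entry `(i, j)` in the recursive order. -/
def zIdx (n0 : ℕ) : ℕ → ℕ → ℕ → ℕ
  | 0, _, _ => 0
  | L + 1, i, j => zIdx n0 L (i / n0) (j / n0) * (n0 * n0) + (i % n0 * n0 + j % n0)

theorem zIdx_digit_lt {n0 : ℕ} (h : 0 < n0) (i j : ℕ) : i % n0 * n0 + j % n0 < n0 * n0 := by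
  have h1 := Nat.mod_lt i h
  have h2 := Nat.mod_lt j h
  calc i % n0 * n0 + j % n0 < i % n0 * n0 + n0 := by omega
    _ = (i % n0 + 1) * n0 := by ring
    _ ≤ _ := Nat.mul_le_mul_right _ h1

theorem zIdx_lt {n0 : ℕ} (h : 0 < n0) (L i j : ℕ) : zIdx n0 L i j < (n0 * n0) ^ L := by
  induction L generalizing i j with
  | zero => simp [zIdx]
  | succ L ih =>
    have h1 := zIdx_digit_lt h i j
    have h2 := ih (i / n0) (j / n0)
    rw [zIdx, pow_succ]
    calc _ < zIdx n0 L (i / n0) (j / n0) * (n0 * n0) + n0 * n0 := by omega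
      _ = (zIdx n0 L (i / n0) (j / n0) + 1) * (n0 * n0) := by ring
      _ ≤ _ := Nat.mul_le_mul_right _ h2

theorem zIdx_div {n0 : ℕ} (h : 0 < n0) (L i j : ℕ) :
    zIdx n0 (L + 1) i j / (n0 * n0) = zIdx n0 L (i / n0) (j / n0) := by
  rw [zIdx, mul_comm, Nat.mul_add_div (by positivity), Nat.div_eq_of_lt (zIdx_digit_lt h i j),
    add_zero]

theorem zIdx_mod {n0 : ℕ} (h : 0 < n0) (L i j : ℕ) :
    zIdx n0 (L + 1) i j % (n0 * n0) = i % n0 * n0 + j % n0 := by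
  rw [zIdx, mul_comm (zIdx _ _ _ _), Nat.mul_add_mod, Nat.mod_eq_of_lt (zIdx_digit_lt h i j)]

theorem sum_zIdx {n0 : ℕ} (h : 0 < n0) (L : ℕ) (f : ℕ → F) :
    ∑ c ∈ Finset.range ((n0 * n0) ^ L), f c =
      ∑ i ∈ Finset.range (n0 ^ L), ∑ j ∈ Finset.range (n0 ^ L), f (zIdx n0 L i j) := by
  induction L generalizing f with
  | zero => simp [zIdx]
  | succ L ih =>
    rw [pow_succ, sum_range_mul, ih, pow_succ, sum_range_mul]
    refine Finset.sum_congr rfl fun i _ => ?_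
    simp only [sum_range_mul]
    rw [Finset.sum_comm]
    refine Finset.sum_congr rfl fun i' hi' => ?_
    refine Finset.sum_congr rfl fun j _ => ?_
    refine Finset.sum_congr rfl fun j' hj' => ?_
    have hi' := Finset.mem_range.1 hi'
    have hj' := Finset.mem_range.1 hj'
    rw [zIdx, mul_comm i n0, mul_comm j n0, Nat.mul_add_div h, Nat.mul_add_div h,
      Nat.div_eq_of_lt hi', Nat.div_eq_of_lt hj', Nat.mul_add_mod, Nat.mul_add_mod,
      Nat.mod_eq_of_lt hi', Nat.mod_eq_of_lt hj', add_zero, add_zero]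

theorem brent_digits {n0 : ℕ} (h : 0 < n0) (i k k' j i' j' : ℕ) :
    brent n0 (i % n0 * n0 + k % n0) (k' % n0 * n0 + j % n0) (i' % n0 * n0 + j' % n0) ↔
      k % n0 = k' % n0 ∧ i' % n0 = i % n0 ∧ j' % n0 = j % n0 := by
  have e : ∀ a b, (a % n0 * n0 + b % n0) / n0 = a % n0 := fun a b => by
    rw [mul_comm, Nat.mul_add_div h, Nat.div_eq_of_lt (Nat.mod_lt _ h), add_zero]
  simp only [brent, e, Nat.mul_add_mod', Nat.mod_mod]

theorem eq_iff_div_mod (n0 a b : ℕ) : a = b ↔ a / n0 = b / n0 ∧ a % n0 = b % n0 :=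
  ⟨fun h => by simp [h], fun ⟨h1, h2⟩ => by rw [← Nat.div_add_mod a n0, h1, h2, Nat.div_add_mod]⟩

/-- The recursive order interleaves the digits of row and column, so the Brent equations hold digit
by digit, and numbers are equal exactly if all their digits are. -/
theorem sum_kr_zIdx {n0 r : ℕ} {U V W : ℕ → ℕ → F} (h0 : 0 < n0)
    (h : ∀ α < n0 * n0, ∀ β < n0 * n0, ∀ γ < n0 * n0,
      ∑ t ∈ Finset.range r, U t α * V t β * W γ t = if brent n0 α β γ then 1 else 0)
    (L : ℕ) {i k k' j i' j' : ℕ} (hi : i < n0 ^ L) (hk : k < n0 ^ L) (hk' : k' < n0 ^ L)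
    (hj : j < n0 ^ L) (hi' : i' < n0 ^ L) (hj' : j' < n0 ^ L) :
    ∑ a ∈ Finset.range (r ^ L), kr r (n0 * n0) U L a (zIdx n0 L i k) *
      kr r (n0 * n0) V L a (zIdx n0 L k' j) * kr (n0 * n0) r W L (zIdx n0 L i' j') a =
      if k = k' ∧ i' = i ∧ j' = j then 1 else 0 := by
  induction L generalizing i k k' j i' j' with
  | zero =>
    simp only [pow_zero, Nat.lt_one_iff] at *
    subst hi hk hk' hj hi' hj'
    simp [kr]
  | succ L ih =>
    have hd : ∀ {a}, a < n0 ^ (L + 1) → a / n0 < n0 ^ L := fun ha =>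
      Nat.div_lt_of_lt_mul (by rwa [← pow_succ'])
    rw [sum_kr (by positivity) h, zIdx_div h0, zIdx_div h0, zIdx_div h0, zIdx_mod h0, zIdx_mod h0,
      zIdx_mod h0, ih (hd hi) (hd hk) (hd hk') (hd hj) (hd hi') (hd hj')]
    simp only [brent_digits h0]
    have key : (k = k' ∧ i' = i ∧ j' = j) ↔
        (k / n0 = k' / n0 ∧ i' / n0 = i / n0 ∧ j' / n0 = j / n0) ∧
        (k % n0 = k' % n0 ∧ i' % n0 = i % n0 ∧ j' % n0 = j % n0) := by
      rw [eq_iff_div_mod n0 k k', eq_iff_div_mod n0 i' i, eq_iff_div_mod n0 j' j]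
      exact ⟨fun ⟨a, b, c⟩ => ⟨⟨a.1, b.1, c.1⟩, ⟨a.2, b.2, c.2⟩⟩,
        fun ⟨a, b⟩ => ⟨⟨a.1, b.1⟩, ⟨a.2.1, b.2.1⟩, ⟨a.2.2, b.2.2⟩⟩⟩
    simp only [key]
    by_cases hP : k / n0 = k' / n0 ∧ i' / n0 = i / n0 ∧ j' / n0 = j / n0
    · by_cases hQ : k % n0 = k' % n0 ∧ i' % n0 = i % n0 ∧ j' % n0 = j % n0
      · rw [if_pos hP, if_pos hQ, if_pos ⟨hP, hQ⟩, one_mul]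
      · rw [if_pos hP, if_neg hQ, if_neg fun h => hQ h.2, mul_zero]
    · rw [if_neg hP, zero_mul, if_neg fun h => hP h.1]

/-- The recursive algorithm computes the matrix product. -/
theorem kronecker_mul {n0 r : ℕ} {U V W : ℕ → ℕ → F} (h0 : 0 < n0)
    (h : ∀ α < n0 * n0, ∀ β < n0 * n0, ∀ γ < n0 * n0,
      ∑ t ∈ Finset.range r, U t α * V t β * W γ t = if brent n0 α β γ then 1 else 0)
    (L : ℕ) (x y : ℕ → F) {i j : ℕ} (hi : i < n0 ^ L) (hj : j < n0 ^ L) :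
    mix (n0 * n0) r L W (fun a => mix r (n0 * n0) L U x L a 0 * mix r (n0 * n0) L V y L a 0) L
      (zIdx n0 L i j) 0 = ∑ k ∈ Finset.range (n0 ^ L), x (zIdx n0 L i k) * y (zIdx n0 L k j) := by
  simp only [mix_self, sum_zIdx h0]
  have e : ∀ a, kr (n0 * n0) r W L (zIdx n0 L i j) a *
      ((∑ i ∈ Finset.range (n0 ^ L), ∑ k ∈ Finset.range (n0 ^ L),
        kr r (n0 * n0) U L a (zIdx n0 L i k) * x (zIdx n0 L i k)) *
      ∑ k' ∈ Finset.range (n0 ^ L), ∑ j ∈ Finset.range (n0 ^ L),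
        kr r (n0 * n0) V L a (zIdx n0 L k' j) * y (zIdx n0 L k' j)) =
      ∑ i' ∈ Finset.range (n0 ^ L), ∑ k ∈ Finset.range (n0 ^ L),
        ∑ k' ∈ Finset.range (n0 ^ L), ∑ j' ∈ Finset.range (n0 ^ L),
        x (zIdx n0 L i' k) * y (zIdx n0 L k' j') * (kr r (n0 * n0) U L a (zIdx n0 L i' k) *
          kr r (n0 * n0) V L a (zIdx n0 L k' j') * kr (n0 * n0) r W L (zIdx n0 L i j) a) := by
    intro a
    rw [Finset.sum_mul, Finset.mul_sum]
    refine Finset.sum_congr rfl fun i' _ => ?_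
    rw [Finset.sum_mul, Finset.mul_sum]
    refine Finset.sum_congr rfl fun k _ => ?_
    rw [Finset.mul_sum, Finset.mul_sum]
    refine Finset.sum_congr rfl fun k' _ => ?_
    rw [Finset.mul_sum, Finset.mul_sum]
    refine Finset.sum_congr rfl fun j' _ => ?_
    ring
  simp only [e]
  -- After expanding the product of the two linear forms, the Brent equations leave only the terms
  -- with matching row, inner index and column.
  have e2 : ∀ i' < n0 ^ L, ∀ k < n0 ^ L, ∀ k' < n0 ^ L, ∀ j' < n0 ^ L,
      ∑ a ∈ Finset.range (r ^ L), x (zIdx n0 L i' k) * y (zIdx n0 L k' j') *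
        (kr r (n0 * n0) U L a (zIdx n0 L i' k) *
          kr r (n0 * n0) V L a (zIdx n0 L k' j') * kr (n0 * n0) r W L (zIdx n0 L i j) a) =
      if i' = i ∧ k' = k ∧ j' = j then x (zIdx n0 L i' k) * y (zIdx n0 L k' j') else 0 := by
    intro i' hi' k hk k' hk' j' hj'
    rw [← Finset.mul_sum, sum_kr_zIdx h0 h L hi' hk hk' hj' hi hj]
    by_cases hh : i' = i ∧ k' = k ∧ j' = j
    · rw [if_pos ⟨hh.2.1.symm, hh.1.symm, hh.2.2.symm⟩, if_pos hh, mul_one]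
    · rw [if_neg fun g => hh ⟨g.2.1.symm, g.1.symm, g.2.2.symm⟩, if_neg hh, mul_zero]
  rw [Finset.sum_comm]
  rw [Finset.sum_eq_single i]
  · rw [Finset.sum_comm]
    refine Finset.sum_congr rfl fun k hk => ?_
    rw [Finset.sum_comm, Finset.sum_eq_single k]
    · rw [Finset.sum_comm, Finset.sum_eq_single j]
      · rw [e2 i hi k (by simpa using hk) k (by simpa using hk) j hj]
        simp
      · intro j' hj' hne
        rw [e2 i hi k (by simpa using hk) k (by simpa using hk) j' (by simpa using hj')]
        simp [hne]
      · simp [hj]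
    · intro k' hk' hne
      rw [Finset.sum_comm]
      refine Finset.sum_eq_zero fun j' hj' => ?_
      rw [e2 i hi k (by simpa using hk) k' (by simpa using hk') j' (by simpa using hj')]
      simp [hne]
    · intro hh; exact absurd hk hh
  · intro i' hi' hne
    rw [Finset.sum_comm]
    refine Finset.sum_eq_zero fun k hk => ?_
    rw [Finset.sum_comm]
    refine Finset.sum_eq_zero fun k' hk' => ?_
    rw [Finset.sum_comm]
    refine Finset.sum_eq_zero fun j' hj' => ?_
    rw [e2 i' (by simpa using hi') k (by simpa using hk) k' (by simpa using hk') j'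
      (by simpa using hj')]
    simp [hne]
  · simp [hi]

end


/-! ## The search for a bilinear algorithm -/

/-- The digit `t` of `k` in base `b`. -/
def dg (b k t : ℕ) : ℕ := k / b ^ t % b

theorem div_pow_succ (b k p : ℕ) : k / b ^ p / b = k / b ^ (p + 1) := by
  rw [Nat.div_div_eq_div_mul, pow_succ]

theorem dg_lt {K b k : ℕ} (hb : b < K) (hk : k < K) (t : ℕ) : dg b k t < K := by
  rcases Nat.eq_zero_or_pos b with rfl | h
  · exact ((Nat.mod_le _ _).trans (Nat.div_le_self _ _)).trans_lt hk
  · exact (Nat.mod_lt _ h).trans hb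

/-- The entry of a table coded by the digit `x`. -/
def ent (M off sc x : ℕ) : ℕ := (x + off * (M - 1)) % M * sc % M

section
variable (N b k : ℕ)
/-- The candidate coded by the digits of `k` in base `b`: the size `cN`, the number `cR` of
products, the denominator `cD`, the offset `cO` of the entries, the modulus `cM` and the tables
`cU`, `cV` and `cW`. -/
def cN : ℕ := dg b k 0
def cR : ℕ := dg b k 1
def cD : ℕ := dg b k 2
def cO : ℕ := dg b k 3
def cE : ℕ := cN b k * cN b k
-- Modulo `cM` the denominator is invertible with inverse -(N + 1), and `cM` exceeds `N`, hence all
-- numbers of common neighbors that are computed. The scale `cM - (N + 1)` in `cW` is this inverse: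
-- it divides the table of the outputs by the denominator.
def cM : ℕ := cD b k * (N + 1) + 1
def cU (t α : ℕ) : ℕ := ent (cM N b k) (cO b k) 1 (dg b k (4 + (t * cE b k + α)))
def cV (t α : ℕ) : ℕ :=
  ent (cM N b k) (cO b k) 1 (dg b k (4 + cR b k * cE b k + (t * cE b k + α)))
def cW (γ t : ℕ) : ℕ := ent (cM N b k) (cO b k) (cM N b k - (N + 1))
  (dg b k (4 + cR b k * cE b k + cR b k * cE b k + (γ * cR b k + t)))

/-- The candidate is a bilinear algorithm modulo `cM`. -/
def Valid : Prop :=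
  (1 < cN b k ∧ 0 < cD b k ∧ cE b k ≤ cR b k) ∧
    ∀ α < cE b k, ∀ β < cE b k, ∀ γ < cE b k,
      (∑ t ∈ Finset.range (cR b k), cU N b k t α * cV N b k t β * cW N b k γ t) % cM N b k =
        if brent (cN b k) α β γ then 1 else 0

/-- The number of products of the recursive algorithm, cut off at `cap`. -/
def cQ (cap : ℕ) : ℕ := min (cR b k ^ Nat.clog (cN b k) N) cap
end

def digit (x : Var) : Cmd := x ::= ♯.ck % ♯.cb ;; .ck ::= ♯.ck / ♯.cb

def loadTab (T : Arr) (rows cols : Var) : Cmd :=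
  .loop .as rows (.loop .s cols
    (.put T .as .s ((♯.ck % ♯.cb + ♯.off * (♯.M - 1)) % ♯.M * ♯.sc % ♯.M) ;;
      .ck ::= ♯.ck / ♯.cb))

/-- Besides a nontrivial size and a positive denominator, `ok` demands that there are at least as
many products as matrix entries. This costs nothing, because 2 ≤ ω, and it bounds all intermediate
vectors by the number of products. -/
def header : Cmd :=
  .ck ::= ♯.kk ;; digit .n0 ;; digit .r ;; digit .D ;; digit .off ;;
  .e2 ::= ♯.n0 * ♯.n0 ;; .M ::= ♯.D * (♯.N + 1) + 1 ;;
  .ok ::= (1 ≺ ♯.n0) * ((0 ≺ ♯.D) * (1 - (♯.r ≺ ♯.e2)))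

def loadAll : Cmd :=
  .sc ::= 1 ;; loadTab .tU .r .e2 ;; loadTab .tV .r .e2 ;;
  .sc ::= ♯.M - (♯.N + 1) ;; loadTab .tW .e2 .r

def checkBrent : Cmd :=
  .loop .al .e2 (.loop .be .e2 (.loop .ga' .e2
    (.acc ::= 0 ;;
      .loop .tt .r
        (.acc ::= (♯.acc + .get .tU .tt .al * .get .tV .tt .be * .get .tW .ga' .tt) % ♯.M) ;;
      .want ::= .eq (♯.al % ♯.n0) (♯.be / ♯.n0) *
        (.eq (♯.ga' / ♯.n0) (♯.al / ♯.n0) * .eq (♯.ga' % ♯.n0) (♯.be % ♯.n0)) ;;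
      .ite (.eq (♯.acc) (♯.want)) .skip (.ok ::= 0))))

/-- Computes the least `L` with `n0 ^ L ≥ N`, provided that `lim` is at least this `L`, and the
power `r ^ L` cut off at `cap`. The cut keeps absurdly expensive candidates from overflowing. -/
def climb (lim : Var) : Cmd :=
  .pw ::= 1 ;; .L ::= 0 ;; .qq ::= 1 ;;
  .loop .as lim
    (.ite (♯.pw ≺ ♯.N)
      (.pw ::= ♯.pw * ♯.n0 ;; .L ::= ♯.L + 1 ;; .qq ::= ♯.qq * ♯.r ;;
        .ite (♯.cap ≺ ♯.qq) (.qq ::= ♯.cap) .skip) .skip)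

def candidate : Cmd :=
  header ;; .ite (♯.ok) (loadAll ;; checkBrent ;; climb .K) .skip

theorem spec_loop_time {E : Env} {p : Cmd} {s : St} {Q : St → Prop} {i lim : Var}
    (I : ℕ → St → Prop) (T : ℕ) (h0 : I 0 (s.set i 0))
    (hs : ∀ k < s.reg lim, ∀ s', Frame (.loop i lim p) s s' → s'.reg i = k → I k s' →
      Spec E p s' fun s'' => I (k + 1) (s''.set i (k + 1)) ∧ s''.time ≤ s'.time + T)
    (hQ : ∀ s', Frame (.loop i lim p) s s' → I (s.reg lim) s' →
      s'.time ≤ s.time + 1 + s.reg lim * (T + 1) → Q s') :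
    Spec E (.loop i lim p) s Q := by
  refine spec_loop (fun k s' => I k s' ∧ s'.time ≤ s.time + 1 + k * (T + 1))
    ⟨h0, by simp⟩ ?_ (fun s' hF h => hQ s' hF h.1 h.2)
  rintro k hk s1 hF hi ⟨h1, h2⟩
  refine (hs k hk s1 hF hi h1).mono ?_
  rintro s2 - - ⟨h3, h4⟩
  refine ⟨h3, ?_⟩
  simp only [St.set_time, add_mul]
  omega

theorem spec_loop_check {E : Env} {p : Cmd} {s : St} {i lim : Var} (P : ℕ → Prop) (T : ℕ)
    (hi : i ≠ .ok)
    (hs : ∀ k < s.reg lim, ∀ s', Frame (.loop i lim p) s s' → s'.reg i = k →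
      Spec E p s' fun s'' => (s''.reg .ok ≠ 0 ↔ s'.reg .ok ≠ 0 ∧ P k) ∧
        s''.time ≤ s'.time + T) :
    Spec E (.loop i lim p) s fun s' => (s'.reg .ok ≠ 0 ↔ s.reg .ok ≠ 0 ∧ ∀ k < s.reg lim, P k) ∧
      s'.time ≤ s.time + 1 + s.reg lim * (T + 1) := by
  refine spec_loop_time (fun k s' => s'.reg .ok ≠ 0 ↔ s.reg .ok ≠ 0 ∧ ∀ l < k, P l) T
    (by simp [hi.symm]) ?_ (fun s' _ h1 h2 => ⟨h1, h2⟩)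
  intro k hk s1 hF1 hi1 h1
  refine (hs k hk s1 hF1 hi1).mono ?_
  rintro s2 - - ⟨h2, h3⟩
  refine ⟨?_, h3⟩
  rw [St.set_reg, if_neg hi.symm, h2, h1, Nat.forall_lt_succ_right, and_assoc]

section
variable {E : Env} {s : St}

theorem loadTab_spec {T : Arr} {rows cols : Var} {k p : ℕ} (hM : 0 < s.reg .M)
    (hc : cols ∉ (loadTab T rows cols).wr)
    (hck : s.reg .ck = k / s.reg .cb ^ p) (hwd : s.reg .M < E.wd) :
    Spec E (loadTab T rows cols) s fun s' =>
      (∀ i < s.reg rows, ∀ j < s.reg cols, s'.arr T i j =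
        ent (s.reg .M) (s.reg .off) (s.reg .sc) (dg (s.reg .cb) k (p + (i * s.reg cols + j)))) ∧
      s'.reg .ck = k / s.reg .cb ^ (p + s.reg rows * s.reg cols) ∧
      s'.time ≤ s.time + 1 + s.reg rows * (s.reg cols * 3 + 2) := by
  simp only [loadTab, Cmd.wr, List.mem_cons, List.mem_append, List.not_mem_nil, or_false, false_or,
    not_or] at hc
  refine spec_loop_time (fun i s' => (∀ i' < i, ∀ j < s.reg cols, s'.arr T i' j =
        ent (s.reg .M) (s.reg .off) (s.reg .sc) (dg (s.reg .cb) k (p + (i' * s.reg cols + j)))) ∧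
      s'.reg .ck = k / s.reg .cb ^ (p + i * s.reg cols)) (s.reg cols * 3 + 1) (by simp [hck]) ?_
    (fun s' _ h1 h2 => ⟨h1.1, h1.2, h2⟩)
  rintro i hi s1 hF1 hi1 ⟨h1, h2⟩
  have c1 := hF1.1 cols (by simp [Cmd.wr]; tauto)
  have cb1 := hF1.1 .cb (by simp [Cmd.wr])
  have M1 := hF1.1 .M (by simp [Cmd.wr])
  have off1 := hF1.1 .off (by simp [Cmd.wr])
  have sc1 := hF1.1 .sc (by simp [Cmd.wr])
  refine spec_loop_time (fun j s' => (∀ i' < i, ∀ j < s.reg cols, s'.arr T i' j =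
        ent (s.reg .M) (s.reg .off) (s.reg .sc) (dg (s.reg .cb) k (p + (i' * s.reg cols + j)))) ∧
      (∀ j' < j, s'.arr T i j' = ent (s.reg .M) (s.reg .off) (s.reg .sc)
        (dg (s.reg .cb) k (p + (i * s.reg cols + j')))) ∧
      s'.reg .ck = k / s.reg .cb ^ (p + (i * s.reg cols + j))) 2 ?_ ?_ ?_
  · exact ⟨by simpa using h1, by simp, by simp [h2]⟩
  · rintro j hj s2 hF2 hj2 ⟨h3, h4, h5⟩
    have cb2 := hF2.1 .cb (by simp [Cmd.wr])
    have M2 := hF2.1 .M (by simp [Cmd.wr])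
    have off2 := hF2.1 .off (by simp [Cmd.wr])
    have sc2 := hF2.1 .sc (by simp [Cmd.wr])
    have as2 := hF2.1 .as (by simp [Cmd.wr])
    have hval : (s2.reg .ck % s2.reg .cb + s2.reg .off * (s2.reg .M - 1)) % s2.reg .M * s2.reg .sc %
        s2.reg .M = ent (s.reg .M) (s.reg .off) (s.reg .sc)
          (dg (s.reg .cb) k (p + (i * s.reg cols + j))) := by
      rw [M2, M1, cb2, cb1, off2, off1, sc2, sc1, h5, ent, dg]
    rw [spec_seq, spec_put, spec_assign]
    simp only [Term.val_mod, Term.val_mul, Term.val_add, Term.val_sub, Term.val_reg, Term.val_ofNat,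
      hval, as2, hi1, hj2]
    refine ⟨fun _ => (Nat.mod_lt _ hM).trans hwd, by simp, ⟨?_, ?_, ?_⟩, by simp⟩
    · intro i' hi' j' hj'
      simp [show i' ≠ i by omega]
      exact h3 i' hi' j' hj'
    · intro j' hj'
      rcases Nat.lt_succ_iff_lt_or_eq.1 hj' with h | rfl
      · simp [show j' ≠ j by omega]
        exact h4 j' h
      · simp
    · simp [h5, cb2, cb1, div_pow_succ, ← add_assoc]
  · rintro s2 hF2 ⟨h3, h4, h5⟩ h6
    rw [c1] at h4 h5 h6
    refine ⟨⟨?_, ?_⟩, by omega⟩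
    · intro i' hi' j hj
      rcases Nat.lt_succ_iff_lt_or_eq.1 hi' with h | rfl
      · simpa using h3 i' h j hj
      · simpa using h4 j hj
    · simp [h5, Nat.succ_mul]

theorem climb_spec {lim : Var} {N n0 r cap : ℕ} (hl : lim ∉ (climb lim).wr) (hN : s.reg .N = N)
    (hn : s.reg .n0 = n0) (hr : s.reg .r = r) (hcap : s.reg .cap = cap) (hn0 : 1 < n0)
    (hr0 : 0 < r) (hcap0 : 0 < cap) (h1 : N * n0 < E.wd) (h2 : cap * r < E.wd) :
    Spec E (climb lim) s fun s' => s'.reg .L = min (s.reg lim) (Nat.clog n0 N) ∧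
      s'.reg .qq = min (r ^ min (s.reg lim) (Nat.clog n0 N)) cap ∧
      s'.time ≤ s.time + 4 + 8 * s.reg lim := by
  simp only [climb, Cmd.wr, List.mem_cons, List.mem_append, List.not_mem_nil, or_false, false_or,
    not_or] at hl
  simp only [climb, spec_seq, spec_assign]
  refine ⟨by simp, by simp, by simp, ?_⟩
  refine spec_loop_time (fun k s' => s'.reg .L = min k (Nat.clog n0 N) ∧
    s'.reg .pw = n0 ^ min k (Nat.clog n0 N) ∧
    s'.reg .qq = min (r ^ min k (Nat.clog n0 N)) cap) 7 ?_ ?_ ?_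
  · simp; omega
  · rintro k hk s1 hF1 hi ⟨h3, h4, h5⟩
    have N1 := hF1.1 .N (by simp [Cmd.wr])
    have n1 := hF1.1 .n0 (by simp [Cmd.wr])
    have r1 := hF1.1 .r (by simp [Cmd.wr])
    have cap1 := hF1.1 .cap (by simp [Cmd.wr])
    simp [hN, hn, hr, hcap] at N1 n1 r1 cap1
    by_cases h : k < Nat.clog n0 N
    · have e1 : min k (Nat.clog n0 N) = k := by omega
      have e2 : min (k + 1) (Nat.clog n0 N) = k + 1 := by omega
      rw [e1] at h3 h4 h5
      rw [e2]
      have h6 : s1.reg .pw < N := by rw [h4]; exact (Nat.lt_clog_iff_pow_lt hn0).1 h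
      rw [spec_ite_of_ne (by simp [N1, h6])]
      simp only [spec_seq, spec_assign]
      have b1 : s1.reg .pw * n0 < E.wd := (Nat.mul_le_mul_right _ h6.le).trans_lt h1
      have b2 : s1.reg .qq * r < E.wd :=
        (Nat.mul_le_mul_right _ (by rw [h5]; exact min_le_right _ _)).trans_lt h2
      refine ⟨by simpa [n1] using b1, by simp, by simpa [r1] using b2, ?_⟩
      by_cases h7 : cap < s1.reg .qq * r
      · rw [spec_ite_of_ne (by simp [cap1, r1, h7]), spec_assign]
        refine ⟨by simp, ⟨by simp [h3], by simp [h4, n1, pow_succ], ?_⟩, by simp⟩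
        simp [cap1]
        rw [h5] at h7
        rw [pow_succ]
        exact h7.le.trans (Nat.mul_le_mul_right _ (min_le_left _ _))
      · rw [spec_ite_of_eq (by simp [cap1, r1, h7]), spec_skip]
        refine ⟨⟨by simp [h3], by simp [h4, n1, pow_succ], ?_⟩, by simp⟩
        simp [r1]
        rw [h5] at h7 ⊢
        rcases le_total (r ^ k) cap with h8 | h8
        · rw [min_eq_left h8, ← pow_succ] at h7 ⊢
          rw [min_eq_left (by omega)]
        · rw [min_eq_right h8] at h7 ⊢
          -- The power has already reached the positive `cap` and one more factor does not exceed
          -- it, so the factor is 1.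
          have : r = 1 := by
            by_contra hne
            have : cap * 2 ≤ cap * r := Nat.mul_le_mul_left _ (by omega)
            omega
          subst this
          simp at h8 ⊢
          omega
    · have e1 : min k (Nat.clog n0 N) = Nat.clog n0 N := by omega
      have e2 : min (k + 1) (Nat.clog n0 N) = Nat.clog n0 N := by omega
      rw [e1] at h3 h4 h5
      rw [e2]
      have h6 : ¬ s1.reg .pw < N := by
        rw [h4]; exact fun hh => lt_irrefl _ ((Nat.lt_clog_iff_pow_lt hn0).2 hh)
      rw [spec_ite_of_eq (by simp [N1, h6]), spec_skip]
      exact ⟨⟨by simpa using h3, by simpa using h4, by simpa using h5⟩, by simp⟩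
  · rintro s1 hF1 ⟨h3, h4, h5⟩ h6
    have e : ((((s.set .pw 1).set .L 0).set .qq 1).reg lim) = s.reg lim := by
      simp [hl]
    simp only [Term.val_ofNat, e] at h3 h4 h5 h6
    exact ⟨h3, h5, by simp at h6; omega⟩

end


section
variable {E : Env} {s : St}

theorem checkBrent_spec {n0 e r M : ℕ} {U V W : ℕ → ℕ → ℕ} (hn : s.reg .n0 = n0)
    (he : s.reg .e2 = e) (hr : s.reg .r = r) (hM : s.reg .M = M) (hM1 : 1 < M) (hwd : M < E.wd)
    (hU : ∀ t < r, ∀ α < e, s.arr .tU t α = U t α) (hV : ∀ t < r, ∀ α < e, s.arr .tV t α = V t α)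
    (hW : ∀ γ < e, ∀ t < r, s.arr .tW γ t = W γ t) :
    Spec E checkBrent s fun s' =>
      (s'.reg .ok ≠ 0 ↔ s.reg .ok ≠ 0 ∧ ∀ α < e, ∀ β < e, ∀ γ < e,
        (∑ t ∈ Finset.range r, U t α * V t β * W γ t) % M = if brent n0 α β γ then 1 else 0) ∧
      s'.time ≤ s.time + 1 + e * (e * (e * (2 * r + 7) + 2) + 2) := by
  have key := spec_loop_check (E := E) (s := s) (i := .al) (lim := .e2) (p := .loop .be .e2 (.loop .ga' .e2
    (.acc ::= 0 ;;
      .loop .tt .r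
        (.acc ::= (♯.acc + .get .tU .tt .al * .get .tV .tt .be * .get .tW .ga' .tt) % ♯.M) ;;
      .want ::= .eq (♯.al % ♯.n0) (♯.be / ♯.n0) *
        (.eq (♯.ga' / ♯.n0) (♯.al / ♯.n0) * .eq (♯.ga' % ♯.n0) (♯.be % ♯.n0)) ;;
      .ite (.eq (♯.acc) (♯.want)) .skip (.ok ::= 0))))
    (fun α => ∀ β < e, ∀ γ < e,
        (∑ t ∈ Finset.range r, U t α * V t β * W γ t) % M = if brent n0 α β γ then 1 else 0)
    (1 + e * (e * (2 * r + 7) + 2)) (by decide) ?_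
  · refine key.mono ?_
    rintro s1 - - ⟨h1, h2⟩
    rw [he] at h1 h2
    exact ⟨h1, h2.trans (le_of_eq (by ring))⟩
  intro α hα s1 hF1 hi1
  rw [he] at hα
  have e1 := hF1.1 .e2 (by decide)
  rw [he] at e1
  have key := spec_loop_check (E := E) (s := s1) (i := .be) (lim := .e2) (p := .loop .ga' .e2
    (.acc ::= 0 ;;
      .loop .tt .r
        (.acc ::= (♯.acc + .get .tU .tt .al * .get .tV .tt .be * .get .tW .ga' .tt) % ♯.M) ;;
      .want ::= .eq (♯.al % ♯.n0) (♯.be / ♯.n0) *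
        (.eq (♯.ga' / ♯.n0) (♯.al / ♯.n0) * .eq (♯.ga' % ♯.n0) (♯.be % ♯.n0)) ;;
      .ite (.eq (♯.acc) (♯.want)) .skip (.ok ::= 0)))
    (fun β => ∀ γ < e,
        (∑ t ∈ Finset.range r, U t α * V t β * W γ t) % M = if brent n0 α β γ then 1 else 0)
    (1 + e * (2 * r + 7)) (by decide) ?_
  · refine key.mono ?_
    rintro s2 - - ⟨h1, h2⟩
    rw [e1] at h1 h2
    exact ⟨h1, h2.trans (le_of_eq (by ring))⟩
  intro β hβ s2 hF2 hi2
  rw [e1] at hβ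
  have e2 := hF2.1 .e2 (by decide)
  have al2 := hF2.1 .al (by decide)
  rw [e1] at e2
  rw [hi1] at al2
  have key := spec_loop_check (E := E) (s := s2) (i := .ga') (lim := .e2) (p :=
    .acc ::= 0 ;;
      .loop .tt .r
        (.acc ::= (♯.acc + .get .tU .tt .al * .get .tV .tt .be * .get .tW .ga' .tt) % ♯.M) ;;
      .want ::= .eq (♯.al % ♯.n0) (♯.be / ♯.n0) *
        (.eq (♯.ga' / ♯.n0) (♯.al / ♯.n0) * .eq (♯.ga' % ♯.n0) (♯.be % ♯.n0)) ;;
      .ite (.eq (♯.acc) (♯.want)) .skip (.ok ::= 0))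
    (fun γ =>
        (∑ t ∈ Finset.range r, U t α * V t β * W γ t) % M = if brent n0 α β γ then 1 else 0)
    (2 * r + 6) (by decide) ?_
  · refine key.mono ?_
    rintro s3 - - ⟨h1, h2⟩
    rw [e2] at h1 h2
    exact ⟨h1, h2.trans (le_of_eq (by ring))⟩
  intro γ hγ s3 hF3 hi3
  rw [e2] at hγ
  have al3 := hF3.1 .al (by decide)
  have be3 := hF3.1 .be (by decide)
  have r3 : s3.reg .r = r := by
    rw [hF3.1 .r (by decide), hF2.1 .r (by decide), hF1.1 .r (by decide), hr]
  have M3 : s3.reg .M = M := by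
    rw [hF3.1 .M (by decide), hF2.1 .M (by decide), hF1.1 .M (by decide), hM]
  have n3 : s3.reg .n0 = n0 := by
    rw [hF3.1 .n0 (by decide), hF2.1 .n0 (by decide), hF1.1 .n0 (by decide), hn]
  have U3 : s3.arr .tU = s.arr .tU := by
    rw [hF3.2 .tU (by decide), hF2.2 .tU (by decide), hF1.2 .tU (by decide)]
  have V3 : s3.arr .tV = s.arr .tV := by
    rw [hF3.2 .tV (by decide), hF2.2 .tV (by decide), hF1.2 .tV (by decide)]
  have W3 : s3.arr .tW = s.arr .tW := by
    rw [hF3.2 .tW (by decide), hF2.2 .tW (by decide), hF1.2 .tW (by decide)]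
  rw [al2] at al3
  rw [hi2] at be3
  rw [spec_seq, spec_assign, spec_seq]
  refine ⟨by simp, ?_⟩
  refine spec_loop_time (fun k s' => s'.reg .acc =
    (∑ t ∈ Finset.range k, U t α * V t β * W γ t) % M) 1 (by simp) ?_ ?_
  · rintro t ht s4 hF4 hi4 h4
    have al4 := hF4.1 .al (by decide)
    have be4 := hF4.1 .be (by decide)
    have ga4 := hF4.1 .ga' (by decide)
    have M4 := hF4.1 .M (by decide)
    have U4 := hF4.2 .tU (by decide)
    have V4 := hF4.2 .tV (by decide)
    have W4 := hF4.2 .tW (by decide)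
    simp [al3, be3, hi3, M3, U3, V3, W3] at al4 be4 ga4 M4 U4 V4 W4
    simp [r3] at ht
    rw [spec_assign]
    have hval : (s4.reg .acc + s4.arr .tU (s4.reg .tt) (s4.reg .al) *
        s4.arr .tV (s4.reg .tt) (s4.reg .be) * s4.arr .tW (s4.reg .ga') (s4.reg .tt)) % s4.reg .M =
        (∑ t ∈ Finset.range (t + 1), U t α * V t β * W γ t) % M := by
      rw [h4, hi4, al4, be4, ga4, M4, U4, V4, W4, hU t ht α hα, hV t ht β hβ, hW γ hγ t ht,
        Finset.sum_range_succ, Nat.mod_add_mod]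
    simp only [Term.val_mod, Term.val_mul, Term.val_add, Term.val_reg, Term.val_get, hval]
    exact ⟨fun _ => (Nat.mod_lt _ (by omega)).trans hwd, by simp, by simp⟩
  · rintro s4 hF4 h4 h5
    have n4 := hF4.1 .n0 (by decide)
    have al4 := hF4.1 .al (by decide)
    have be4 := hF4.1 .be (by decide)
    have ga4 := hF4.1 .ga' (by decide)
    have ok4 := hF4.1 .ok (by decide)
    simp [al3, be3, hi3, n3, r3] at al4 be4 ga4 n4 ok4 h4 h5
    have hw : (if α % n0 = β / n0 then 1 else 0) * ((if γ / n0 = α / n0 then 1 else 0) *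
        (if γ % n0 = β % n0 then 1 else 0)) = if brent n0 α β γ then 1 else 0 := by
      by_cases a1 : α % n0 = β / n0 <;> by_cases a2 : γ / n0 = α / n0 <;>
        by_cases a3 : γ % n0 = β % n0 <;> simp [brent, a1, a2, a3]
    have hw1 : (if brent n0 α β γ then 1 else 0) < E.wd := by split_ifs <;> omega
    rw [spec_seq, spec_assign]
    simp only [Term.val_mul, Term.val_eq, Term.val_mod, Term.val_div, Term.val_reg, n4, al4, be4,
      ga4, hw]
    refine ⟨fun _ => hw1, ?_⟩
    by_cases h : (∑ t ∈ Finset.range r, U t α * V t β * W γ t) % M =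
        if brent n0 α β γ then 1 else 0
    · rw [spec_ite_of_ne (by simp [h4, h]), spec_skip]
      refine ⟨by simp [h, ok4], by simp; omega⟩
    · rw [spec_ite_of_eq (by simp [h4, h]), spec_assign]
      refine ⟨by simp, by simp [h], by simp; omega⟩

/-- The state holds the candidate coded by `k` in base `b`. -/
structure CRep (s : St) (N b k cap : ℕ) : Prop where
  n0 : s.reg .n0 = cN b k
  e2 : s.reg .e2 = cE b k
  r : s.reg .r = cR b k
  M : s.reg .M = cM N b k
  L : s.reg .L = Nat.clog (cN b k) N
  qq : s.reg .qq = cQ N b k cap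
  U : ∀ t < cR b k, ∀ α < cE b k, s.arr .tU t α = cU N b k t α
  V : ∀ t < cR b k, ∀ α < cE b k, s.arr .tV t α = cV N b k t α
  W : ∀ γ < cE b k, ∀ t < cR b k, s.arr .tW γ t = cW N b k γ t

theorem header_spec {N K b k : ℕ} (hb : s.reg .cb = b) (hk : s.reg .kk = k) (hN : s.reg .N = N)
    (hbK : b < K) (hkK : k < K) (hwd : K * (K + N + 2) < E.wd) :
    Spec E header s fun s' => s'.reg .n0 = cN b k ∧ s'.reg .r = cR b k ∧ s'.reg .off = cO b k ∧
      s'.reg .e2 = cE b k ∧ s'.reg .M = cM N b k ∧ s'.reg .ck = k / b ^ 4 ∧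
      (s'.reg .ok ≠ 0 ↔ 1 < cN b k ∧ 0 < cD b k ∧ cE b k ≤ cR b k) ∧ s'.time ≤ s.time + 12 := by
  have hw : K * (K + N + 2) = K * K + K * N + 2 * K := by ring
  have hw2 : K * (N + 1) = K * N + K := by ring
  have h0 := dg_lt hbK hkK 0
  have h2 := dg_lt hbK hkK 2
  have d0 : k % b = cN b k := by simp [cN, dg]
  have d1 : k / b % b = cR b k := by simp [cR, dg]
  have d2 : k / b / b % b = cD b k := by rw [cD, dg, pow_two, Nat.div_div_eq_div_mul]
  have d3 : k / b / b / b % b = cO b k := by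
    rw [cO, dg, Nat.div_div_eq_div_mul, Nat.div_div_eq_div_mul, pow_succ, pow_two, mul_assoc]
  have d4 : k / b / b / b / b = k / b ^ 4 := by
    rw [Nat.div_div_eq_div_mul, Nat.div_div_eq_div_mul, Nat.div_div_eq_div_mul]
    congr 1
    ring
  have b1 : cN b k * cN b k < E.wd := by
    have : cN b k * cN b k ≤ K * K := Nat.mul_le_mul h0.le h0.le
    omega
  have b2 : cD b k * (N + 1) + 1 < E.wd := by
    have : cD b k * (N + 1) ≤ K * (N + 1) := Nat.mul_le_mul_right _ h2.le
    omega
  have b3 : 2 < E.wd := by omega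
  simp only [header, digit, spec_seq, spec_assign]
  simp [hb, hk, hN, d0, d1, d2, d3, d4, b1, b2]
  refine ⟨?_, rfl, rfl, ?_⟩
  · split_ifs <;> omega
  · rw [cE]
    by_cases a3 : cR b k < cN b k * cN b k
    · rw [if_pos a3]
      omega
    · rw [if_neg a3]
      omega

theorem candidate_spec {N K b k cap : ℕ} (hb : s.reg .cb = b) (hk : s.reg .kk = k)
    (hN : s.reg .N = N) (hK : s.reg .K = K) (hcap : s.reg .cap = cap)
    (hbK : b < K) (hkK : k < K) (hKN : Nat.clog 2 N ≤ K) (hcap0 : 0 < cap)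
    (hwd : K * (K + N + 2 + cap) < E.wd) :
    Spec E candidate s fun s' => (s'.reg .ok ≠ 0 ↔ Valid N b k) ∧
      (Valid N b k → CRep s' N b k cap) ∧ s'.time ≤ s.time + 80 * K ^ 4 := by
  have hK0 : 1 ≤ K := by omega
  have hw : K * (K + N + 2 + cap) = K * K + N * K + 2 * K + cap * K := by ring
  have hw2 : K * (N + 1) = N * K + K := by ring
  have hKp : K ≤ K ^ 4 := Nat.le_self_pow (by omega) K
  have hwd1 : K * (K + N + 2) < E.wd := (Nat.mul_le_mul_left _ (by omega)).trans_lt hwd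
  rw [candidate, spec_seq]
  refine Spec.mono (header_spec hb hk hN hbK hkK hwd1) ?_
  rintro s1 hF1 - ⟨g1, g2, g3, g4, g5, g6, g7, g8⟩
  by_cases h : 1 < cN b k ∧ 0 < cD b k ∧ cE b k ≤ cR b k
  swap
  · have := g7.not.2 h
    rw [not_not] at this
    rw [spec_ite_of_eq (by simpa using this), spec_skip]
    refine ⟨⟨fun h' => absurd this h', fun h' => absurd h'.1 h⟩, fun h' => absurd h'.1 h, ?_⟩
    simp; omega
  have hok := g7.2 h
  rw [spec_ite_of_ne (by simpa using hok)]
  have N1 : s1.reg .N = N := by rw [hF1.1 .N (by decide), hN]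
  have K1 : s1.reg .K = K := by rw [hF1.1 .K (by decide), hK]
  have cap1 : s1.reg .cap = cap := by rw [hF1.1 .cap (by decide), hcap]
  have cb1 : s1.reg .cb = b := by rw [hF1.1 .cb (by decide), hb]
  have hr : cR b k < K := dg_lt hbK hkK 1
  have he : cE b k < K := h.2.2.trans_lt hr
  have hM1 : 1 < cM N b k := by
    rw [cM]
    have : 1 * 1 ≤ cD b k * (N + 1) := Nat.mul_le_mul h.2.1 (by omega)
    omega
  have hMwd : cM N b k < E.wd := by
    have : cD b k * (N + 1) ≤ K * (N + 1) := Nat.mul_le_mul_right _ (dg_lt hbK hkK 2).le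
    rw [cM]
    omega
  have hre : cR b k * (cE b k * 3 + 2) ≤ K * (K * 3 + 2) :=
    Nat.mul_le_mul hr.le (by omega)
  have hre' : cE b k * (cR b k * 3 + 2) ≤ K * (K * 3 + 2) :=
    Nat.mul_le_mul he.le (by omega)
  rw [spec_seq]
  simp only [loadAll, spec_seq, spec_assign]
  refine ⟨by simp, ?_⟩
  refine Spec.mono (loadTab_spec (k := k) (p := 4) (by simp [g5]; omega) (by decide)
    (by simp [g6, cb1]) (by simpa [g5] using hMwd)) ?_
  rintro s2 hF2 - ⟨a1, a2, a3⟩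
  simp [g2, g3, g4, g5, cb1] at a1 a2 a3
  have r2 := hF2.1 .r (by decide)
  have e2 := hF2.1 .e2 (by decide)
  have M2 := hF2.1 .M (by decide)
  have off2 := hF2.1 .off (by decide)
  have sc2 := hF2.1 .sc (by decide)
  have cb2 := hF2.1 .cb (by decide)
  have N2 := hF2.1 .N (by decide)
  simp [g2, g3, g4, g5, cb1, N1] at r2 e2 M2 off2 sc2 cb2 N2
  refine Spec.mono (loadTab_spec (k := k) (p := 4 + cR b k * cE b k) (by rw [M2]; omega) (by decide)
    (by rw [a2, cb2]) (by rwa [M2])) ?_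
  rintro s3 hF3 - ⟨b1, b2, b3⟩
  rw [r2, e2, cb2] at b2
  rw [r2, e2] at b3
  rw [r2, e2, M2, off2, sc2, cb2] at b1
  have r3 := hF3.1 .r (by decide)
  have e3 := hF3.1 .e2 (by decide)
  have M3 := hF3.1 .M (by decide)
  have off3 := hF3.1 .off (by decide)
  have cb3 := hF3.1 .cb (by decide)
  have N3 := hF3.1 .N (by decide)
  rw [r2] at r3
  rw [e2] at e3
  rw [M2] at M3
  rw [off2] at off3
  rw [cb2] at cb3
  rw [N2] at N3
  refine ⟨by simp, ?_⟩
  refine Spec.mono (loadTab_spec (k := k) (p := 4 + cR b k * cE b k + cR b k * cE b k)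
    (by simp [M3]; omega) (by decide) (by simp [b2, cb3]) (by simpa [M3] using hMwd)) ?_
  rintro s4 hF4 - ⟨c1, c2, c3⟩
  simp [r3, e3, M3, off3, cb3, N3] at c1 c3
  have r4 := hF4.1 .r (by decide)
  have e4 := hF4.1 .e2 (by decide)
  have M4 := hF4.1 .M (by decide)
  have n4 : s4.reg .n0 = cN b k := by
    rw [hF4.1 .n0 (by decide)]
    simp [hF3.1 .n0 (by decide), hF2.1 .n0 (by decide), g1]
  have ok4 : s4.reg .ok = s1.reg .ok := by
    rw [hF4.1 .ok (by decide)]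
    simp [hF3.1 .ok (by decide), hF2.1 .ok (by decide)]
  have N4 : s4.reg .N = N := by
    rw [hF4.1 .N (by decide)]
    simp [N3]
  have K4 : s4.reg .K = K := by
    rw [hF4.1 .K (by decide)]
    simp [hF3.1 .K (by decide), hF2.1 .K (by decide), K1]
  have cap4 : s4.reg .cap = cap := by
    rw [hF4.1 .cap (by decide)]
    simp [hF3.1 .cap (by decide), hF2.1 .cap (by decide), cap1]
  simp [r3, e3, M3] at r4 e4 M4
  have U4 : ∀ t < cR b k, ∀ α < cE b k, s4.arr .tU t α = cU N b k t α := by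
    intro t ht α hα
    rw [hF4.2 .tU (by decide), St.set_arr, hF3.2 .tU (by decide), a1 t ht α hα]
    rfl
  have V4 : ∀ t < cR b k, ∀ α < cE b k, s4.arr .tV t α = cV N b k t α := by
    intro t ht α hα
    rw [hF4.2 .tV (by decide), St.set_arr, b1 t ht α hα]
    rfl
  refine Spec.mono (checkBrent_spec n4 e4 r4 M4 hM1 hMwd U4 V4 c1) ?_
  rintro s5 hF5 - ⟨d1, d2⟩
  have qb : cap * cR b k < E.wd := by
    have : cap * cR b k ≤ cap * K := Nat.mul_le_mul_left _ hr.le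
    omega
  have nb : N * cN b k < E.wd := by
    have : N * cN b k ≤ N * K := Nat.mul_le_mul_left _ (dg_lt hbK hkK 0).le
    omega
  refine Spec.mono (climb_spec (lim := .K) (by decide) (N := N) (n0 := cN b k) (r := cR b k) (cap := cap)
    (by rw [hF5.1 .N (by decide), N4]) (by rw [hF5.1 .n0 (by decide), n4])
    (by rw [hF5.1 .r (by decide), r4]) (by rw [hF5.1 .cap (by decide), cap4]) h.1
    (lt_of_lt_of_le (by have := h.1; rw [cE]; positivity) h.2.2) hcap0 nb qb) ?_
  rintro s6 hF6 - ⟨f1, f2, f3⟩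
  rw [hF5.1 .K (by decide), K4] at f1 f2 f3
  have hmin : min K (Nat.clog (cN b k) N) = Nat.clog (cN b k) N :=
    min_eq_right ((Nat.clog_anti_left (by omega) h.1).trans hKN)
  rw [hmin] at f1 f2
  refine ⟨?_, fun _ => ⟨?_, ?_, ?_, ?_, f1, f2, ?_, ?_, ?_⟩, ?_⟩
  · rw [hF6.1 .ok (by decide), d1, ok4]
    exact ⟨fun h' => ⟨h, h'.2⟩, fun h' => ⟨hok, h'.2⟩⟩
  · rw [hF6.1 .n0 (by decide), hF5.1 .n0 (by decide), n4]
  · rw [hF6.1 .e2 (by decide), hF5.1 .e2 (by decide), e4]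
  · rw [hF6.1 .r (by decide), hF5.1 .r (by decide), r4]
  · rw [hF6.1 .M (by decide), hF5.1 .M (by decide), M4]
  · rw [hF6.2 .tU (by decide), hF5.2 .tU (by decide)]; exact U4
  · rw [hF6.2 .tV (by decide), hF5.2 .tV (by decide)]; exact V4
  · rw [hF6.2 .tW (by decide), hF5.2 .tW (by decide)]; exact c1
  · have t1 : cE b k * (cE b k * (cE b k * (2 * cR b k + 7) + 2) + 2) ≤
        K * (K * (K * (2 * K + 7) + 2) + 2) := by gcongr
    have t2 : K * (K * (K * (2 * K + 7) + 2) + 2) = 2 * K ^ 4 + 7 * K ^ 3 + 2 * K ^ 2 + 2 * K := by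
      ring
    have t3 : K ^ 3 ≤ K ^ 4 := Nat.pow_le_pow_right hK0 (by omega)
    have t4 : K ^ 2 ≤ K ^ 4 := Nat.pow_le_pow_right hK0 (by omega)
    have t5 : K * (K * 3 + 2) = 3 * K ^ 2 + 2 * K := by ring
    omega

end


/-- The term `c₁ N ^ A`. -/
def capT (c₁ : ℕ) : ℕ → Term
  | 0 => .const c₁
  | A + 1 => capT c₁ A * ♯.N

theorem val_capT (s : St) (c₁ A : ℕ) : (capT c₁ A).val s = c₁ * s.reg .N ^ A := by
  induction A with
  | zero => simp [capT]
  | succ A ih => simp [capT, ih, pow_succ, mul_assoc]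

def tryAll : Cmd :=
  .loop .cb .K (.loop .kk .K
    (candidate ;;
      .ite (♯.ok) (.ite (♯.qq ≺ ♯.bq) (.bq ::= ♯.qq ;; .fb ::= ♯.cb ;; .fk ::= ♯.kk) .skip) .skip))

/-- Find the best candidate for matrices of size `N`. -/
def search (c₁ A K₀ : ℕ) : Cmd :=
  -- With these values `climb` merely computes the logarithm of `N`.
  .n0 ::= 2 ;; .r ::= 1 ;; .cap ::= 1 ;; climb .N ;; .K ::= ♯.L + .const K₀ ;;
  .cap ::= capT c₁ A ;; .bq ::= ♯.cap ;; .fb ::= 0 ;; .fk ::= 0 ;; tryAll ;;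
  -- The tables in memory belong to the last candidate tried, so those of the winner are loaded
  -- again.
  .cb ::= ♯.fb ;; .kk ::= ♯.fk ;; candidate

/-- `q` is the least cost of a candidate. -/
structure IsBestQ (N K cap q : ℕ) : Prop where
  le_cap : q ≤ cap
  le : ∀ b < K, ∀ k < K, Valid N b k → q ≤ cQ N b k cap
  att : q < cap → ∃ b < K, ∃ k < K, Valid N b k ∧ cQ N b k cap = q

theorem IsBestQ.le_of {N K cap q q' : ℕ} (h : IsBestQ N K cap q) (h' : IsBestQ N K cap q') :
    q ≤ q' := by
  by_contra hlt
  obtain ⟨b, hb, k, hk, hv, hq⟩ := h'.att (by have := h.le_cap; omega)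
  have := h.le b hb k hk hv
  omega

/-- Uniqueness identifies the number found by the program with the abstract minimum `bestQ`, in
terms of which all costs are stated. -/
theorem IsBestQ.eq {N K cap q q' : ℕ} (h : IsBestQ N K cap q) (h' : IsBestQ N K cap q') :
    q = q' := le_antisymm (h.le_of h') (h'.le_of h)

section
variable {E : Env} {s : St}

/-- The best candidate among those satisfying `S`. -/
structure BestC (N K cap : ℕ) (s : St) (S : ℕ → ℕ → Prop) : Prop where
  le_cap : s.reg .bq ≤ cap
  le : ∀ b k, S b k → Valid N b k → s.reg .bq ≤ cQ N b k cap
  fb : s.reg .fb < K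
  fk : s.reg .fk < K
  att : s.reg .bq < cap → Valid N (s.reg .fb) (s.reg .fk) ∧
    cQ N (s.reg .fb) (s.reg .fk) cap = s.reg .bq

theorem BestC.congr {N K cap : ℕ} {s' : St} {S S' : ℕ → ℕ → Prop} (h : BestC N K cap s S)
    (h1 : s'.reg .bq = s.reg .bq) (h2 : s'.reg .fb = s.reg .fb) (h3 : s'.reg .fk = s.reg .fk)
    (h4 : ∀ b k, S' b k → S b k) : BestC N K cap s' S' :=
  ⟨by rw [h1]; exact h.le_cap, fun b k hs hv => by rw [h1]; exact h.le b k (h4 b k hs) hv,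
    by rw [h2]; exact h.fb, by rw [h3]; exact h.fk, by rw [h1, h2, h3]; exact h.att⟩

theorem tryAll_spec {N K cap : ℕ} (hN : s.reg .N = N) (hK : s.reg .K = K) (hcap : s.reg .cap = cap)
    (hKN : Nat.clog 2 N ≤ K) (hcap0 : 0 < cap) (hwd : K * (K + N + 2 + cap) < E.wd)
    (h0 : BestC N K cap s fun _ _ => False) :
    Spec E tryAll s fun s' => BestC N K cap s' (fun b k => b < K ∧ k < K) ∧
      s'.time ≤ s.time + 1 + K * (K * (80 * K ^ 4 + 7) + 2) := by
  refine spec_loop_time (fun b' s' => BestC N K cap s' fun b k => b < b' ∧ k < K)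
    (1 + K * (80 * K ^ 4 + 7)) (h0.congr (by simp) (by simp) (by simp) (by simp)) ?_ ?_
  · rintro b hb s1 hF1 hi1 h1
    rw [hK] at hb
    have K1 : s1.reg .K = K := by rw [hF1.1 .K (by decide), hK]
    refine spec_loop_time (fun k' s' => BestC N K cap s' fun b' k =>
      (b' < b ∧ k < K) ∨ b' = b ∧ k < k') (80 * K ^ 4 + 6)
      (h1.congr (by simp) (by simp) (by simp) (by simp)) ?_ ?_
    · rintro k hk s2 hF2 hi2 h2
      rw [K1] at hk
      have cb2 : s2.reg .cb = b := by rw [hF2.1 .cb (by decide), hi1]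
      have N2 : s2.reg .N = N := by rw [hF2.1 .N (by decide), hF1.1 .N (by decide), hN]
      have K2 : s2.reg .K = K := by rw [hF2.1 .K (by decide), K1]
      have cap2 : s2.reg .cap = cap := by rw [hF2.1 .cap (by decide), hF1.1 .cap (by decide), hcap]
      rw [spec_seq]
      refine Spec.mono (candidate_spec cb2 hi2 N2 K2 cap2 hb hk hKN hcap0 hwd) ?_
      rintro s3 hF3 - ⟨g1, g2, g3⟩
      have h3 : BestC N K cap s3 fun b' k' => (b' < b ∧ k' < K) ∨ b' = b ∧ k' < k :=
        h2.congr (hF3.1 .bq (by decide)) (hF3.1 .fb (by decide)) (hF3.1 .fk (by decide))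
          (fun _ _ h => h)
      have cb3 : s3.reg .cb = b := by rw [hF3.1 .cb (by decide), cb2]
      have kk3 : s3.reg .kk = k := by rw [hF3.1 .kk (by decide), hi2]
      have fin : ∀ s4 : St, s4.reg .bq = s3.reg .bq → s4.reg .fb = s3.reg .fb →
          s4.reg .fk = s3.reg .fk → (Valid N b k → s3.reg .bq ≤ cQ N b k cap) →
          BestC N K cap s4 fun b' k' => (b' < b ∧ k' < K) ∨ b' = b ∧ k' < k + 1 := by
        intro s4 e1 e2 e3 e4
        have := h3.congr (S' := fun b' k' => (b' < b ∧ k' < K) ∨ b' = b ∧ k' < k) e1 e2 e3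
          fun _ _ h => h
        refine ⟨this.le_cap, fun b' k' hs hv => ?_, this.fb, this.fk, this.att⟩
        rcases hs with hs | ⟨rfl, hs⟩
        · exact this.le b' k' (.inl hs) hv
        · rcases Nat.lt_succ_iff_lt_or_eq.1 hs with hs | rfl
          · exact this.le b' k' (.inr ⟨rfl, hs⟩) hv
          · rw [e1]; exact e4 hv
      by_cases hok : s3.reg .ok = 0
      · rw [spec_ite_of_eq (by simpa using hok), spec_skip]
        refine ⟨fin _ (by simp) (by simp) (by simp) fun hv => absurd hok (g1.2 hv), ?_⟩
        simp; omega
      · rw [spec_ite_of_ne (by simpa using hok)]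
        have hv := g1.1 hok
        have hq := (g2 hv).qq
        by_cases hlt : s3.reg .qq < s3.reg .bq
        · rw [spec_ite_of_ne (by simp [hlt])]
          simp only [spec_seq, spec_assign]
          refine ⟨by simp, by simp, by simp, ⟨?_, ?_, ?_, ?_, ?_⟩, by simp; omega⟩
          · simp [hq, cQ]
          · intro b' k' hs hv'
            simp
            rcases hs with hs | ⟨rfl, hs⟩
            · exact hlt.le.trans (h3.le b' k' (.inl hs) hv')
            · rcases Nat.lt_succ_iff_lt_or_eq.1 hs with hs | rfl
              · exact hlt.le.trans (h3.le b' k' (.inr ⟨rfl, hs⟩) hv')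
              · exact hq.le
          · simpa [cb3] using hb
          · simpa [kk3] using hk
          · simp [cb3, kk3, hq, hv]
        · rw [spec_ite_of_eq (by simp [hlt]), spec_skip]
          refine ⟨fin _ (by simp) (by simp) (by simp) fun hv => by omega, ?_⟩
          simp; omega
    · rintro s2 hF2 h2 h3
      rw [K1] at h2 h3
      have h4 : s2.time ≤ s1.time + 1 + K * (80 * K ^ 4 + 7) := h3
      refine ⟨h2.congr (by simp) (by simp) (by simp) ?_, by omega⟩
      rintro b' k' ⟨h4, h5⟩
      rcases Nat.lt_succ_iff_lt_or_eq.1 h4 with h4 | rfl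
      · exact .inl ⟨h4, h5⟩
      · exact .inr ⟨rfl, h5⟩
  · rintro s1 - h1 h2
    rw [hK] at h1 h2
    exact ⟨h1, h2.trans (le_of_eq (by ring))⟩

theorem search_spec {c₁ A K₀ N K cap : ℕ} (hN : s.reg .N = N) (hK : K = Nat.clog 2 N + K₀)
    (hcap : cap = c₁ * N ^ A) (hK0 : 0 < K₀) (hN0 : 0 < N)
    (hcap0 : 0 < cap) (hwd : K * (K + N + 2 + cap) < E.wd) :
    Spec E (search c₁ A K₀) s fun s' => IsBestQ N K cap (s'.reg .bq) ∧
      (s'.reg .bq < cap → ∃ b < K, ∃ k < K, Valid N b k ∧ CRep s' N b k cap ∧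
        cQ N b k cap = s'.reg .bq) ∧
      s'.time ≤ s.time + 300 * (K ^ 6 + N) := by
  have hK1 : 1 ≤ K := by omega
  have hw : K * (K + N + 2 + cap) = K * K + K * N + 2 * K + K * cap := by ring
  have hw1 : N ≤ K * N := Nat.le_mul_of_pos_left _ hK1
  have hw2 : cap ≤ K * cap := Nat.le_mul_of_pos_left _ hK1
  have hw3 : K ≤ K * K := Nat.le_mul_of_pos_left _ hK1
  have hclog : min N (Nat.clog 2 N) = Nat.clog 2 N :=
    min_eq_right (Nat.clog_le_of_le_pow Nat.lt_two_pow_self.le)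
  simp only [search, spec_seq, spec_assign]
  refine ⟨by simp, by simp, by simp, ?_⟩
  refine Spec.mono (climb_spec (lim := .N) (by decide) (N := N) (n0 := 2) (r := 1) (cap := 1)
    (by simp [hN]) (by simp) (by simp) (by simp) (by omega) (by omega) (by omega) (by
      -- The doubled `N` must fit. Either `K` has a factor 2 to spare, or the logarithm is 0 and `N
      -- ≤ 1`.
      rcases Nat.lt_or_ge 1 K with h | h
      · have : 2 * N ≤ K * N := Nat.mul_le_mul_right _ h
        omega
      · have h1 : Nat.clog 2 N = 0 := by omega
        have h2 := Nat.le_pow_clog (b := 2) (by omega) N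
        rw [h1] at h2
        omega) (by omega)) ?_
  rintro s1 hF1 - ⟨g1, -, g3⟩
  have N1 := hF1.1 .N (by decide)
  simp [hN] at g1 g3 N1
  rw [hclog] at g1
  have K1 : s1.reg .L + K₀ = K := by rw [g1, hK]
  refine ⟨fun _ => by simp [K1]; omega, fun _ => ?_, by simp, by simp, by simp, ?_⟩
  · rw [val_capT]
    simp [N1, ← hcap]
    omega
  refine Spec.mono (tryAll_spec (N := N) (K := K) (cap := cap) (by simp [N1]) (by simp [K1])
    (by simp [val_capT, N1, hcap]) (by omega) hcap0 hwd
    ⟨by simp [val_capT, N1, hcap], by simp, by simp; omega, by simp; omega,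
      by simp [val_capT, N1, hcap]⟩) ?_
  rintro s2 hF2 - ⟨g4, g5⟩
  have N2 := hF2.1 .N (by decide)
  have K2 := hF2.1 .K (by decide)
  have cap2 := hF2.1 .cap (by decide)
  simp [val_capT, N1, K1, ← hcap] at N2 K2 cap2
  refine ⟨by simp, by simp, ?_⟩
  refine Spec.mono (candidate_spec (N := N) (K := K) (b := s2.reg .fb) (k := s2.reg .fk) (cap := cap)
    (by simp) (by simp) (by simp [N2]) (by simp [K2]) (by simp [cap2])
    g4.fb g4.fk (by omega) hcap0 hwd) ?_
  rintro s3 hF3 - ⟨g6, g7, g8⟩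
  have bq3 := hF3.1 .bq (by decide)
  simp at bq3
  rw [bq3]
  refine ⟨⟨g4.le_cap, fun b hb k hk => g4.le b k ⟨hb, hk⟩, fun h =>
    ⟨_, g4.fb, _, g4.fk, g4.att h⟩⟩, fun h => ⟨_, g4.fb, _, g4.fk, (g4.att h).1, g7 (g4.att h).1,
      (g4.att h).2⟩, ?_⟩
  have t1 : K * (K * (80 * K ^ 4 + 7) + 2) = 80 * K ^ 6 + 7 * K ^ 2 + 2 * K := by ring
  have t2 : K ^ 2 ≤ K ^ 6 := Nat.pow_le_pow_right hK1 (by omega)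
  have t3 : K ^ 4 ≤ K ^ 6 := Nat.pow_le_pow_right hK1 (by omega)
  have t4 : K ≤ K ^ 6 := Nat.le_self_pow (by omega) K
  simp at g5 g8
  omega

end


/-! ## The recursive multiplication as a program -/

def powLoop (x y : Var) : Cmd := x ::= 1 ;; .loop .as .L (x ::= ♯x * ♯y)

/-- Row `s` of `X` holds the vector with its first `s` digits transformed. The position `ix` splits
into the transformed digits `kn`, the digit `kt` treated now, and the untouched rest `kc`. -/
def kronStep (X T : Arr) (ρ κ : Var) : Cmd :=
  .kn ::= ♯.ix / ♯.kq / ♯ρ ;; .kt ::= ♯.ix / ♯.kq % ♯ρ ;; .kc ::= ♯.ix % ♯.kq ;; .acc ::= 0 ;;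
  .loop .kb κ (.tt ::= (♯.kn * ♯κ + ♯.kb) * ♯.kq + ♯.kc ;;
    .acc ::= (♯.acc + .get T .kt .kb * .get X .s .tt) % ♯.M) ;;
  .put X .s1 .ix (♯.acc)

/-- Apply the `L`-th Kronecker power of `T` to the vector `X[0]`. -/
def kron (X T : Arr) (ρ κ : Var) : Cmd :=
  powLoop .kq κ ;; .ka ::= ♯.kq ;;
  .loop .s .L
    (.kq ::= ♯.kq / ♯κ ;; .ka ::= ♯.ka / ♯κ * ♯ρ ;; .s1 ::= ♯.s + 1 ;;
      .loop .ix .ka (kronStep X T ρ κ))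

/-- The position of the entry `(xi, xj)`. -/
def zindex (xi xj : Var) : Cmd :=
  .tt ::= 0 ;; .ka ::= 1 ;; .kn ::= ♯xi ;; .kt ::= ♯xj ;;
  .loop .as .L
    (.tt ::= ♯.tt + (♯.kn % ♯.n0 * ♯.n0 + ♯.kt % ♯.n0) * ♯.ka ;; .ka ::= ♯.ka * ♯.e2 ;;
      .kn ::= ♯.kn / ♯.n0 ;; .kt ::= ♯.kt / ♯.n0)

def product : Cmd :=
  kron .xA .tU .r .e2 ;; kron .xB .tV .r .e2 ;; powLoop .ka .r ;; .kb ::= 0 ;;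
  .loop .ix .ka
    (.acc ::= .get .xA .L .ix * .get .xB .L .ix % ♯.M ;; .put .xC .kb .ix (♯.acc)) ;;
  kron .xC .tW .e2 .r

section
variable {E : Env} {s : St}

theorem powLoop_spec {x y : Var} (hxy : x ≠ y) (hx : x ≠ .as) (hy : y ≠ .as) (hxL : x ≠ .L)
    (hy0 : 0 < s.reg y) (hwd : s.reg y ^ s.reg .L < E.wd) :
    Spec E (powLoop x y) s fun s' => s'.reg x = s.reg y ^ s.reg .L ∧
      s'.time ≤ s.time + 2 + 2 * s.reg .L := by
  simp only [powLoop, spec_seq, spec_assign]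
  refine ⟨by simp, ?_⟩
  refine spec_loop_time (fun k s' => s'.reg x = s.reg y ^ k) 1 (by simp [hx]) ?_ ?_
  · rintro k hk s1 hF1 - h1
    have y1 := hF1.1 y (by simp [Cmd.wr, hy, Ne.symm hxy])
    simp [Ne.symm hxy] at y1
    simp [hxL.symm] at hk
    rw [spec_assign]
    refine ⟨fun _ => ?_, by simp [hx, h1, y1, pow_succ], by simp⟩
    simp only [Term.val_mul, Term.val_reg, h1, y1, ← pow_succ]
    exact (Nat.pow_le_pow_right hy0 hk).trans_lt hwd
  · rintro s1 - h1 h2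
    simp [hxL.symm] at h1 h2
    exact ⟨h1, by omega⟩

theorem kronStep_spec {X T : Arr} {ρ κ : Var} {ix S L M kq : ℕ}
    (hρ : ρ = .r ∨ ρ = .e2) (hκ : κ = .r ∨ κ = .e2) (hρ0 : 0 < s.reg ρ)
    (hs : s.reg .s = S) (hs1 : s.reg .s1 = S + 1) (hix : s.reg .ix = ix) (hSL : S < L)
    (hM : s.reg .M = M) (hM1 : 1 < M) (hwd : M < E.wd)
    (hkq : s.reg .kq = kq) (hkq' : kq = s.reg κ ^ (L - (S + 1))) (hkq0 : 0 < kq)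
    {x : ℕ → ZMod M} (hX : ∀ a < s.reg ρ ^ S, ∀ c < s.reg κ ^ (L - S),
      (s.arr X S (a * s.reg κ ^ (L - S) + c) : ZMod M) =
        mix (s.reg ρ) (s.reg κ) L (fun t β => (s.arr T t β : ZMod M)) x S a c)
    (hixlt : ix < s.reg ρ ^ (S + 1) * kq) (hq : s.reg ρ ^ S * s.reg κ ^ (L - S) < E.wd) :
    Spec E (kronStep X T ρ κ) s fun s' =>
      (s'.arr X (S + 1) ix : ZMod M) =
        mix (s.reg ρ) (s.reg κ) L (fun t β => (s.arr T t β : ZMod M)) x (S + 1) (ix / kq)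
          (ix % kq) ∧
      (∀ y z, ¬(y = S + 1 ∧ z = ix) → s'.arr X y z = s.arr X y z) ∧
      s'.time ≤ s.time + 6 + 3 * s.reg κ := by
  have ρn : ρ ≠ .kn ∧ ρ ≠ .kt ∧ ρ ≠ .kc ∧ ρ ≠ .acc ∧ ρ ≠ .kb ∧ ρ ≠ .tt := by
    rcases hρ with rfl | rfl <;> decide
  have κn : κ ≠ .kn ∧ κ ≠ .kt ∧ κ ≠ .kc ∧ κ ≠ .acc ∧ κ ≠ .kb ∧ κ ≠ .tt := by
    rcases hκ with rfl | rfl <;> decide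
  have hdiv : ix / kq < s.reg ρ ^ (S + 1) := Nat.div_lt_of_lt_mul (by rwa [mul_comm])
  have hkn : ix / kq / s.reg ρ < s.reg ρ ^ S :=
    Nat.div_lt_of_lt_mul (by rwa [← pow_succ'])
  have hmod : ix % kq < kq := Nat.mod_lt _ hkq0
  have hκL : s.reg κ ^ (L - S) = s.reg κ * kq := by
    rw [hkq', ← pow_succ']
    congr 1
    omega
  simp only [kronStep, spec_seq, spec_assign]
  refine ⟨by simp, by simp, by simp, by simp, ?_⟩
  refine spec_loop_time (fun k s' => (s'.reg .acc : ZMod M) = ∑ β ∈ Finset.range k,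
    (s.arr T (ix / kq % s.reg ρ) β : ZMod M) * mix (s.reg ρ) (s.reg κ) L
      (fun t β => (s.arr T t β : ZMod M)) x S (ix / kq / s.reg ρ) (β * kq + ix % kq)) 2
    (by simp) ?_ ?_
  · rintro β hβ s1 hF1 hi1 h1
    have kn1 := hF1.1 .kn (by simp [Cmd.wr])
    have kt1 := hF1.1 .kt (by simp [Cmd.wr])
    have kc1 := hF1.1 .kc (by simp [Cmd.wr])
    have kq1 := hF1.1 .kq (by simp [Cmd.wr])
    have M1 := hF1.1 .M (by simp [Cmd.wr])
    have S1 := hF1.1 .s (by simp [Cmd.wr])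
    have κ1 := hF1.1 κ (by simp [Cmd.wr, κn])
    have X1 := hF1.2 X (by simp [Cmd.wa])
    have T1 := hF1.2 T (by simp [Cmd.wa])
    simp [hix, hkq, hM, hs, ρn, κn] at kn1 kt1 kc1 kq1 M1 S1 κ1 X1 T1 hβ
    have hlt : β * kq + ix % kq < s.reg κ ^ (L - S) := by
      rw [hκL]
      calc β * kq + ix % kq < β * kq + kq := by omega
        _ = (β + 1) * kq := by ring
        _ ≤ _ := Nat.mul_le_mul_right _ hβ
    have e1 : (ix / kq / s.reg ρ * s.reg κ + β) * kq + ix % kq =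
        ix / kq / s.reg ρ * s.reg κ ^ (L - S) + (β * kq + ix % kq) := by rw [hκL]; ring
    have e2 : (ix / kq / s.reg ρ * s.reg κ + β) * kq + ix % kq < E.wd := by
      rw [e1]
      refine lt_of_lt_of_le ?_ hq.le
      calc _ < ix / kq / s.reg ρ * s.reg κ ^ (L - S) + s.reg κ ^ (L - S) := by omega
        _ = (ix / kq / s.reg ρ + 1) * s.reg κ ^ (L - S) := by ring
        _ ≤ _ := Nat.mul_le_mul_right _ hkn
    rw [spec_seq, spec_assign, spec_assign]
    simp only [Term.val_add, Term.val_mul, Term.val_reg, Term.val_mod, Term.val_get, kn1, κ1, hi1,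
      kq1, kc1]
    refine ⟨fun _ => e2, ?_⟩
    simp [kt1, S1, M1, X1, T1, hi1]
    refine ⟨(Nat.mod_lt _ (by omega)).trans hwd, ?_⟩
    rw [h1, Finset.sum_range_succ, e1, hX _ hkn _ hlt]
  · rintro s1 hF1 h1 h2
    have s11 := hF1.1 .s1 (by simp [Cmd.wr])
    have ix1 := hF1.1 .ix (by simp [Cmd.wr])
    have X1 := hF1.2 X (by simp [Cmd.wa])
    simp [hs1, hix, κn] at s11 ix1 h1 h2 X1
    rw [spec_put]
    refine ⟨by simp, ?_, ?_, by simp; omega⟩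
    · simp only [St.put_arr, if_true, s11, ix1, and_self, Term.val_reg, h1]
      have := mix_succ (ρ := s.reg ρ) (κ := s.reg κ) hSL (fun t β => (s.arr T t β : ZMod M)) x
        (a := ix / kq / s.reg ρ) (t := ix / kq % s.reg ρ) (c := ix % kq) (Nat.mod_lt _ hρ0)
      rw [Nat.div_add_mod'] at this
      rw [this, ← hkq']
    · intro y z hyz
      simp only [St.put_arr, if_true, s11, ix1, if_neg hyz, X1]

/-- Stage `S` has length ρ ^ S · κ ^ (L - S); `q` bounds all stages, hence both the indices and the
time per stage. The identities hold modulo `M`, since the program reduces after every operation. -/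
theorem kron_spec {X T : Arr} {ρ κ : Var} {L M q : ℕ} (hXT : X ≠ T)
    (hρ : ρ = .r ∨ ρ = .e2) (hκ : κ = .r ∨ κ = .e2) (hρ0 : 0 < s.reg ρ) (hκ0 : 0 < s.reg κ)
    (hL : s.reg .L = L) (hM : s.reg .M = M) (hM1 : 1 < M) (hwd : M < E.wd)
    (hq : ∀ S ≤ L, s.reg ρ ^ S * s.reg κ ^ (L - S) ≤ q) (hqwd : q < E.wd) :
    Spec E (kron X T ρ κ) s fun s' =>
      (∀ a < s.reg ρ ^ L, (s'.arr X L a : ZMod M) =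
        mix (s.reg ρ) (s.reg κ) L (fun t β => (s.arr T t β : ZMod M))
          (fun c => (s.arr X 0 c : ZMod M)) L a 0) ∧
      s'.time ≤ s.time + 4 + 2 * L + L * (8 + q * (3 * s.reg κ + 8)) := by
  have ρn : ρ ≠ .kn ∧ ρ ≠ .kt ∧ ρ ≠ .kc ∧ ρ ≠ .acc ∧ ρ ≠ .kb ∧ ρ ≠ .tt ∧ ρ ≠ .kq ∧ ρ ≠ .ka ∧
    ρ ≠ .s ∧ ρ ≠ .s1 ∧ ρ ≠ .ix ∧ ρ ≠ .as := by
    rcases hρ with rfl | rfl <;> decide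
  have κn : κ ≠ .kn ∧ κ ≠ .kt ∧ κ ≠ .kc ∧ κ ≠ .acc ∧ κ ≠ .kb ∧ κ ≠ .tt ∧ κ ≠ .kq ∧ κ ≠ .ka ∧
    κ ≠ .s ∧ κ ≠ .s1 ∧ κ ≠ .ix ∧ κ ≠ .as := by
    rcases hκ with rfl | rfl <;> decide
  have hwrκ : κ ∉ (powLoop .kq κ).wr := by simp [powLoop, Cmd.wr, κn]
  have hwrρ : ρ ∉ (powLoop .kq κ).wr := by simp [powLoop, Cmd.wr, ρn]
  rw [kron, spec_seq]
  refine Spec.mono (powLoop_spec (Ne.symm κn.2.2.2.2.2.2.1) (by decide) (by simp [κn]) (by decide) hκ0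
    (by rw [hL]; exact lt_of_le_of_lt (by simpa using hq 0 (by omega)) hqwd)) ?_
  rintro s1 hF1 - ⟨g1, g2⟩
  have κ1 := hF1.1 κ hwrκ
  have ρ1 := hF1.1 ρ hwrρ
  have L1 := hF1.1 .L (by simp [powLoop, Cmd.wr])
  have M1 := hF1.1 .M (by simp [powLoop, Cmd.wr])
  have a1 : s1.arr = s.arr := by funext a; exact hF1.2 a (by simp [powLoop, Cmd.wa])
  rw [hL] at g1 g2 L1
  rw [hM] at M1
  rw [spec_seq, spec_assign]
  refine ⟨by simp, ?_⟩
  refine spec_loop_time (fun S s' => s'.arr T = s.arr T ∧ s'.reg .kq = s.reg κ ^ (L - S) ∧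
    s'.reg .ka = s.reg ρ ^ S * s.reg κ ^ (L - S) ∧
    ∀ a < s.reg ρ ^ S, ∀ c < s.reg κ ^ (L - S),
      (s'.arr X S (a * s.reg κ ^ (L - S) + c) : ZMod M) =
        mix (s.reg ρ) (s.reg κ) L (fun t β => (s.arr T t β : ZMod M))
          (fun c => (s.arr X 0 c : ZMod M)) S a c) (7 + q * (3 * s.reg κ + 7)) ?_ ?_ ?_
  · simp [a1, g1, mix_zero]
  · rintro S hS s2 hF2 hi2 ⟨h1, h2, h3, h4⟩
    simp [L1] at hS
    have κ2 := hF2.1 κ (by simp [Cmd.wr, κn, kronStep])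
    have ρ2 := hF2.1 ρ (by simp [Cmd.wr, ρn, kronStep])
    have M2 := hF2.1 .M (by simp [Cmd.wr, kronStep])
    simp [κn, ρn, κ1, ρ1, M1] at κ2 ρ2 M2
    have e1 : s.reg κ ^ (L - S) / s.reg κ = s.reg κ ^ (L - (S + 1)) := by
      rw [show L - S = L - (S + 1) + 1 by omega, pow_succ, Nat.mul_div_cancel _ hκ0]
    have e2 : s.reg ρ ^ S * s.reg κ ^ (L - S) / s.reg κ * s.reg ρ =
        s.reg ρ ^ (S + 1) * s.reg κ ^ (L - (S + 1)) := by
      rw [show L - S = L - (S + 1) + 1 by omega, pow_succ, ← mul_assoc, Nat.mul_div_cancel _ hκ0,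
        pow_succ]
      ring
    have e3 := hq (S + 1) hS
    set kq := s.reg κ ^ (L - (S + 1)) with hkq
    have hkq0 : 0 < kq := Nat.pow_pos hκ0
    simp only [spec_seq, spec_assign]
    refine ⟨by simp, fun _ => ?_, by simp, ?_⟩
    · simp [h3, κ2, ρ2, κn, ρn, e2]
      omega
    refine spec_loop_time (fun j s' => s'.arr T = s.arr T ∧ s'.arr X S = s2.arr X S ∧
      ∀ j' < j, (s'.arr X (S + 1) j' : ZMod M) =
        mix (s.reg ρ) (s.reg κ) L (fun t β => (s.arr T t β : ZMod M))
          (fun c => (s.arr X 0 c : ZMod M)) (S + 1) (j' / kq) (j' % kq))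
          (3 * s.reg κ + 6) ?_ ?_ ?_
    · simp [h1]
    · rintro j hj s3 hF3 hi3 ⟨h5, h6, h7⟩
      simp [h3, κ2, ρ2, κn, ρn, e2] at hj
      have κ3 := hF3.1 κ (by simp [Cmd.wr, κn, kronStep])
      have ρ3 := hF3.1 ρ (by simp [Cmd.wr, ρn, kronStep])
      have M3 := hF3.1 .M (by simp [Cmd.wr, kronStep])
      have S3 := hF3.1 .s (by simp [Cmd.wr, kronStep])
      have s13 := hF3.1 .s1 (by simp [Cmd.wr, kronStep])
      have kq3 := hF3.1 .kq (by simp [Cmd.wr, kronStep])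
      simp [κn, ρn, κ2, ρ2, M2, h2, hi2, e1] at κ3 ρ3 M3 S3 s13 kq3
      refine Spec.mono (kronStep_spec (X := X) (T := T) (ρ := ρ) (κ := κ) (ix := j) (S := S) (L := L)
        (M := M) (kq := kq) (x := fun c => (s.arr X 0 c : ZMod M)) hρ hκ (by rw [ρ3]; exact hρ0)
        S3 s13 hi3 (by omega) M3 hM1 hwd kq3 (by rw [κ3]) hkq0
        (by rw [κ3, ρ3, h5, h6]; exact h4) (by rw [ρ3]; exact hj)
        (by rw [κ3, ρ3]; exact (hq S (by omega)).trans_lt hqwd)) ?_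
      rintro s4 hF4 - ⟨k1, k2, k3⟩
      rw [κ3, ρ3, h5] at k1
      rw [κ3] at k3
      refine ⟨⟨?_, ?_, ?_⟩, by omega⟩
      · rw [St.set_arr, hF4.2 T (by simp [kronStep, Cmd.wa, hXT.symm]), h5]
      · rw [St.set_arr, ← h6]
        funext z
        exact k2 S z (by omega)
      · intro j' hj'
        rw [St.set_arr]
        rcases Nat.lt_succ_iff_lt_or_eq.1 hj' with h | rfl
        · rw [k2 _ _ (by omega)]
          exact h7 j' h
        · exact k1
    · rintro s3 hF3 ⟨h5, h6, h7⟩ h8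
      have ka3 := hF3.1 .ka (by simp [Cmd.wr, kronStep])
      have kq3 := hF3.1 .kq (by simp [Cmd.wr, kronStep])
      simp [h3, h2, κ2, ρ2, κn, ρn, e2, e1] at h7 h8 ka3 kq3
      refine ⟨⟨h5, kq3, ka3, ?_⟩, ?_⟩
      · intro a ha c hc
        rw [St.set_arr, h7]
        · rw [mul_comm a kq, Nat.mul_add_div hkq0, Nat.div_eq_of_lt hc, Nat.mul_add_mod,
            Nat.mod_eq_of_lt hc, add_zero]
        · calc a * kq + c < a * kq + kq := by omega
            _ = (a + 1) * kq := by ring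
            _ ≤ _ := Nat.mul_le_mul_right _ ha
      · have : s.reg ρ ^ (S + 1) * kq * (3 * s.reg κ + 6 + 1) ≤ q * (3 * s.reg κ + 7) :=
          Nat.mul_le_mul_right _ e3
        omega
  · rintro s2 - ⟨-, -, -, h4⟩ h5
    simp [L1] at h4 h5
    refine ⟨h4, ?_⟩
    have : L * (7 + q * (3 * s.reg κ + 7) + 1) ≤ L * (8 + q * (3 * s.reg κ + 8)) := by
      have : q * (3 * s.reg κ + 7) ≤ q * (3 * s.reg κ + 8) := Nat.mul_le_mul_left _ (by omega)
      exact Nat.mul_le_mul_left _ (by omega)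
    omega

end


section
variable {E : Env} {s : St}

theorem zindex_spec {xi xj : Var} {n0 L : ℕ} (hi : xi ≠ .tt ∧ xi ≠ .ka)
    (hj : xj ≠ .tt ∧ xj ≠ .ka ∧ xj ≠ .kn) (hL : s.reg .L = L) (hn : s.reg .n0 = n0)
    (he : s.reg .e2 = n0 * n0) (hn0 : 0 < n0) (hwd : (n0 * n0) ^ L < E.wd) :
    Spec E (zindex xi xj) s fun s' => s'.reg .tt = zIdx n0 L (s.reg xi) (s.reg xj) ∧
      s'.time ≤ s.time + 5 + 5 * L := by
  simp only [zindex, spec_seq, spec_assign]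
  refine ⟨by simp, by simp, by simp, by simp, ?_⟩
  -- The digits are taken from the low end: `tt` holds the part from the last `k` digits, and the
  -- recursive index of the remaining quotients accounts for the rest.
  refine spec_loop_time (fun k s' => s'.reg .tt +
      zIdx n0 (L - k) (s'.reg .kn) (s'.reg .kt) * (n0 * n0) ^ k =
        zIdx n0 L (s.reg xi) (s.reg xj) ∧ s'.reg .ka = (n0 * n0) ^ k) 4 ?_ ?_ ?_
  · simp [hi, hj]
  · rintro k hk s1 hF1 - ⟨h1, h2⟩
    have n1 := hF1.1 .n0 (by decide)
    have e1 := hF1.1 .e2 (by decide)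
    simp [hn, he, hL] at n1 e1 hk
    obtain ⟨l, hl⟩ : ∃ l, L - k = l + 1 := ⟨L - k - 1, by omega⟩
    have hl' : L - (k + 1) = l := by omega
    rw [hl, zIdx] at h1
    have h3 : s1.reg .tt + (s1.reg .kn % n0 * n0 + s1.reg .kt % n0) * s1.reg .ka +
        zIdx n0 l (s1.reg .kn / n0) (s1.reg .kt / n0) * (n0 * n0) ^ (k + 1) =
        zIdx n0 L (s.reg xi) (s.reg xj) := by rw [h2, ← h1]; ring
    have h4 := zIdx_lt hn0 L (s.reg xi) (s.reg xj)
    have h5 : (n0 * n0) ^ (k + 1) ≤ (n0 * n0) ^ L := Nat.pow_le_pow_right (by positivity) hk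
    simp only [spec_seq, spec_assign]
    simp [n1, e1]
    refine ⟨by omega, by rw [h2, ← pow_succ]; omega, ?_, by rw [h2, ← pow_succ]⟩
    rw [hl', h3]
  · rintro s1 - ⟨h1, -⟩ h2
    simp [hL, zIdx] at h1 h2
    exact ⟨h1, by omega⟩

/-- No stage of the transformation is longer than the number of products of the recursive algorithm;
here the condition n₀² ≤ r is used. -/
theorem pow_mul_pow_le {ρ κ r L S : ℕ} (hρ : ρ ≤ r) (hκ : κ ≤ r) (hS : S ≤ L) :
    ρ ^ S * κ ^ (L - S) ≤ r ^ L := by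
  calc ρ ^ S * κ ^ (L - S) ≤ r ^ S * r ^ (L - S) :=
        Nat.mul_le_mul (Nat.pow_le_pow_left hρ _) (Nat.pow_le_pow_left hκ _)
    _ = r ^ L := by rw [← pow_add]; congr 1; omega

theorem mix_congr {F : Type*} [CommRing F] {ρ κ L : ℕ} {T T' : ℕ → ℕ → F} {x x' : ℕ → F}
    (hκ : 0 < κ) (hT : ∀ t < ρ, ∀ β < κ, T t β = T' t β) (hx : ∀ c < κ ^ L, x c = x' c) {a : ℕ}
    (ha : a < ρ ^ L) : mix ρ κ L T x L a 0 = mix ρ κ L T' x' L a 0 := by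
  have hk : ∀ (L a b : ℕ), a < ρ ^ L → kr ρ κ T L a b = kr ρ κ T' L a b := by
    intro L
    induction L with
    | zero => simp [kr]
    | succ L ih =>
      intro a b ha
      have hρ : 0 < ρ := by
        rcases Nat.eq_zero_or_pos ρ with rfl | h
        · simp at ha
        · exact h
      rw [kr, kr, ih _ _ (Nat.div_lt_of_lt_mul (by rwa [← pow_succ'])),
        hT _ (Nat.mod_lt _ hρ) _ (Nat.mod_lt _ hκ)]
  rw [mix_self, mix_self]
  refine Finset.sum_congr rfl fun b hb => ?_
  rw [hk _ _ _ ha, hx b (by simpa using hb)]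

/-- Because `q < cap`, the cut-off was not effective and `q` really is the number of products.
Correctness needs only that the check of the Brent equations modulo `M` succeeded, not where the
tables come from. -/
theorem product_spec {N K b k cap q : ℕ} (hv : Valid N b k) (hC : CRep s N b k cap)
    (hq : cQ N b k cap = q) (hqc : q < cap) (hbK : b < K) (hkK : k < K)
    (hKN : Nat.clog 2 N ≤ K) (hwd : K * (K + N + 2 + cap) < E.wd) :
    Spec E product s fun s' =>
      (∀ i < cN b k ^ Nat.clog (cN b k) N, ∀ j < cN b k ^ Nat.clog (cN b k) N,
        (s'.arr .xC (Nat.clog (cN b k) N) (zIdx (cN b k) (Nat.clog (cN b k) N) i j) :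
          ZMod (cM N b k)) =
        ∑ l ∈ Finset.range (cN b k ^ Nat.clog (cN b k) N),
          (s.arr .xA 0 (zIdx (cN b k) (Nat.clog (cN b k) N) i l) *
            s.arr .xB 0 (zIdx (cN b k) (Nat.clog (cN b k) N) l j) : ZMod (cM N b k))) ∧
      s'.time ≤ s.time + 100 * (K ^ 2 * q) := by
  obtain ⟨⟨hn0, hD0, her⟩, hbr⟩ := hv
  have hw : K * (K + N + 2 + cap) = K * K + K * N + 2 * K + K * cap := by ring
  set n0 := cN b k with hn0d
  set L := Nat.clog n0 N with hLd
  set r := cR b k with hrd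
  set M := cM N b k with hMd
  have he : cE b k = n0 * n0 := rfl
  rw [he] at her hbr
  have he0 : 0 < n0 * n0 := by positivity
  have hr0 : 0 < r := by omega
  have hrK : r < K := dg_lt hbK hkK 1
  have hK1 : 1 ≤ K := by omega
  have hLK : L ≤ K := (Nat.clog_anti_left (by omega) hn0).trans hKN
  have hqe : r ^ L = q := by
    rw [cQ, ← hrd, ← hn0d, ← hLd] at hq
    omega
  have hq1 : 1 ≤ q := by rw [← hqe]; exact Nat.pow_pos hr0
  have hqwd : q < E.wd := by
    have : cap ≤ K * cap := Nat.le_mul_of_pos_left _ hK1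
    omega
  have hM1 : 1 < M := by
    rw [hMd, cM]
    have : 1 * 1 ≤ cD b k * (N + 1) := Nat.mul_le_mul hD0 (by omega)
    omega
  have hMwd : M < E.wd := by
    have h1 : cD b k * (N + 1) ≤ K * (N + 1) := Nat.mul_le_mul_right _ (dg_lt hbK hkK 2).le
    have h2 : K * (N + 1) = K * N + K := by ring
    rw [hMd, cM]
    omega
  have hM0 : NeZero M := ⟨by omega⟩
  rw [product, spec_seq]
  refine Spec.mono (kron_spec (X := .xA) (T := .tU) (ρ := .r) (κ := .e2) (q := q) (L := L) (M := M) (by decide)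
    (.inl rfl) (.inr rfl) (by rw [hC.r]; exact hr0) (by rw [hC.e2]; exact he0) hC.L hC.M hM1 hMwd
    (by rw [hC.r, hC.e2, ← hqe]; exact fun S hS => pow_mul_pow_le le_rfl her hS) hqwd) ?_
  rintro s1 hF1 - ⟨g1, g2⟩
  rw [hC.r, hC.e2] at g1
  rw [hC.e2] at g2
  rw [spec_seq]
  have r1 : s1.reg .r = r := by rw [hF1.1 .r (by decide), hC.r]
  have e1 : s1.reg .e2 = n0 * n0 := by rw [hF1.1 .e2 (by decide), hC.e2, he]
  have L1 : s1.reg .L = L := by rw [hF1.1 .L (by decide), hC.L]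
  have M1 : s1.reg .M = M := by rw [hF1.1 .M (by decide), hC.M]
  refine Spec.mono (kron_spec (X := .xB) (T := .tV) (ρ := .r) (κ := .e2) (q := q) (L := L) (M := M) (by decide)
    (.inl rfl) (.inr rfl) (by rw [r1]; exact hr0) (by rw [e1]; exact he0) L1 M1 hM1 hMwd
    (by rw [r1, e1, ← hqe]; exact fun S hS => pow_mul_pow_le le_rfl her hS) hqwd) ?_
  rintro s2 hF2 - ⟨g3, g4⟩
  rw [r1, e1, hF1.2 .tV (by decide), hF1.2 .xB (by decide)] at g3
  rw [e1] at g4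
  have r2 : s2.reg .r = r := by rw [hF2.1 .r (by decide), r1]
  have e2 : s2.reg .e2 = n0 * n0 := by rw [hF2.1 .e2 (by decide), e1]
  have L2 : s2.reg .L = L := by rw [hF2.1 .L (by decide), L1]
  have M2 : s2.reg .M = M := by rw [hF2.1 .M (by decide), M1]
  rw [spec_seq]
  refine Spec.mono (powLoop_spec (x := .ka) (y := .r) (by decide) (by decide) (by decide) (by decide)
    (by rw [r2]; exact hr0) (by rw [r2, L2, hqe]; exact hqwd)) ?_
  rintro s3 hF3 - ⟨g5, g6⟩
  rw [r2, L2] at g5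
  rw [L2] at g6
  have r3 : s3.reg .r = r := by rw [hF3.1 .r (by decide), r2]
  have e3 : s3.reg .e2 = n0 * n0 := by rw [hF3.1 .e2 (by decide), e2]
  have L3 : s3.reg .L = L := by rw [hF3.1 .L (by decide), L2]
  have M3 : s3.reg .M = M := by rw [hF3.1 .M (by decide), M2]
  have A3 : s3.arr .xA = s1.arr .xA := by rw [hF3.2 .xA (by decide), hF2.2 .xA (by decide)]
  have B3 : s3.arr .xB = s2.arr .xB := hF3.2 .xB (by decide)
  rw [spec_seq, spec_assign, spec_seq]
  refine ⟨by simp, ?_⟩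
  refine spec_loop_time (fun a s' => ∀ a' < a, (s'.arr .xC 0 a' : ZMod M) =
    (s1.arr .xA L a' : ZMod M) * (s2.arr .xB L a' : ZMod M)) 2 (by simp) ?_ ?_
  · rintro a ha s4 hF4 hi4 h4
    have M4 := hF4.1 .M (by decide)
    have L4 := hF4.1 .L (by decide)
    have A4 := hF4.2 .xA (by decide)
    have B4 := hF4.2 .xB (by decide)
    have kb4 := hF4.1 .kb (by decide)
    simp [M3, L3, A3, B3] at M4 L4 A4 B4 kb4
    rw [spec_seq, spec_assign, spec_put]
    refine ⟨fun _ => ?_, by simp, ?_, by simp⟩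
    · simp [M4]
      exact (Nat.mod_lt _ (by omega)).trans hMwd
    · intro a' ha'
      rcases Nat.lt_succ_iff_lt_or_eq.1 ha' with h | rfl
      · simp [hi4, kb4, h.ne, h4 a' h]
      · simp [hi4, kb4, M4, L4, A4, B4]
  · rintro s4 hF4 h4 h5
    simp [g5] at h4 h5
    have r4 : s4.reg .r = r := by rw [hF4.1 .r (by decide)]; simp [r3]
    have e4 : s4.reg .e2 = n0 * n0 := by rw [hF4.1 .e2 (by decide)]; simp [e3]
    have L4 : s4.reg .L = L := by rw [hF4.1 .L (by decide)]; simp [L3]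
    have M4 : s4.reg .M = M := by rw [hF4.1 .M (by decide)]; simp [M3]
    have W4 : s4.arr .tW = s.arr .tW := by
      rw [hF4.2 .tW (by decide), St.set_arr, hF3.2 .tW (by decide), hF2.2 .tW (by decide),
        hF1.2 .tW (by decide)]
    refine Spec.mono (kron_spec (X := .xC) (T := .tW) (ρ := .e2) (κ := .r) (q := q) (by decide)
      (.inr rfl) (.inl rfl) (by rw [e4]; exact he0) (by rw [r4]; exact hr0) L4 M4 hM1 hMwd
      (by rw [r4, e4, ← hqe]; exact fun S hS => pow_mul_pow_le her le_rfl hS) hqwd) ?_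
    rintro s5 - - ⟨g7, g8⟩
    rw [e4, r4, W4] at g7
    rw [r4] at g8
    refine ⟨fun i hi j hj => ?_, ?_⟩
    · have hz := zIdx_lt (n0 := n0) (by omega) L i j
      rw [g7 _ hz]
      have key := kronecker_mul (F := ZMod M) (n0 := n0) (r := r) (by omega)
        (U := fun t α => (cU N b k t α : ZMod M)) (V := fun t α => (cV N b k t α : ZMod M))
        (W := fun γ t => (cW N b k γ t : ZMod M)) (fun α hα β hβ γ hγ => by
          have := congrArg (Nat.cast : ℕ → ZMod M) (hbr α hα β hβ γ hγ)
          rw [ZMod.natCast_mod] at this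
          push_cast at this
          rw [this]) L (fun c => (s.arr .xA 0 c : ZMod M)) (fun c => (s.arr .xB 0 c : ZMod M)) hi hj
      rw [← key]
      refine mix_congr hr0 (fun γ hγ t ht => by rw [hC.W γ hγ t ht]) (fun a ha => ?_) hz
      rw [h4 a ha, g1 a ha, g3 a ha]
      congr 1
      · exact mix_congr he0 (fun t ht α hα => by rw [hC.U t ht α hα]) (fun _ _ => rfl) ha
      · exact mix_congr he0 (fun t ht α hα => by rw [hC.V t ht α hα]) (fun _ _ => rfl) ha
    · have t1 : L * (8 + q * (3 * (n0 * n0) + 8)) ≤ K * (8 + q * (3 * K + 8)) := by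
        gcongr
        omega
      have t2 : L * (8 + q * (3 * r + 8)) ≤ K * (8 + q * (3 * K + 8)) := by
        gcongr
      have t3 : K * (8 + q * (3 * K + 8)) = 8 * K + 3 * (K ^ 2 * q) + 8 * (K * q) := by ring
      have t4 : K * q ≤ K ^ 2 * q := Nat.mul_le_mul_right _ (Nat.le_self_pow (by omega) K)
      have t5 : K ≤ K * q := Nat.le_mul_of_pos_right _ hq1
      have t6 : q ≤ K * q := Nat.le_mul_of_pos_left _ hK1
      rw [he] at g2
      rw [hqe] at h5
      omega

end


/-! ## Pairs of vertices of high degree -/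

def collectHeavy : Cmd :=
  .hc ::= 0 ;;
  .forEach .i .cnt .v .ver .n
    (.t ::= .get .len .v .v ;; .ite (♯.d ≺ ♯.t) (.put .hgh .n .hc (♯.v) ;; .hc ::= ♯.hc + 1) .skip)

/-- Each vertex of small degree contributes to all pairs of its closed neighborhood. Its quadratic
cost is at most `d` times the length of its list, so O(d(m + 1)) in total. -/
def countLow : Cmd :=
  .forEach .i .cnt .v .ver .n
    (.t ::= .get .len .v .v ;;
      .ite (♯.d ≺ ♯.t) .skip
        (.forEach .j .t .x .adj .v
          (.forEach .k .t .y .adj .v (.c ::= .get .c2 .x .y ;; .put .c2 .x .y (♯.c + 1)))))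

def loadHeavy : Cmd :=
  .kb ::= 0 ;;
  .loop .i .hc
    (.x ::= .get .hgh .n .i ;;
      .loop .j .hc
        (.y ::= .get .hgh .n .j ;; .q ::= .get .mat .x .y ;; zindex .i .j ;;
          .put .xA .kb .tt (♯.q) ;; .put .xB .kb .tt (♯.q)))

def evalHeavy : Cmd :=
  .loop .i .hc
    (.x ::= .get .hgh .n .i ;; .p ::= .get .len .x .x ;;
      .loop .j .hc
        (.y ::= .get .hgh .n .j ;; .q ::= .get .len .y .y ;; zindex .i .j ;;
          .c ::= ♯.p + ♯.q - (.get .c2 .x .y + .get .xC .L .tt % ♯.M) ;;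
          .ite (♯.best ≺ ♯.c) (.best ::= ♯.c ;; .b1 ::= ♯.x ;; .b2 ::= ♯.y) .skip))

/-- Find a best pair of vertices whose closed neighborhoods have more than `d` elements. -/
def heavyCore (c₁ A K₀ : ℕ) : Cmd :=
  .best ::= 0 ;; .b1 ::= 0 ;; .b2 ::= 0 ;; collectHeavy ;;
  .ite (♯.hc)
    (countLow ;; .N ::= (♯.m + ♯.m) / ♯.d ;; search c₁ A K₀ ;; loadHeavy ;; product ;; evalHeavy)
    .skip

theorem zIdx_inj {n0 : ℕ} (h : 0 < n0) {L i j i' j' : ℕ} (hi : i < n0 ^ L) (hj : j < n0 ^ L)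
    (hi' : i' < n0 ^ L) (hj' : j' < n0 ^ L) (he : zIdx n0 L i j = zIdx n0 L i' j') :
    i = i' ∧ j = j' := by
  induction L generalizing i j i' j' with
  | zero =>
    simp only [pow_zero, Nat.lt_one_iff] at *
    omega
  | succ L ih =>
    have hd : ∀ {a}, a < n0 ^ (L + 1) → a / n0 < n0 ^ L := fun ha =>
      Nat.div_lt_of_lt_mul (by rwa [← pow_succ'])
    have h1 := congrArg (· / (n0 * n0)) he
    have h2 := congrArg (· % (n0 * n0)) he
    simp only [zIdx_div h, zIdx_mod h] at h1 h2
    obtain ⟨h3, h4⟩ := ih (hd hi) (hd hj) (hd hi') (hd hj') h1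
    have h5 : i % n0 = i' % n0 ∧ j % n0 = j' % n0 := by
      have e1 := congrArg (· / n0) h2
      have e2 := congrArg (· % n0) h2
      simp only [mul_comm _ n0, Nat.mul_add_div h, Nat.div_eq_of_lt (Nat.mod_lt _ h),
        Nat.mul_add_mod, Nat.mod_mod, add_zero] at e1 e2
      exact ⟨e1, e2⟩
    exact ⟨(eq_iff_div_mod n0 _ _).2 ⟨h3, h5.1⟩, (eq_iff_div_mod n0 _ _).2 ⟨h4, h5.2⟩⟩

theorem countP_row (p : ℕ → Prop) [DecidablePred p] (f : ℕ → ℕ) (k : ℕ) :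
    (row f k).countP (fun v => p v) = ∑ l ∈ Finset.range k, if p (f l) then 1 else 0 := by
  induction k with
  | zero => rfl
  | succ k ih =>
    rw [row_succ, List.countP_append, ih, Finset.sum_range_succ]
    congr 1
    by_cases h : p (f k) <;> simp [h]

section
variable {E : Env} {s : St} {R : List ℕ} {A : ℕ → List ℕ} {m : ℕ}

/-- The vertices of degree at least `d`. -/
def heavy (A : ℕ → List ℕ) (R : List ℕ) (d : ℕ) : List ℕ := R.filter fun v => d < (A v).length

theorem mem_heavy {d v : ℕ} : v ∈ heavy A R d ↔ v ∈ R ∧ d < (A v).length := by simp [heavy]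

/-- Handshaking. Lengths exceed degrees by one, so one is subtracted from each before summing. -/
theorem Nbr.length_heavy_mul_le (h : Nbr m R A) (d : ℕ) : (heavy A R d).length * d ≤ 2 * m := by
  have h1 : (R.map fun v => (A v).length - 1).sum + R.length = (R.map fun v => (A v).length).sum := by
    have : ∀ l : List ℕ, (∀ v ∈ l, 1 ≤ (A v).length) →
        (l.map fun v => (A v).length - 1).sum + l.length = (l.map fun v => (A v).length).sum := by
      intro l hl
      induction l with
      | nil => rfl
      | cons a l ih =>
        have := ih fun v hv => hl v (List.mem_cons_of_mem _ hv)
        have := hl a List.mem_cons_self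
        simp
        omega
    exact this R fun v hv => h.length_pos hv
  have h2 : ((heavy A R d).map fun _ => d).sum ≤
      ((heavy A R d).map fun v => (A v).length - 1).sum :=
    sum_map_le_sum fun v hv => by
      have := (mem_heavy.1 hv).2
      omega
  rw [List.map_const', List.sum_replicate, smul_eq_mul] at h2
  have h3 : ((heavy A R d).map fun v => (A v).length - 1).sum ≤
      (R.map fun v => (A v).length - 1).sum :=
    ((List.filter_sublist (l := R)).map _).sum_le_sum (by simp)
  have := h.sum
  omega

/-- Inclusion and exclusion, with the common elements split by their degrees: the small ones are
counted directly, the others by the matrix product. -/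
theorem Nbr.dom_add_common (h : Nbr m R A) (d x y : ℕ) :
    dom A x y + (R.countP (fun v => (A v).length ≤ d ∧ x ∈ A v ∧ y ∈ A v) +
      (heavy A R d).countP (fun v => v ∈ A x ∧ y ∈ A v)) = (A x).length + (A y).length := by
  have h1 : (A y).length = (A y).countP (· ∉ A x) + (A y).countP (· ∈ A x) := by
    rw [List.length_eq_countP_add_countP (p := fun v => decide (v ∉ A x))]
    congr 1
    refine List.countP_congr fun v _ => by simp
  have h2 : (A y).countP (· ∈ A x) = R.countP fun v => v ∈ A x ∧ y ∈ A v := by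
    rw [List.countP_eq_length_filter, List.countP_eq_length_filter]
    refine List.Perm.length_eq ((List.perm_ext_iff_of_nodup ((h.nodupA y).filter _)
      (h.nodup.filter _)).2 fun v => ?_)
    simp only [List.mem_filter, decide_eq_true_eq]
    exact ⟨fun ⟨a, b⟩ => ⟨h.mem _ _ (h.symm _ _ a), b, h.symm _ _ a⟩,
      fun ⟨_, b, c⟩ => ⟨h.symm _ _ c, b⟩⟩
  have h3 : R.countP (fun v => v ∈ A x ∧ y ∈ A v) =
      R.countP (fun v => (A v).length ≤ d ∧ x ∈ A v ∧ y ∈ A v) +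
      (heavy A R d).countP (fun v => v ∈ A x ∧ y ∈ A v) := by
    have e : ∀ v, v ∈ A x ↔ x ∈ A v := fun v => ⟨h.symm _ _, h.symm _ _⟩
    rw [heavy, List.countP_filter]
    simp only [e]
    clear h1 h2 h
    induction R with
    | nil => rfl
    | cons a R ih =>
      simp only [List.countP_cons]
      by_cases k1 : (A a).length ≤ d
      · by_cases k2 : x ∈ A a ∧ y ∈ A a <;> simp [k1, k2, not_lt.2 k1] at ih ⊢ <;> omega
      · by_cases k2 : x ∈ A a ∧ y ∈ A a <;> simp [k1, k2, not_le.1 k1] at ih ⊢ <;> omega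
  rw [h.dom_eq]
  omega

theorem collectHeavy_spec (hG : GRep s R A) : Spec E collectHeavy s fun s' =>
    row (s'.arr .hgh (s'.reg .n)) (s'.reg .hc) = heavy A R (s.reg .d) ∧
    s'.time ≤ s.time + 2 + 7 * R.length := by
  simp only [collectHeavy, spec_seq, spec_assign]
  refine ⟨by simp, ?_⟩
  refine spec_forEach R (fun l s' =>
    row (s'.arr .hgh (s'.reg .n)) (s'.reg .hc) = heavy A l (s.reg .d) ∧
    s'.time ≤ s.time + 2 + 7 * l.length) (by decide) (by decide) (by simp [hG.cnt, hG.ver])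
    (by simp [heavy]) ?_ (fun s' _ h => h)
  rintro l₁ v l₂ hl s1 hF1 hi ⟨h1, h2⟩
  have hG1 : GRep s1 R A := hG.frame_of_eq hF1 (by decide) (by simp) (by simp) rfl
  have d1 := hF1.1 .d (by decide)
  simp at d1
  rw [spec_seq, spec_assign]
  refine ⟨by simp, ?_⟩
  by_cases h : s.reg .d < (A v).length
  · rw [spec_ite_of_ne (by simp [hG1.len, d1, h])]
    simp [heavy, h]
    refine ⟨?_, by omega⟩
    rw [row_push (s1.arr .hgh (s1.reg .n)) _ _ v, h1, heavy]
    · simp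
    · intro i hi
      simp
      omega
  · rw [spec_ite_of_eq (by simp [hG1.len, d1, h])]
    simp [heavy, h]
    exact ⟨by simpa [heavy] using h1, by omega⟩

theorem countLow_spec (hG : GRep s R A) (hnd : ∀ v, (A v).Nodup) (h0 : ∀ x y, s.arr .c2 x y = 0) :
    Spec E countLow s fun s' =>
      (∀ x y, s'.arr .c2 x y =
        R.countP (fun v => (A v).length ≤ s.reg .d ∧ x ∈ A v ∧ y ∈ A v)) ∧
      s'.time ≤ s.time + 1 + wsum (fun v => 6 + 3 * (A v).length +
        4 * (s.reg .d * (A v).length)) R := by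
  refine spec_forEach R (fun l s' => (∀ x y, s'.arr .c2 x y =
        l.countP (fun v => (A v).length ≤ s.reg .d ∧ x ∈ A v ∧ y ∈ A v)) ∧
      s'.time ≤ s.time + 1 + wsum (fun v => 6 + 3 * (A v).length +
        4 * (s.reg .d * (A v).length)) l) (by decide) (by decide) (by simp [hG.cnt, hG.ver])
    (by simp [h0]) ?_ (fun s' _ h => h)
  rintro l₁ v l₂ hl s1 hF1 hi ⟨h1, h2⟩
  have hG1 : GRep s1 R A := hG.frame hF1 (by decide)
  have d1 := hF1.1 .d (by decide)
  rw [spec_seq, spec_assign]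
  refine ⟨by simp, ?_⟩
  by_cases h : s.reg .d < (A v).length
  · rw [spec_ite_of_ne (by simp [hG1.len, d1, h])]
    have h' : ¬ (A v).length ≤ s.reg .d := by omega
    simp [h, h']
    exact ⟨fun x y => by simpa using h1 x y, by omega⟩
  · rw [spec_ite_of_eq (by simp [hG1.len, d1, h])]
    have h' : (A v).length ≤ s.reg .d := by omega
    refine spec_forEach (A v) (fun l s' => (∀ x y, s'.arr .c2 x y =
      s1.arr .c2 x y + if x ∈ l ∧ y ∈ A v then 1 else 0) ∧
      s'.time ≤ s1.time + 4 + l.length * (3 + 4 * (A v).length)) (by decide) (by decide)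
      (by simp [hG1.len, hG1.adj]) (by simp) ?_ ?_
    · rintro m₁ x m₂ hm s2 hF2 hj ⟨h3, h4⟩
      have hG2 : GRep s2 R A := hG1.frame_of_eq hF2 (by decide) (by simp) (by simp) rfl
      have v2 := hF2.1 .v (by decide)
      have t2 := hF2.1 .t (by decide)
      simp [hG1.len] at v2 t2
      have hxm : x ∉ m₁ := fun hx => by
        have := hnd v
        rw [hm, List.nodup_append] at this
        exact this.2.2 x hx x (by simp) rfl
      refine spec_forEach (A v) (fun l s' => (∀ x' y, s'.arr .c2 x' y =
        s2.arr .c2 x' y + if x' = x ∧ y ∈ l then 1 else 0) ∧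
        s'.time ≤ s2.time + 2 + 4 * l.length) (by decide) (by decide)
        (by simp [v2, t2, hG2.adj]) (by simp) ?_ ?_
      · rintro p₁ y p₂ hp s3 hF3 hk ⟨h5, h6⟩
        have x3 := hF3.1 .x (by decide)
        simp at x3
        have hyp : y ∉ p₁ := fun hx => by
          have := hnd v
          rw [hp, List.nodup_append] at this
          exact this.2.2 y hx y (by simp) rfl
        simp [x3]
        refine ⟨fun x' y' => ?_, by omega⟩
        by_cases e1 : x' = x
        · by_cases e2 : y' = y
          · subst e1 e2
            simp [h5, hyp]
          · subst e1
            simp [h5, e2]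
        · simp [h5, e1]
      · rintro s3 hF3 ⟨h5, h6⟩
        refine ⟨fun x' y' => ?_, ?_⟩
        · simp only [St.set_arr, h5, h3, List.mem_append, List.mem_singleton]
          by_cases e1 : x' = x
          · subst e1
            simp [hxm]
          · simp [e1]
        · simp [add_mul]
          omega
    · rintro s2 hF2 ⟨h3, h4⟩
      refine ⟨fun x y => ?_, ?_⟩
      · simp [h3, h1, h']
      -- This branch concerns lists of length at most `d`; one factor of the square is replaced by
      -- `d`.
      · have e1 : (A v).length * (A v).length ≤ s.reg .d * (A v).length :=
          Nat.mul_le_mul_right _ h'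
        have e2 : (A v).length * (3 + 4 * (A v).length) =
          3 * (A v).length + 4 * ((A v).length * (A v).length) := by ring
        simp
        omega

end


section
variable {E : Env} {s : St} {R : List ℕ} {A : ℕ → List ℕ} {m : ℕ}

theorem loadHeavy_spec {n0 L h : ℕ} {f : ℕ → ℕ} (hG : GRep s R A) (hh : s.reg .hc = h)
    (hf : ∀ i, s.arr .hgh (s.reg .n) i = f i) (hL : s.reg .L = L) (hn : s.reg .n0 = n0)
    (he : s.reg .e2 = n0 * n0) (hn0 : 0 < n0) (hhL : h ≤ n0 ^ L) (hwd : (n0 * n0) ^ L < E.wd)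
    (hA : ∀ a, s.arr .xA 0 a = 0) (hB : ∀ a, s.arr .xB 0 a = 0) :
    Spec E loadHeavy s fun s' =>
      (∀ i < n0 ^ L, ∀ j < n0 ^ L,
        s'.arr .xA 0 (zIdx n0 L i j) = (if i < h ∧ j < h ∧ f j ∈ A (f i) then 1 else 0) ∧
        s'.arr .xB 0 (zIdx n0 L i j) = (if i < h ∧ j < h ∧ f j ∈ A (f i) then 1 else 0)) ∧
      s'.time ≤ s.time + 2 + h * (4 + h * (10 + 5 * L)) := by
  rw [loadHeavy, spec_seq, spec_assign]
  refine ⟨by simp, ?_⟩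
  refine spec_loop_time (fun k s' => ∀ i < n0 ^ L, ∀ j < n0 ^ L,
    s'.arr .xA 0 (zIdx n0 L i j) = (if i < k ∧ j < h ∧ f j ∈ A (f i) then 1 else 0) ∧
    s'.arr .xB 0 (zIdx n0 L i j) = (if i < k ∧ j < h ∧ f j ∈ A (f i) then 1 else 0))
    (3 + h * (10 + 5 * L)) (by simp [hA, hB]) ?_ ?_
  · rintro k hk s1 hF1 hi1 h1
    have hG1 : GRep s1 R A := hG.frame_of_eq hF1 (by decide) (by simp) (by simp) rfl
    have hc1 := hF1.1 .hc (by decide)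
    have n1 := hF1.1 .n (by decide)
    have kb1 := hF1.1 .kb (by decide)
    have L1 := hF1.1 .L (by decide)
    have n01 := hF1.1 .n0 (by decide)
    have e1 := hF1.1 .e2 (by decide)
    have hg1 := hF1.2 .hgh (by decide)
    simp [hh, hL, hn, he] at hc1 n1 kb1 L1 n01 e1 hg1 hk
    rw [spec_seq, spec_assign]
    refine ⟨by simp, ?_⟩
    refine spec_loop_time (fun l s' => ∀ i < n0 ^ L, ∀ j < n0 ^ L,
      s'.arr .xA 0 (zIdx n0 L i j) =
        (if (i < k ∧ j < h ∨ i = k ∧ j < l) ∧ f j ∈ A (f i) then 1 else 0) ∧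
      s'.arr .xB 0 (zIdx n0 L i j) =
        (if (i < k ∧ j < h ∨ i = k ∧ j < l) ∧ f j ∈ A (f i) then 1 else 0))
      (9 + 5 * L) (by simpa [and_assoc] using h1) ?_ ?_
    · rintro l hl s2 hF2 hi2 h2
      have hG2 : GRep s2 R A := hG1.frame_of_eq hF2 (by decide) (by simp) (by simp) rfl
      have n2 := hF2.1 .n (by decide)
      have kb2 := hF2.1 .kb (by decide)
      have L2 := hF2.1 .L (by decide)
      have n02 := hF2.1 .n0 (by decide)
      have e2 := hF2.1 .e2 (by decide)
      have x2 := hF2.1 .x (by decide)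
      have i2 := hF2.1 .i (by decide)
      have hg2 := hF2.2 .hgh (by decide)
      simp [hc1, n1, kb1, L1, n01, e1, hg1, hi1, hf] at hl n2 kb2 L2 n02 e2 x2 i2 hg2
      simp only [spec_seq, spec_assign]
      refine ⟨by simp, by simp, ?_⟩
      refine Spec.mono (zindex_spec (n0 := n0) (L := L) (by decide) (by decide) (by simp [L2])
        (by simp [n02]) (by simp [e2]) hn0 hwd) ?_
      rintro s3 hF3 - ⟨g1, g2⟩
      have kb3 := hF3.1 .kb (by decide)
      have q3 := hF3.1 .q (by decide)
      have A3 := hF3.2 .xA (by decide)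
      have B3 := hF3.2 .xB (by decide)
      simp [hi2, i2, n2, hg2, hf, x2, hG2.mat, kb2] at g1 g2 kb3 q3 A3 B3
      rw [spec_put, spec_put]
      refine ⟨by simp, by simp, fun i hi j hj => ?_, by simp; omega⟩
      obtain ⟨h3, h4⟩ := h2 i hi j hj
      simp [kb3, g1, q3, A3, B3]
      by_cases hz : i = k ∧ j = l
      · obtain ⟨rfl, rfl⟩ := hz
        simp
      -- The recursive order is injective, so the new entry does not destroy an earlier one.
      · have hz' : zIdx n0 L i j ≠ zIdx n0 L k l := fun hz' =>
          hz (zIdx_inj hn0 hi hj (by omega) (by omega) hz')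
        have e : (i = k ∧ j ≤ l) ↔ (i = k ∧ j < l) := by omega
        rw [if_neg hz', if_neg hz', h3, h4]
        simp only [e, and_self]
    · rintro s2 hF2 h2 h3
      simp [hc1] at h2 h3
      refine ⟨fun i hi j hj => ?_, by
        have : h * (9 + 5 * L + 1) = h * (10 + 5 * L) := by ring
        omega⟩
      obtain ⟨h4, h5⟩ := h2 i hi j hj
      have e : (i < k + 1 ∧ j < h) ↔ (i < k ∧ j < h ∨ i = k ∧ j < h) := by omega
      simp only [St.set_arr, ← and_assoc, e]
      exact ⟨h4, h5⟩
  · rintro s1 - h1 h2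
    simp [hh] at h1 h2
    refine ⟨h1, ?_⟩
    have : h * (3 + h * (10 + 5 * L) + 1) = h * (4 + h * (10 + 5 * L)) := by ring
    omega

theorem evalHeavy_spec {n0 L h M : ℕ} {f : ℕ → ℕ} {P : ℕ → ℕ → Prop} (hG : GRep s R A)
    (hh : s.reg .hc = h)
    (hf : ∀ i, s.arr .hgh (s.reg .n) i = f i) (hL : s.reg .L = L) (hn : s.reg .n0 = n0)
    (he : s.reg .e2 = n0 * n0) (hM : s.reg .M = M) (hn0 : 0 < n0) (hwd : (n0 * n0) ^ L < E.wd)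
    (hb : s.reg .best = 0) (hP : ∀ i < h, ∀ j < h, P (f i) (f j))
    (hv : ∀ i < h, ∀ j < h, (A (f i)).length + (A (f j)).length -
      (s.arr .c2 (f i) (f j) + s.arr .xC L (zIdx n0 L i j) % M) = dom A (f i) (f j) ∧
      dom A (f i) (f j) < E.wd) :
    Spec E evalHeavy s fun s' =>
      Best A s' P (fun x y => ∃ i < h, ∃ j < h, x = f i ∧ y = f j) ∧
      s'.time ≤ s.time + 1 + h * (4 + h * (15 + 5 * L)) := by
  refine spec_loop_time (fun k s' => Best A s' P (fun x y => ∃ i < k, ∃ j < h, x = f i ∧ y = f j))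
    (3 + h * (15 + 5 * L)) ⟨by simp, by simp [hb]⟩ ?_ ?_
  · rintro k hk s1 hF1 hi1 h1
    have hG1 : GRep s1 R A := hG.frame hF1 (by decide)
    have hc1 := hF1.1 .hc (by decide)
    have n1 := hF1.1 .n (by decide)
    have L1 := hF1.1 .L (by decide)
    have n01 := hF1.1 .n0 (by decide)
    have e1 := hF1.1 .e2 (by decide)
    have M1 := hF1.1 .M (by decide)
    have hg1 := hF1.2 .hgh (by decide)
    have c1 := hF1.2 .c2 (by decide)
    have C1 := hF1.2 .xC (by decide)
    rw [hh] at hk hc1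
    rw [hL] at L1
    rw [hn] at n01
    rw [he] at e1
    rw [hM] at M1
    simp only [spec_seq, spec_assign]
    refine ⟨by simp, by simp, ?_⟩
    refine spec_loop_time (fun l s' => Best A s' P
      (fun x y => (∃ i < k, ∃ j < h, x = f i ∧ y = f j) ∨ ∃ j < l, x = f k ∧ y = f j))
      (14 + 5 * L) (h1.congr (by simp) (by simp) (by simp) (by simp)) ?_ ?_
    · rintro l hl s2 hF2 hi2 h2
      have hG2 : GRep s2 R A := hG1.frame_of_eq hF2 (by decide) (by simp) (by simp) rfl
      have n2 := hF2.1 .n (by decide)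
      have L2 := hF2.1 .L (by decide)
      have n02 := hF2.1 .n0 (by decide)
      have e2 := hF2.1 .e2 (by decide)
      have M2 := hF2.1 .M (by decide)
      have x2 := hF2.1 .x (by decide)
      have p2 := hF2.1 .p (by decide)
      have i2 := hF2.1 .i (by decide)
      have hg2 := hF2.2 .hgh (by decide)
      have c22 := hF2.2 .c2 (by decide)
      have C2 := hF2.2 .xC (by decide)
      simp [hc1, n1, L1, n01, e1, M1, hg1, c1, C1, hi1, hf, hG1.len] at hl n2 L2 n02 e2 M2 x2 p2 i2 hg2 c22 C2
      simp only [spec_seq, spec_assign]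
      refine ⟨by simp, by simp, ?_⟩
      refine Spec.mono (zindex_spec (n0 := n0) (L := L) (by decide) (by decide) (by simp [L2])
        (by simp [n02]) (by simp [e2]) hn0 hwd) ?_
      rintro s3 hF3 - ⟨g1, g2⟩
      have L3 := hF3.1 .L (by decide)
      have M3 := hF3.1 .M (by decide)
      have x3 := hF3.1 .x (by decide)
      have y3 := hF3.1 .y (by decide)
      have p3 := hF3.1 .p (by decide)
      have q3 := hF3.1 .q (by decide)
      have b3 := hF3.1 .best (by decide)
      have b13 := hF3.1 .b1 (by decide)
      have b23 := hF3.1 .b2 (by decide)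
      have c23 := hF3.2 .c2 (by decide)
      have C3 := hF3.2 .xC (by decide)
      simp [hi2, i2, n2, hg2, hf, x2, hG2.len, L2, M2, p2, c22, C2] at g1 g2 L3 M3 x3 y3 p3 q3 b3 b13 b23 c23 C3
      obtain ⟨k1, k2⟩ := hv k hk l hl
      have h3 : Best A s3 P
          (fun x y => (∃ i < k, ∃ j < h, x = f i ∧ y = f j) ∨ ∃ j < l, x = f k ∧ y = f j) :=
        h2.congr b3 b13 b23 fun _ _ h => h
      have hval : (♯.p + ♯.q - (Term.get .c2 .x .y + Term.get .xC .L .tt % ♯.M)).val s3 =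
          dom A (f k) (f l) := by
        simp [p3, q3, c23, x3, y3, C3, L3, g1, M3, k1]
      rw [hval]
      refine ⟨fun _ => k2, ?_⟩
      by_cases hlt : s3.reg .best < dom A (f k) (f l)
      · rw [spec_ite_of_ne (by simp [hlt])]
        simp [x3, y3]
        refine ⟨⟨?_, .inr ⟨by simpa using hP k hk l hl, by simp⟩⟩, by omega⟩
        rintro x y (h | ⟨j, hj, rfl, rfl⟩)
        · simpa using (h3.le x y (.inl h)).trans hlt.le
        · rcases Nat.lt_or_eq_of_le hj with hj | rfl
          · simpa using (h3.le _ _ (.inr ⟨j, hj, rfl, rfl⟩)).trans hlt.le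
          · simp
      · rw [spec_ite_of_eq (by simp [hlt])]
        simp
        refine ⟨⟨?_, by simpa using h3.att⟩, by omega⟩
        rintro x y (h | ⟨j, hj, rfl, rfl⟩)
        · simpa using h3.le x y (.inl h)
        · rcases Nat.lt_or_eq_of_le hj with hj | rfl
          · simpa using h3.le _ _ (.inr ⟨j, hj, rfl, rfl⟩)
          · simpa using hlt
    · rintro s2 hF2 h2 h3
      simp [hc1] at h2 h3
      refine ⟨h2.congr (by simp) (by simp) (by simp) ?_, by
        have : h * (14 + 5 * L + 1) = h * (15 + 5 * L) := by ring
        omega⟩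
      rintro x y ⟨i, hi, j, hj, rfl, rfl⟩
      rcases Nat.lt_succ_iff_lt_or_eq.1 hi with hi | rfl
      · exact .inl ⟨i, hi, j, hj, rfl, rfl⟩
      · exact .inr ⟨j, hj, rfl, rfl⟩
  · rintro s1 - h1 h2
    rw [hh] at h1 h2
    refine ⟨h1, ?_⟩
    have : h * (3 + h * (15 + 5 * L) + 1) = h * (4 + h * (15 + 5 * L)) := by ring
    omega

end


section
variable {E : Env} {s : St} {R : List ℕ} {A : ℕ → List ℕ} {m : ℕ}

/-- What the program writes does not depend on its numerical parameters; after replacing them by 0,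
membership in these lists can be decided. -/
theorem search_wr (c₁ B K₀ : ℕ) : (search c₁ B K₀).wr = (search 0 0 0).wr := rfl

theorem search_wa (c₁ B K₀ : ℕ) : (search c₁ B K₀).wa = (search 0 0 0).wa := rfl

theorem search_graphFree (c₁ B K₀ : ℕ) :
    (search c₁ B K₀).graphFree = (search 0 0 0).graphFree := rfl

/-- The adjacency matrix of the vertices of high degree, with ones on the diagonal, is padded with
zeros to size n₀ ^ L and squared. The hypothesis `hQ` is stated for the least cost rather than a
particular candidate, because the program chooses the candidate. If no vertex qualifies, no search
is made, and `best` stays 0. -/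
theorem heavyCore_spec {c₁ B K₀ d N K cap Q : ℕ} (hN : Nbr m R A) (hG : GRep s R A)
    (hm : s.reg .m = m) (hd : s.reg .d = d) (hd1 : 1 ≤ d) (hNd : N = 2 * m / d)
    (hK : K = Nat.clog 2 N + K₀) (hcap : cap = c₁ * N ^ B) (hK0 : 0 < K₀) (hc1 : 0 < c₁)
    (hwR : R.length < E.wd) (hwd : K * (K + N + 2 + cap) < E.wd)
    (hQ : 0 < N → ∀ q, IsBestQ N K cap q → q < cap ∧ q ≤ Q)
    (hc0 : ∀ x y, s.arr .c2 x y = 0) (hA0 : ∀ x y, s.arr .xA x y = 0)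
    (hB0 : ∀ x y, s.arr .xB x y = 0) :
    Spec E (heavyCore c₁ B K₀) s fun s' =>
      Best A s' (fun x y => (x ∈ R ∧ d < (A x).length) ∧ y ∈ R ∧ d < (A y).length)
        (fun x y => (x ∈ R ∧ d < (A x).length) ∧ y ∈ R ∧ d < (A y).length) ∧
      s'.time ≤ s.time + 1000 * (d * (m + 1) + K ^ 6 * Q) := by
  have hRl := hN.length
  have dm : d * (m + 1) = d * m + d := by ring
  have md : m ≤ d * m := Nat.le_mul_of_pos_left _ hd1
  simp only [heavyCore, spec_seq, spec_assign]
  refine ⟨by simp, by simp, by simp, ?_⟩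
  refine Spec.mono (collectHeavy_spec (R := R) (A := A)
    (hG.congr (by simp) (by simp) rfl rfl rfl rfl)) ?_
  rintro s1 hF1 - ⟨g1, g2⟩
  have hG1 : GRep s1 R A := hG.frame_of_eq hF1 (by decide) (by simp) (by simp) rfl
  have b1 := hF1.1 .best (by decide)
  have m1 := hF1.1 .m (by decide)
  have d1 := hF1.1 .d (by decide)
  simp [hm, hd] at b1 m1 d1 g1 g2
  have c1 := hF1.2 .c2 (by decide)
  have A1 := hF1.2 .xA (by decide)
  have B1 := hF1.2 .xB (by decide)
  set h := s1.reg .hc with hh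
  have hlen : (heavy A R d).length = h := by rw [← g1]; simp
  have hhd : h * d ≤ 2 * m := by rw [← hlen]; exact hN.length_heavy_mul_le d
  have hhN : h ≤ N := by rw [hNd]; exact (Nat.le_div_iff_mul_le hd1).2 hhd
  by_cases hz : h = 0
  · rw [spec_ite_of_eq (by simpa using hz), spec_skip]
    refine ⟨⟨?_, .inl (by simpa using b1)⟩, by simp; omega⟩
    rintro x y ⟨h1, -⟩
    rw [hz] at hlen
    have := mem_heavy.2 h1
    rw [List.eq_nil_of_length_eq_zero hlen] at this
    simp at this
  rw [spec_ite_of_ne (by simpa using hz)]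
  have hN0 : 0 < N := by omega
  have hcap0 : 0 < cap := by rw [hcap]; positivity
  rw [spec_seq]
  refine Spec.mono (countLow_spec (R := R) (A := A) (hG1.congr (by simp) (by simp) rfl rfl rfl rfl)
    hN.nodupA (by simp [c1, hc0])) ?_
  rintro s2 hF2 - ⟨g3, g4⟩
  have hG2 : GRep s2 R A := hG1.frame_of_eq hF2 (by decide) (by simp) (by simp) rfl
  have b2 := hF2.1 .best (by decide)
  have m2 := hF2.1 .m (by decide)
  have d2 := hF2.1 .d (by decide)
  have h2 := hF2.1 .hc (by decide)
  have n2 := hF2.1 .n (by decide)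
  simp [b1, m1, d1, ← hh] at b2 m2 d2 h2 n2 g3 g4
  have gr2 := hF2.2 .hgh (by decide)
  have A2 := hF2.2 .xA (by decide)
  have B2 := hF2.2 .xB (by decide)
  simp [A1, B1] at gr2 A2 B2
  have hNv : (s2.reg .m + s2.reg .m) / s2.reg .d = N := by rw [m2, d2, hNd, two_mul]
  have hKN : N < E.wd := by
    have : N ≤ K * (K + N + 2 + cap) := by
      calc N ≤ 1 * (K + N + 2 + cap) := by omega
        _ ≤ K * (K + N + 2 + cap) := Nat.mul_le_mul_right _ (by omega)
    omega
  rw [spec_seq, spec_assign, spec_seq]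
  refine ⟨fun _ => by simpa [hNv] using hKN, ?_⟩
  refine Spec.mono (search_spec (N := N) (K := K) (cap := cap) (by simp [hNv]) hK hcap hK0 hN0 hcap0
    hwd) ?_
  rintro s3 hF3 - ⟨g5, g6, g7⟩
  have hG3 : GRep s3 R A := hG2.frame_of_eq hF3 (by rw [search_graphFree]; decide) (by simp) (by simp) rfl
  obtain ⟨hqc, hqQ⟩ := hQ hN0 _ g5
  obtain ⟨b, hb, k, hk, hv, hC, hq⟩ := g6 hqc
  set q := s3.reg .bq
  have b3 := hF3.1 .best (by rw [search_wr]; decide)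
  have h3 := hF3.1 .hc (by rw [search_wr]; decide)
  have n3 := hF3.1 .n (by rw [search_wr]; decide)
  simp [b2, h2, n2] at b3 h3 n3 g7
  have gr3 := hF3.2 .hgh (by rw [search_wa]; decide)
  have A3 := hF3.2 .xA (by rw [search_wa]; decide)
  have B3 := hF3.2 .xB (by rw [search_wa]; decide)
  have c3 := hF3.2 .c2 (by rw [search_wa]; decide)
  simp [gr2, A2, B2] at gr3 A3 B3 c3
  obtain ⟨⟨hn1, hD0, her⟩, hbr⟩ := hv
  set n0 := cN b k with hn0d
  set L := Nat.clog n0 N with hLd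
  set M := cM N b k with hMd
  have hn0 : 0 < n0 := by omega
  have hNL : N ≤ n0 ^ L := Nat.le_pow_clog hn1 N
  have hqr : cR b k ^ L = q := by
    change min (cR b k ^ L) cap = q at hq
    omega
  have hqL : (n0 * n0) ^ L ≤ q := by rw [← hqr]; exact Nat.pow_le_pow_left her L
  have hK1 : 1 ≤ K := by omega
  have hcapw : cap < E.wd := by
    have : cap ≤ K * (K + N + 2 + cap) := by
      calc cap ≤ 1 * (K + N + 2 + cap) := by omega
        _ ≤ K * (K + N + 2 + cap) := Nat.mul_le_mul_right _ (by omega)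
    omega
  -- Entries of the product are at most `N`, so they are determined by their residues.
  have hNM : N < M := by
    have : N + 1 ≤ cD b k * (N + 1) := Nat.le_mul_of_pos_left _ hD0
    rw [hMd, cM]
    omega
  have hLK : L ≤ K :=
    (Nat.clog_anti_left (by omega) hn1).trans (show Nat.clog 2 N ≤ K by omega)
  set f := s1.arr .hgh (s1.reg .n) with hf
  rw [spec_seq]
  refine Spec.mono (loadHeavy_spec (n0 := n0) (L := L) (h := h) (f := f) hG3 h3
    (by rw [gr3, n3]; simp [hf]) hC.L hC.n0 hC.e2 hn0 (hhN.trans hNL)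
    (hqL.trans_lt (hqc.trans hcapw))
    (by simp [A3, hA0]) (by simp [B3, hB0])) ?_
  rintro s4 hF4 - ⟨g8, g9⟩
  have hG4 : GRep s4 R A := hG3.frame hF4 (by decide)
  have hC4 : CRep s4 N b k cap := ⟨by rw [hF4.1 .n0 (by decide), hC.n0],
    by rw [hF4.1 .e2 (by decide), hC.e2], by rw [hF4.1 .r (by decide), hC.r],
    by rw [hF4.1 .M (by decide), hC.M], by rw [hF4.1 .L (by decide), hC.L],
    by rw [hF4.1 .qq (by decide), hC.qq], by rw [hF4.2 .tU (by decide)]; exact hC.U,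
    by rw [hF4.2 .tV (by decide)]; exact hC.V, by rw [hF4.2 .tW (by decide)]; exact hC.W⟩
  rw [spec_seq]
  refine Spec.mono (product_spec (N := N) (K := K) (b := b) (k := k) (cap := cap) (q := q)
    ⟨⟨hn1, hD0, her⟩, hbr⟩ hC4 hq hqc hb hk (by omega) hwd) ?_
  rintro s5 hF5 - ⟨g10, g11⟩
  rw [← hn0d, ← hLd, ← hMd] at g10
  have hG5 : GRep s5 R A := hG4.frame hF5 (by decide)
  have h5 : s5.reg .hc = h := by rw [hF5.1 .hc (by decide), hF4.1 .hc (by decide), h3]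
  have b5 : s5.reg .best = 0 := by rw [hF5.1 .best (by decide), hF4.1 .best (by decide), b3]
  have n5 : s5.reg .n = s1.reg .n := by rw [hF5.1 .n (by decide), hF4.1 .n (by decide), n3]
  have gr5 : s5.arr .hgh = s1.arr .hgh := by
    rw [hF5.2 .hgh (by decide), hF4.2 .hgh (by decide), gr3]
  have c5 : s5.arr .c2 = s2.arr .c2 := by rw [hF5.2 .c2 (by decide), hF4.2 .c2 (by decide), c3]
  have hfm : ∀ i < h, f i ∈ heavy A R d := fun i hi => by
    rw [← g1]
    exact List.mem_map_of_mem (List.mem_range.2 hi)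
  -- Only inner indices below `h` contribute because of the padding. Their contributions count the
  -- common closed neighbors of high degree.
  have hX : ∀ i < h, ∀ j < h, s5.arr .xC L (zIdx n0 L i j) % M =
      (heavy A R d).countP fun v => v ∈ A (f i) ∧ f j ∈ A v := by
    intro i hi j hj
    have e1 := g10 i (by omega) j (by omega)
    have e2 : ∀ l ∈ Finset.range (n0 ^ L),
        (s4.arr .xA 0 (zIdx n0 L i l) * s4.arr .xB 0 (zIdx n0 L l j) : ZMod M) =
        ((if l < h ∧ f l ∈ A (f i) ∧ f j ∈ A (f l) then 1 else 0 : ℕ) : ZMod M) := by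
      intro l hl
      rw [Finset.mem_range] at hl
      rw [(g8 i (by omega) l hl).1, (g8 l hl j (by omega)).2, ← Nat.cast_mul]
      congr 1
      by_cases k1 : l < h <;> by_cases k2 : f l ∈ A (f i) <;> by_cases k3 : f j ∈ A (f l) <;>
        simp [k1, k2, k3, hi, hj]
    rw [Finset.sum_congr rfl e2, ← Nat.cast_sum, ZMod.natCast_eq_natCast_iff'] at e1
    have e3 : ∑ l ∈ Finset.range (n0 ^ L),
        (if l < h ∧ f l ∈ A (f i) ∧ f j ∈ A (f l) then 1 else 0) =
        (heavy A R d).countP fun v => v ∈ A (f i) ∧ f j ∈ A v := by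
      rw [← g1, countP_row]
      rw [← Finset.sum_subset (Finset.range_subset_range.2 (hhN.trans hNL))]
      · exact Finset.sum_congr rfl fun l hl => by simp [Finset.mem_range.1 hl]
      · intro l _ hl
        rw [Finset.mem_range] at hl
        simp [hl]
    rw [e1, e3, Nat.mod_eq_of_lt]
    exact (List.countP_le_length.trans (by omega)).trans_lt hNM
  refine Spec.mono (evalHeavy_spec (n0 := n0) (L := L) (h := h) (M := M) (f := f)
    (P := fun x y => (x ∈ R ∧ d < (A x).length) ∧ y ∈ R ∧ d < (A y).length) hG5 h5
    (by rw [gr5, n5]; simp [hf]) (by rw [hF5.1 .L (by decide), hC4.L])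
    (by rw [hF5.1 .n0 (by decide), hC4.n0]) (by rw [hF5.1 .e2 (by decide), hC4.e2]; rfl)
    (by rw [hF5.1 .M (by decide), hC4.M]) hn0 (hqL.trans_lt (hqc.trans hcapw)) b5
    (fun i hi j hj => ⟨mem_heavy.1 (hfm i hi), mem_heavy.1 (hfm j hj)⟩) ?_) ?_
  · intro i hi j hj
    rw [c5, g3, hX i hi j hj]
    have e1 := hN.dom_add_common d (f i) (f j)
    simp only [Bool.decide_and] at e1 ⊢
    exact ⟨by omega, (hN.dom_le_length _ _).trans_lt hwR⟩
  · rintro s6 - - ⟨g12, g13⟩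
    refine ⟨g12.congr rfl rfl rfl ?_, ?_⟩
    · rintro x y ⟨hx, hy⟩
      have hx' := mem_heavy.2 hx
      have hy' := mem_heavy.2 hy
      rw [← g1] at hx' hy'
      obtain ⟨i, hi, rfl⟩ := List.mem_map.1 hx'
      obtain ⟨j, hj, rfl⟩ := List.mem_map.1 hy'
      exact ⟨i, List.mem_range.1 hi, j, List.mem_range.1 hj, rfl, rfl⟩
    · have w1 : wsum (fun v => 6 + 3 * (A v).length + 4 * (d * (A v).length)) R ≤
          6 * R.length + (3 + 4 * d) * (R.length + 2 * m) := by
        have : ∀ l : List ℕ, wsum (fun v => 6 + 3 * (A v).length + 4 * (d * (A v).length)) l =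
            6 * l.length + (3 + 4 * d) * (l.map fun v => (A v).length).sum := by
          intro l
          induction l with
          | nil => rfl
          | cons a l ih => simp [wsum] at ih ⊢; rw [ih]; ring
        rw [this]
        have := Nat.mul_le_mul_left (3 + 4 * d) hN.sum
        omega
      have w2 : (3 + 4 * d) * (R.length + 2 * m) ≤ (3 + 4 * d) * (6 * m + 2) :=
        Nat.mul_le_mul_left _ (by omega)
      have w3 : (3 + 4 * d) * (6 * m + 2) = 18 * m + 6 + 24 * (d * m) + 8 * d := by ring
      -- Loading and reading the matrices, and also the time O(N) of the search, are dominated by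
      -- the number of products, as n₀² ≤ r.
      have hhq : h * h ≤ q := by
        calc h * h ≤ n0 ^ L * n0 ^ L := Nat.mul_le_mul (by omega) (by omega)
          _ = (n0 * n0) ^ L := (mul_pow _ _ _).symm
          _ ≤ q := hqL
      have hNq : N ≤ q := by
        refine hNL.trans (le_trans ?_ hqL)
        rw [mul_pow]
        exact Nat.le_mul_of_pos_left _ (Nat.pow_pos hn0)
      have hh1 : h ≤ h * h := Nat.le_mul_of_pos_left _ (by omega)
      have w4 : h * (4 + h * (10 + 5 * L)) = 4 * h + 10 * (h * h) + 5 * (h * h * L) := by ring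
      have w5 : h * (4 + h * (15 + 5 * L)) = 4 * h + 15 * (h * h) + 5 * (h * h * L) := by ring
      have w6 : h * h * L ≤ K * q := by rw [mul_comm]; exact Nat.mul_le_mul hLK hhq
      have hq1 : 1 ≤ q := by omega
      have k1 : K * q ≤ K ^ 6 * q := Nat.mul_le_mul_right _ (Nat.le_self_pow (by omega) K)
      have k2 : K ^ 2 * q ≤ K ^ 6 * q :=
        Nat.mul_le_mul_right _ (Nat.pow_le_pow_right hK1 (by omega))
      have k3 : q ≤ K * q := Nat.le_mul_of_pos_left _ hK1
      have k4 : K ^ 6 ≤ K ^ 6 * q := Nat.le_mul_of_pos_right _ hq1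
      have k5 : K ^ 6 * q ≤ K ^ 6 * Q := Nat.mul_le_mul_left _ hqQ
      rw [dm]
      omega

end


/-! ## Graphs as lists -/

theorem _root_.IsEdgeList.adj_iff {n : ℕ} {G : SimpleGraph (Fin n)}
    {L : List (Fin n × Fin n)} (hL : IsEdgeList G L) (x y : Fin n) : G.Adj x y ↔ (x, y) ∈ L ∨ (y, x) ∈ L := by
  have h := hL.2 s(x, y)
  rw [SimpleGraph.mem_edgeSet] at h
  rw [← h, List.mem_map]
  constructor
  · rintro ⟨⟨a, b⟩, h1, h2⟩
    simp only [Sym2.eq_iff] at h2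
    rcases h2 with ⟨rfl, rfl⟩ | ⟨rfl, rfl⟩
    exacts [.inl h1, .inr h1]
  · rintro (h | h)
    exacts [⟨_, h, rfl⟩, ⟨_, h, Sym2.eq_swap⟩]

section
variable {n : ℕ} (G : SimpleGraph (Fin n)) [DecidableRel G.Adj]

/-- The closed neighborhood. -/
def nbhd (x : Fin n) : Finset (Fin n) := insert x (G.neighborFinset x)

/-- The vertices kept by the algorithms: enough isolated ones and all others. -/
def Core (m : ℕ) (x : Fin n) : Prop := (x : ℕ) < 2 * m + 2 ∨ 0 < G.degree x

/-- The lists `R`, `A` describe the graph `G`. -/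
structure Models (m : ℕ) (R : List ℕ) (A : ℕ → List ℕ) : Prop where
  nbr : Nbr m R A
  out : A n = []
  lt : ∀ v ∈ R, v < n
  mem : ∀ x : Fin n, (x : ℕ) ∈ R ↔ Core G m x
  toFinset : ∀ x : Fin n, (x : ℕ) ∈ R → (A x).toFinset = (nbhd G x).map Fin.valEmbedding

variable {G}

theorem domCount_eq (x y : Fin n) : domCount G x y = (nbhd G x ∪ nbhd G y).card := by
  simp only [domCount, nbhd]

theorem domCount_comm (x y : Fin n) : domCount G x y = domCount G y x := by
  rw [domCount_eq, domCount_eq, Finset.union_comm]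

theorem card_nbhd (x : Fin n) : (nbhd G x).card = G.degree x + 1 := by
  rw [nbhd, Finset.card_insert_of_notMem (by simp), SimpleGraph.card_neighborFinset_eq_degree]

theorem domCount_pos (x y : Fin n) : 0 < domCount G x y := by
  rw [domCount_eq]
  exact Finset.card_pos.2 ⟨x, by simp [nbhd]⟩

namespace Models
variable {m : ℕ} {R : List ℕ} {A : ℕ → List ℕ}

theorem dom_eq (h : Models G m R A) {x y : Fin n} (hx : (x : ℕ) ∈ R) (hy : (y : ℕ) ∈ R) :
    dom A x y = domCount G x y := by
  rw [dom, h.toFinset x hx, h.toFinset y hy, ← Finset.map_union, Finset.card_map, domCount_eq]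

theorem length_eq (h : Models G m R A) {x : Fin n} (hx : (x : ℕ) ∈ R) :
    (A x).length = G.degree x + 1 := by
  rw [← List.toFinset_card_of_nodup (h.nbr.nodupA x), h.toFinset x hx, Finset.card_map, card_nbhd]

end Models

section
variable {L : List (Fin n × Fin n)}

theorem _root_.IsEdgeList.length_eq (hL : IsEdgeList G L) : L.length = G.edgeFinset.card := by
  have h : (L.map fun e => s(e.1, e.2)).toFinset = G.edgeFinset := by
    ext e
    simp only [List.mem_toFinset, SimpleGraph.mem_edgeFinset]
    exact hL.2 e
  rw [← h, List.toFinset_card_of_nodup hL.1, List.length_map]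

/-- If a vertex was dropped, then all of the first 2m + 2 vertices exist. The edges have at most 2m
ends, so two of these vertices are isolated. -/
theorem _root_.IsEdgeList.not_core (hL : IsEdgeList G L) {x : Fin n} {m : ℕ} (hm : m = L.length) (hx : ¬ Core G m x) :
    ∃ a b : Fin n, a ≠ b ∧ Core G m a ∧ Core G m b ∧ G.degree a = 0 ∧ G.degree b = 0 := by
  simp only [Core, not_or, not_lt, nonpos_iff_eq_zero] at hx
  have hx2 := x.2
  set S : Finset (Fin n) := Finset.univ.filter fun v => (v : ℕ) < 2 * m + 2 with hS
  have hSc : S.card = 2 * m + 2 := by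
    have : S.map Fin.valEmbedding = Finset.range (2 * m + 2) := by
      ext v
      simp only [hS, Finset.mem_map, Finset.mem_filter, Finset.mem_univ, true_and,
        Fin.valEmbedding_apply, Finset.mem_range]
      exact ⟨fun ⟨a, h, e⟩ => e ▸ h, fun h => ⟨⟨v, by omega⟩, h, rfl⟩⟩
    rw [← Finset.card_map Fin.valEmbedding, this, Finset.card_range]
  set T : Finset (Fin n) := (L.map Prod.fst).toFinset ∪ (L.map Prod.snd).toFinset with hT
  have hTc : T.card ≤ 2 * m := by
    have h1 := (L.map Prod.fst).toFinset_card_le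
    have h2 := (L.map Prod.snd).toFinset_card_le
    have h3 := Finset.card_union_le (L.map Prod.fst).toFinset (L.map Prod.snd).toFinset
    rw [List.length_map] at h1 h2
    rw [← hT] at h3
    omega
  have h1 : 1 < (S \ T).card := by
    have := Finset.le_card_sdiff T S
    omega
  obtain ⟨a, ha, b, hb, hab⟩ := Finset.one_lt_card.1 h1
  have key : ∀ v ∈ S \ T, Core G m v ∧ G.degree v = 0 := by
    intro v hv
    rw [Finset.mem_sdiff] at hv
    refine ⟨.inl (by simpa [hS] using hv.1), ?_⟩
    by_contra h0
    obtain ⟨u, hu⟩ := (G.degree_pos_iff_exists_adj v).1 (Nat.pos_of_ne_zero h0)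
    refine hv.2 ?_
    rw [hT, Finset.mem_union, List.mem_toFinset, List.mem_toFinset, List.mem_map, List.mem_map]
    rcases (hL.adj_iff v u).1 hu with h | h
    exacts [.inl ⟨_, h, rfl⟩, .inr ⟨_, h, rfl⟩]
  exact ⟨a, b, hab, (key a ha).1, (key b hb).1, (key a ha).2, (key b hb).2⟩


theorem nbhd_of_degree {x : Fin n} (h : G.degree x = 0) : nbhd G x = {x} := by
  rw [← SimpleGraph.card_neighborFinset_eq_degree, Finset.card_eq_zero] at h
  rw [nbhd, h]
  rfl

theorem notMem_nbhd_of_degree {x y : Fin n} (h : G.degree x = 0) (hxy : x ≠ y) : x ∉ nbhd G y := by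
  intro hx
  rw [nbhd, Finset.mem_insert, SimpleGraph.mem_neighborFinset] at hx
  have := (G.degree_pos_iff_exists_adj x).2 ⟨y, (hx.resolve_left hxy).symm⟩
  omega

/-- A dropped `x` is isolated and adds at most one vertex to the neighborhood of `y`. An isolated
kept vertex other than `y` adds exactly one. Two of them are needed because one could be `y` itself.
-/
theorem _root_.IsEdgeList.exists_core_left (hL : IsEdgeList G L) {m : ℕ} (hm : m = L.length) (x y : Fin n) :
    ∃ x', Core G m x' ∧ domCount G x y ≤ domCount G x' y := by
  by_cases hx : Core G m x
  · exact ⟨x, hx, le_rfl⟩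
  obtain ⟨a, b, hab, ha, hb, ha0, hb0⟩ := hL.not_core hm hx
  have hx0 : G.degree x = 0 := by
    simp only [Core, not_or] at hx
    omega
  obtain ⟨c, hc, hc0, hcy⟩ : ∃ c, Core G m c ∧ G.degree c = 0 ∧ c ≠ y := by
    by_cases h : a = y
    · exact ⟨b, hb, hb0, fun h' => hab (h.trans h'.symm)⟩
    · exact ⟨a, ha, ha0, h⟩
  refine ⟨c, hc, ?_⟩
  rw [domCount_eq, domCount_eq, nbhd_of_degree hx0, nbhd_of_degree hc0,
    ← Finset.insert_eq, ← Finset.insert_eq,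
    Finset.card_insert_of_notMem (notMem_nbhd_of_degree hc0 hcy)]
  exact Finset.card_insert_le _ _

theorem _root_.IsEdgeList.exists_core (hL : IsEdgeList G L) {m : ℕ} (hm : m = L.length) (x y : Fin n) :
    ∃ x' y', Core G m x' ∧ Core G m y' ∧ domCount G x y ≤ domCount G x' y' := by
  obtain ⟨x', hx', h1⟩ := hL.exists_core_left hm x y
  obtain ⟨y', hy', h2⟩ := hL.exists_core_left hm y x'
  rw [domCount_comm, domCount_comm y'] at h2
  exact ⟨x', y', hx', hy', h1.trans h2⟩

theorem _root_.IsEdgeList.models (hL : IsEdgeList G L) {R : List ℕ} {A : ℕ → List ℕ}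
    (h : GInv (edgeV (min n (2 * L.length + 2)) (L.map fun e => (e.1.1, e.2.1)))
      (edgeR (L.map fun e => (e.1.1, e.2.1))) (2 * L.length) (4 * L.length + 2) R A) :
    Models G L.length R A := by
  have hr : ∀ x y : Fin n, edgeR (L.map fun e => (e.1.1, e.2.1)) x y ↔ G.Adj x y := by
    intro x y
    rw [hL.adj_iff, edgeR]
    simp only [List.mem_map, Prod.mk.injEq, Fin.val_inj, Prod.exists]
    constructor
    · rintro (⟨a, b, h, rfl, rfl⟩ | ⟨a, b, h, rfl, rfl⟩)
      exacts [.inl h, .inr h]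
    · rintro (h | h)
      exacts [.inl ⟨_, _, h, rfl, rfl⟩, .inr ⟨_, _, h, rfl, rfl⟩]
  have hV : ∀ v, edgeV (min n (2 * L.length + 2)) (L.map fun e => (e.1.1, e.2.1)) v → v < n := by
    rintro v (h | ⟨e, he, h⟩)
    · omega
    · obtain ⟨e, -, rfl⟩ := List.mem_map.1 he
      rcases h with rfl | rfl
      exacts [e.1.2, e.2.2]
  have hr' : ∀ v u, edgeR (L.map fun e => (e.1.1, e.2.1)) v u → u < n := by
    rintro v u (h | h) <;> obtain ⟨e, -, h⟩ := List.mem_map.1 h <;>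
      simp only [Prod.mk.injEq] at h
    exacts [h.2 ▸ e.2.2, h.1 ▸ e.1.2]
  refine ⟨GInv.nbr h, ?_, fun v hv => hV v ((h.mem v).1 hv), fun x => ?_, fun x hx => ?_⟩
  · rw [List.eq_nil_iff_forall_not_mem]
    intro u hu
    exact lt_irrefl _ (hV _ ((h.memA n u).1 hu).1)
  · rw [h.mem, Core, edgeV, G.degree_pos_iff_exists_adj]
    refine or_congr (by have := x.2; omega) ?_
    constructor
    · rintro ⟨e, he, h⟩
      obtain ⟨e, he', rfl⟩ := List.mem_map.1 he
      rcases h with h | h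
      · exact ⟨e.2, (hL.adj_iff _ _).2 (.inl (by rw [Fin.ext h]; exact he'))⟩
      · exact ⟨e.1, (hL.adj_iff _ _).2 (.inr (by rw [Fin.ext h]; exact he'))⟩
    · rintro ⟨y, hy⟩
      rcases (hL.adj_iff _ _).1 hy with h | h
      · exact ⟨_, List.mem_map_of_mem h, .inl rfl⟩
      · exact ⟨_, List.mem_map_of_mem h, .inr rfl⟩
  · ext u
    simp only [List.mem_toFinset, h.memA, Finset.mem_map, nbhd, Finset.mem_insert,
      SimpleGraph.mem_neighborFinset, Fin.valEmbedding_apply]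
    constructor
    · rintro ⟨-, rfl | hu⟩
      · exact ⟨x, .inl rfl, rfl⟩
      · exact ⟨⟨u, hr' _ _ hu⟩, .inr ((hr x ⟨u, _⟩).1 hu), rfl⟩
    · rintro ⟨y, rfl | hy, rfl⟩
      · exact ⟨(h.mem _).1 hx, .inl rfl⟩
      · exact ⟨(h.mem _).1 hx, .inr ((hr x y).2 hy)⟩

end

theorem inputState_edge {L : List (Fin n × Fin n)} {d k : ℕ} (h : k < L.length) :
    (inputState n L d).mem (2 + 2 * k) = L[k].1 ∧ (inputState n L d).mem (3 + 2 * k) = L[k].2 := by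
  have key : ∀ (L : List (Fin n × Fin n)) (k : ℕ) (h : k < L.length),
      (L.flatMap fun e => [(e.1 : ℕ), (e.2 : ℕ)]).getD (2 * k) 0 = L[k].1 ∧
      (L.flatMap fun e => [(e.1 : ℕ), (e.2 : ℕ)]).getD (2 * k + 1) 0 = L[k].2 := by
    intro L
    induction L with
    | nil => simp
    | cons e L ih =>
      intro k h
      cases k with
      | zero => simp
      | succ k => simpa [Nat.mul_add] using ih k (by simpa using h)
  have := key L k h
  have e1 : 2 + 2 * k = 2 * k + 1 + 1 := by omega
  have e2 : 3 + 2 * k = 2 * k + 1 + 1 + 1 := by omega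
  rw [e1, e2]
  simpa [inputState] using this

theorem input_spec {L : List (Fin n × Fin n)} (hL : IsEdgeList G L) {d a : ℕ} (ha : 6 ≤ a) {s : St}
    (hs : ∀ a x y, s.arr a x y = 0) :
    Spec (inputEnv n L d a) pre s fun s' => (∃ R A, GRep s' R A ∧ Models G L.length R A) ∧
      s'.reg .n = n ∧ s'.reg .m = L.length ∧ s'.time ≤ s.time + 60 * (L.length + 1) ∧
      ∀ a x y, a ∉ pre.wa → s'.arr a x y = 0 := by
  set F := L.map fun e => (e.1.1, e.2.1) with hF
  have hFl : F.length = L.length := by simp [hF]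
  have hwd : 2 * F.length + 2 < (inputEnv n L d a).wd := by
    have h1 : (n + L.length + d + 2) ^ 2 ≤ (n + L.length + d + 2) ^ a :=
      Nat.pow_le_pow_right (by omega) (by omega)
    have h2 : (L.length + 2) * (L.length + 2) ≤ (n + L.length + d + 2) ^ 2 := by
      rw [sq]; exact Nat.mul_le_mul (by omega) (by omega)
    have h3 : (L.length + 2) * (L.length + 2) = L.length * L.length + 4 * L.length + 4 := by ring
    change 2 * F.length + 2 < (n + L.length + d + 2) ^ a
    omega
  refine Spec.mono (pre_spec (n := n) F (by simp [inputEnv]) (by simp [inputEnv, hFl]) ?_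
    (by simp [inputEnv, hFl]) hwd ?_ hs) ?_
  · intro k h
    simpa [inputEnv, hF] using inputState_edge (d := d) (hFl ▸ h)
  · intro k h
    have hk : k < L.length := hFl ▸ h
    have h1 : G.Adj L[k].1 L[k].2 := (hL.adj_iff _ _).2 (.inl (List.getElem_mem hk))
    refine ⟨by simpa [hF, Fin.val_inj] using h1.ne, fun h2 => ?_⟩
    have h3 : s(L[k].1, L[k].2) ∈ (L.take k).map fun e => s(e.1, e.2) := by
      rw [List.mem_map]
      simp only [edgeR, hF, ← List.map_take, List.mem_map, List.getElem_map, Prod.mk.injEq,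
        Fin.val_inj] at h2
      rcases h2 with ⟨e, he, h3, h4⟩ | ⟨e, he, h3, h4⟩
      · exact ⟨e, he, by rw [h3, h4]⟩
      · exact ⟨e, he, by rw [h3, h4, Sym2.eq_swap]⟩
    obtain ⟨j, hj, h4⟩ := List.getElem_of_mem h3
    simp only [List.length_map, List.length_take, lt_min_iff] at hj
    have h5 := hL.1.getElem_inj_iff (i := j) (j := k) (hi := by simp; omega) (hj := by simpa)
    simp only [List.getElem_map, List.getElem_take] at h4 h5
    have := h5.1 h4
    omega
  · rintro s' - - ⟨⟨R, A, h1, h2⟩, h3, h4, h5, h6⟩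
    rw [hFl] at h2 h4 h5
    exact ⟨⟨R, A, h1, hL.models h2⟩, h3, h4, h5, h6⟩

end


/-! ## The algorithms for pairs of vertices of given degrees -/

def output : Cmd := .o0 ::= ♯.best ;; .o1 ::= ♯.b1 ;; .o2 ::= ♯.b2

/-- Closed neighborhoods of more than `d` and at most `2d` elements belong to degrees from `d` to
`2d - 1`. -/
def nearProg : Cmd :=
  .d ::= ♯.o0 ;; pre ;; .lo ::= ♯.d ;; .hi ::= ♯.d + ♯.d ;; nearCore ;; output

def heavyProg (c₁ B K₀ : ℕ) : Cmd := .d ::= ♯.o0 ;; pre ;; heavyCore c₁ B K₀ ;; output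

theorem inputEnv_lt {n : ℕ} {L : List (Fin n × Fin n)} {d a k : ℕ} (ha : 6 ≤ a)
    (hk : k < 32 * (n + L.length + d + 2)) : k < (inputEnv n L d a).wd := by
  have h1 : (n + L.length + d + 2) ^ 6 ≤ (n + L.length + d + 2) ^ a :=
    Nat.pow_le_pow_right (by omega) ha
  have h2 : 2 ^ 5 ≤ (n + L.length + d + 2) ^ 5 := Nat.pow_le_pow_left (by omega) 5
  have h3 : 32 * (n + L.length + d + 2) ≤ (n + L.length + d + 2) ^ 6 := by
    rw [pow_succ]; exact Nat.mul_le_mul_right _ h2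
  change k < (n + L.length + d + 2) ^ a
  omega

section
variable {n : ℕ} {G : SimpleGraph (Fin n)} [DecidableRel G.Adj] {m : ℕ} {R : List ℕ}
  {A : ℕ → List ℕ}

theorem Models.exists_fin (h : Models G m R A) {v : ℕ} (hv : v ∈ R) : ∃ x : Fin n, (x : ℕ) = v :=
  ⟨⟨v, h.lt v hv⟩, rfl⟩

/-- Every pair dominates at least one vertex, so a final value 0 can only mean that no pair
satisfies `P`. -/
theorem Models.result (h : Models G m R A) {P : ℕ → ℕ → Prop} {s : St}
    (hP : ∀ x y, P x y → x ∈ R ∧ y ∈ R) (hB : Best A s P P) :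
    (∃ x y : Fin n, P x y ∧ (∀ x' y' : Fin n, P x' y' → domCount G x' y' ≤ domCount G x y) ∧
      s.reg .best = domCount G x y ∧ s.reg .b1 = x ∧ s.reg .b2 = y) ∨
    (s.reg .best = 0 ∧ ∀ x y : Fin n, ¬ P x y) := by
  have key : ∀ x y : Fin n, P x y → domCount G x y ≤ s.reg .best := fun x y hxy => by
    rw [← h.dom_eq (hP _ _ hxy).1 (hP _ _ hxy).2]
    exact hB.le _ _ hxy
  rcases hB.att with h0 | ⟨h1, h2⟩
  · refine .inr ⟨h0, fun x y hxy => ?_⟩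
    have := key x y hxy
    have := domCount_pos (G := G) x y
    omega
  · obtain ⟨h3, h4⟩ := hP _ _ h1
    obtain ⟨x, hx⟩ := h.exists_fin h3
    obtain ⟨y, hy⟩ := h.exists_fin h4
    rw [← hx, ← hy] at h1 h2
    rw [← hx] at h3
    rw [← hy] at h4
    rw [h.dom_eq h3 h4] at h2
    exact .inl ⟨x, y, h1, fun x' y' h' => h2 ▸ key x' y' h', h2, hx.symm, hy.symm⟩

theorem Models.mem_of_degree (h : Models G m R A) {x : Fin n} (hx : 0 < G.degree x) :
    (x : ℕ) ∈ R := (h.mem x).2 (.inr hx)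

theorem pre_near {x : Arr} (h : x ∈ [Arr.dlen, .pos, .neg, .c2, .xA, .xB]) : x ∉ pre.wa := by
  revert x
  decide

variable {L : List (Fin n × Fin n)}

theorem nearProg_spec (hL : IsEdgeList G L) {d a : ℕ} (ha : 6 ≤ a) (hd : 1 ≤ d) :
    Spec (inputEnv n L d a) nearProg (initSt d) fun s =>
      ((∃ x y : Fin n, IsBestPair G (fun _ y => d ≤ G.degree y ∧ G.degree y < 2 * d) x y ∧
        s.reg .o0 = domCount G x y ∧ s.reg .o1 = x ∧ s.reg .o2 = y) ∨
      (s.reg .o0 = 0 ∧ ∀ x y : Fin n, IsSolution G x y →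
        ¬(d ≤ G.degree y ∧ G.degree y < 2 * d))) ∧
      s.time ≤ 6000 * (d * (L.length + 1)) := by
  simp only [nearProg, spec_seq, spec_assign]
  refine ⟨by simp, ?_⟩
  refine Spec.mono (input_spec hL ha (by simp [initSt])) ?_
  rintro s1 hF1 - ⟨⟨R, A, hG, hM⟩, hn, hm, ht, h0⟩
  have d1 := hF1.1 .d (by decide)
  simp [initSt] at d1 ht
  refine ⟨by simp, fun _ => ?_, ?_⟩
  · simp [d1]
    exact inputEnv_lt ha (by omega)
  refine Spec.mono (nearCore_spec (R := R) (A := A) hM.nbr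
    (hG.congr (by simp) (by simp) rfl rfl rfl rfl) (by simp [hn, hM.out])
    (inputEnv_lt ha (by have := hM.nbr.length; omega)) (by simp; omega)
    (by simp [h0 .dlen _ _ (pre_near (by simp))])
    (by simp [h0 .pos _ _ (pre_near (by simp)), h0 .neg _ _ (pre_near (by simp))])) ?_
  rintro s2 - - ⟨h1, h2⟩
  simp [d1] at h1 h2
  simp only [output, spec_seq, spec_assign]
  simp
  have hR : ∀ x : Fin n, d ≤ G.degree x → (x : ℕ) ∈ R := fun x hx => hM.mem_of_degree (by omega)
  refine ⟨?_, ?_⟩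
  · rcases h1 with ⟨h1, h3⟩ | ⟨h1, h3⟩
    · refine .inr ⟨h1, fun x y hs hy1 => ?_⟩
      by_contra! hy2
      -- The vertex `y` has positive degree and is kept in any case; only `x` may have to be
      -- replaced.
      obtain ⟨x', hx', hle⟩ := hL.exists_core_left rfl x y
      have hxR := (hM.mem x').2 hx'
      have hyR := hR y hy1
      obtain ⟨a, ha, b, hb, hab⟩ := h3 x' hxR y hyR (by rw [hM.length_eq hyR]; omega)
        (by rw [hM.length_eq hyR]; omega)
      obtain ⟨a, rfl⟩ := hM.exists_fin ha
      obtain ⟨b, rfl⟩ := hM.exists_fin hb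
      rw [hM.dom_eq hxR hyR, hM.dom_eq ha hb] at hab
      have := hs.2 a b trivial
      omega
    · rcases hM.result (fun x y h => ⟨h.1, h.2.1⟩) h3 with ⟨x, y, h4, h5, h6⟩ | h4
      · refine .inl ⟨x, y, ⟨?_, fun x' y' hy' => ?_⟩, h6⟩
        · have := hM.length_eq h4.2.1
          omega
        · obtain ⟨x'', hx'', hle⟩ := hL.exists_core_left rfl x' y'
          have hyR := hR y' hy'.1
          refine hle.trans (h5 x'' y' ⟨(hM.mem x'').2 hx'', hyR, ?_⟩)
          rw [hM.length_eq hyR]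
          omega
      · exact absurd h4.1 h1
  · have e1 : max d 1 = d := by omega
    rw [e1] at h2
    have : L.length + 1 ≤ d * (L.length + 1) := Nat.le_mul_of_pos_left _ hd
    omega

theorem heavyProg_spec {c₁ B K₀ N K cap Q : ℕ} (hL : IsEdgeList G L) {d a : ℕ} (ha : 6 ≤ a)
    (hd : 1 ≤ d) (hNd : N = 2 * L.length / d)
    (hK : K = Nat.clog 2 N + K₀) (hcap : cap = c₁ * N ^ B) (hK0 : 0 < K₀) (hc1 : 0 < c₁)
    (hwd : K * (K + N + 2 + cap) < (inputEnv n L d a).wd)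
    (hQ : 0 < N → ∀ q, IsBestQ N K cap q → q < cap ∧ q ≤ Q) :
    Spec (inputEnv n L d a) (heavyProg c₁ B K₀) (initSt d) fun s =>
      ((∃ x y : Fin n, IsBestPair G (fun x y => d ≤ G.degree x ∧ d ≤ G.degree y) x y ∧
        s.reg .o0 = domCount G x y ∧ s.reg .o1 = x ∧ s.reg .o2 = y) ∨
      (s.reg .o0 = 0 ∧ ∀ x : Fin n, G.degree x < d)) ∧
      s.time ≤ 2000 * (d * (L.length + 1) + K ^ 6 * Q) := by
  simp only [heavyProg, spec_seq, spec_assign]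
  refine ⟨by simp, ?_⟩
  refine Spec.mono (input_spec hL ha (by simp [initSt])) ?_
  rintro s1 hF1 - ⟨⟨R, A, hG, hM⟩, hn, hm, ht, h0⟩
  have d1 := hF1.1 .d (by decide)
  simp [initSt] at d1 ht
  refine Spec.mono (heavyCore_spec (N := N) (K := K) (cap := cap) (Q := Q) hM.nbr hG hm d1 hd hNd hK
    hcap hK0 hc1 (inputEnv_lt ha (by have := hM.nbr.length; omega)) hwd hQ
    (fun x y => h0 .c2 _ _ (pre_near (by simp))) (fun x y => h0 .xA _ _ (pre_near (by simp)))
    (fun x y => h0 .xB _ _ (pre_near (by simp)))) ?_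
  rintro s2 - - ⟨h1, h2⟩
  simp only [output, spec_seq, spec_assign]
  simp
  have hR : ∀ x : Fin n, d ≤ G.degree x → (x : ℕ) ∈ R ∧ d < (A x).length := fun x hx => by
    have h := hM.mem_of_degree (x := x) (by omega)
    rw [hM.length_eq h]
    exact ⟨h, by omega⟩
  refine ⟨?_, ?_⟩
  · rcases hM.result (fun x y h => ⟨h.1.1, h.2.1⟩) h1 with ⟨x, y, h4, h5, h6⟩ | ⟨h4, h5⟩
    · refine .inl ⟨x, y, ⟨?_, fun x' y' hy' => h5 x' y' ⟨hR x' hy'.1, hR y' hy'.2⟩⟩, h6⟩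
      have := hM.length_eq h4.1.1
      have := hM.length_eq h4.2.1
      omega
    · refine .inr ⟨h4, fun x => ?_⟩
      by_contra! hx
      exact h5 x x ⟨hR x hx, hR x hx⟩
  · have : L.length + 1 ≤ d * (L.length + 1) := Nat.le_mul_of_pos_left _ hd
    omega

end


/-! ## The algorithm for all pairs -/

/-- The least cost of a candidate. -/
noncomputable def bestQ (N K cap : ℕ) : ℕ :=
  sInf {q | q = cap ∨ ∃ b < K, ∃ k < K, Valid N b k ∧ cQ N b k cap = q}

theorem isBestQ_bestQ (N K cap : ℕ) : IsBestQ N K cap (bestQ N K cap) := by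
  have hne : {q | q = cap ∨ ∃ b < K, ∃ k < K, Valid N b k ∧ cQ N b k cap = q}.Nonempty :=
    ⟨cap, .inl rfl⟩
  refine ⟨Nat.sInf_le (.inl rfl), fun b hb k hk hv => Nat.sInf_le (.inr ⟨b, hb, k, hk, hv, rfl⟩),
    fun h => ?_⟩
  rcases Nat.sInf_mem hne with h1 | h1
  · exact absurd h1 h.ne
  · exact h1

/-- The estimated cost of multiplying matrices of size `N`. -/
noncomputable def mulCost (c₁ B K₀ N : ℕ) : ℕ := bestQ N (Nat.clog 2 N + K₀) (c₁ * N ^ B)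

/-- The balancing threshold depends on ω, which is not available to the program. Instead it compares
the actual costs for all powers of two up to m; the search for each costs only O(m) up to
logarithmic factors. -/
def chooseD (c₁ B K₀ : ℕ) : Cmd :=
  .gt ::= 1 ;; .read .m .gt ;; .bd ::= 1 ;; .bc ::= 0 ;; .bj ::= 1 ;;
  .loop .jj .m
    (.ite (♯.m ≺ ♯.bj) .skip
      (.N ::= (♯.m + ♯.m) / ♯.bj ;; search c₁ B K₀ ;; .c ::= ♯.m * ♯.bj + ♯.bq ;;
        .ite ((♯.jj ≺ 1) + (♯.c ≺ ♯.bc)) (.bc ::= ♯.c ;; .bd ::= ♯.bj) .skip ;;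
        .bj ::= ♯.bj + ♯.bj))

def combine : Cmd :=
  .ite (♯.g0 ≺ ♯.best) (.g0 ::= ♯.best ;; .g1 ::= ♯.b1 ;; .g2 ::= ♯.b2) .skip

/-- The ranges (0, 1], (1, 2], (2, 4], … cover all sizes up to the power of two `bd`. Each round
starts with cleared arrays and reads the graph again, since `nearCore` relies on zero counters. -/
def scanNear : Cmd :=
  .lo ::= 0 ;; .hi ::= 1 ;; .g0 ::= 0 ;; .g1 ::= 0 ;; .g2 ::= 0 ;;
  .loop .jj .bd
    (.ite (♯.lo ≺ ♯.bd)
      (.clear ;; pre ;; nearCore ;; combine ;; .lo ::= ♯.hi ;; .hi ::= ♯.hi + ♯.hi) .skip)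

def mainProg (c₁ B K₀ : ℕ) : Cmd :=
  chooseD c₁ B K₀ ;; scanNear ;; .clear ;; pre ;; .d ::= ♯.bd ;; heavyCore c₁ B K₀ ;; combine ;;
  .o0 ::= ♯.g0 ;; .o1 ::= ♯.g1 ;; .o2 ::= ♯.g2

section
variable {E : Env} {s : St}

theorem chooseD_spec {c₁ B K₀ m Km : ℕ} (hm : E.inp 1 = m) (hsz : 1 < E.size) (hK0 : 0 < K₀)
    (hc1 : 0 < c₁) (hKm : Km = Nat.clog 2 (2 * m) + K₀)
    (hwd : ∀ N ≤ 2 * m, (Nat.clog 2 N + K₀) * (Nat.clog 2 N + K₀ + N + 2 + c₁ * N ^ B) < E.wd)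
    (hwd2 : m * m + c₁ * (2 * m) ^ B < E.wd) (hwd3 : 2 * m < E.wd) :
    Spec E (chooseD c₁ B K₀) s fun s' =>
      (∃ e, s'.reg .bd = 2 ^ e) ∧ s'.reg .bd ≤ max m 1 ∧
      (∀ j, 2 ^ j ≤ m → m * s'.reg .bd + mulCost c₁ B K₀ (2 * m / s'.reg .bd) ≤
        m * 2 ^ j + mulCost c₁ B K₀ (2 * m / 2 ^ j)) ∧
      s'.time ≤ s.time + 10 * (m + 1) + Km * (300 * (Km ^ 6 + 2 * m) + 20) := by
  set f : ℕ → ℕ := fun j => m * 2 ^ j + mulCost c₁ B K₀ (2 * m / 2 ^ j) with hf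
  simp only [chooseD, spec_seq, spec_assign, spec_read]
  refine ⟨by simp, by simpa, by simp, by simp, by simp, ?_⟩
  -- The loop runs m times, but only the rounds with 2 ^ k ≤ m do work; from then on `bj` stays at
  -- the first power of two above m. In round 0 there is no earlier cost to compare with.
  refine spec_loop (fun k s' => s'.reg .bj = 2 ^ (min k (Nat.log 2 m + 1)) ∧
    (k = 0 ∧ s'.reg .bd = 1 ∨ 0 < k ∧ (∃ j < min k (Nat.log 2 m + 1), s'.reg .bd = 2 ^ j ∧
      s'.reg .bc = f j) ∧ ∀ j < min k (Nat.log 2 m + 1), s'.reg .bc ≤ f j) ∧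
    s'.time ≤ s.time + 6 + 5 * k + min k (Nat.log 2 m + 1) * (300 * (Km ^ 6 + 2 * m) + 20))
    (by simp) ?_ ?_
  · rintro k hk s1 hF1 hi ⟨h1, h2, h3⟩
    have m1 := hF1.1 .m (by rw [Cmd.wr, Cmd.wr, Cmd.wr, Cmd.wr, Cmd.wr, search_wr]; decide)
    simp [hm] at m1 hk
    have hle : ∀ j, 2 ^ j ≤ m ↔ j ≤ Nat.log 2 m := fun j =>
      (Nat.le_log_iff_pow_le (by omega) (by omega)).symm
    by_cases hlt : m < s1.reg .bj
    · rw [spec_ite_of_ne (by simp [m1, hlt]), spec_skip]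
      have h4 : ¬ min k (Nat.log 2 m + 1) ≤ Nat.log 2 m := by
        rw [← hle, ← h1]
        omega
      have h5 : min (k + 1) (Nat.log 2 m + 1) = min k (Nat.log 2 m + 1) := by omega
      simp only [h5, St.set_reg, St.tick_reg, reduceCtorEq, if_false]
      refine ⟨h1, ?_, by simp; omega⟩
      rcases h2 with h2 | h2
      · omega
      · exact .inr ⟨by omega, h2.2⟩
    · rw [spec_ite_of_eq (by simp [m1, hlt])]
      have h4 : min k (Nat.log 2 m + 1) ≤ Nat.log 2 m := by
        rw [← hle, ← h1]
        omega
      have h5 : min k (Nat.log 2 m + 1) = k := by omega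
      have h6 : min (k + 1) (Nat.log 2 m + 1) = k + 1 := by omega
      rw [h5] at h1 h2 h3
      have h7 : 2 ^ k ≤ m := by omega
      have hN : 0 < 2 * m / 2 ^ k := Nat.div_pos (by omega) (Nat.two_pow_pos k)
      have hN2 : 2 * m / 2 ^ k ≤ 2 * m := Nat.div_le_self _ _
      simp only [spec_seq, spec_assign]
      refine ⟨fun _ => ?_, ?_⟩
      · simp [m1, h1, ← two_mul]
        omega
      refine Spec.mono (search_spec (N := 2 * m / 2 ^ k) (by simp [m1, h1, two_mul]) rfl rfl hK0 hN
        (by positivity) (hwd _ hN2)) ?_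
      rintro s2 hF2 - ⟨h8, -, h9⟩
      have q2 : s2.reg .bq = mulCost c₁ B K₀ (2 * m / 2 ^ k) := h8.eq (isBestQ_bestQ _ _ _)
      have m2 := hF2.1 .m (by rw [search_wr]; decide)
      have bj2 := hF2.1 .bj (by rw [search_wr]; decide)
      have bd2 := hF2.1 .bd (by rw [search_wr]; decide)
      have bc2 := hF2.1 .bc (by rw [search_wr]; decide)
      have jj2 := hF2.1 .jj (by rw [search_wr]; decide)
      simp [m1, h1, hi] at m2 bj2 bd2 bc2 jj2 h9
      have hval : s2.reg .m * s2.reg .bj + s2.reg .bq = f k := by rw [m2, bj2, q2]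
      have hK : (Nat.clog 2 (2 * m / 2 ^ k) + K₀) ^ 6 ≤ Km ^ 6 := by
        rw [hKm]
        exact Nat.pow_le_pow_left (Nat.add_le_add_right (Nat.clog_mono_right 2 hN2) _) 6
      have e1 : (k + 1) * (300 * (Km ^ 6 + 2 * m) + 20) =
          k * (300 * (Km ^ 6 + 2 * m) + 20) + 300 * (Km ^ 6 + 2 * m) + 20 := by ring
      have hb2 : 2 ^ k + 2 ^ k = 2 ^ (k + 1) := by ring
      refine ⟨fun _ => ?_, ?_⟩
      · simp only [Term.val_add, Term.val_mul, Term.val_reg, m2, bj2, q2]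
        have e1 : m * 2 ^ k ≤ m * m := Nat.mul_le_mul_left _ h7
        have e2 : mulCost c₁ B K₀ (2 * m / 2 ^ k) ≤ c₁ * (2 * m / 2 ^ k) ^ B :=
          (isBestQ_bestQ _ _ _).le_cap
        have e3 : c₁ * (2 * m / 2 ^ k) ^ B ≤ c₁ * (2 * m) ^ B :=
          Nat.mul_le_mul_left _ (Nat.pow_le_pow_left hN2 _)
        omega
      rw [Term.val_add, Term.val_mul, Term.val_reg, Term.val_reg, Term.val_reg, hval, h6]
      by_cases hc : k = 0 ∨ f k < s1.reg .bc
      · rw [spec_ite_of_ne (by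
          rcases hc with hc | hc
          · simp [jj2, hc]
          · simp [bc2, hc])]
        simp [bj2, hb2]
        refine ⟨by omega, fun j hj => ?_, by omega⟩
        rcases Nat.lt_or_eq_of_le hj with hj | rfl
        · rcases hc with hc | hc
          · omega
          · rcases h2 with h2 | h2
            · omega
            · exact hc.le.trans (h2.2.2 j hj)
        · exact le_rfl
      · push Not at hc
        rw [spec_ite_of_eq (by simp [bc2, jj2, hc.1, hc.2, Nat.pos_of_ne_zero])]
        simp [bj2, hb2, bc2, bd2]
        rcases h2 with h2 | ⟨h2, ⟨j0, h10, h11⟩, h12⟩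
        · exact absurd h2.1 hc.1
        refine ⟨by omega, ⟨⟨j0, by omega, h11⟩, fun j hj => ?_⟩, by omega⟩
        rcases Nat.lt_or_eq_of_le hj with hj | rfl
        · exact h12 j hj
        · exact hc.2
  · rintro s1 hF1 ⟨h1, h2, h3⟩
    simp [hm] at h1 h2 h3
    have h4 : min m (Nat.log 2 m + 1) * (300 * (Km ^ 6 + 2 * m) + 20) ≤
        Km * (300 * (Km ^ 6 + 2 * m) + 20) := by
      refine Nat.mul_le_mul_right _ ?_
      rcases Nat.eq_zero_or_pos m with h0 | h0
      · simp [h0]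
      have : Nat.log 2 m ≤ Nat.clog 2 (2 * m) := (Nat.log_le_clog 2 m).trans
        (Nat.clog_mono_right 2 (by omega))
      omega
    rcases h2 with ⟨h5, h6⟩ | ⟨h5, ⟨j0, h6, h7, h8⟩, h9⟩
    · subst h5
      exact ⟨⟨0, by simp [h6]⟩, by simp [h6], fun j hj => absurd hj (by simp), by omega⟩
    · have hle : ∀ j, 2 ^ j ≤ m ↔ j ≤ Nat.log 2 m := fun j =>
        (Nat.le_log_iff_pow_le (by omega) (by omega)).symm
      have h10 := (hle j0).2 (by omega)
      refine ⟨⟨j0, h7⟩, by omega, fun j hj => ?_, by omega⟩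
      have h11 := h9 j ?_ (by have := (hle j).1 hj; omega)
      · rw [h7]
        rw [h8] at h11
        exact h11
      · exact (Nat.lt_two_pow_self).trans_le hj

end


section
variable {n : ℕ} {G : SimpleGraph (Fin n)} [DecidableRel G.Adj]

/-- The best pair stored so far is at least as good as the pairs in `T`. -/
def Found (G : SimpleGraph (Fin n)) [DecidableRel G.Adj] (s : St) (T : Fin n → Fin n → Prop) :
    Prop :=
  (∀ x y, T x y → domCount G x y ≤ s.reg .g0) ∧
    (s.reg .g0 = 0 ∨ ∃ x y : Fin n, s.reg .g0 = domCount G x y ∧ s.reg .g1 = x ∧ s.reg .g2 = y)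

theorem Found.congr {s s' : St} {T : Fin n → Fin n → Prop} (h : Found G s T)
    (h0 : s'.reg .g0 = s.reg .g0) (h1 : s'.reg .g1 = s.reg .g1) (h2 : s'.reg .g2 = s.reg .g2) :
    Found G s' T := by
  rw [Found, h0, h1, h2]
  exact h

theorem combine_spec {E : Env} {s : St} {T T' T'' : Fin n → Fin n → Prop} (h : Found G s T)
    (hb : s.reg .best = 0 ∨
      ∃ x y : Fin n, s.reg .best = domCount G x y ∧ s.reg .b1 = x ∧ s.reg .b2 = y)
    (hT : ∀ x y, T' x y → domCount G x y ≤ s.reg .best) (hT'' : ∀ x y, T'' x y → T x y ∨ T' x y) :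
    Spec E combine s fun s' => Found G s' T'' ∧ s'.time ≤ s.time + 4 := by
  rw [combine]
  by_cases hlt : s.reg .g0 < s.reg .best
  · rw [spec_ite_of_ne (by simp [hlt])]
    simp [Found]
    refine ⟨fun x y hxy => ?_, hb⟩
    rcases hT'' x y hxy with h1 | h1
    · exact (h.1 x y h1).trans hlt.le
    · exact hT x y h1
  · rw [spec_ite_of_eq (by simp [hlt])]
    simp
    refine ⟨fun x y hxy => ?_, by simpa using h.2⟩
    rw [St.tick_reg, St.tick_reg]
    rcases hT'' x y hxy with h1 | h1
    · exact h.1 x y h1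
    · exact (hT x y h1).trans (not_lt.1 hlt)

variable {L : List (Fin n × Fin n)}

/-- Solutions with kept vertices. -/
def CoreSol (G : SimpleGraph (Fin n)) [DecidableRel G.Adj] (m : ℕ) (x y : Fin n) : Prop :=
  IsSolution G x y ∧ Core G m x ∧ Core G m y

/-- The guarantee concerns solutions only: a range may be left without a result if it meets no
solution. By symmetry it suffices that the second vertex has small degree. -/
theorem scanNear_spec (hL : IsEdgeList G L) {d a e : ℕ} (ha : 6 ≤ a) {s : St}
    (he : s.reg .bd = 2 ^ e) (hwd : 2 * 2 ^ e < (inputEnv n L d a).wd) :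
    Spec (inputEnv n L d a) scanNear s fun s' =>
      Found G s' (fun x y => CoreSol G L.length x y ∧ G.degree y + 1 ≤ 2 ^ e) ∧
      s'.time ≤ s.time + 13000 * (2 ^ e * (L.length + 1)) := by
  simp only [scanNear, spec_seq, spec_assign]
  refine ⟨by simp, by simp, by simp, by simp, by simp, ?_⟩
  refine spec_loop (fun k s' => ∃ j, j = min k (e + 1) ∧ s'.reg .hi = 2 ^ j ∧
    s'.reg .lo = 2 ^ j / 2 ∧
    Found G s' (fun x y => CoreSol G L.length x y ∧ G.degree y + 1 ≤ 2 ^ j / 2) ∧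
    s'.time ≤ s.time + 6 + 3 * k + 6000 * (2 ^ j * (L.length + 1))) ?_ ?_ ?_
  · refine ⟨0, by simp, by simp, by simp, ⟨by simp, by simp⟩, by simp⟩
  · rintro k hk s1 hF1 hi ⟨j, hj, h1, h2, h3, h4⟩
    have bd1 := hF1.1 .bd (by decide)
    simp [he] at bd1 hk
    by_cases hje : j ≤ e
    swap
    · rw [spec_ite_of_eq, spec_skip]
      · exact ⟨j, by omega, by simpa using h1, by simpa using h2, h3.congr (by simp) (by simp) (by simp),
          by simp; omega⟩
      · have hje' : j = e + 1 := by omega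
        simp [bd1, h2, hje', pow_succ]
    have hk' : j = k := by omega
    have hpos := Nat.two_pow_pos j
    have hlo : 2 ^ j / 2 < 2 ^ e := by
      have := Nat.pow_le_pow_right (n := 2) (by omega) hje
      omega
    rw [spec_ite_of_ne (by simp [bd1, h2, hlo])]
    simp only [spec_seq, spec_clear]
    refine Spec.mono (input_spec hL ha (by simp)) ?_
    rintro s2 hF2 - ⟨⟨R, A, hG, hM⟩, hn, hm, ht, h0⟩
    have lo2 := hF2.1 .lo (by decide)
    have hi2 := hF2.1 .hi (by decide)
    have g02 := hF2.1 .g0 (by decide)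
    have g12 := hF2.1 .g1 (by decide)
    have g22 := hF2.1 .g2 (by decide)
    simp [h1, h2] at lo2 hi2 g02 g12 g22
    have hhl : 2 ^ j ≤ 2 * max (2 ^ j / 2) 1 := by
      rcases Nat.eq_zero_or_pos j with h | h
      · simp [h]
      · have h2 : 2 ^ j = 2 * 2 ^ (j - 1) := by rw [← pow_succ']; congr 1; omega
        omega
    refine Spec.mono (nearCore_spec (R := R) (A := A) hM.nbr hG (by rw [hn, hM.out])
      (inputEnv_lt ha (by have := hM.nbr.length; omega)) (by rw [hi2, lo2]; exact hhl)
      (fun v => h0 .dlen _ _ (pre_near (by simp)))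
      (fun y x => ⟨h0 .pos _ _ (pre_near (by simp)), h0 .neg _ _ (pre_near (by simp))⟩)) ?_
    rintro s3 hF3 - ⟨h5, h6⟩
    have lo3 := hF3.1 .lo (by decide)
    have hi3 := hF3.1 .hi (by decide)
    have g03 := hF3.1 .g0 (by decide)
    have g13 := hF3.1 .g1 (by decide)
    have g23 := hF3.1 .g2 (by decide)
    rw [lo2] at lo3 h5 h6
    rw [hi2] at hi3 h5
    have h7 : (s3.reg .best = 0 ∨ ∃ x y : Fin n, s3.reg .best = domCount G x y ∧
        s3.reg .b1 = x ∧ s3.reg .b2 = y) ∧ ∀ x y, CoreSol G L.length x y ∧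
        2 ^ j / 2 < G.degree y + 1 ∧ G.degree y + 1 ≤ 2 ^ j → domCount G x y ≤ s3.reg .best := by
      rcases h5 with ⟨h5, h7⟩ | ⟨h5, h7⟩
      · refine ⟨.inl h5, ?_⟩
        rintro x y ⟨⟨hs, hx, hy⟩, hy1, hy2⟩
        have hxR := (hM.mem x).2 hx
        have hyR := (hM.mem y).2 hy
        rw [← hM.length_eq hyR] at hy1 hy2
        obtain ⟨a, ha, b, hb, hab⟩ := h7 x hxR y hyR hy1 hy2
        obtain ⟨a, rfl⟩ := hM.exists_fin ha
        obtain ⟨b, rfl⟩ := hM.exists_fin hb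
        rw [hM.dom_eq hxR hyR, hM.dom_eq ha hb] at hab
        have := hs.2 a b trivial
        omega
      · refine ⟨?_, ?_⟩
        · rcases hM.result (fun x y h => ⟨h.1, h.2.1⟩) h7 with ⟨x, y, -, -, h8⟩ | h8
          · exact .inr ⟨x, y, h8⟩
          · exact .inl h8.1
        · rintro x y ⟨⟨hs, hx, hy⟩, hy1, hy2⟩
          have hxR := (hM.mem x).2 hx
          have hyR := (hM.mem y).2 hy
          rw [← hM.length_eq hyR] at hy1 hy2
          rw [← hM.dom_eq hxR hyR]
          exact h7.le x y ⟨hxR, hyR, hy1, hy2⟩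
    refine Spec.mono (combine_spec (T'' := fun x y => CoreSol G L.length x y ∧
      G.degree y + 1 ≤ 2 ^ (j + 1) / 2) (h3.congr (g03.trans g02) (g13.trans g12) (g23.trans g22))
      h7.1 h7.2 ?_) ?_
    · rintro x y ⟨hs, hy⟩
      have e1 : 2 ^ (j + 1) / 2 = 2 ^ j := by rw [pow_succ]; omega
      rw [e1] at hy
      by_cases h : G.degree y + 1 ≤ 2 ^ j / 2
      · exact .inl ⟨hs, h⟩
      · exact .inr ⟨hs, by omega, hy⟩
    · rintro s4 hF4 - ⟨h8, h9⟩
      have hi4 := hF4.1 .hi (by decide)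
      rw [hi3] at hi4
      simp only [spec_seq, spec_assign]
      have e1 : 2 ^ j + 2 ^ j = 2 ^ (j + 1) := by ring
      refine ⟨by simp, fun _ => ?_, j + 1, by omega, ?_, ?_, ?_, ?_⟩
      · have := Nat.pow_le_pow_right (n := 2) (by omega) hje
        simp [hi4]
        omega
      · simp [hi4, e1]
      · simp [hi4, pow_succ]
      · exact h8.congr (by simp) (by simp) (by simp)
      -- The costs of the rounds form a geometric series, so the last one dominates.
      · have e2 : 6000 * (2 ^ (j + 1) * (L.length + 1)) =
          6000 * (2 ^ j * (L.length + 1)) + 6000 * (2 ^ j * (L.length + 1)) := by ring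
        have e3 : max (2 ^ j / 2) 1 * (L.length + 1) ≤ 2 ^ j * (L.length + 1) :=
          Nat.mul_le_mul_right _ (by omega)
        have e4 : L.length + 1 ≤ 2 ^ j * (L.length + 1) := Nat.le_mul_of_pos_left _ hpos
        simp at ht ⊢
        omega
  · rintro s1 - ⟨j, hj, -, -, h3, h4⟩
    simp [he] at hj h3 h4
    -- The loop limit 2 ^ e exceeds e, so there are enough rounds for all e + 1 ranges.
    have h5 : j = e + 1 := by
      have : e < 2 ^ e := Nat.lt_two_pow_self
      omega
    subst h5
    have e1 : 2 ^ (e + 1) / 2 = 2 ^ e := by rw [pow_succ]; omega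
    rw [e1] at h3
    refine ⟨h3, ?_⟩
    have e2 : 6000 * (2 ^ (e + 1) * (L.length + 1)) = 12000 * (2 ^ e * (L.length + 1)) := by ring
    have e3 : 2 ^ e ≤ 2 ^ e * (L.length + 1) := Nat.le_mul_of_pos_right _ (by omega)
    have e4 : 1 ≤ 2 ^ e := Nat.two_pow_pos e
    omega

theorem heavyCore_wr (c₁ B K₀ : ℕ) : (heavyCore c₁ B K₀).wr = (heavyCore 0 0 0).wr := rfl

/-- Some solution consists of kept vertices. Either one of its closed neighborhoods has at most `bd`
elements and the scan finds an equally good pair, or both are larger and the matrix algorithm does.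
The time is stated relative to the chosen threshold `b`, which is optimal among the powers of two up
to m. -/
theorem mainProg_spec (hL : IsEdgeList G L) (hn : 1 ≤ n) {a c₁ B K₀ m Km : ℕ} (hm : m = L.length)
    (ha : 6 ≤ a) (hK0 : 0 < K₀) (hc1 : 0 < c₁) (hKm : Km = Nat.clog 2 (2 * m) + K₀)
    (hwd : ∀ N ≤ 2 * m, (Nat.clog 2 N + K₀) * (Nat.clog 2 N + K₀ + N + 2 + c₁ * N ^ B) <
      (inputEnv n L 0 a).wd)
    (hwd2 : m * m + c₁ * (2 * m) ^ B < (inputEnv n L 0 a).wd)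
    (hQ : ∀ N, 0 < N → mulCost c₁ B K₀ N < c₁ * N ^ B) :
    Spec (inputEnv n L 0 a) (mainProg c₁ B K₀) (initSt 0) fun s =>
      (∃ x y : Fin n, IsSolution G x y ∧
        s.reg .o0 = domCount G x y ∧ s.reg .o1 = x ∧ s.reg .o2 = y) ∧
      ∃ b, b ≤ max m 1 ∧ (∀ j, 2 ^ j ≤ m → m * b + mulCost c₁ B K₀ (2 * m / b) ≤
        m * 2 ^ j + mulCost c₁ B K₀ (2 * m / 2 ^ j)) ∧
      s.time ≤ Km * (300 * (Km ^ 6 + 2 * m) + 20) + 15000 * (b * (m + 1)) +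
        1000 * (Km ^ 6 * mulCost c₁ B K₀ (2 * m / b)) := by
  have hwd3 : 2 * m < (inputEnv n L 0 a).wd := inputEnv_lt ha (by omega)
  simp only [mainProg, spec_seq, spec_assign, spec_clear]
  refine Spec.mono (chooseD_spec (m := m) (Km := Km) (by simp [inputEnv, hm]) (by simp [inputEnv])
    hK0 hc1 hKm hwd hwd2 hwd3) ?_
  rintro s1 - - ⟨⟨e, he⟩, h1, h2, h3⟩
  rw [he] at h1 h2
  have hb1 : 1 ≤ 2 ^ e := Nat.two_pow_pos e
  have hbwd : 2 * 2 ^ e < (inputEnv n L 0 a).wd := inputEnv_lt ha (by omega)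
  refine Spec.mono (scanNear_spec hL ha he hbwd) ?_
  rintro s2 hF2 - ⟨h4, h5⟩
  have bd2 := hF2.1 .bd (by decide)
  rw [he] at bd2
  refine Spec.mono (input_spec hL ha (by simp)) ?_
  rintro s3 hF3 - ⟨⟨R, A, hG, hM⟩, hn3, hm3, ht, h0⟩
  have bd3 := hF3.1 .bd (by decide)
  have g03 := hF3.1 .g0 (by decide)
  have g13 := hF3.1 .g1 (by decide)
  have g23 := hF3.1 .g2 (by decide)
  simp [bd2] at bd3 g03 g13 g23 ht
  refine ⟨by simp, ?_⟩
  have hN2 : 2 * m / 2 ^ e ≤ 2 * m := Nat.div_le_self _ _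
  refine Spec.mono (heavyCore_spec (R := R) (A := A) (m := m) (d := 2 ^ e) (N := 2 * m / 2 ^ e)
    (Q := mulCost c₁ B K₀ (2 * m / 2 ^ e)) (hm ▸ hM.nbr)
    (hG.congr (by simp) (by simp) rfl rfl rfl rfl) (by simp [hm3, hm]) (by simp [bd3]) hb1 rfl
    rfl rfl hK0 hc1 (inputEnv_lt ha (by have := hM.nbr.length; omega)) (hwd _ hN2)
    (fun hN q hq => by
      rw [hq.eq (isBestQ_bestQ _ _ _)]
      exact ⟨hQ _ hN, le_rfl⟩)
    (fun x y => h0 .c2 _ _ (pre_near (by simp))) (fun x y => h0 .xA _ _ (pre_near (by simp)))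
    (fun x y => h0 .xB _ _ (pre_near (by simp)))) ?_
  rintro s4 hF4 - ⟨h6, h7⟩
  have g04 := hF4.1 .g0 (by rw [heavyCore_wr]; decide)
  have g14 := hF4.1 .g1 (by rw [heavyCore_wr]; decide)
  have g24 := hF4.1 .g2 (by rw [heavyCore_wr]; decide)
  simp [g03, g13, g23] at g04 g14 g24 h7
  refine Spec.mono (combine_spec (T' := fun x y => CoreSol G L.length x y ∧
      2 ^ e < G.degree x + 1 ∧ 2 ^ e < G.degree y + 1) (T'' := CoreSol G L.length)
      (Found.congr (T := fun x y => CoreSol G L.length x y ∧ (G.degree x + 1 ≤ 2 ^ e ∨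
        G.degree y + 1 ≤ 2 ^ e)) ⟨?_, h4.2⟩ g04 g14 g24) ?_ ?_ ?_) ?_
  -- If the small degree belongs to the first vertex, exchange the two.
  · rintro x y ⟨⟨hs, hx, hy⟩, h | h⟩
    · rw [domCount_comm]
      refine h4.1 y x ⟨⟨⟨trivial, fun x' y' _ => ?_⟩, hy, hx⟩, h⟩
      rw [domCount_comm y x]
      exact hs.2 x' y' trivial
    · exact h4.1 x y ⟨⟨hs, hx, hy⟩, h⟩
  · rcases hM.result (fun x y h => ⟨h.1.1, h.2.1⟩) h6 with ⟨x, y, -, -, h8⟩ | h8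
    · exact .inr ⟨x, y, h8⟩
    · exact .inl h8.1
  · rintro x y ⟨⟨hs, hx, hy⟩, hx1, hy1⟩
    have hxR := (hM.mem x).2 hx
    have hyR := (hM.mem y).2 hy
    rw [← hM.length_eq hxR] at hx1
    rw [← hM.length_eq hyR] at hy1
    rw [← hM.dom_eq hxR hyR]
    exact h6.le x y ⟨⟨hxR, hx1⟩, hyR, hy1⟩
  · intro x y h
    by_cases h1 : G.degree x + 1 ≤ 2 ^ e
    · exact .inl ⟨h, .inl h1⟩
    · by_cases h2 : G.degree y + 1 ≤ 2 ^ e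
      · exact .inl ⟨h, .inr h2⟩
      · exact .inr ⟨h, by omega, by omega⟩
  · rintro s5 - - ⟨h8, h9⟩
    simp
    -- A best pair exists because there is a vertex; replacing its vertices by kept ones gives a
    -- solution to which the guarantees apply.
    have hne : (Finset.univ : Finset (Fin n × Fin n)).Nonempty := ⟨(⟨0, hn⟩, ⟨0, hn⟩), by simp⟩
    obtain ⟨⟨x, y⟩, -, hxy⟩ :=
      Finset.exists_max_image Finset.univ (fun p : Fin n × Fin n => domCount G p.1 p.2) hne
    obtain ⟨x', y', hx', hy', hle⟩ := hL.exists_core rfl x y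
    have hs : IsSolution G x' y' := ⟨trivial, fun a b _ => (hxy (a, b) (by simp)).trans hle⟩
    have h10 := h8.1 x' y' ⟨hs, hx', hy'⟩
    refine ⟨?_, 2 ^ e, by omega, h2, ?_⟩
    · rcases h8.2 with h11 | ⟨x, y, h11, h12, h13⟩
      · have := domCount_pos (G := G) x' y'
        omega
      · refine ⟨x, y, ⟨trivial, fun a b _ => ?_⟩, h11, h12, h13⟩
        rw [← h11]
        exact (hs.2 a b trivial).trans h10
    · have e1 : (Nat.clog 2 (2 * m / 2 ^ e) + K₀) ^ 6 * mulCost c₁ B K₀ (2 * m / 2 ^ e) ≤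
          Km ^ 6 * mulCost c₁ B K₀ (2 * m / 2 ^ e) := by
        rw [hKm]
        exact Nat.mul_le_mul_right _ (Nat.pow_le_pow_left
          (Nat.add_le_add_right (Nat.clog_mono_right 2 hN2) _) 6)
      have e2 : m + 1 ≤ 2 ^ e * (m + 1) := Nat.le_mul_of_pos_left _ hb1
      rw [← hm] at h5 ht
      simp [initSt] at h3
      omega

end

end LoopRAM

/-! ## Bilinear algorithms from straight-line programs -/

namespace LoopRAM

open MvPolynomial

section
variable {ι κ : Type*}

/-- The coefficients of the constant, the linear and the bilinear terms, via derivatives at `0`. -/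
noncomputable def atZero (f : MvPolynomial (ι ⊕ κ) ℚ) : ℚ := eval (fun _ => 0) f
noncomputable def linL (f : MvPolynomial (ι ⊕ κ) ℚ) (i : ι) : ℚ := atZero (pderiv (Sum.inl i) f)
noncomputable def linR (f : MvPolynomial (ι ⊕ κ) ℚ) (j : κ) : ℚ := atZero (pderiv (Sum.inr j) f)
noncomputable def bilin (f : MvPolynomial (ι ⊕ κ) ℚ) (p : ι × κ) : ℚ :=
  atZero (pderiv (Sum.inl p.1) (pderiv (Sum.inr p.2) f))

theorem bilin_add (f g : MvPolynomial (ι ⊕ κ) ℚ) : bilin (f + g) = bilin f + bilin g := by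
  ext p; simp [bilin, atZero]

theorem bilin_sub (f g : MvPolynomial (ι ⊕ κ) ℚ) : bilin (f - g) = bilin f - bilin g := by
  ext p; simp [bilin, atZero]

/-- Leibniz' rule at 0. A multiplication adds only two new products of linear forms, one on the left
and one on the right variables; the rest are multiples of earlier bilinear parts. No bound on the
degrees of intermediate results is needed. -/
theorem bilin_mul (f g : MvPolynomial (ι ⊕ κ) ℚ) : bilin (f * g) =
    atZero f • bilin g + atZero g • bilin f + (fun p => linL f p.1 * linR g p.2) +
      fun p => linL g p.1 * linR f p.2 := by
  ext p
  simp [bilin, linL, linR, atZero, Derivation.leibniz]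
  ring

/-- The span of the products of pairs of linear forms. -/
def prodSpan (P : List ((ι → ℚ) × (κ → ℚ))) : Submodule ℚ (ι × κ → ℚ) :=
  Submodule.span ℚ (Set.range fun t : Fin P.length => fun p : ι × κ => P[t].1 p.1 * P[t].2 p.2)

theorem mem_prodSpan {P : List ((ι → ℚ) × (κ → ℚ))} {u : ι → ℚ} {v : κ → ℚ} (h : (u, v) ∈ P) :
    (fun p : ι × κ => u p.1 * v p.2) ∈ prodSpan P := by
  obtain ⟨t, ht, he⟩ := List.getElem_of_mem h
  exact Submodule.subset_span ⟨⟨t, ht⟩, by simp [he]⟩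

theorem prodSpan_mono {P Q : List ((ι → ℚ) × (κ → ℚ))} (h : ∀ p ∈ P, p ∈ Q) :
    prodSpan P ≤ prodSpan Q := by
  refine Submodule.span_le.2 ?_
  rintro _ ⟨t, rfl⟩
  exact mem_prodSpan (h _ (List.getElem_mem t.2))

/-- Variables and constants have no bilinear part, sums and differences stay in the span, and a
multiplication needs two more generators. For simplicity, two are added for every operation. -/
theorem IsComputation.exists_prodSpan [DecidableEq ι] [DecidableEq κ]
    {l : List (MvPolynomial (ι ⊕ κ) ℚ)} (h : IsComputation (Set.range X ∪ Set.range C) l) :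
    ∃ P : List ((ι → ℚ) × (κ → ℚ)), P.length = 2 * l.length ∧ ∀ f ∈ l, bilin f ∈ prodSpan P := by
  have hfree : ∀ f : MvPolynomial (ι ⊕ κ) ℚ, f ∈ Set.range X ∪ Set.range C → bilin f = 0 := by
    rintro f (⟨x, rfl⟩ | ⟨c, rfl⟩)
    · ext p
      simp only [bilin, pderiv_X, Pi.zero_apply]
      by_cases hx : x = Sum.inr p.2
      · subst hx; simp [atZero]
      · simp [hx, atZero, Pi.single_apply, Ne.symm hx]
    · ext p; simp [bilin, atZero]
  induction l with
  | nil => exact ⟨[], rfl, by simp⟩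
  | cons f l ih =>
    obtain ⟨h1, g, k, hg, hk, hf⟩ := h
    obtain ⟨P, hP, hb⟩ := ih h1
    refine ⟨(linL g, linR k) :: (linL k, linR g) :: P, by simp [hP]; ring, ?_⟩
    have hle : prodSpan P ≤ prodSpan ((linL g, linR k) :: (linL k, linR g) :: P) :=
      prodSpan_mono fun p hp => by simp [hp]
    have key : ∀ x, (x ∈ Set.range X ∪ Set.range C ∨ x ∈ l) →
        bilin x ∈ prodSpan ((linL g, linR k) :: (linL k, linR g) :: P) := by
      rintro x (hx | hx)
      · rw [hfree x hx]; exact Submodule.zero_mem _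
      · exact hle (hb x hx)
    intro x hx
    rcases List.mem_cons.1 hx with rfl | hx
    · rcases hf with rfl | rfl | rfl
      · rw [bilin_add]; exact Submodule.add_mem _ (key _ hg) (key _ hk)
      · rw [bilin_sub]; exact Submodule.sub_mem _ (key _ hg) (key _ hk)
      · rw [bilin_mul]
        exact Submodule.add_mem _ (Submodule.add_mem _ (Submodule.add_mem _
          (Submodule.smul_mem _ _ (key _ hk)) (Submodule.smul_mem _ _ (key _ hg)))
          (mem_prodSpan (by simp))) (mem_prodSpan (by simp))
    · exact key x (.inr hx)

end

theorem bilin_generic {n : ℕ} (i k : Fin n) (p : (Fin n × Fin n) × (Fin n × Fin n)) :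
    bilin ((genericLeft n * genericRight n) i k) p =
      if p.1.2 = p.2.1 ∧ i = p.1.1 ∧ k = p.2.2 then 1 else 0 := by
  have h : ∀ j, atZero (pderiv (Sum.inl p.1) (pderiv (Sum.inr p.2)
      (genericLeft n i j * genericRight n j k))) =
      if (i, j) = p.1 ∧ (j, k) = p.2 then 1 else 0 := by
    intro j
    simp only [genericLeft, genericRight, Derivation.leibniz, pderiv_X, smul_eq_mul, map_add]
    have e1 : (p.1 = (i, j)) = ((i, j) = p.1) := propext eq_comm
    have e2 : (p.2 = (j, k)) = ((j, k) = p.2) := propext eq_comm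
    by_cases h1 : (i, j) = p.1 <;> by_cases h2 : (j, k) = p.2 <;>
      simp [h1, h2, e1, e2, atZero, Pi.single_apply]
  rw [bilin, Matrix.mul_apply, map_sum, map_sum, atZero, map_sum]
  change ∑ j, atZero _ = _
  simp only [h]
  obtain ⟨⟨a, b⟩, c, d⟩ := p
  simp only [Prod.mk.injEq]
  by_cases hb : b = c
  · subst hb
    rw [Finset.sum_eq_single b (by
      intro j _ hj
      rw [if_neg (fun h => hj h.1.2)]) (by simp)]
    simp
  · rw [if_neg (fun h => hb h.1)]
    exact Finset.sum_eq_zero fun j _ => if_neg fun h => hb (h.1.2.symm.trans h.2.1)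

/-- Rational tables of a bilinear algorithm for matrices of size `n` with `r` products. -/
def HasRank (n r : ℕ) : Prop :=
  ∃ U V W : ℕ → ℕ → ℚ, ∀ α < n * n, ∀ β < n * n, ∀ γ < n * n,
    ∑ t ∈ Finset.range r, U t α * V t β * W γ t = if brent n α β γ then 1 else 0

theorem HasRank.mono {n r r' : ℕ} (h : HasRank n r) (hr : r ≤ r') : HasRank n r' := by
  obtain ⟨U, V, W, h⟩ := h
  refine ⟨fun t α => if t < r then U t α else 0, V, W, fun α hα β hβ γ hγ => ?_⟩
  rw [← h α hα β hβ γ hγ, ← Finset.sum_subset (Finset.range_subset_range.2 hr)]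
  · exact Finset.sum_congr rfl fun t ht => by simp only [if_pos (Finset.mem_range.1 ht)]
  · intro t _ ht
    simp only [if_neg (fun h' => ht (Finset.mem_range.2 h')), zero_mul]

/-- The bilinear part of an entry of the product has the structure constants of matrix
multiplication as coefficients. Expressing it by the generators of the span yields the three tables.
-/
theorem hasRank_of_computation {n : ℕ} (hn : 0 < n) {l : List (EntryPoly n)}
    (h : IsComputation (Set.range X ∪ Set.range C) l)
    (hl : ∀ i k : Fin n, (genericLeft n * genericRight n) i k ∈ l) : HasRank n (2 * l.length) := by
  have : NeZero n := ⟨hn.ne'⟩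
  obtain ⟨P, hP, hb⟩ := IsComputation.exists_prodSpan h
  set e : ℕ → Fin n × Fin n := fun α => (Fin.ofNat n (α / n), Fin.ofNat n α) with he
  have hc : ∀ γ : ℕ, ∃ c : Fin P.length → ℚ, ∑ t, c t • (fun p : (Fin n × Fin n) × (Fin n × Fin n) =>
      P[t].1 p.1 * P[t].2 p.2) = bilin ((genericLeft n * genericRight n) (e γ).1 (e γ).2) :=
    fun γ => (Submodule.mem_span_range_iff_exists_fun ℚ).1 (hb _ (hl _ _))
  choose c hc using hc
  refine ⟨fun t α => if h : t < P.length then P[t].1 (e α) else 0,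
    fun t β => if h : t < P.length then P[t].2 (e β) else 0,
    fun γ t => if h : t < P.length then c γ ⟨t, h⟩ else 0, fun α hα β hβ γ hγ => ?_⟩
  have h1 := congrFun (hc γ) (e α, e β)
  rw [bilin_generic] at h1
  rw [← hP, Finset.sum_range]
  have h2 : ∀ a, a < n * n → a / n % n = a / n := fun a ha =>
    Nat.mod_eq_of_lt (Nat.div_lt_of_lt_mul ha)
  have h3 : ((e α).2 = (e β).1 ∧ (e γ).1 = (e α).1 ∧ (e γ).2 = (e β).2) ↔ brent n α β γ := by
    simp only [he, brent, Fin.ext_iff, Fin.val_ofNat, h2 α hα, h2 β hβ, h2 γ hγ]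
  simp only [h3] at h1
  rw [← h1, Finset.sum_apply]
  refine Finset.sum_congr rfl fun t _ => ?_
  simp only [t.2, dif_pos, Fin.eta, Pi.smul_apply, smul_eq_mul]
  simp only [Fin.getElem_fin]
  ring

end LoopRAM

/-! ## Codes of bilinear algorithms -/

namespace LoopRAM

/-- The number with the digits `c 0, …, c (T - 1)` in base `b`. -/
def ofDig (b : ℕ) : (ℕ → ℕ) → ℕ → ℕ
  | _, 0 => 0
  | c, T + 1 => c 0 + b * ofDig b (fun i => c (i + 1)) T

theorem dg_ofDig {b T t : ℕ} {c : ℕ → ℕ} (hc : ∀ i, c i < b) (ht : t < T) :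
    dg b (ofDig b c T) t = c t := by
  induction T generalizing t c with
  | zero => omega
  | succ T ih =>
    have hb : 0 < b := (Nat.zero_le _).trans_lt (hc 0)
    cases t with
    | zero => rw [dg, ofDig, pow_zero, Nat.div_one, Nat.add_mul_mod_self_left, Nat.mod_eq_of_lt (hc 0)]
    | succ t =>
      rw [← ih (c := fun i => c (i + 1)) (fun i => hc _) (by omega), dg, dg, pow_succ',
        ← Nat.div_div_eq_div_mul, ofDig, Nat.add_mul_div_left _ _ hb, Nat.div_eq_of_lt (hc 0),
        zero_add]

theorem exists_denominator (S : Finset ℚ) : ∃ D : ℕ, 0 < D ∧ ∀ x ∈ S, ∃ z : ℤ, (z : ℚ) = D * x := by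
  refine ⟨∏ x ∈ S, x.den, Finset.prod_pos fun x _ => x.pos, fun x hx => ?_⟩
  obtain ⟨k, hk⟩ := Finset.dvd_prod_of_mem (fun x : ℚ => x.den) hx
  refine ⟨k * x.num, ?_⟩
  rw [hk]
  push_cast
  have := Rat.den_mul_eq_num x
  rw [← this]
  ring

/-- Clearing denominators scales the Brent equations by one common factor `D`; the division by `D`
is postponed to the arithmetic modulo `cM`. -/
theorem exists_integer_tables {n r : ℕ} (h : HasRank n r) : ∃ (D : ℕ) (U V W : ℕ → ℕ → ℤ), 0 < D ∧
    ∀ α < n * n, ∀ β < n * n, ∀ γ < n * n,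
      ∑ t ∈ Finset.range r, U t α * V t β * W γ t = if brent n α β γ then (D : ℤ) else 0 := by
  obtain ⟨U, V, W, h⟩ := h
  have key : ∀ F : ℕ → ℕ → ℚ, ∀ a b : ℕ, ∃ D : ℕ, 0 < D ∧ ∃ F' : ℕ → ℕ → ℤ,
      ∀ i < a, ∀ j < b, (F' i j : ℚ) = D * F i j := by
    intro F a b
    obtain ⟨D, hD, hz⟩ := exists_denominator
      ((Finset.range a ×ˢ Finset.range b).image fun p => F p.1 p.2)
    have : ∀ i j, ∃ z : ℤ, i < a → j < b → (z : ℚ) = D * F i j := by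
      intro i j
      by_cases hij : i < a ∧ j < b
      · obtain ⟨z, hz⟩ := hz (F i j) (Finset.mem_image.2 ⟨(i, j), by simp [hij], rfl⟩)
        exact ⟨z, fun _ _ => hz⟩
      · exact ⟨0, fun h1 h2 => absurd ⟨h1, h2⟩ hij⟩
    choose F' hF' using this
    exact ⟨D, hD, F', fun i hi j hj => hF' i j hi hj⟩
  obtain ⟨D₁, h1, U', hU⟩ := key U r (n * n)
  obtain ⟨D₂, h2, V', hV⟩ := key V r (n * n)
  obtain ⟨D₃, h3, W', hW⟩ := key W (n * n) r
  refine ⟨D₁ * D₂ * D₃, U', V', W', by positivity, fun α hα β hβ γ hγ => ?_⟩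
  have h4 := congrArg (fun x : ℚ => (D₁ * D₂ * D₃ : ℚ) * x) (h α hα β hβ γ hγ)
  have h5 : ((∑ t ∈ Finset.range r, U' t α * V' t β * W' γ t : ℤ) : ℚ) =
      if brent n α β γ then ((D₁ * D₂ * D₃ : ℕ) : ℚ) else 0 := by
    push_cast
    rw [Finset.sum_congr rfl fun t ht => by
      rw [hU t (Finset.mem_range.1 ht) α hα, hV t (Finset.mem_range.1 ht) β hβ,
        hW γ hγ t (Finset.mem_range.1 ht)]]
    simp only [Finset.mul_sum] at h4
    refine Eq.trans (Finset.sum_congr rfl fun t _ => by ring) (h4.trans (by simp))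
  have h6 : ((∑ t ∈ Finset.range r, U' t α * V' t β * W' γ t : ℤ) : ℚ) =
      ((if brent n α β γ then ((D₁ * D₂ * D₃ : ℕ) : ℤ) else 0 : ℤ) : ℚ) := by
    rw [h5]; split_ifs <;> simp
  exact_mod_cast h6

/-- Negative entries are stored with an offset; multiplication of the offset by M - 1 subtracts it
modulo M. -/
theorem cast_ent {M : ℕ} (hM : 0 < M) (off sc x : ℕ) :
    (ent M off sc x : ZMod M) = ((x : ZMod M) - off) * sc := by
  rw [ent, ZMod.natCast_mod, Nat.cast_mul, ZMod.natCast_mod]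
  push_cast [Nat.cast_sub (show 1 ≤ M from hM)]
  rw [ZMod.natCast_self]
  ring

/-- The code depends on the table only, not on `N`: the modulus is formed from `N` and the stored
denominator. So one code is valid for all sizes. -/
theorem exists_code {n r : ℕ} (hn : 1 < n) (hr : n * n ≤ r) (h : HasRank n r) :
    ∃ b k, cN b k = n ∧ cR b k = r ∧ ∀ N, Valid N b k := by
  obtain ⟨D, U, V, W, hD, hb⟩ := exists_integer_tables h
  set e := n * n with he
  have he0 : 0 < e := by positivity
  set off : ℕ := ∑ p ∈ Finset.range r ×ˢ Finset.range e,
    ((U p.1 p.2).natAbs + (V p.1 p.2).natAbs + (W p.2 p.1).natAbs) with hoff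
  have habs : ∀ t < r, ∀ α < e, (U t α).natAbs ≤ off ∧ (V t α).natAbs ≤ off ∧
      (W α t).natAbs ≤ off := by
    intro t ht α hα
    have := Finset.single_le_sum (f := fun p : ℕ × ℕ =>
      ((U p.1 p.2).natAbs + (V p.1 p.2).natAbs + (W p.2 p.1).natAbs)) (fun _ _ => Nat.zero_le _)
      (show (t, α) ∈ Finset.range r ×ˢ Finset.range e by simp [ht, hα])
    rw [← hoff] at this
    simp only at this
    omega
  -- The base exceeds every digit; entries shifted by `off` lie between 0 and `2 * off`.
  set b := n + r + D + 2 * off + 1 with hbd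
  set c : ℕ → ℕ := fun i => if i = 0 then n else if i = 1 then r else if i = 2 then D else
    if i = 3 then off else if i < 4 + r * e then
      (U ((i - 4) / e) ((i - 4) % e) + off).toNat else if i < 4 + r * e + r * e then
      (V ((i - (4 + r * e)) / e) ((i - (4 + r * e)) % e) + off).toNat else
      if i < 4 + r * e + r * e + e * r then (W ((i - (4 + r * e + r * e)) / r)
        ((i - (4 + r * e + r * e)) % r) + off).toNat else 0 with hc
  have hr0 : 0 < r := by omega
  have hdm : ∀ i, i < r * e → i / e < r ∧ i % e < e := fun i hi =>
    ⟨Nat.div_lt_of_lt_mul (by rwa [mul_comm]), Nat.mod_lt _ he0⟩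
  have hdm' : ∀ i, i < e * r → i / r < e ∧ i % r < r := fun i hi =>
    ⟨Nat.div_lt_of_lt_mul (by rwa [mul_comm]), Nat.mod_lt _ hr0⟩
  have hcb : ∀ i, c i < b := by
    intro i
    simp only [hc]
    split_ifs with h0 h1 h2 h3 h4 h5 h6
    · omega
    · omega
    · omega
    · omega
    · obtain ⟨k1, k2⟩ := hdm (i - 4) (by omega)
      have := (habs _ k1 _ k2).1
      omega
    · obtain ⟨k1, k2⟩ := hdm (i - (4 + r * e)) (by omega)
      have := (habs _ k1 _ k2).2.1
      omega
    · obtain ⟨k1, k2⟩ := hdm' (i - (4 + r * e + r * e)) (by omega)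
      have := (habs _ k2 _ k1).2.2
      omega
    · omega
  set k := ofDig b c (4 + r * e + r * e + e * r) with hk
  have hdg : ∀ t < 4 + r * e + r * e + e * r, dg b k t = c t := fun t ht => dg_ofDig hcb ht
  have h0 : cN b k = n := hdg 0 (by omega)
  have h1 : cR b k = r := hdg 1 (by omega)
  have h2 : cD b k = D := hdg 2 (by omega)
  have h3 : cO b k = off := hdg 3 (by omega)
  have hE : cE b k = e := by rw [cE, h0]
  have hpos : ∀ {a b' x y : ℕ}, x < a → y < b' → x * b' + y < a * b' := by
    intro a b' x y hx hy
    calc x * b' + y < (x + 1) * b' := by rw [Nat.succ_mul]; omega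
      _ ≤ a * b' := Nat.mul_le_mul_right _ hx
  have hdiv : ∀ {b' x y : ℕ}, y < b' → (x * b' + y) / b' = x ∧ (x * b' + y) % b' = y := by
    intro b' x y hy
    rw [mul_comm x, Nat.mul_add_div (by omega), Nat.mul_add_mod, Nat.div_eq_of_lt hy,
      Nat.mod_eq_of_lt hy]
    simp
  refine ⟨b, k, h0, h1, fun N => ⟨⟨by rw [h0]; exact hn, by rw [h2]; exact hD, by rw [hE, h1]; exact hr⟩,
    fun α hα β hβ γ hγ => ?_⟩⟩
  rw [hE] at hα hβ hγ
  set M := cM N b k with hM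
  have hMD : M = D * (N + 1) + 1 := by rw [hM, cM, h2]
  have hM1 : 1 < M := by
    have : 1 * 1 ≤ D * (N + 1) := Nat.mul_le_mul hD (by omega)
    omega
  have hMN : N + 1 ≤ M := by
    have : N + 1 ≤ D * (N + 1) := Nat.le_mul_of_pos_left _ hD
    omega
  have toN : ∀ z : ℤ, z.natAbs ≤ off → (((z + off).toNat : ℕ) : ZMod M) - off = (z : ZMod M) := by
    intro z hz
    have : (((z + off).toNat : ℕ) : ℤ) = z + off := Int.toNat_of_nonneg (by omega)
    have := congrArg (Int.cast : ℤ → ZMod M) this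
    push_cast at this
    rw [this]
    ring
  have hU : ∀ t < r, (cU N b k t α : ZMod M) = (U t α : ZMod M) := by
    intro t ht
    have k1 := hpos ht hα
    rw [cU, ← hM, cast_ent (by omega), h3, hE, hdg _ (by omega)]
    have k2 : c (4 + (t * e + α)) = (U t α + off).toNat := by
      have e1 : 4 + (t * e + α) - 4 = t * e + α := by omega
      simp only [hc, e1, (hdiv (x := t) hα).1, (hdiv (x := t) hα).2]
      rw [if_neg (by omega), if_neg (by omega), if_neg (by omega), if_neg (by omega),
        if_pos (by omega)]
    rw [k2, toN _ (habs t ht α hα).1, Nat.cast_one, mul_one]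
  have hV : ∀ t < r, (cV N b k t β : ZMod M) = (V t β : ZMod M) := by
    intro t ht
    have k1 := hpos ht hβ
    rw [cV, ← hM, cast_ent (by omega), h3, hE, h1, hdg _ (by omega)]
    have k2 : c (4 + r * e + (t * e + β)) = (V t β + off).toNat := by
      have e1 : 4 + r * e + (t * e + β) - (4 + r * e) = t * e + β := by omega
      simp only [hc, e1, (hdiv (x := t) hβ).1, (hdiv (x := t) hβ).2]
      rw [if_neg (by omega), if_neg (by omega), if_neg (by omega), if_neg (by omega),
        if_neg (by omega), if_pos (by omega)]
    rw [k2, toN _ (habs t ht β hβ).2.1, Nat.cast_one, mul_one]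
  have hW : ∀ t < r, (cW N b k γ t : ZMod M) = (W γ t : ZMod M) * (-(N + 1)) := by
    intro t ht
    have k1 := hpos hγ ht
    rw [cW, ← hM, cast_ent (by omega), h3, hE, h1, hdg _ (by omega)]
    have k2 : c (4 + r * e + r * e + (γ * r + t)) = (W γ t + off).toNat := by
      have e1 : 4 + r * e + r * e + (γ * r + t) - (4 + r * e + r * e) = γ * r + t := by omega
      simp only [hc, e1, (hdiv (x := γ) ht).1, (hdiv (x := γ) ht).2]
      rw [if_neg (by omega), if_neg (by omega), if_neg (by omega), if_neg (by omega),
        if_neg (by omega), if_neg (by omega), if_pos (by omega)]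
    rw [k2, toN _ (habs t ht γ hγ).2.2, Nat.cast_sub hMN, ZMod.natCast_self]
    push_cast
    ring
  have hsum : ((∑ t ∈ Finset.range (cR b k), cU N b k t α * cV N b k t β * cW N b k γ t : ℕ) :
      ZMod M) = ((if brent (cN b k) α β γ then 1 else 0 : ℕ) : ZMod M) := by
    have h4 := congrArg (Int.cast : ℤ → ZMod M) (hb α hα β hβ γ hγ)
    push_cast at h4 ⊢
    rw [h1, h0, Finset.sum_congr rfl fun t ht => by
      rw [hU t (Finset.mem_range.1 ht), hV t (Finset.mem_range.1 ht),
        hW t (Finset.mem_range.1 ht), ← mul_assoc], ← Finset.sum_mul, h4]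
    -- Immediate from M = D(N + 1) + 1; this removes the common factor `D`.
    have h5 : (D : ZMod M) * (-(N + 1)) = 1 := by
      have := congrArg (Nat.cast : ℕ → ZMod M) hMD
      rw [ZMod.natCast_self] at this
      push_cast at this
      linear_combination this
    split_ifs
    · exact h5
    · simp
  rw [ZMod.natCast_eq_natCast_iff'] at hsum
  rw [hsum]
  split_ifs
  · exact Nat.mod_eq_of_lt hM1
  · exact Nat.zero_mod _

end LoopRAM

/-! ## The exponent of matrix multiplication -/

namespace LoopRAM

open MvPolynomial

theorem IsComputation.append {R : Type*} [Ring R] {free : Set R} {l₁ l₂ : List R}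
    (h₁ : IsComputation free l₁) (h₂ : IsComputation free l₂) : IsComputation free (l₁ ++ l₂) := by
  induction l₁ with
  | nil => exact h₂
  | cons f l ih =>
    obtain ⟨h1, g, k, hg, hk, hf⟩ := h₁
    exact ⟨ih h1, g, k, hg.imp_right fun h => List.mem_append_left _ h,
      hk.imp_right fun h => List.mem_append_left _ h, hf⟩

theorem exists_computation_sum {R : Type*} [Ring R] {free : Set R} (h0 : (0 : R) ∈ free)
    (P : List (R × R)) (hP : ∀ p ∈ P, p.1 ∈ free ∧ p.2 ∈ free) :
    ∃ l : List R, IsComputation free l ∧ l.length = 2 * P.length ∧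
      ((P.map fun p => p.1 * p.2).sum ∈ l ∨ P = []) := by
  induction P with
  | nil => exact ⟨[], trivial, rfl, .inr rfl⟩
  | cons p P ih =>
    obtain ⟨l, h1, h2, h3⟩ := ih fun q hq => hP q (List.mem_cons_of_mem _ hq)
    obtain ⟨h4, h5⟩ := hP p List.mem_cons_self
    refine ⟨(p.1 * p.2 + (P.map fun p => p.1 * p.2).sum) :: p.1 * p.2 :: l,
      ⟨⟨h1, p.1, p.2, .inl h4, .inl h5, by simp⟩, p.1 * p.2, (P.map fun p => p.1 * p.2).sum,
        .inr (by simp), ?_, by simp⟩, by simp [h2]; ring, .inl (by simp)⟩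
    rcases h3 with h3 | rfl
    · exact .inr (List.mem_cons_of_mem _ h3)
    · exact .inl (by simpa using h0)

/-- Needed because the infimum of an empty set of reals would be 0. -/
theorem matMulWithin_naive (n : ℕ) : MatMulWithin n (2 * (n : ℝ) ^ (3 : ℝ)) := by
  set free : Set (EntryPoly n) := Set.range X ∪ Set.range C with hfree
  have h0 : (0 : EntryPoly n) ∈ free := .inr ⟨0, by simp⟩
  have key : ∀ s : Finset (Fin n × Fin n), ∃ l : List (EntryPoly n), IsComputation free l ∧
      l.length = s.card * (2 * n) ∧ ∀ p ∈ s, (genericLeft n * genericRight n) p.1 p.2 ∈ l := by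
    intro s
    induction s using Finset.induction_on with
    | empty => exact ⟨[], trivial, by simp, by simp⟩
    | insert p s hp ih =>
      obtain ⟨l, h1, h2, h3⟩ := ih
      obtain ⟨l', h4, h5, h6⟩ := exists_computation_sum h0
        ((List.finRange n).map fun j => (genericLeft n p.1 j, genericRight n j p.2)) (by
          intro q hq
          obtain ⟨j, -, rfl⟩ := List.mem_map.1 hq
          exact ⟨.inl ⟨_, rfl⟩, .inl ⟨_, rfl⟩⟩)
      refine ⟨l' ++ l, IsComputation.append h4 h1, ?_, fun q hq => ?_⟩
      · rw [Finset.card_insert_of_notMem hp]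
        simp [h2, h5]
        ring
      · rcases Finset.mem_insert.1 hq with rfl | hq
        · refine List.mem_append_left _ ?_
          rcases h6 with h6 | h6
          · rw [Matrix.mul_apply]
            convert h6
            rw [List.map_map, ← List.ofFn_eq_map, List.sum_ofFn]
            rfl
          · rw [List.map_eq_nil_iff, List.finRange_eq_nil_iff] at h6
            exact absurd q.1.2 (by omega)
        · exact List.mem_append_right _ (h3 q hq)
  obtain ⟨l, h1, h2, h3⟩ := key Finset.univ
  refine ⟨l, h1, fun i k => h3 (i, k) (by simp), ?_⟩
  rw [h2]
  simp
  norm_cast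
  refine le_of_eq ?_
  ring

/-- The entries of the product are distinct polynomials, told apart by one coefficient, and all of
them occur in the list. This gives 2 ≤ ω, whence the padding of r to at least n² is harmless. -/
theorem sq_le_length {n : ℕ} {l : List (EntryPoly n)}
    (hl : ∀ i k : Fin n, (genericLeft n * genericRight n) i k ∈ l) : n * n ≤ l.length := by
  classical
  have hinj : Function.Injective fun p : Fin n × Fin n =>
      (genericLeft n * genericRight n) p.1 p.2 := by
    rintro ⟨i, k⟩ ⟨i', k'⟩ h
    have h1 := congrArg (fun f => bilin f ((i, i), (i, k))) h
    simp only [bilin_generic] at h1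
    by_contra hne
    rw [if_pos (by simp), if_neg] at h1
    · exact one_ne_zero h1
    · rintro ⟨-, rfl, rfl⟩
      exact hne rfl
  have h1 : (Finset.univ.image fun p : Fin n × Fin n =>
      (genericLeft n * genericRight n) p.1 p.2) ⊆ l.toFinset := by
    intro f hf
    obtain ⟨p, -, rfl⟩ := Finset.mem_image.1 hf
    exact List.mem_toFinset.2 (hl _ _)
  have h2 := (Finset.card_le_card h1).trans l.toFinset_card_le
  rw [Finset.card_image_of_injective _ hinj] at h2
  simpa using h2

theorem two_le_of_matMulWithin {τ C : ℝ} (h : ∀ n : ℕ, MatMulWithin n (C * (n : ℝ) ^ τ)) :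
    2 ≤ τ := by
  by_contra! hτ
  have h1 : ∀ n : ℕ, 0 < n → (n : ℝ) ^ (2 - τ) ≤ C := by
    intro n hn
    obtain ⟨l, -, hl, hlen⟩ := h n
    have h2 : ((n * n : ℕ) : ℝ) ≤ l.length := by exact_mod_cast sq_le_length hl
    have hn' : (0 : ℝ) < n := by exact_mod_cast hn
    rw [Real.rpow_sub hn', div_le_iff₀ (Real.rpow_pos_of_pos hn' _)]
    refine le_trans (le_of_eq ?_) (h2.trans hlen)
    rw [Real.rpow_two]
    push_cast
    ring
  have h2 := (tendsto_rpow_atTop (show 0 < 2 - τ by linarith)).comp tendsto_natCast_atTop_atTop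
  obtain ⟨n, hn, hn0⟩ := ((h2.eventually_gt_atTop C).and (eventually_gt_atTop 0)).exists
  exact absurd (h1 n hn0) (not_le.2 hn)

theorem two_le_matMulExponent : 2 ≤ matMulExponent :=
  le_csInf ⟨3, 2, matMulWithin_naive⟩ fun _ ⟨_, h⟩ => two_le_of_matMulWithin h

/-- Choose an admissible τ below ω + ε; for large n the slack in the exponent absorbs the constant
and the factor 2 of the bilinear algorithm. -/
theorem exists_hasRank {ε : ℝ} (hε : 0 < ε) : ∃ n r : ℕ, 1 < n ∧ n * n ≤ r ∧ HasRank n r ∧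
    (r : ℝ) ≤ (n : ℝ) ^ (matMulExponent + ε) := by
  have hne : {τ : ℝ | ∃ C : ℝ, ∀ n : ℕ, MatMulWithin n (C * (n : ℝ) ^ τ)}.Nonempty :=
    ⟨3, 2, matMulWithin_naive⟩
  obtain ⟨τ, ⟨C, hC⟩, hτ⟩ := exists_lt_of_csInf_lt hne
    (show sInf _ < matMulExponent + ε by rw [← matMulExponent]; linarith)
  have h2 := (tendsto_rpow_atTop (show 0 < matMulExponent + ε - τ by linarith)).comp
    tendsto_natCast_atTop_atTop
  obtain ⟨n, hn, hn1⟩ := ((h2.eventually_ge_atTop (2 * C)).and (eventually_gt_atTop 1)).exists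
  have hn' : (1 : ℝ) < n := by exact_mod_cast hn1
  obtain ⟨l, hl, hl1, hl2⟩ := hC n
  refine ⟨n, max (n * n) (2 * l.length), hn1, le_max_left _ _,
    (hasRank_of_computation (by omega) hl hl1).mono (le_max_right _ _), ?_⟩
  rw [Nat.cast_max]
  refine max_le ?_ ?_
  · have : ((n * n : ℕ) : ℝ) = (n : ℝ) ^ (2 : ℝ) := by rw [Real.rpow_two]; push_cast; ring
    rw [this]
    exact Real.rpow_le_rpow_of_exponent_le hn'.le (by linarith [two_le_matMulExponent])
  · push_cast
    calc 2 * (l.length : ℝ) ≤ 2 * C * (n : ℝ) ^ τ := by linarith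
      _ ≤ (n : ℝ) ^ (matMulExponent + ε - τ) * (n : ℝ) ^ τ :=
        mul_le_mul_of_nonneg_right hn (Real.rpow_nonneg (by linarith) _)
      _ = (n : ℝ) ^ (matMulExponent + ε) := by
        rw [← Real.rpow_add (by linarith)]; congr 1; ring

theorem pow_clog_le {n N : ℕ} (hn : 1 < n) (hN : 0 < N) : n ^ Nat.clog n N ≤ n * N := by
  rcases Nat.lt_or_ge 1 N with h | h
  · have h1 := Nat.clog_pos hn h
    have h2 := Nat.pow_pred_clog_lt_self hn h
    have h3 : n ^ Nat.clog n N = n * n ^ (Nat.clog n N).pred := by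
      rw [← pow_succ']
      congr 1
      exact (Nat.succ_pred_eq_of_pos h1).symm
    rw [h3]
    exact Nat.mul_le_mul_left _ h2.le
  · rw [Nat.clog_of_right_le_one h, pow_zero]
    exact Nat.mul_pos (by omega) hN

/-- One fixed valid code, for ε = 1, provides the parameters: `K₀` lets it be tried for every N, and
`cap` is a polynomial bound that it undercuts strictly. For another ε, a better code is found as
soon as log N exceeds it, and the smaller N are covered by the constant. -/
theorem exists_params : ∃ c₁ B K₀ : ℕ, 0 < c₁ ∧ 0 < K₀ ∧
    (∀ N, 0 < N → mulCost c₁ B K₀ N < c₁ * N ^ B) ∧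
    ∀ ε > 0, ∃ C : ℝ, ∀ N : ℕ, 0 < N →
      (mulCost c₁ B K₀ N : ℝ) ≤ C * (N : ℝ) ^ (matMulExponent + ε) := by
  have code : ∀ ε > 0, ∃ b k, 1 < cN b k ∧ (cR b k : ℝ) ≤ (cN b k : ℝ) ^ (matMulExponent + ε) ∧
      ∀ N, Valid N b k := by
    intro ε hε
    obtain ⟨n, r, hn, hnr, hr, hrε⟩ := exists_hasRank hε
    obtain ⟨b, k, h1, h2, h3⟩ := exists_code hn hnr hr
    exact ⟨b, k, h1 ▸ hn, by rw [h1, h2]; exact hrε, h3⟩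
  obtain ⟨b₁, k₁, hn₁, -, hv₁⟩ := code 1 one_pos
  set n₁ := cN b₁ k₁
  set r₁ := cR b₁ k₁ with hr₁
  have hlt : ∀ N, 0 < N → mulCost (n₁ ^ r₁ + 1) r₁ (max b₁ k₁ + 1) N <
      (n₁ ^ r₁ + 1) * N ^ r₁ := by
    intro N hN
    have h1 := (isBestQ_bestQ N (Nat.clog 2 N + (max b₁ k₁ + 1)) ((n₁ ^ r₁ + 1) * N ^ r₁)).le b₁
      (by omega) k₁ (by omega) (hv₁ N)
    refine h1.trans_lt ((min_le_left _ _).trans_lt ?_)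
    rw [← hr₁]
    -- A crude estimate by r₁ ≤ n₁ ^ r₁; any polynomial in N will do for the cap.
    calc r₁ ^ Nat.clog n₁ N ≤ (n₁ ^ r₁) ^ Nat.clog n₁ N :=
          Nat.pow_le_pow_left (Nat.lt_pow_self hn₁).le _
      _ = (n₁ ^ Nat.clog n₁ N) ^ r₁ := by rw [← pow_mul, ← pow_mul, mul_comm]
      _ ≤ (n₁ * N) ^ r₁ := Nat.pow_le_pow_left (pow_clog_le hn₁ hN) _
      _ = n₁ ^ r₁ * N ^ r₁ := mul_pow _ _ _
      _ < (n₁ ^ r₁ + 1) * N ^ r₁ := Nat.mul_lt_mul_of_pos_right (by omega) (Nat.pow_pos hN)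
  refine ⟨n₁ ^ r₁ + 1, r₁, max b₁ k₁ + 1, by omega, by omega, hlt, fun ε hε => ?_⟩
  obtain ⟨b, k, hn, hr, hv⟩ := code ε hε
  set ω := matMulExponent + ε with hω
  have hω0 : 0 < ω := by linarith [two_le_matMulExponent]
  -- Above this size both parts of the code lie below the logarithm of N, so the search meets it.
  set N₀ := 2 ^ max b k with hN₀
  have hn' : (1 : ℝ) < cN b k := by exact_mod_cast hn
  refine ⟨(cN b k : ℝ) ^ ω + ((n₁ ^ r₁ + 1) * N₀ ^ r₁ : ℕ), fun N hN => ?_⟩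
  have hN' : (1 : ℝ) ≤ N := by exact_mod_cast hN
  have hNω : (1 : ℝ) ≤ (N : ℝ) ^ ω := Real.one_le_rpow hN' hω0.le
  rw [add_mul]
  by_cases hle : N ≤ N₀
  · have h1 : (mulCost (n₁ ^ r₁ + 1) r₁ (max b₁ k₁ + 1) N : ℝ) ≤
        ((n₁ ^ r₁ + 1) * N₀ ^ r₁ : ℕ) := by
      exact_mod_cast (hlt N hN).le.trans (Nat.mul_le_mul_left _ (Nat.pow_le_pow_left hle _))
    have h2 : 0 ≤ (cN b k : ℝ) ^ ω * (N : ℝ) ^ ω := by positivity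
    have h3 : (((n₁ ^ r₁ + 1) * N₀ ^ r₁ : ℕ) : ℝ) * 1 ≤
        (((n₁ ^ r₁ + 1) * N₀ ^ r₁ : ℕ) : ℝ) * (N : ℝ) ^ ω :=
      mul_le_mul_of_nonneg_left hNω (Nat.cast_nonneg _)
    linarith
  · have hK : max b k ≤ Nat.clog 2 N := by
      rw [← Nat.clog_pow 2 (max b k) (by omega)]
      exact Nat.clog_mono_right 2 (by omega)
    have h1 := (isBestQ_bestQ N (Nat.clog 2 N + (max b₁ k₁ + 1)) ((n₁ ^ r₁ + 1) * N ^ r₁)).le b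
      (by omega) k (by omega) (hv N)
    have h2 : (mulCost (n₁ ^ r₁ + 1) r₁ (max b₁ k₁ + 1) N : ℝ) ≤
        (cR b k : ℝ) ^ Nat.clog (cN b k) N := by
      exact_mod_cast h1.trans (min_le_left _ _)
    have h3 : ((cN b k ^ Nat.clog (cN b k) N : ℕ) : ℝ) ≤ (cN b k * N : ℕ) := by
      exact_mod_cast pow_clog_le hn hN
    push_cast at h3
    have h4 : (cR b k : ℝ) ^ Nat.clog (cN b k) N ≤ (cN b k : ℝ) ^ ω * (N : ℝ) ^ ω := by
      calc (cR b k : ℝ) ^ Nat.clog (cN b k) N ≤ ((cN b k : ℝ) ^ ω) ^ Nat.clog (cN b k) N :=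
            pow_le_pow_left₀ (Nat.cast_nonneg _) hr _
        _ = ((cN b k : ℝ) ^ Nat.clog (cN b k) N) ^ ω := by
          rw [← Real.rpow_natCast, ← Real.rpow_natCast, ← Real.rpow_mul (by linarith),
            ← Real.rpow_mul (by linarith), mul_comm]
        _ ≤ (cN b k * N : ℝ) ^ ω := Real.rpow_le_rpow (by positivity) h3 hω0.le
        _ = _ := Real.mul_rpow (by linarith) (by linarith)
    have h5 : 0 ≤ (((n₁ ^ r₁ + 1) * N₀ ^ r₁ : ℕ) : ℝ) * (N : ℝ) ^ ω := by positivity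
    linarith

end LoopRAM

/-! ## Growth of the running times -/

namespace LoopRAM

/-- Passes from bounds with every ε, each with its own constant, to a single exponent a + o(1)
without a constant. -/
theorem exists_exponent {ι : Type*} {l : Filter ι} {t h : ι → ℝ} {a : ℝ} (ha : 0 ≤ a)
    (ht : Tendsto t l atTop)
    (hh : ∀ ε > 0, ∃ C : ℝ, ∀ i, 1 < t i → h i ≤ C * t i ^ (a + ε)) :
    ∃ f : ι → ℝ, Tendsto f l (𝓝 0) ∧ ∀ i, 1 < t i → h i ≤ t i ^ (a + f i) := by
  -- The exact excess of the exponent of `h` over `a`. Replacing `h` by at least 1 keeps the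
  -- logarithm nonnegative.
  refine ⟨fun i => max 0 (Real.log (max (h i) 1) / Real.log (t i) - a), ?_, fun i hi => ?_⟩
  · rw [Metric.tendsto_nhds]
    intro ε hε
    obtain ⟨C, hC⟩ := hh (ε / 2) (by positivity)
    have hlog := Real.tendsto_log_atTop.comp ht
    filter_upwards [ht.eventually_gt_atTop 1,
      hlog.eventually_gt_atTop (2 * Real.log (max C 1) / ε)] with i h1 h2
    have hl : 0 < Real.log (t i) := Real.log_pos h1
    have hp : 1 ≤ t i ^ (a + ε / 2) := Real.one_le_rpow h1.le (by positivity)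
    have h3 : max (h i) 1 ≤ max C 1 * t i ^ (a + ε / 2) := by
      refine max_le ((hC i h1).trans ?_) ?_
      · exact mul_le_mul_of_nonneg_right (le_max_left _ _) (by linarith)
      · exact one_le_mul_of_one_le_of_one_le (le_max_right _ _) hp
    have h4 : Real.log (max (h i) 1) ≤ Real.log (max C 1) + (a + ε / 2) * Real.log (t i) := by
      have := Real.log_le_log (by positivity) h3
      rwa [Real.log_mul (by positivity) (by positivity), Real.log_rpow (by linarith)] at this
    have h5 : 2 * Real.log (max C 1) < ε * Real.log (t i) := by
      have := (div_lt_iff₀ hε).1 h2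
      simp only [Function.comp] at this
      linarith
    have h6 : Real.log (max (h i) 1) / Real.log (t i) < a + ε := by
      rw [div_lt_iff₀ hl]
      linarith
    rw [Real.dist_eq, sub_zero, abs_of_nonneg (le_max_left _ _)]
    exact max_lt hε (by linarith)
  · have hl : 0 < Real.log (t i) := Real.log_pos hi
    have h1 : Real.log (max (h i) 1) / Real.log (t i) ≤
        a + max 0 (Real.log (max (h i) 1) / Real.log (t i) - a) := by
      linarith [le_max_right 0 (Real.log (max (h i) 1) / Real.log (t i) - a)]
    refine (le_max_left (h i) 1).trans (le_trans (le_of_eq ?_)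
      (Real.rpow_le_rpow_of_exponent_le hi.le h1))
    rw [Real.rpow_def_of_pos (by linarith), mul_div_cancel₀ _ hl.ne', Real.exp_log (by positivity)]

/-- Makes the polylogarithmic overhead of the search and the recursion part of the o(1). -/
theorem clog_pow_le (K₀ p : ℕ) {ε : ℝ} (hε : 0 < ε) : ∃ C : ℝ, 0 ≤ C ∧ ∀ N : ℕ, 0 < N →
    (((Nat.clog 2 N + K₀) ^ p : ℕ) : ℝ) ≤ C * (N : ℝ) ^ ε := by
  set δ := ε / (p + 1) with hδ
  have hδ0 : 0 < δ := by positivity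
  have hl2 : 0 < Real.log 2 := Real.log_pos one_lt_two
  refine ⟨(1 / (δ * Real.log 2) + 1 + K₀) ^ p, by positivity, fun N hN => ?_⟩
  have hN' : (1 : ℝ) ≤ N := by exact_mod_cast hN
  have h1 : (1 : ℝ) ≤ (N : ℝ) ^ δ := Real.one_le_rpow hN' hδ0.le
  have h2 : (Nat.clog 2 N : ℝ) ≤ Real.log N / Real.log 2 + 1 := by
    have h3 : 2 ^ Nat.clog 2 N ≤ 2 * N := pow_clog_le (by omega) hN
    have h4 : ((2 : ℝ) ^ Nat.clog 2 N) ≤ 2 * N := by exact_mod_cast h3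
    have h5 := Real.log_le_log (by positivity) h4
    rw [Real.log_pow, Real.log_mul (by norm_num) (by positivity)] at h5
    rw [← sub_le_iff_le_add, le_div_iff₀ hl2]
    linarith
  have h3 : Real.log N / Real.log 2 ≤ 1 / (δ * Real.log 2) * (N : ℝ) ^ δ := by
    have := Real.log_le_rpow_div (show (0 : ℝ) ≤ N by linarith) hδ0
    calc Real.log N / Real.log 2 ≤ (N : ℝ) ^ δ / δ / Real.log 2 := by gcongr
      _ = _ := by field_simp
  have h4 : (Nat.clog 2 N + K₀ : ℝ) ≤ (1 / (δ * Real.log 2) + 1 + K₀) * (N : ℝ) ^ δ := by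
    have h5 : (K₀ : ℝ) * 1 ≤ K₀ * (N : ℝ) ^ δ := by gcongr
    rw [add_mul, add_mul, one_mul]
    linarith
  push_cast
  calc (Nat.clog 2 N + K₀ : ℝ) ^ p ≤ ((1 / (δ * Real.log 2) + 1 + K₀) * (N : ℝ) ^ δ) ^ p := by gcongr
    _ = (1 / (δ * Real.log 2) + 1 + K₀) ^ p * (N : ℝ) ^ (δ * p) := by
      rw [mul_pow, Real.rpow_mul_natCast (by linarith)]
    _ ≤ (1 / (δ * Real.log 2) + 1 + K₀) ^ p * (N : ℝ) ^ ε := by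
      gcongr
      rw [hδ, div_mul_eq_mul_div, div_le_iff₀ (by positivity)]
      nlinarith

/-- As S ≥ 2, a constant factor Z is below S ^ Z. So all polynomial bounds on times and values
become one power of S, as required for the word size. -/
theorem lt_pow_of_le {S Z e a k : ℕ} (hS : 2 ≤ S) (hk : k ≤ Z * S ^ e) (ha : Z + e ≤ a) :
    k < S ^ a := by
  calc k ≤ Z * S ^ e := hk
    _ < S ^ Z * S ^ e := Nat.mul_lt_mul_of_pos_right (Nat.lt_pow_self (by omega)) (by positivity)
    _ = S ^ (Z + e) := (pow_add _ _ _).symm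
    _ ≤ S ^ a := Nat.pow_le_pow_right (by omega) ha

section
variable (c₁ B K₀ : ℕ)

theorem mulCost_le (N : ℕ) : mulCost c₁ B K₀ N ≤ c₁ * N ^ B := (isBestQ_bestQ _ _ _).le_cap

theorem clog_le_self (N : ℕ) : Nat.clog 2 N ≤ N :=
  Nat.clog_le_of_le_pow Nat.lt_two_pow_self.le

theorem cap_le {S N : ℕ} (hN : N ≤ 2 * S) : c₁ * N ^ B ≤ c₁ * 2 ^ B * S ^ B := by
  rw [mul_assoc, ← mul_pow]
  gcongr

theorem words_le {S N : ℕ} (hS : 2 ≤ S) (hN : N ≤ 2 * S) :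
    (Nat.clog 2 N + K₀) * (Nat.clog 2 N + K₀ + N + 2 + c₁ * N ^ B) ≤
      (K₀ + 2) * (K₀ + 5 + c₁ * 2 ^ B) * S ^ (B + 2) := by
  have h1 : Nat.clog 2 N + K₀ ≤ (K₀ + 2) * S := by
    have := clog_le_self N
    have h2 : K₀ ≤ K₀ * S := Nat.le_mul_of_pos_right _ (by omega)
    rw [add_mul]
    omega
  have h2 : S ≤ S ^ (B + 1) := Nat.le_self_pow (by omega) S
  have h3 : S ^ B ≤ S ^ (B + 1) := Nat.pow_le_pow_right (by omega) (by omega)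
  have h4 := cap_le c₁ B hN
  calc (Nat.clog 2 N + K₀) * (Nat.clog 2 N + K₀ + N + 2 + c₁ * N ^ B) ≤
      ((K₀ + 2) * S) * ((K₀ + 2) * S + 2 * S + S + c₁ * 2 ^ B * S ^ B) := by gcongr
    _ ≤ ((K₀ + 2) * S) * ((K₀ + 2) * S ^ (B + 1) + 2 * S ^ (B + 1) + S ^ (B + 1) +
        c₁ * 2 ^ B * S ^ (B + 1)) := by gcongr
    _ = (K₀ + 2) * (K₀ + 5 + c₁ * 2 ^ B) * S ^ (B + 2) := by ring

theorem heavyTime_le {S N d m : ℕ} (hS : 2 ≤ S) (hN : N ≤ 2 * S) (hd : d ≤ S) (hm : m + 1 ≤ S) :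
    2000 * (d * (m + 1) + (Nat.clog 2 N + K₀) ^ 6 * (c₁ * N ^ B)) ≤
      2000 * (1 + (K₀ + 2) ^ 6 * (c₁ * 2 ^ B)) * S ^ (B + 6) := by
  have h1 : Nat.clog 2 N + K₀ ≤ (K₀ + 2) * S := by
    have := clog_le_self N
    have h2 : K₀ ≤ K₀ * S := Nat.le_mul_of_pos_right _ (by omega)
    rw [add_mul]
    omega
  have h2 : S ^ 2 ≤ S ^ (B + 6) := Nat.pow_le_pow_right (by omega) (by omega)
  have h4 := cap_le c₁ B hN
  calc 2000 * (d * (m + 1) + (Nat.clog 2 N + K₀) ^ 6 * (c₁ * N ^ B)) ≤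
      2000 * (S * S + ((K₀ + 2) * S) ^ 6 * (c₁ * 2 ^ B * S ^ B)) := by gcongr
    _ = 2000 * (S ^ 2 + (K₀ + 2) ^ 6 * (c₁ * 2 ^ B) * S ^ (B + 6)) := by ring
    _ ≤ 2000 * (S ^ (B + 6) + (K₀ + 2) ^ 6 * (c₁ * 2 ^ B) * S ^ (B + 6)) := by gcongr
    _ = _ := by ring

/-- A crude bound for the time of `mainProg`. -/
def mainTime (m : ℕ) : ℕ :=
  (Nat.clog 2 (2 * m) + K₀) * (300 * ((Nat.clog 2 (2 * m) + K₀) ^ 6 + 2 * m) + 20) +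
    15000 * (max m 1 * (m + 1)) + 1000 * ((Nat.clog 2 (2 * m) + K₀) ^ 6 * (c₁ * (2 * m) ^ B))

theorem mainTime_le {S m : ℕ} (hS : 2 ≤ S) (hm : m + 1 ≤ S) : mainTime c₁ B K₀ m ≤
    ((K₀ + 2) * (300 * ((K₀ + 2) ^ 6 + 2) + 20) + 15000 + 1000 * ((K₀ + 2) ^ 6 * (c₁ * 2 ^ B))) *
      S ^ (B + 7) := by
  have h1 : Nat.clog 2 (2 * m) + K₀ ≤ (K₀ + 2) * S := by
    have := clog_le_self (2 * m)
    have h2 : K₀ ≤ K₀ * S := Nat.le_mul_of_pos_right _ (by omega)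
    rw [add_mul]
    omega
  have h2 : S ^ 2 ≤ S ^ (B + 7) := Nat.pow_le_pow_right (by omega) (by omega)
  have h3 : S ^ (B + 6) ≤ S ^ (B + 7) := Nat.pow_le_pow_right (by omega) (by omega)
  have h5 : S ^ 7 ≤ S ^ (B + 7) := Nat.pow_le_pow_right (by omega) (by omega)
  have h6 : S ≤ S ^ 6 := Nat.le_self_pow (by omega) S
  have h7 : 1 ≤ S ^ 6 := Nat.one_le_pow _ _ (by omega)
  have h4 := cap_le c₁ B (show 2 * m ≤ 2 * S by omega)
  have h8 : max m 1 ≤ S := by omega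
  have h9 : m ≤ S := by omega
  calc mainTime c₁ B K₀ m ≤ ((K₀ + 2) * S) * (300 * (((K₀ + 2) * S) ^ 6 + 2 * S) + 20 * 1) +
        15000 * (S * S) + 1000 * (((K₀ + 2) * S) ^ 6 * (c₁ * 2 ^ B * S ^ B)) := by
          rw [mainTime]; gcongr
    _ ≤ ((K₀ + 2) * S) * (300 * (((K₀ + 2) * S) ^ 6 + 2 * S ^ 6) + 20 * S ^ 6) +
        15000 * (S * S) + 1000 * (((K₀ + 2) * S) ^ 6 * (c₁ * 2 ^ B * S ^ B)) := by gcongr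
    _ = (K₀ + 2) * (300 * ((K₀ + 2) ^ 6 + 2) + 20) * S ^ 7 + 15000 * S ^ 2 +
        1000 * ((K₀ + 2) ^ 6 * (c₁ * 2 ^ B)) * S ^ (B + 6) := by ring
    _ ≤ (K₀ + 2) * (300 * ((K₀ + 2) ^ 6 + 2) + 20) * S ^ (B + 7) + 15000 * S ^ (B + 7) +
        1000 * ((K₀ + 2) ^ 6 * (c₁ * 2 ^ B)) * S ^ (B + 7) := by gcongr
    _ = _ := by ring

end

/-- The cost depends on m and d only through m/d, since 2m/d rounded down is ⌊2x⌋ for x = m/d;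
therefore the error term can be a function of this quotient. -/
theorem heavy_exponent {c₁ B K₀ : ℕ} (hcost : ∀ ε > 0, ∃ C : ℝ, ∀ N : ℕ, 0 < N →
    (mulCost c₁ B K₀ N : ℝ) ≤ C * (N : ℝ) ^ (matMulExponent + ε)) (k : ℕ) : ∃ f : ℝ → ℝ, Tendsto f atTop (𝓝 0) ∧ ∀ x : ℝ, 1 < x →
    ((k * ((Nat.clog 2 ⌊2 * x⌋₊ + K₀) ^ 6 * mulCost c₁ B K₀ ⌊2 * x⌋₊) : ℕ) : ℝ) ≤
      x ^ (matMulExponent + f x) := by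
  have hω := two_le_matMulExponent
  refine exists_exponent (t := fun x => x) (by linarith) tendsto_id fun ε hε => ?_
  obtain ⟨C₁, hC₁0, hC₁⟩ := clog_pow_le K₀ 6 (half_pos hε)
  obtain ⟨C₂, hC₂⟩ := hcost (ε / 2) (half_pos hε)
  refine ⟨k * (C₁ * |C₂|) * 2 ^ (matMulExponent + ε), fun x hx => ?_⟩
  have hN : 0 < ⌊2 * x⌋₊ := Nat.floor_pos.2 (by linarith)
  set N := ⌊2 * x⌋₊ with hNd
  have hN' : (0 : ℝ) < N := by exact_mod_cast hN
  have hNx : (N : ℝ) ≤ 2 * x := Nat.floor_le (by linarith)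
  have h1 := hC₁ N hN
  have h2 : (mulCost c₁ B K₀ N : ℝ) ≤ |C₂| * (N : ℝ) ^ (matMulExponent + ε / 2) :=
    (hC₂ N hN).trans (by gcongr; exact le_abs_self _)
  rw [Nat.cast_mul, Nat.cast_mul]
  calc (k : ℝ) * ((((Nat.clog 2 N + K₀) ^ 6 : ℕ) : ℝ) * mulCost c₁ B K₀ N) ≤
      k * ((C₁ * (N : ℝ) ^ (ε / 2)) * (|C₂| * (N : ℝ) ^ (matMulExponent + ε / 2))) := by gcongr
    _ = k * (C₁ * |C₂|) * ((N : ℝ) ^ (ε / 2) * (N : ℝ) ^ (matMulExponent + ε / 2)) := by ring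
    _ = k * (C₁ * |C₂|) * (N : ℝ) ^ (matMulExponent + ε) := by
      rw [← Real.rpow_add hN']; congr 2; ring
    _ ≤ k * (C₁ * |C₂|) * (2 * x) ^ (matMulExponent + ε) := by gcongr
    _ = _ := by rw [Real.mul_rpow (by norm_num) (by linarith)]; ring

/-- The power of two below `m ^ ((ω - 1) / (ω + 1))`. -/
noncomputable def balance (m : ℕ) : ℕ :=
  Nat.log 2 ⌊(m : ℝ) ^ ((matMulExponent - 1) / (matMulExponent + 1))⌋₊

theorem balance_spec {m : ℕ} (hm : 1 ≤ m) :
    ((2 ^ balance m : ℕ) : ℝ) ≤ (m : ℝ) ^ ((matMulExponent - 1) / (matMulExponent + 1)) ∧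
    (m : ℝ) ^ ((matMulExponent - 1) / (matMulExponent + 1)) ≤ 2 * ((2 ^ balance m : ℕ) : ℝ) ∧
    2 ^ balance m ≤ m := by
  have hω := two_le_matMulExponent
  set θ := (matMulExponent - 1) / (matMulExponent + 1) with hθ
  have hθ0 : 0 ≤ θ := div_nonneg (by linarith) (by linarith)
  have hθ1 : θ ≤ 1 := by rw [hθ, div_le_one (by linarith)]; linarith
  have hm' : (1 : ℝ) ≤ m := by exact_mod_cast hm
  have h1 : (1 : ℝ) ≤ (m : ℝ) ^ θ := Real.one_le_rpow hm' hθ0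
  have h2 : ⌊(m : ℝ) ^ θ⌋₊ ≠ 0 := (Nat.floor_pos.2 h1).ne'
  have h3 : 2 ^ balance m ≤ ⌊(m : ℝ) ^ θ⌋₊ := Nat.pow_log_le_self 2 h2
  have h4 : ((2 ^ balance m : ℕ) : ℝ) ≤ (m : ℝ) ^ θ :=
    le_trans (by exact_mod_cast h3) (Nat.floor_le (by linarith))
  refine ⟨h4, ?_, ?_⟩
  · have h5 : ⌊(m : ℝ) ^ θ⌋₊ + 1 ≤ 2 * 2 ^ balance m := by
      rw [← pow_succ']
      exact Nat.lt_pow_succ_log_self (by omega) _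
    refine (Nat.lt_floor_add_one _).le.trans ?_
    exact_mod_cast h5
  · have h5 : (m : ℝ) ^ θ ≤ (m : ℝ) ^ (1 : ℝ) := Real.rpow_le_rpow_of_exponent_le hm' hθ1
    rw [Real.rpow_one] at h5
    exact_mod_cast h4.trans h5

/-- A bound for the time of `mainProg`. -/
noncomputable def mainBound (c₁ B K₀ m : ℕ) : ℕ :=
  (Nat.clog 2 (2 * m) + K₀) ^ 7 *
    (40000 * (m * 2 ^ balance m + mulCost c₁ B K₀ (2 * m / 2 ^ balance m)))

/-- For d about m ^ θ with θ = (ω - 1)/(ω + 1), both md and (m/d) ^ ω have the exponent 2ω/(ω + 1).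
Half of ε is spent on the logarithms, half on the cost of multiplication. -/
theorem main_exponent {c₁ B K₀ : ℕ} (hcost : ∀ ε > 0, ∃ C : ℝ, ∀ N : ℕ, 0 < N →
    (mulCost c₁ B K₀ N : ℝ) ≤ C * (N : ℝ) ^ (matMulExponent + ε)) (k : ℕ) :
    ∃ f : ℕ → ℝ, Tendsto f atTop (𝓝 0) ∧ ∀ m : ℕ, 1 < m → ((k * mainBound c₁ B K₀ m : ℕ) : ℝ) ≤
      (m : ℝ) ^ (2 * matMulExponent / (matMulExponent + 1) + f m) := by
  have hω := two_le_matMulExponent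
  suffices h : ∃ f : ℕ → ℝ, Tendsto f atTop (𝓝 0) ∧ ∀ m : ℕ, (1 : ℝ) < m →
      ((k * mainBound c₁ B K₀ m : ℕ) : ℝ) ≤
      (m : ℝ) ^ (2 * matMulExponent / (matMulExponent + 1) + f m) by
    obtain ⟨f, h1, h2⟩ := h
    exact ⟨f, h1, fun m hm => h2 m (by exact_mod_cast hm)⟩
  refine exists_exponent (div_nonneg (by linarith) (by linarith)) tendsto_natCast_atTop_atTop
    fun ε hε => ?_
  obtain ⟨C₁, hC₁0, hC₁⟩ := clog_pow_le K₀ 7 (half_pos hε)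
  obtain ⟨C₂, hC₂⟩ := hcost (ε / 2) (half_pos hε)
  set p := 2 * matMulExponent / (matMulExponent + 1) with hp
  set θ := (matMulExponent - 1) / (matMulExponent + 1) with hθ
  set η := matMulExponent + ε / 2 with hη
  -- The two sides of the balance.
  have e1 : 1 + θ = p := by rw [hp, hθ]; field_simp; ring
  have e2 : (1 - θ) * matMulExponent = p := by rw [hp, hθ]; field_simp; ring
  have hθ0 : 0 ≤ θ := div_nonneg (by linarith) (by linarith)
  refine ⟨k * (C₁ * 2 ^ (ε / 2)) * (40000 * (1 + |C₂| * 4 ^ η)), fun m hm => ?_⟩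
  have hm1 : 1 ≤ m := by exact_mod_cast hm.le
  have hm0 : (0 : ℝ) < m := by linarith
  obtain ⟨h1, h2, h3⟩ := balance_spec hm1
  rw [← hθ] at h1 h2
  have hd0 : (0 : ℝ) < ((2 ^ balance m : ℕ) : ℝ) := by exact_mod_cast Nat.two_pow_pos _
  have hN : 0 < 2 * m / 2 ^ balance m := Nat.div_pos (by omega) (Nat.two_pow_pos _)
  -- The power of two loses at most a factor 2 against m ^ θ, so the matrices have size at most 4 m
  -- ^ (1 - θ).
  have h4 : ((2 * m / 2 ^ balance m : ℕ) : ℝ) ≤ 4 * (m : ℝ) ^ (1 - θ) := by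
    refine Nat.cast_div_le.trans ?_
    rw [div_le_iff₀ hd0, Real.rpow_sub hm0, Real.rpow_one]
    have hmt : 0 < (m : ℝ) ^ θ := Real.rpow_pos_of_pos hm0 _
    have h5 : (m : ℝ) ≤ m / (m : ℝ) ^ θ * (2 * ((2 ^ balance m : ℕ) : ℝ)) := by
      rw [div_mul_eq_mul_div, le_div_iff₀ hmt]
      gcongr
    push_cast at h5 ⊢
    linarith
  have h5 : (mulCost c₁ B K₀ (2 * m / 2 ^ balance m) : ℝ) ≤
      |C₂| * 4 ^ η * (m : ℝ) ^ (p + ε / 2) := by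
    calc (mulCost c₁ B K₀ (2 * m / 2 ^ balance m) : ℝ) ≤
        C₂ * ((2 * m / 2 ^ balance m : ℕ) : ℝ) ^ η := hC₂ _ hN
      _ ≤ |C₂| * (4 * (m : ℝ) ^ (1 - θ)) ^ η := by
        gcongr
        exact le_abs_self _
      _ = |C₂| * 4 ^ η * (m : ℝ) ^ ((1 - θ) * η) := by
        rw [Real.mul_rpow (by norm_num) (by positivity), ← Real.rpow_mul hm0.le, mul_assoc]
      _ ≤ |C₂| * 4 ^ η * (m : ℝ) ^ (p + ε / 2) := by
        gcongr
        · exact hm.le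
        · rw [hη, mul_add, e2]
          nlinarith
  have h6 : ((m * 2 ^ balance m : ℕ) : ℝ) ≤ (m : ℝ) ^ (p + ε / 2) := by
    calc ((m * 2 ^ balance m : ℕ) : ℝ) = (m : ℝ) * ((2 ^ balance m : ℕ) : ℝ) := by push_cast; ring
      _ ≤ (m : ℝ) * (m : ℝ) ^ θ := by gcongr
      _ = (m : ℝ) ^ p := by rw [← e1, Real.rpow_add hm0, Real.rpow_one]
      _ ≤ (m : ℝ) ^ (p + ε / 2) := Real.rpow_le_rpow_of_exponent_le hm.le (by linarith)
  have h7 : (((Nat.clog 2 (2 * m) + K₀) ^ 7 : ℕ) : ℝ) ≤ C₁ * 2 ^ (ε / 2) * (m : ℝ) ^ (ε / 2) := by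
    refine (hC₁ (2 * m) (by omega)).trans (le_of_eq ?_)
    push_cast
    rw [Real.mul_rpow (by norm_num) hm0.le, mul_assoc]
  rw [mainBound, Nat.cast_mul, Nat.cast_mul, Nat.cast_mul, Nat.cast_add]
  calc (k : ℝ) * ((((Nat.clog 2 (2 * m) + K₀) ^ 7 : ℕ) : ℝ) * (((40000 : ℕ) : ℝ) *
        (((m * 2 ^ balance m : ℕ) : ℝ) + mulCost c₁ B K₀ (2 * m / 2 ^ balance m)))) ≤
      k * ((C₁ * 2 ^ (ε / 2) * (m : ℝ) ^ (ε / 2)) * (((40000 : ℕ) : ℝ) *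
        ((m : ℝ) ^ (p + ε / 2) + |C₂| * 4 ^ η * (m : ℝ) ^ (p + ε / 2)))) := by gcongr
    _ = k * (C₁ * 2 ^ (ε / 2)) * (40000 * (1 + |C₂| * 4 ^ η)) *
        ((m : ℝ) ^ (ε / 2) * (m : ℝ) ^ (p + ε / 2)) := by push_cast; ring
    _ = k * (C₁ * 2 ^ (ε / 2)) * (40000 * (1 + |C₂| * 4 ^ η)) * (m : ℝ) ^ (p + ε) := by
      rw [← Real.rpow_add hm0]; congr 2; ring


/-! ## The programs -/

/-- The program and its constants are chosen before the graph; afterwards any time bound `T` may be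
used, provided that it is at most the power that fixes the word size. -/
theorem exists_runsWithin (p : Cmd) (hwf : p.wf = true) (a : ℕ) (ha : 6 ≤ a) (hbd : p.bd ≤ 2 ^ a) :
    ∃ (P : WordRAM.Prog) (c K : ℕ), ∀ (n : ℕ) (G : SimpleGraph (Fin n)) [DecidableRel G.Adj]
      (d T : ℕ) (Q : ℕ → ℕ → ℕ → Prop) (b : ℝ),
      (∀ L, IsEdgeList G L → Spec (inputEnv n L d a) p (initSt d) fun s =>
        Q (s.reg .o0) (s.reg .o1) (s.reg .o2) ∧ s.time ≤ T) →
      T ≤ (n + G.edgeFinset.card + d + 2) ^ a → ((K * (T + 1) : ℕ) : ℝ) ≤ b →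
      RunsWithin P c G d b fun s => Q (s.reg 0) (s.reg 1) (s.reg 2) := by
  obtain ⟨P, c, K, h⟩ := exists_prog p hwf a ha hbd
  refine ⟨P, c, K, fun n G _ d T Q b hs hT hb L hL w hw => ?_⟩
  obtain ⟨h1, h2, h3⟩ := hs L hL
  rw [← hL.length_eq] at hT hw
  obtain ⟨σ, t, h4, h5, h6, h7, h8⟩ := h n L d w h1 (h3.trans hT) hw
  refine ⟨σ, t, h4, le_trans ?_ hb, ?_⟩
  · exact_mod_cast h5.trans (Nat.mul_le_mul_left _ (by omega))
  · show Q (σ.reg 0) (σ.reg 1) (σ.reg 2)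
    rwa [h6, h7, h8]

theorem exists_nearProg : ∃ (P : WordRAM.Prog) (c : ℕ) (C : ℝ),
    ∀ (n : ℕ) (G : SimpleGraph (Fin n)) [DecidableRel G.Adj] (m : ℕ),
      m = G.edgeFinset.card → 1 ≤ m → ∀ d : ℕ, 1 ≤ d →
      RunsWithin P c G d (C * (m * d))
        (fun s =>
          (∃ x y : Fin n, IsBestPair G (fun _ y => d ≤ G.degree y ∧ G.degree y < 2 * d) x y ∧
            Outputs G s x y) ∨
          (OutputsNone s ∧ ∀ x y : Fin n, IsSolution G x y →
            ¬(d ≤ G.degree y ∧ G.degree y < 2 * d))) := by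
  obtain ⟨P, c, K, h⟩ := exists_runsWithin nearProg (by decide) (nearProg.bd + 6002)
    (by omega) ((Nat.lt_two_pow_self).le.trans (Nat.pow_le_pow_right (by omega) (by omega)))
  refine ⟨P, c, 20000 * K, fun n G _ m hm hm1 d hd => ?_⟩
  refine h n G d (6000 * (d * (m + 1))) (fun r0 r1 r2 =>
    (∃ x y : Fin n, IsBestPair G (fun _ y => d ≤ G.degree y ∧ G.degree y < 2 * d) x y ∧
      r0 = domCount G x y ∧ r1 = x ∧ r2 = y) ∨
    (r0 = 0 ∧ ∀ x y : Fin n, IsSolution G x y → ¬(d ≤ G.degree y ∧ G.degree y < 2 * d))) _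
    (fun L hL => ?_) ?_ ?_
  · rw [hm, ← hL.length_eq]
    exact nearProg_spec hL (by omega) hd
  · rw [← hm]
    refine (lt_pow_of_le (S := n + m + d + 2) (Z := 6000) (e := 2) (by omega) ?_ (by omega)).le
    rw [sq]
    exact Nat.mul_le_mul_left _ (Nat.mul_le_mul (by omega) (by omega))
  · have h1 : d * (m + 1) ≤ 2 * (m * d) := by
      calc d * (m + 1) ≤ d * (m + m) := Nat.mul_le_mul_left _ (by omega)
        _ = 2 * (m * d) := by ring
    have h2 : 1 ≤ m * d := Nat.mul_pos hm1 hd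
    have h3 : K * (6000 * (d * (m + 1)) + 1) ≤ K * (20000 * (m * d)) :=
      Nat.mul_le_mul_left _ (by omega)
    refine le_trans (by exact_mod_cast h3 : ((K * (6000 * (d * (m + 1)) + 1) : ℕ) : ℝ) ≤
      ((K * (20000 * (m * d)) : ℕ) : ℝ)) (le_of_eq ?_)
    push_cast
    ring

theorem exists_heavyProg {c₁ B K₀ : ℕ} (hc1 : 0 < c₁) (hK0 : 0 < K₀)
    (hlt : ∀ N, 0 < N → mulCost c₁ B K₀ N < c₁ * N ^ B)
    (hcost : ∀ ε > 0, ∃ C : ℝ, ∀ N : ℕ, 0 < N →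
      (mulCost c₁ B K₀ N : ℝ) ≤ C * (N : ℝ) ^ (matMulExponent + ε)) :
    ∃ (P : WordRAM.Prog) (c : ℕ) (C : ℝ) (f : ℝ → ℝ), Tendsto f atTop (𝓝 0) ∧
      ∀ (n : ℕ) (G : SimpleGraph (Fin n)) [DecidableRel G.Adj] (m : ℕ),
        m = G.edgeFinset.card → 1 ≤ m → ∀ d : ℕ, 1 ≤ d →
        RunsWithin P c G d
          (C * (m * d) + ((m : ℝ) / d) ^ (matMulExponent + f ((m : ℝ) / d)))
          (fun s =>
            (∃ x y : Fin n, IsBestPair G (fun x y => d ≤ G.degree x ∧ d ≤ G.degree y) x y ∧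
              Outputs G s x y) ∨
            (OutputsNone s ∧ ∀ x : Fin n, G.degree x < d)) := by
  set Z₁ := (K₀ + 2) * (K₀ + 5 + c₁ * 2 ^ B) with hZ₁
  set Z₂ := 2000 * (1 + (K₀ + 2) ^ 6 * (c₁ * 2 ^ B)) with hZ₂
  set a := (heavyProg c₁ B K₀).bd + Z₁ + Z₂ + B + 8 with ha
  obtain ⟨P, c, K, h⟩ := exists_runsWithin (heavyProg c₁ B K₀) rfl a
    (by omega) ((Nat.lt_two_pow_self).le.trans (Nat.pow_le_pow_right (by omega) (by omega)))
  obtain ⟨f, hf, hfx⟩ := heavy_exponent hcost (K * 2000)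
  -- For N = 0 there is no vertex of degree at least `d`, and no search takes place.
  set w : ℕ → ℕ := fun N => (Nat.clog 2 N + K₀) ^ 6 * (if N = 0 then 0 else mulCost c₁ B K₀ N)
    with hw
  refine ⟨P, c, K * (5000 + 2000 * (w 1 + w 2)), f, hf, fun n G _ m hm hm1 d hd => ?_⟩
  set N := 2 * m / d with hN
  have hN2 : N ≤ 2 * m := Nat.div_le_self _ _
  refine h n G d (2000 * (d * (m + 1) + w N)) (fun r0 r1 r2 =>
    (∃ x y : Fin n, IsBestPair G (fun x y => d ≤ G.degree x ∧ d ≤ G.degree y) x y ∧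
      r0 = domCount G x y ∧ r1 = x ∧ r2 = y) ∨ (r0 = 0 ∧ ∀ x : Fin n, G.degree x < d)) _
    (fun L hL => ?_) ?_ ?_
  · have hml : m = L.length := by rw [hm, hL.length_eq]
    rw [hml] at hN hN2 ⊢
    refine heavyProg_spec hL (by omega) hd hN rfl rfl hK0 hc1 ?_ fun hN0 q hq => ?_
    · exact lt_pow_of_le (S := n + L.length + d + 2) (by omega) (words_le c₁ B K₀ (by omega) (by omega))
        (by omega)
    · rw [hq.eq (isBestQ_bestQ _ _ _), if_neg hN0.ne']
      exact ⟨hlt N hN0, le_rfl⟩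
  · rw [← hm]
    refine (lt_pow_of_le (S := n + m + d + 2) (by omega) (le_trans ?_ (heavyTime_le c₁ B K₀
      (S := n + m + d + 2) (N := N) (d := d) (m := m) (by omega) (by omega) (by omega) (by omega)))
      (by omega)).le
    have : (if N = 0 then 0 else mulCost c₁ B K₀ N) ≤ c₁ * N ^ B := by
      split_ifs
      · exact Nat.zero_le _
      · exact mulCost_le _ _ _ _
    gcongr
    simp only [hw]
    gcongr
  · have h1 : d * (m + 1) ≤ 2 * (m * d) := by
      calc d * (m + 1) ≤ d * (m + m) := Nat.mul_le_mul_left _ (by omega)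
        _ = 2 * (m * d) := by ring
    have h2 : 1 ≤ m * d := Nat.mul_pos hm1 hd
    have h3 : K * (2000 * (d * (m + 1) + w N) + 1) ≤ K * (5000 * (m * d)) + K * 2000 * w N := by
      calc K * (2000 * (d * (m + 1) + w N) + 1) ≤ K * (5000 * (m * d) + 2000 * w N) :=
            Nat.mul_le_mul_left _ (by omega)
        _ = _ := by ring
    have hd' : (0 : ℝ) < d := by exact_mod_cast hd
    refine le_trans (by exact_mod_cast h3 :
      ((K * (2000 * (d * (m + 1) + w N) + 1) : ℕ) : ℝ) ≤
        ((K * (5000 * (m * d)) + K * 2000 * w N : ℕ) : ℝ)) ?_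
    by_cases hx : (1 : ℝ) < m / d
    · have h4 := hfx _ hx
      have h5 : ⌊2 * ((m : ℝ) / d)⌋₊ = N := by
        rw [hN, ← Nat.floor_div_eq_div (K := ℝ)]
        congr 1
        push_cast
        ring
      have h6 : N ≠ 0 := by
        rw [← h5]
        exact (Nat.floor_pos.2 (by linarith)).ne'
      rw [h5] at h4
      have h7 : w N = (Nat.clog 2 N + K₀) ^ 6 * mulCost c₁ B K₀ N := by simp only [hw, if_neg h6]
      rw [← h7] at h4
      have h8 : (0 : ℝ) ≤ K * (2000 * (w 1 + w 2)) * (m * d) := by positivity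
      rw [Nat.cast_add]
      push_cast at h4 ⊢
      linarith
    -- If m/d ≤ 1, the power of m/d gives no useful bound, but then N ≤ 2 and the cost is at most a
    -- constant, absorbed by md.
    · have h4 : m ≤ d := by
        rw [not_lt, div_le_one hd'] at hx
        exact_mod_cast hx
      have h5 : N ≤ 2 := by
        rw [hN]
        exact Nat.div_le_of_le_mul (by omega)
      have h6 : w N ≤ w 1 + w 2 := by
        have : w 0 = 0 := by simp [hw]
        interval_cases N <;> omega
      have h7 : w N ≤ (w 1 + w 2) * (m * d) := h6.trans (Nat.le_mul_of_pos_right _ h2)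
      have h8 : (w N : ℝ) ≤ (w 1 + w 2) * (m * d) := by exact_mod_cast h7
      have h9 : (0 : ℝ) ≤ ((m : ℝ) / d) ^ (matMulExponent + f ((m : ℝ) / d)) :=
        Real.rpow_nonneg (by positivity) _
      have h10 : (K : ℝ) * 2000 * w N ≤ K * 2000 * ((w 1 + w 2) * (m * d)) := by gcongr
      push_cast
      linarith

theorem exists_mainProg {c₁ B K₀ : ℕ} (hc1 : 0 < c₁) (hK0 : 0 < K₀)
    (hlt : ∀ N, 0 < N → mulCost c₁ B K₀ N < c₁ * N ^ B)
    (hcost : ∀ ε > 0, ∃ C : ℝ, ∀ N : ℕ, 0 < N →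
      (mulCost c₁ B K₀ N : ℝ) ≤ C * (N : ℝ) ^ (matMulExponent + ε)) :
    ∃ (P : WordRAM.Prog) (c : ℕ) (C : ℝ) (f : ℕ → ℝ), Tendsto f atTop (𝓝 0) ∧
      ∀ (n : ℕ), 1 ≤ n → ∀ (G : SimpleGraph (Fin n)) [DecidableRel G.Adj] (m : ℕ),
        m = G.edgeFinset.card →
        RunsWithin P c G 0
          (C + (m : ℝ) ^ (2 * matMulExponent / (matMulExponent + 1) + f m))
          (fun s => ∃ x y : Fin n, IsSolution G x y ∧ Outputs G s x y) := by
  set Z₁ := (K₀ + 2) * (K₀ + 5 + c₁ * 2 ^ B) with hZ₁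
  set Z₂ := (K₀ + 2) * (300 * ((K₀ + 2) ^ 6 + 2) + 20) + 15000 +
    1000 * ((K₀ + 2) ^ 6 * (c₁ * 2 ^ B)) with hZ₂
  set Z₃ := 1 + c₁ * 2 ^ B with hZ₃
  set a := (mainProg c₁ B K₀).bd + Z₁ + Z₂ + Z₃ + B + 8 with ha
  obtain ⟨P, c, K, h⟩ := exists_runsWithin (mainProg c₁ B K₀) rfl a
    (by omega) ((Nat.lt_two_pow_self).le.trans (Nat.pow_le_pow_right (by omega) (by omega)))
  obtain ⟨f, hf, hfm⟩ := main_exponent hcost (2 * K)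
  set t := mainTime c₁ B K₀ with ht
  refine ⟨P, c, (K * (t 0 + t 1 + 1) : ℕ), f, hf, fun n hn G _ m hm => ?_⟩
  -- The polynomial bound `t m` serves the word size, the sharp `mainBound` the claimed time; for m
  -- ≤ 1 a constant suffices.
  refine h n G 0 (if 1 < m then min (t m) (mainBound c₁ B K₀ m) else t m) (fun r0 r1 r2 =>
    ∃ x y : Fin n, IsSolution G x y ∧ r0 = domCount G x y ∧ r1 = x ∧ r2 = y) _
    (fun L hL => ?_) ?_ ?_
  · have hml : m = L.length := by rw [hm, hL.length_eq]
    refine Spec.mono (mainProg_spec hL hn hml (by omega) hK0 hc1 rfl (fun N hN => ?_) ?_ hlt) ?_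
    · exact lt_pow_of_le (S := n + L.length + 0 + 2) (by omega)
        (words_le c₁ B K₀ (by omega) (by omega)) (by omega)
    · refine lt_pow_of_le (S := n + L.length + 0 + 2) (Z := Z₃) (e := B + 2) (by omega) ?_ (by omega)
      have h1 := cap_le c₁ B (show 2 * m ≤ 2 * (n + L.length + 0 + 2) by omega)
      set S := n + L.length + 0 + 2 with hS
      have h2 : m * m ≤ S ^ 2 := by
        rw [sq]
        exact Nat.mul_le_mul (by omega) (by omega)
      have h3 : S ^ 2 ≤ S ^ (B + 2) := Nat.pow_le_pow_right (by omega) (by omega)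
      have h4 : S ^ B ≤ S ^ (B + 2) := Nat.pow_le_pow_right (by omega) (by omega)
      have h5 : c₁ * 2 ^ B * S ^ B ≤ c₁ * 2 ^ B * S ^ (B + 2) := Nat.mul_le_mul_left _ h4
      rw [hZ₃, add_mul, one_mul]
      omega
    · rintro s - - ⟨h1, b, hb, hbj, h2⟩
      refine ⟨h1, ?_⟩
      set Km := Nat.clog 2 (2 * m) + K₀ with hKm
      have h3 : s.time ≤ t m := by
        refine h2.trans ?_
        rw [ht, mainTime, ← hKm]
        have : mulCost c₁ B K₀ (2 * m / b) ≤ c₁ * (2 * m) ^ B :=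
          (mulCost_le _ _ _ _).trans (Nat.mul_le_mul_left _
            (Nat.pow_le_pow_left (Nat.div_le_self _ _) _))
        gcongr
      split_ifs with hm1
      · refine le_min h3 (h2.trans ?_)
        -- The chosen threshold is no more expensive than the balanced one, which is never computed.
        have h4 := hbj (balance m) (balance_spec (by omega)).2.2
        rw [mainBound, ← hKm]
        set V := m * 2 ^ balance m + mulCost c₁ B K₀ (2 * m / 2 ^ balance m) with hV
        set q := mulCost c₁ B K₀ (2 * m / b)
        have hVm : m ≤ V := (Nat.le_mul_of_pos_right _ (Nat.two_pow_pos _)).trans (Nat.le_add_right _ _)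
        have hK1 : 1 ≤ Km := by omega
        have e1 : Km * (300 * (Km ^ 6 + 2 * m) + 20) = 300 * Km ^ 7 + 600 * (Km * m) + 20 * Km := by
          ring
        have e2 : Km ≤ Km ^ 7 := Nat.le_self_pow (by omega) _
        have e3 : Km * m ≤ Km ^ 7 * V := Nat.mul_le_mul e2 hVm
        have e4 : Km ^ 7 ≤ Km ^ 7 * V := Nat.le_mul_of_pos_right _ (by omega)
        have e5 : V ≤ Km ^ 7 * V := Nat.le_mul_of_pos_left _ (by positivity)
        have e6 : b * (m + 1) ≤ 2 * (m * b) := by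
          calc b * (m + 1) ≤ b * (m + m) := Nat.mul_le_mul_left _ (by omega)
            _ = 2 * (m * b) := by ring
        have e7 : Km ^ 6 * q ≤ Km ^ 7 * V :=
          Nat.mul_le_mul (Nat.pow_le_pow_right hK1 (by omega)) (by omega)
        have e8 : Km ^ 7 * (40000 * V) = 40000 * (Km ^ 7 * V) := by ring
        omega
      · exact h3
  · rw [← hm]
    have h1 := mainTime_le c₁ B K₀ (S := n + m + 0 + 2) (m := m) (by omega) (by omega)
    have h2 := (lt_pow_of_le (a := a) (S := n + m + 0 + 2) (by omega) h1 (by omega)).le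
    split_ifs
    · exact (min_le_left _ _).trans h2
    · exact h2
  · by_cases hm1 : 1 < m
    · rw [if_pos hm1]
      refine le_trans ?_ ((hfm m hm1).trans (le_add_of_nonneg_left (Nat.cast_nonneg _)))
      have h1 : 1 ≤ mainBound c₁ B K₀ m := by
        rw [mainBound]
        have : 0 < m * 2 ^ balance m := Nat.mul_pos (by omega) (Nat.two_pow_pos _)
        exact Nat.mul_pos (by positivity) (by omega)
      have h2 : K * (min (t m) (mainBound c₁ B K₀ m) + 1) ≤ K * (2 * mainBound c₁ B K₀ m) :=
        Nat.mul_le_mul_left _ (by omega)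
      have h3 : K * (2 * mainBound c₁ B K₀ m) = 2 * K * mainBound c₁ B K₀ m := by ring
      exact_mod_cast h2.trans h3.le
    · rw [if_neg hm1]
      have h1 : t m ≤ t 0 + t 1 := by
        have : m = 0 ∨ m = 1 := by omega
        rcases this with rfl | rfl <;> omega
      have h2 : K * (t m + 1) ≤ K * (t 0 + t 1 + 1) := Nat.mul_le_mul_left _ (by omega)
      exact (Nat.cast_le.2 h2).trans (le_add_of_nonneg_right (Real.rpow_nonneg (Nat.cast_nonneg _) _))

end LoopRAM

/-! ### The three running times -/

theorem mainTheorem7 :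
    -- Partial 2-Dominating Set is solved in time `m ^ (2ω / (ω + 1) + o(1))`
    (∃ (P : WordRAM.Prog) (c : ℕ) (C : ℝ) (f : ℕ → ℝ), Tendsto f atTop (𝓝 0) ∧
      ∀ (n : ℕ), 1 ≤ n → ∀ (G : SimpleGraph (Fin n)) [DecidableRel G.Adj] (m : ℕ),
        m = G.edgeFinset.card →
        RunsWithin P c G 0
          (C + (m : ℝ) ^ (2 * matMulExponent / (matMulExponent + 1) + f m))
          (fun s => ∃ x y : Fin n, IsSolution G x y ∧ Outputs G s x y)) ∧
    -- best pairs of vertices of degree at least `d`, in time `O(m d) + (m / d) ^ (ω + o(1))`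
    (∃ (P : WordRAM.Prog) (c : ℕ) (C : ℝ) (f : ℝ → ℝ), Tendsto f atTop (𝓝 0) ∧
      ∀ (n : ℕ) (G : SimpleGraph (Fin n)) [DecidableRel G.Adj] (m : ℕ),
        m = G.edgeFinset.card → 1 ≤ m → ∀ d : ℕ, 1 ≤ d →
        RunsWithin P c G d
          (C * (m * d) + ((m : ℝ) / d) ^ (matMulExponent + f ((m : ℝ) / d)))
          (fun s =>
            (∃ x y : Fin n, IsBestPair G (fun x y => d ≤ G.degree x ∧ d ≤ G.degree y) x y ∧
              Outputs G s x y) ∨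
            (OutputsNone s ∧ ∀ x : Fin n, G.degree x < d))) ∧
    -- solutions with a vertex whose degree is in `[d, 2d)`, in time `O(m d)`
    (∃ (P : WordRAM.Prog) (c : ℕ) (C : ℝ),
      ∀ (n : ℕ) (G : SimpleGraph (Fin n)) [DecidableRel G.Adj] (m : ℕ),
        m = G.edgeFinset.card → 1 ≤ m → ∀ d : ℕ, 1 ≤ d →
        RunsWithin P c G d (C * (m * d))
          (fun s =>
            (∃ x y : Fin n, IsBestPair G (fun _ y => d ≤ G.degree y ∧ G.degree y < 2 * d) x y ∧
              Outputs G s x y) ∨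
            (OutputsNone s ∧ ∀ x y : Fin n, IsSolution G x y →
              ¬(d ≤ G.degree y ∧ G.degree y < 2 * d)))) := by
  obtain ⟨c₁, B, K₀, hc1, hK0, hlt, hcost⟩ := LoopRAM.exists_params
  exact ⟨LoopRAM.exists_mainProg hc1 hK0 hlt hcost, LoopRAM.exists_heavyProg hc1 hK0 hlt hcost,
    LoopRAM.exists_nearProg⟩
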